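/- Let $(S,g,\xi,\eta,\Phi)$ be a compact (non-empty) Sasakian manifold of dimension $2m+1$, i.e. a normal contact metric manifold: $\eta(\xi)=1$, $\Phi^2=-\mathrm{id}+\eta\otimes\xi$, $g(\Phi X,\Phi Y)=g(X,Y)-\eta(X)\eta(Y)$, $d\eta(X,Y)=2g(\Phi X,Y)$ and $N_\Phi=-d\eta\otimes\xi$, where $d\eta(X,Y)=X\eta(Y)-Y\eta(X)-\eta([X,Y])$ and $N_\Phi(X,Y)=\Phi^2[X,Y]+[\Phi X,\Phi Y]-\Phi[\Phi X,Y]-\Phi[X,\Phi Y]$ (equivalently, the metric cone is Kähler). Orient $S$ by $(d\eta)^m\wedge\eta$. A smooth function $f$ is basic if $\xi f=0$; for such $f$ let $\partial_Bf$ and $\bar\partial_Bf$ be the $(1,0)$- and $(0,1)$-parts of $df$ with respect to the transverse complex structure $\Phi$, and $d_B^c=\frac{\sqrt{-1}}{2}(\bar\partial_B-\partial_B)$. For a real basic function $\varphi$ put $\eta_\varphi=\eta+d_B^c\varphi$, and let $$\Omega=\{\varphi \mid \varphi \text{ is a real basic function and } d\eta_\varphi(X,\Phi X)>0 \text{ for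 all } 0\ne X\in\ker\eta\}.$$ For $\varphi\in\Omega$ let $\square^B_\varphi=\bar\partial_B^*\bar\partial_B$ be the basic Dolbeault Laplacian on functions for the transverse Kähler metric $d\eta_\varphi(\cdot,\Phi\,\cdot)$ (whose Kähler form is $d\eta_\varphi$). Put $V=\int_S(d\eta)^m\wedge\eta$. For $\varphi,\varphi'\in\Omega$ define $$I(\varphi,\varphi')=\frac1V\int_S(\varphi'-\varphi)\big((d\eta_\varphi)^m-(d\eta_{\varphi'})^m\big)\wedge\eta,$$ $$J(\varphi,\varphi')=\frac1V\int_a^b\Big(\int_S\dot\varphi_t\big((d\eta_\varphi)^m-(d\eta_{\varphi_t})^m\big)\wedge\eta\Big)dt,\qquad L(\varphi,\varphi')=\frac1V\int_a^b\Big(\int_S\dot\varphi_t\,(d\eta_{\varphi_t})^m\wedge\eta_{\varphi_t}\Big)dt,$$ where $\{\varphi_t\}_{a\le t\le b}$ is any piecewise smooth path in $\Omega$ with $\varphi_a=\varphi$, $\varphi_b=\varphi'$. Then $V>0$, any two elements of $\Omega$ are joined by such a path, the integrals over $[a,b]$ exist, and: 1. $J$ (and likewise $L$) is independent of the choice of the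 path, and $J(\varphi,\varphi')=-L(\varphi,\varphi')+\frac1V\int_S(\varphi'-\varphi)(d\eta_\varphi)^m\wedge\eta$. 2. For all $\varphi,\varphi',\varphi''\in\Omega$, $$J(\varphi,\varphi')+J(\varphi',\varphi'')=J(\varphi,\varphi'')-\frac1V\int_S(\varphi''-\varphi')\big((d\eta_\varphi)^m-(d\eta_{\varphi'})^m\big)\wedge\eta .$$ The $1$-cocycle condition $J(\varphi,\varphi')+J(\varphi',\varphi'')=J(\varphi,\varphi'')$ itself fails: $J(\varphi,\varphi')+J(\varphi',\varphi)\neq J(\varphi,\varphi)$ whenever $\varphi'-\varphi$ is not locally constant. 3. For every $C\in\mathbb R$: $\varphi'+C\in\Omega$, $I(\varphi,\varphi'+C)=I(\varphi,\varphi')$ and $J(\varphi,\varphi'+C)=J(\varphi,\varphi')$. 4. If $\varphi\in\Omega$ and $\{\varphi_t\}_{t\in[a,b]}$, $a<b$, is a smooth family in $\Omega$, then $\square^B_{\varphi_t}\dot\varphi_t$ exists, is unique and real, and for all $t\in[a,b]$ (one-sided derivatives at the end points) $$\frac{d}{dt}\big(I(\varphi,\varphi_t)-J(\varphi,\varphi_t)\big)=\frac1V\int_S(\varphi_t-\varphi)\big(\square^B_{\varphi_t}\dot\varphi_t\big)(d\eta_{\varphi_t})^m\wedge\eta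 .$$ 5. $I$, $I-J$ and $J$ are non-negative on $\Omega\times\Omega$, and $$0\le I(\varphi,\varphi')\le(m+1)\big(I(\varphi,\varphi')-J(\varphi,\varphi')\big)\le m\,I(\varphi,\varphi').$$ -/

import Mathlib

open Set MeasureTheory Bundle
open scoped Manifold ContDiff ComplexConjugate

noncomputable section

namespace Sasaki

/-! ### Differential forms on a manifold modelled on `ℝⁿ` -/

section Forms

variable {n : ℕ} {S : Type*} [TopologicalSpace S] [ChartedSpace (EuclideanSpace ℝ (Fin n)) S]

variable (n S) in
/-- (Not necessarily smooth) real differential `k`-forms on the `n`-manifold `S`. -/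
abbrev DForm (k : ℕ) : Type _ :=
  ∀ p : S, TangentSpace (𝓡 n) p [⋀^Fin k]→L[ℝ] ℝ

variable (n S) in
/-- (Not necessarily smooth) real differential `1`-forms, as fields of covectors. -/
abbrev OneForm : Type _ :=
  ∀ p : S, TangentSpace (𝓡 n) p →L[ℝ] ℝ

/-- A field of covectors seen as a differential form of degree one. -/
def OneForm.toDForm (α : OneForm n S) : DForm n S 1 :=
  fun p => ContinuousAlternatingMap.ofSubsingleton ℝ (TangentSpace (𝓡 n) p) ℝ (0 : Fin 1) (α p)

/-- The expression of a form in the preferred chart at `x`: its pull-back under the inverse of the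
chart, a form on (an open subset of) `ℝⁿ`. -/
def DForm.inChart {k : ℕ} (α : DForm n S k) (x : S) (y : EuclideanSpace ℝ (Fin n)) :
    EuclideanSpace ℝ (Fin n) [⋀^Fin k]→L[ℝ] ℝ :=
  (α ((extChartAt (𝓡 n) x).symm y)).compContinuousLinearMap
    (mfderiv 𝓘(ℝ, EuclideanSpace ℝ (Fin n)) (𝓡 n) (extChartAt (𝓡 n) x).symm y)

/-- The exterior derivative, computed at `p` in the preferred chart at `p`.  For a `1`-form
`dα(X, Y) = X α(Y) - Y α(X) - α([X, Y])`, without a factor `1/2`. -/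
def DForm.d {k : ℕ} (α : DForm n S k) : DForm n S (k + 1) :=
  fun p => (extDeriv (α.inChart p) (extChartAt (𝓡 n) p p)).compContinuousLinearMap
    (mfderiv (𝓡 n) 𝓘(ℝ, EuclideanSpace ℝ (Fin n)) (extChartAt (𝓡 n) p) p)

/-- The wedge product of two alternating forms on a vector space,
`(α ∧ β)(v) = (1 / (k! l!)) ∑_σ sign σ α(v_σ(1), …) β(v_σ(k+1), …)`. -/
def wedge {V : Type*} [AddCommGroup V] [Module ℝ V] [TopologicalSpace V] {k l : ℕ}
    (α : V [⋀^Fin k]→L[ℝ] ℝ) (β : V [⋀^Fin l]→L[ℝ] ℝ) : V [⋀^Fin (k + l)]→L[ℝ] ℝ :=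
  { ((LinearMap.mul' ℝ ℝ).compAlternatingMap
      (α.toAlternatingMap.domCoprod β.toAlternatingMap)).domDomCongr finSumFinEquiv with
    cont := by
      change Continuous fun v : Fin (k + l) → V => LinearMap.mul' ℝ ℝ
        (α.toAlternatingMap.domCoprod β.toAlternatingMap (fun i => v (finSumFinEquiv i)))
      simp only [AlternatingMap.domCoprod_apply, sum_apply, map_sum]
      refine continuous_finsetSum _ fun s _ => ?_
      induction s using Quotient.inductionOn' with
      | h s =>
        simp only [AlternatingMap.domCoprod.summand_mk'', _root_.smul_apply,
          MultilinearMap.domDomCongr_apply, MultilinearMap.domCoprod_apply, map_zsmul_unit,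
          LinearMap.mul'_apply]
        refine Continuous.const_smul (Continuous.mul ?_ ?_) _
        · exact α.cont.comp (by fun_prop)
        · exact β.cont.comp (by fun_prop) }

/-- The wedge product of differential forms. -/
def DForm.wedge {k l : ℕ} (α : DForm n S k) (β : DForm n S l) : DForm n S (k + l) :=
  fun p => Sasaki.wedge (α p) (β p)

/-- The powers `θʲ = θ ∧ ⋯ ∧ θ` of a `2`-form; `θ⁰` is the constant `1`. -/
def DForm.wpow (θ : DForm n S 2) : (j : ℕ) → DForm n S (2 * j)
  | 0 => fun p =>
      haveI : IsEmpty (Fin (2 * 0)) := inferInstanceAs (IsEmpty (Fin 0))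
      ContinuousAlternatingMap.constOfIsEmpty ℝ (TangentSpace (𝓡 n) p) (Fin (2 * 0)) (1 : ℝ)
  | j + 1 => (θ.wpow j).wedge θ

/-- The coefficient of a form of top degree in the preferred chart at `x`, that is the function
`a` such that the form is `a dx¹ ∧ ⋯ ∧ dxⁿ` there. -/
def DForm.coeff (α : DForm n S n) (x : S) (y : EuclideanSpace ℝ (Fin n)) : ℝ :=
  α.inChart x y (EuclideanSpace.basisFun (Fin n) ℝ)

variable [IsManifold (𝓡 n) ∞ S] [CompactSpace S] [T2Space S]

variable (n S) in
/-- A smooth partition of unity subordinate to the domains of the preferred charts. -/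
def chartPartition : SmoothPartitionOfUnity S (𝓡 n) S univ :=
  (SmoothPartitionOfUnity.exists_isSubordinate_chartAt_source (𝓡 n) S).choose

/-- The integral `∫_S f α` of a function `f` (real or complex) times a form `α` of top degree over
the compact manifold `S` with the orientation given by the nowhere vanishing top form `ν`:
in each chart, the sign of `ν` tells whether the chart is positively oriented. -/
def formIntegral {F : Type*} [NormedAddCommGroup F] [NormedSpace ℝ F]
    (ν : DForm n S n) (f : S → F) (α : DForm n S n) : F :=
  ∑ᶠ x : S, ∫ y in (extChartAt (𝓡 n) x).target,
    (chartPartition n S x ((extChartAt (𝓡 n) x).symm y) *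
      (SignType.sign (ν.coeff x y) : ℝ) * α.coeff x y) • f ((extChartAt (𝓡 n) x).symm y)

end Forms

/-! ### Sasakian structures -/

section Sasakian

/-- A Sasakian structure `(g, ξ, η, Φ)` on a manifold of dimension `2m + 1`: a contact metric
structure that is normal.  The normalization is the one for which the metric cone
`(S × ℝ_{>0}, dr² + r² g)`, with the complex structure `J` given by `J (r ∂_r) = ξ` and
`J X = Φ X` for `X` in `ker η`, is Kähler with Kähler form `d(r² η) / 2`. -/
structure SasakianStructure (m : ℕ) (S : Type*) [TopologicalSpace S]
    [ChartedSpace (EuclideanSpace ℝ (Fin (2 * m + 1))) S] [IsManifold (𝓡 (2 * m + 1)) ∞ S] where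
  /-- The Riemannian metric. -/
  g : ContMDiffRiemannianMetric (𝓡 (2 * m + 1)) ∞ (EuclideanSpace ℝ (Fin (2 * m + 1)))
    (fun p : S => TangentSpace (𝓡 (2 * m + 1)) p)
  /-- The Reeb field. -/
  ξ : ∀ p : S, TangentSpace (𝓡 (2 * m + 1)) p
  /-- The contact form. -/
  η : OneForm (2 * m + 1) S
  /-- The transverse complex structure, extended by zero on the Reeb field. -/
  Φ : ∀ p : S, TangentSpace (𝓡 (2 * m + 1)) p →L[ℝ] TangentSpace (𝓡 (2 * m + 1)) p
  ξ_smooth : ContMDiff (𝓡 (2 * m + 1)) (𝓡 (2 * m + 1)).tangent ∞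
    (fun p => (⟨p, ξ p⟩ : TangentBundle (𝓡 (2 * m + 1)) S))
  η_smooth : ContMDiff (𝓡 (2 * m + 1))
    ((𝓡 (2 * m + 1)).prod 𝓘(ℝ, EuclideanSpace ℝ (Fin (2 * m + 1)) →L[ℝ] ℝ)) ∞
    (fun p => TotalSpace.mk' (EuclideanSpace ℝ (Fin (2 * m + 1)) →L[ℝ] ℝ)
      (E := fun p : S => TangentSpace (𝓡 (2 * m + 1)) p →L[ℝ] ℝ) p (η p))
  Φ_smooth : ContMDiff (𝓡 (2 * m + 1))
    ((𝓡 (2 * m + 1)).prod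
      𝓘(ℝ, EuclideanSpace ℝ (Fin (2 * m + 1)) →L[ℝ] EuclideanSpace ℝ (Fin (2 * m + 1)))) ∞
    (fun p => TotalSpace.mk'
      (EuclideanSpace ℝ (Fin (2 * m + 1)) →L[ℝ] EuclideanSpace ℝ (Fin (2 * m + 1)))
      (E := fun p : S =>
        TangentSpace (𝓡 (2 * m + 1)) p →L[ℝ] TangentSpace (𝓡 (2 * m + 1)) p) p (Φ p))
  η_ξ : ∀ p, η p (ξ p) = 1
  Φ_Φ : ∀ p X, Φ p (Φ p X) = -X + η p X • ξ p
  g_Φ_Φ : ∀ p X Y, g.inner p (Φ p X) (Φ p Y) = g.inner p X Y - η p X * η p Y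
  dη_eq : ∀ p X Y, η.toDForm.d p ![X, Y] = 2 * g.inner p (Φ p X) Y
  /-- Normality: the Nijenhuis torsion of `Φ` is `-dη ⊗ ξ`. -/
  normal : ∀ (X Y : ∀ p : S, TangentSpace (𝓡 (2 * m + 1)) p) (p : S),
    ContMDiffAt (𝓡 (2 * m + 1)) (𝓡 (2 * m + 1)).tangent ∞
      (fun q => (⟨q, X q⟩ : TangentBundle (𝓡 (2 * m + 1)) S)) p →
    ContMDiffAt (𝓡 (2 * m + 1)) (𝓡 (2 * m + 1)).tangent ∞
      (fun q => (⟨q, Y q⟩ : TangentBundle (𝓡 (2 * m + 1)) S)) p →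
    Φ p (Φ p (VectorField.mlieBracket (𝓡 (2 * m + 1)) X Y p))
      + VectorField.mlieBracket (𝓡 (2 * m + 1)) (fun q => Φ q (X q)) (fun q => Φ q (Y q)) p
      - Φ p (VectorField.mlieBracket (𝓡 (2 * m + 1)) (fun q => Φ q (X q)) Y p)
      - Φ p (VectorField.mlieBracket (𝓡 (2 * m + 1)) X (fun q => Φ q (Y q)) p)
      + η.toDForm.d p ![X p, Y p] • ξ p = 0

namespace SasakianStructure

variable {m : ℕ} {S : Type*} [TopologicalSpace S]
  [ChartedSpace (EuclideanSpace ℝ (Fin (2 * m + 1))) S] [IsManifold (𝓡 (2 * m + 1)) ∞ S]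
  (σ : SasakianStructure m S)

/-! #### Basic functions and the basic Dolbeault operators on functions -/

/-- Smooth basic functions, with real (`F = ℝ`) or complex (`F = ℂ`) values: `ξ f = 0`. -/
def IsBasic {F : Type*} [NormedAddCommGroup F] [NormedSpace ℝ F] (f : S → F) : Prop :=
  ContMDiff (𝓡 (2 * m + 1)) 𝓘(ℝ, F) ∞ f ∧
    ∀ p, mfderiv (𝓡 (2 * m + 1)) 𝓘(ℝ, F) f p (σ.ξ p) = 0

/-- The differential of a complex function, as a field of complex valued covectors. -/
def dC (f : S → ℂ) (p : S) : TangentSpace (𝓡 (2 * m + 1)) p →L[ℝ] ℂ :=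
  mfderiv (𝓡 (2 * m + 1)) 𝓘(ℝ, ℂ) f p

/-- `∂_B f`, the `(1,0)`-part of the differential of a basic function. -/
def del (f : S → ℂ) (p : S) : TangentSpace (𝓡 (2 * m + 1)) p →L[ℝ] ℂ :=
  (1 / 2 : ℂ) • (dC f p - Complex.I • (dC f p).comp (σ.Φ p))

/-- `∂̄_B f`, the `(0,1)`-part of the differential of a basic function. -/
def delbar (f : S → ℂ) (p : S) : TangentSpace (𝓡 (2 * m + 1)) p →L[ℝ] ℂ :=
  (1 / 2 : ℂ) • (dC f p + Complex.I • (dC f p).comp (σ.Φ p))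

/-- `d_B^c φ = (√-1 / 2) (∂̄_B - ∂_B) φ` for a real function `φ`.  This covector is real; its
values are written as real numbers by taking real parts. -/
def dc (φ : S → ℝ) : OneForm (2 * m + 1) S :=
  fun p => Complex.reCLM.comp
    ((Complex.I / 2) • (σ.delbar (fun q => (φ q : ℂ)) p - σ.del (fun q => (φ q : ℂ)) p))

/-! #### The space of potentials -/

/-- `η_φ = η + d_B^c φ`. -/
def etaOf (φ : S → ℝ) : OneForm (2 * m + 1) S :=
  fun p => σ.η p + σ.dc φ p

/-- `dη_φ = dη + d d_B^c φ`. -/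
def omegaOf (φ : S → ℝ) : DForm (2 * m + 1) S 2 :=
  (σ.etaOf φ).toDForm.d

/-- The space `Ω` of basic functions `φ` for which the transverse `(1,1)`-form `dη_φ` is positive
definite. -/
def potentials : Set (S → ℝ) :=
  {φ | σ.IsBasic φ ∧ ∀ (p : S) (X : TangentSpace (𝓡 (2 * m + 1)) p),
    σ.η p X = 0 → X ≠ 0 → 0 < σ.omegaOf φ p ![X, σ.Φ p X]}

/-- `(dη_φ)^m ∧ η`. -/
def volOf (φ : S → ℝ) : DForm (2 * m + 1) S (2 * m + 1) :=
  ((σ.omegaOf φ).wpow m).wedge σ.η.toDForm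

/-- `(dη_φ)^m ∧ η_φ`. -/
def volOf' (φ : S → ℝ) : DForm (2 * m + 1) S (2 * m + 1) :=
  ((σ.omegaOf φ).wpow m).wedge (σ.etaOf φ).toDForm

/-- `((dη_φ)^m - (dη_φ')^m) ∧ η`. -/
def volDiff (φ φ' : S → ℝ) : DForm (2 * m + 1) S (2 * m + 1) :=
  DForm.wedge (fun p => (σ.omegaOf φ).wpow m p - (σ.omegaOf φ').wpow m p) σ.η.toDForm

/-- `(dη)^m ∧ η`. -/
def vol : DForm (2 * m + 1) S (2 * m + 1) :=
  (σ.η.toDForm.d.wpow m).wedge σ.η.toDForm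

/-- The Hermitian inner product on (complex valued) covectors on `ker η` at `p` that is induced by
the transverse metric `g_φ(X, Y) = dη_φ(X, Φ Y)` with Kähler form `dη_φ`:
`⟨α, β⟩ = ∑_a α(e_a) conj β(e_a)` for any `g_φ`-orthonormal basis `(e_a)` of `ker η`. -/
def covectorInner (φ : S → ℝ) (p : S) (α β : TangentSpace (𝓡 (2 * m + 1)) p →L[ℝ] ℂ) : ℂ :=
  open Classical in
  if h : ∃ e : Fin (2 * m) → TangentSpace (𝓡 (2 * m + 1)) p,
      (∀ a, σ.η p (e a) = 0) ∧
      ∀ a b, σ.omegaOf φ p ![e a, σ.Φ p (e b)] = if a = b then 1 else 0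
  then ∑ a, α (h.choose a) * conj (β (h.choose a))
  else 0

/-! #### Integration, and the functionals -/

variable [CompactSpace S] [T2Space S]

/-- `∫_S f α`, where `S` carries the orientation given by `(dη)^m ∧ η`. -/
def integral {F : Type*} [NormedAddCommGroup F] [NormedSpace ℝ F]
    (f : S → F) (α : DForm (2 * m + 1) S (2 * m + 1)) : F :=
  formIntegral σ.vol f α

/-- `V = ∫_S (dη)^m ∧ η`. -/
def V : ℝ := σ.integral (fun _ => (1 : ℝ)) σ.vol

/-- `u = □_φ^B f = ∂̄_B^* ∂̄_B f`, where the adjoint is taken with respect to the transverse Kähler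
metric with Kähler form `dη_φ`: `u` is a basic function and
`∫_S u ψ̄ (dη_φ)^m ∧ η = ∫_S ⟨∂̄_B f, ∂̄_B ψ⟩_φ (dη_φ)^m ∧ η` for all basic functions `ψ`. -/
def IsDolbeaultLaplacian (φ : S → ℝ) (f u : S → ℂ) : Prop :=
  σ.IsBasic u ∧ ∀ ψ : S → ℂ, σ.IsBasic ψ →
    σ.integral (fun p => u p * conj (ψ p)) (σ.volOf φ) =
      σ.integral (fun p => σ.covectorInner φ p (σ.delbar f p) (σ.delbar ψ p)) (σ.volOf φ)

/-- `{c_t | t ∈ [a, b]}` is a smooth family in `Ω`. -/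
def IsSmoothFamily (a b : ℝ) (c : ℝ → S → ℝ) : Prop :=
  (∀ t ∈ Icc a b, c t ∈ σ.potentials) ∧
    ContMDiffOn (𝓘(ℝ, ℝ).prod (𝓡 (2 * m + 1))) 𝓘(ℝ, ℝ) ∞
      (fun q : ℝ × S => c q.1 q.2) (Icc a b ×ˢ univ)

/-- `{c_t | t ∈ [a, b]}` is a piecewise smooth path in `Ω` from `φ` to `φ'`. -/
def IsPath (φ φ' : S → ℝ) (a b : ℝ) (c : ℝ → S → ℝ) : Prop :=
  c a = φ ∧ c b = φ' ∧ (∀ t ∈ Icc a b, c t ∈ σ.potentials) ∧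
    ∃ (N : ℕ) (τ : Fin (N + 1) → ℝ), StrictMono τ ∧ τ 0 = a ∧ τ (Fin.last N) = b ∧
      ∀ i : Fin N, σ.IsSmoothFamily (τ i.castSucc) (τ i.succ) c

/-- The integrand in `L`: `∫_S ċ_t (dη_{c_t})^m ∧ η_{c_t}`. -/
def integrandL (c : ℝ → S → ℝ) (t : ℝ) : ℝ :=
  σ.integral (fun p => deriv (fun s => c s p) t) (σ.volOf' (c t))

/-- The integrand in `J`: `∫_S ċ_t ((dη_φ)^m - (dη_{c_t})^m) ∧ η`. -/
def integrandJ (φ : S → ℝ) (c : ℝ → S → ℝ) (t : ℝ) : ℝ :=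
  σ.integral (fun p => deriv (fun s => c s p) t) (σ.volDiff φ (c t))

/-- The value of `L` computed along a path. -/
def pathL (a b : ℝ) (c : ℝ → S → ℝ) : ℝ :=
  1 / σ.V * ∫ t in a..b, σ.integrandL c t

/-- The value of `J` computed along a path that starts at `φ`. -/
def pathJ (φ : S → ℝ) (a b : ℝ) (c : ℝ → S → ℝ) : ℝ :=
  1 / σ.V * ∫ t in a..b, σ.integrandJ φ c t

/-- `L(φ, φ')`, computed along some piecewise smooth path from `φ` to `φ'`. -/
def L (φ φ' : S → ℝ) : ℝ :=
  Classical.epsilon fun x => ∃ a b c, σ.IsPath φ φ' a b c ∧ x = σ.pathL a b c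

/-- `J(φ, φ')`, computed along some piecewise smooth path from `φ` to `φ'`. -/
def J (φ φ' : S → ℝ) : ℝ :=
  Classical.epsilon fun x => ∃ a b c, σ.IsPath φ φ' a b c ∧ x = σ.pathJ φ a b c

/-- `I(φ, φ') = (1/V) ∫_S (φ' - φ) ((dη_φ)^m - (dη_φ')^m) ∧ η`. -/
def I (φ φ' : S → ℝ) : ℝ :=
  1 / σ.V * σ.integral (fun p => φ' p - φ p) (σ.volDiff φ φ')

end SasakianStructure

end Sasakian

end Sasaki

end

open Set MeasureTheory Bundle
open scoped Manifold ContDiff ComplexConjugate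

noncomputable section

namespace Sasaki

/-! ### Algebra of the wedge product on a single vector space. -/

section WedgeAlgebra

variable {V W : Type*} [AddCommGroup V] [Module ℝ V] [TopologicalSpace V]
  [AddCommGroup W] [Module ℝ W] [TopologicalSpace W]

/-! Write ω_φ = dη_φ, ψ = φ' - φ and φ_s = φ + sψ.

All integrals of forms become integrals of functions against one finite measure, that of (dη)^m ∧ η;
the form ω_φ^m ∧ η enters through its density `dens φ`. This density is positive: the Φ-invariant
horizontal 2-forms θ that are positive on ker η form a convex set, on which θ^m ∧ η never vanishes
(`IsAlmostContact.topVal_ne_zero`). The first variation of the density in a direction ψ, classically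
m ω_φ^(m-1) ∧ dd^cψ ∧ η, is never expanded. It is the derivative `topDeriv` of the top coefficient
`topVal`, and its properties follow by differentiating the rule that pulling back a top form by A
multiplies it by det A.

Stokes. For a 1-form β with β(ξ) = 0 let Z in ker η be the field with ι_Z ω_φ = β. Cartan's formula
gives L_Z ω_φ = dβ, while L_Z η = ι_Z dη is horizontal and contributes nothing to a top form. Hence
the divergence of Z with respect to ω_φ^m ∧ η is the variation in direction dβ
(`divergence_eq_topDeriv`). The divergence theorem in charts and a partition of unity give `stokes`:
∫ f · `densDeriv`(dβ) = -∫ df(Z) · `dens`. For β = d^c g the integrand df(Z) is half the inner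
product of df and dg, which is symmetric and non-negative for f = g; for β = dg the left side
vanishes. It follows that -`densDeriv`/`dens` is the basic Dolbeault Laplacian. Normality of Φ is
used only to see that dd^cψ is of type (1,1) (`isTransverse_ddc`).

Path independence. The symmetry just found says that the 1-form ψ ↦ ∫ ψ ω_φ^m ∧ η on the convex set
Ω is closed. Its primitive is `energy` (`hasDerivWithinAt_energy`), so L is a difference of
energies, J is L corrected by a linear term, and (1)-(4) reduce to algebra and one differentiation.

Inequalities. Let A(s) = ∫ dψ(Z_s) ω_{φ_s}^m ∧ η ≥ 0, where ι_{Z_s} ω_{φ_s} = d^cψ (`dirichlet`).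
Then V·I = ∫ A(s) ds and V·(I - J) = ∫ s A(s) ds, so both are non-negative. Let m ≥ 1. Diagonalizing
ω_φ and ω_φ' simultaneously shows that A(s)/(1-s)^(m-1) is non-decreasing: the eigenvalue in the
denominator of |dψ|² is doubled by Φ, and this pair cancels against the volume factor
(`exists_monotone_density`). The weight (m+1)s - 1 changes sign once and is orthogonal to
(1-s)^(m-1) on [0,1], so ∫ ((m+1)s - 1) A(s) ds ≥ 0, which is I ≤ (m+1)(I - J). The upper bound is
this estimate for (φ', φ), because I is symmetric and J(φ,φ') + J(φ',φ) = I. Finally I = 0 forces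
A(0) = 0, hence dψ = 0; this is why the cocycle condition fails. -/

theorem wedge_apply {k l : ℕ} (α : V [⋀^Fin k]→L[ℝ] ℝ) (β : V [⋀^Fin l]→L[ℝ] ℝ)
    (v : Fin (k + l) → V) :
    wedge α β v = LinearMap.mul' ℝ ℝ (α.toAlternatingMap.domCoprod β.toAlternatingMap
      (fun i => v (finSumFinEquiv i))) := rfl

/-- An explicit sum over chosen representatives of the shuffle cosets. Naturality, additivity and
smoothness of the wedge can then be checked summand by summand, whatever the representatives are. -/
theorem wedge_apply_sum {k l : ℕ} (α : V [⋀^Fin k]→L[ℝ] ℝ) (β : V [⋀^Fin l]→L[ℝ] ℝ)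
    (v : Fin (k + l) → V) :
    wedge α β v = ∑ s : Equiv.Perm.ModSumCongr (Fin k) (Fin l),
      ((Equiv.Perm.sign s.out : ℤ) : ℝ) *
        (α (fun i => v (finSumFinEquiv (s.out (Sum.inl i)))) *
          β (fun i => v (finSumFinEquiv (s.out (Sum.inr i))))) := by
  rw [wedge_apply, AlternatingMap.domCoprod_apply, sum_apply, map_sum]
  refine Finset.sum_congr rfl fun s _ => ?_
  conv_lhs => rw [← Quotient.out_eq' s]
  rw [AlternatingMap.domCoprod.summand_mk'']
  simp only [_root_.smul_apply,
          MultilinearMap.domDomCongr_apply, MultilinearMap.domCoprod_apply, map_zsmul_unit,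
          LinearMap.mul'_apply]
  rw [Units.smul_def, zsmul_eq_mul]
  rfl

theorem wedge_comp {k l : ℕ} (α : V [⋀^Fin k]→L[ℝ] ℝ) (β : V [⋀^Fin l]→L[ℝ] ℝ) (A : W →L[ℝ] V) :
    (wedge α β).compContinuousLinearMap A =
      wedge (α.compContinuousLinearMap A) (β.compContinuousLinearMap A) := by
  ext v
  simp only [ContinuousAlternatingMap.compContinuousLinearMap_apply, wedge_apply_sum]
  rfl

theorem wedge_sub_left {k l : ℕ} (α α' : V [⋀^Fin k]→L[ℝ] ℝ) (β : V [⋀^Fin l]→L[ℝ] ℝ) :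
    wedge (α - α') β = wedge α β - wedge α' β := by
  ext v
  simp only [ContinuousAlternatingMap.sub_apply, wedge_apply_sum, ← Finset.sum_sub_distrib]
  exact Finset.sum_congr rfl fun s _ => by ring

theorem wedge_add_right {k l : ℕ} (α : V [⋀^Fin k]→L[ℝ] ℝ) (β β' : V [⋀^Fin l]→L[ℝ] ℝ) :
    wedge α (β + β') = wedge α β + wedge α β' := by
  ext v
  simp only [ContinuousAlternatingMap.add_apply, wedge_apply_sum, ← Finset.sum_add_distrib]
  exact Finset.sum_congr rfl fun s _ => by ring

theorem wedge_smul_right {k l : ℕ} (c : ℝ) (α : V [⋀^Fin k]→L[ℝ] ℝ) (β : V [⋀^Fin l]→L[ℝ] ℝ) :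
    wedge α (c • β) = c • wedge α β := by
  ext v
  simp only [ContinuousAlternatingMap.smul_apply, wedge_apply_sum, smul_eq_mul, Finset.mul_sum]
  exact Finset.sum_congr rfl fun s _ => by ring

/-- The powers of a `2`-form on a vector space. -/
def pw (θ : V [⋀^Fin 2]→L[ℝ] ℝ) : (j : ℕ) → V [⋀^Fin (2 * j)]→L[ℝ] ℝ
  | 0 =>
      haveI : IsEmpty (Fin (2 * 0)) := inferInstanceAs (IsEmpty (Fin 0))
      ContinuousAlternatingMap.constOfIsEmpty ℝ V (Fin (2 * 0)) (1 : ℝ)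
  | j + 1 => wedge (pw θ j) θ

/-- Powers of a form are pointwise, so the statements about `DForm.wpow` reduce to linear algebra in
one tangent space. -/
theorem wpow_eq_pw {n : ℕ} {S : Type*} [TopologicalSpace S]
    [ChartedSpace (EuclideanSpace ℝ (Fin n)) S] (θ : DForm n S 2) (j : ℕ) (p : S) :
    θ.wpow j p = pw (θ p) j := by
  induction j with
  | zero => rfl
  | succ j ih =>
    change wedge (θ.wpow j p) (θ p) = wedge (pw (θ p) j) (θ p)
    rw [ih]

theorem pw_comp (θ : V [⋀^Fin 2]→L[ℝ] ℝ) (A : W →L[ℝ] V) (j : ℕ) :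
    (pw θ j).compContinuousLinearMap A = pw (θ.compContinuousLinearMap A) j := by
  induction j with
  | zero => rfl
  | succ j ih =>
    change (wedge (pw θ j) θ).compContinuousLinearMap A = wedge _ _
    rw [wedge_comp, ih]

/-- The form `θ^m ∧ η`. -/
def contactTop (m : ℕ) (θ : V [⋀^Fin 2]→L[ℝ] ℝ) (η : V →L[ℝ] ℝ) : V [⋀^Fin (2 * m + 1)]→L[ℝ] ℝ :=
  wedge (pw θ m) (ContinuousAlternatingMap.ofSubsingleton ℝ V ℝ (0 : Fin 1) η)

theorem contactTop_comp (m : ℕ) (θ : V [⋀^Fin 2]→L[ℝ] ℝ) (η : V →L[ℝ] ℝ) (A : W →L[ℝ] V) :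
    (contactTop m θ η).compContinuousLinearMap A =
      contactTop m (θ.compContinuousLinearMap A) (η.comp A) := by
  unfold contactTop
  rw [wedge_comp, pw_comp]
  rfl

end WedgeAlgebra


/-! ### The coefficient of θ^m ∧ η, its derivative in θ, and their behaviour under linear maps. -/

section TopValue

variable {m : ℕ} {E : Type*} [NormedAddCommGroup E] [NormedSpace ℝ E]
  (b : Module.Basis (Fin (2 * m + 1)) ℝ E)

/-- The coefficient of `θ^m ∧ η` with respect to a basis. -/
def topVal (θ : E [⋀^Fin 2]→L[ℝ] ℝ) (η : E →L[ℝ] ℝ) : ℝ :=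
  contactTop m θ η b

/-- Top forms are multiples of the determinant of the basis, and the determinant is multiplicative.
-/
theorem topForm_comp_basis {n : ℕ} (b : Module.Basis (Fin n) ℝ E) (τ : E [⋀^Fin n]→L[ℝ] ℝ)
    (A : E →L[ℝ] E) : τ.compContinuousLinearMap A b = A.det * τ b := by
  have h := AlternatingMap.eq_smul_basis_det b τ.toAlternatingMap
  have h2 := congrArg (fun f => f ((A : E →ₗ[ℝ] E) ∘ b)) h
  simp only [AlternatingMap.smul_apply, Module.Basis.det_comp, Module.Basis.det_self, mul_one,
    smul_eq_mul] at h2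
  rw [mul_comm]
  exact h2

/-- The single source of the identities below: differentiating it in θ gives `topDeriv_comp`,
differentiating it in A at the identity gives `topDeriv_act`. -/
theorem topVal_comp (θ : E [⋀^Fin 2]→L[ℝ] ℝ) (η : E →L[ℝ] ℝ) (A : E →L[ℝ] E) :
    topVal b (θ.compContinuousLinearMap A) (η.comp A) = A.det * topVal b θ η := by
  rw [topVal, ← contactTop_comp, topForm_comp_basis]
  rfl

theorem contDiff_alternating_apply {k : ℕ} (v : Fin k → E) :
    ContDiff ℝ ∞ (fun θ : E [⋀^Fin k]→L[ℝ] ℝ => θ v) :=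
  (ContinuousAlternatingMap.apply ℝ E ℝ v).contDiff

theorem contDiff_pw (j : ℕ) (v : Fin (2 * j) → E) :
    ContDiff ℝ ∞ (fun θ : E [⋀^Fin 2]→L[ℝ] ℝ => pw θ j v) := by
  induction j with
  | zero => exact contDiff_const
  | succ j ih =>
    change ContDiff ℝ ∞ (fun θ : E [⋀^Fin 2]→L[ℝ] ℝ => wedge (pw θ j) θ v)
    simp only [wedge_apply_sum]
    refine ContDiff.sum fun s _ => contDiff_const.mul ((ih _).mul ?_)
    exact contDiff_alternating_apply _

theorem contDiff_topVal :
    ContDiff ℝ ∞ (fun q : (E [⋀^Fin 2]→L[ℝ] ℝ) × (E →L[ℝ] ℝ) => topVal b q.1 q.2) := by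
  unfold topVal contactTop
  simp only [wedge_apply_sum]
  refine ContDiff.sum fun s _ => contDiff_const.mul (((contDiff_pw _ _).comp contDiff_fst).mul ?_)
  simp only [ContinuousAlternatingMap.ofSubsingleton_apply_apply]
  fun_prop

theorem contactTop_add_right (θ : E [⋀^Fin 2]→L[ℝ] ℝ) (η η' : E →L[ℝ] ℝ) :
    contactTop m θ (η + η') = contactTop m θ η + contactTop m θ η' := by
  unfold contactTop
  rw [← wedge_add_right]
  rfl

theorem topVal_add_right (θ : E [⋀^Fin 2]→L[ℝ] ℝ) (η η' : E →L[ℝ] ℝ) :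
    topVal b θ (η + η') = topVal b θ η + topVal b θ η' := by
  rw [topVal, contactTop_add_right]; rfl

theorem topVal_smul_right (c : ℝ) (θ : E [⋀^Fin 2]→L[ℝ] ℝ) (η : E →L[ℝ] ℝ) :
    topVal b θ (c • η) = c * topVal b θ η := by
  have : contactTop m θ (c • η) = c • contactTop m θ η := by
    unfold contactTop
    rw [← wedge_smul_right]
    rfl
  rw [topVal, this]; rfl

/-- The derivative of `topVal` in its first argument. -/
def topDeriv (θ : E [⋀^Fin 2]→L[ℝ] ℝ) (η : E →L[ℝ] ℝ) : (E [⋀^Fin 2]→L[ℝ] ℝ) →L[ℝ] ℝ :=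
  fderiv ℝ (fun θ => topVal b θ η) θ

theorem contDiff_topDeriv : ContDiff ℝ ∞
    (fun q : (E [⋀^Fin 2]→L[ℝ] ℝ) × (E →L[ℝ] ℝ) × (E [⋀^Fin 2]→L[ℝ] ℝ) =>
      topDeriv b q.1 q.2.1 q.2.2) := by
  unfold topDeriv
  have h : ContDiff ℝ ∞ (Function.uncurry fun (q : (E [⋀^Fin 2]→L[ℝ] ℝ) × (E →L[ℝ] ℝ) ×
      (E [⋀^Fin 2]→L[ℝ] ℝ)) (θ : E [⋀^Fin 2]→L[ℝ] ℝ) => topVal b θ q.2.1) :=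
    ContDiff.comp (g := fun q : (E [⋀^Fin 2]→L[ℝ] ℝ) × (E →L[ℝ] ℝ) => topVal b q.1 q.2)
      (f := fun z : ((E [⋀^Fin 2]→L[ℝ] ℝ) × (E →L[ℝ] ℝ) × (E [⋀^Fin 2]→L[ℝ] ℝ)) ×
        (E [⋀^Fin 2]→L[ℝ] ℝ) => (z.2, z.1.2.1)) (contDiff_topVal b) (by fun_prop)
  have h2 : ContDiff ℝ ∞ (fun q : (E [⋀^Fin 2]→L[ℝ] ℝ) × (E →L[ℝ] ℝ) × (E [⋀^Fin 2]→L[ℝ] ℝ) =>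
      fderiv ℝ (fun θ => topVal b θ q.2.1) q.1) := ContDiff.fderiv h contDiff_fst (by simp)
  exact ContDiff.clm_apply h2 (contDiff_snd.comp contDiff_snd)

/-- The product rule. Only the values of the derivative are recorded, which is all that is used of
it. -/
theorem hasFDerivAt_topVal {F : Type*} [NormedAddCommGroup F] [NormedSpace ℝ F]
    {θ : F → E [⋀^Fin 2]→L[ℝ] ℝ} {η : F → E →L[ℝ] ℝ} {θ' : F →L[ℝ] E [⋀^Fin 2]→L[ℝ] ℝ}
    {η' : F →L[ℝ] E →L[ℝ] ℝ} {s : Set F} {x : F} (hθ : HasFDerivWithinAt θ θ' s x)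
    (hη : HasFDerivWithinAt η η' s x) :
    ∃ L : F →L[ℝ] ℝ, HasFDerivWithinAt (fun y => topVal b (θ y) (η y)) L s x ∧
      ∀ v, L v = topDeriv b (θ x) (η x) (θ' v) + topVal b (θ x) (η' v) := by
  set T := fun q : (E [⋀^Fin 2]→L[ℝ] ℝ) × (E →L[ℝ] ℝ) => topVal b q.1 q.2
  have hT : HasFDerivAt T (fderiv ℝ T (θ x, η x)) (θ x, η x) :=
    ((contDiff_topVal b).differentiable (by simp) _).hasFDerivAt
  refine ⟨(fderiv ℝ T (θ x, η x)).comp (θ'.prod η'),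
    HasFDerivAt.comp_hasFDerivWithinAt (g := T) (f := fun y => (θ y, η y)) x hT
      (hθ.prodMk hη), fun v => ?_⟩
  have h1 : topDeriv b (θ x) (η x) (θ' v) = fderiv ℝ T (θ x, η x) (θ' v, 0) := by
    have : HasFDerivAt (fun t => topVal b t (η x)) ((fderiv ℝ T (θ x, η x)).comp
        (ContinuousLinearMap.inl ℝ _ _)) (θ x) :=
      HasFDerivAt.comp (θ x) (g := T) (f := fun t => (t, η x)) hT (hasFDerivAt_prodMk_left _ _)
    rw [topDeriv, this.fderiv]; rfl
  -- `topVal` is linear in η, so its derivative in the direction η' v is its value at η' v.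
  have h2 : topVal b (θ x) (η' v) = fderiv ℝ T (θ x, η x) (0, η' v) := by
    have h3 : HasDerivAt (fun s : ℝ => topVal b (θ x) (η x + s • η' v))
        (fderiv ℝ T (θ x, η x) (0, η' v)) 0 := by
      have h4 : HasDerivAt (fun s : ℝ => (θ x, η x + s • η' v)) (0, η' v) 0 := by
        refine (hasDerivAt_const _ _).prodMk ?_
        simpa using ((hasDerivAt_id (0 : ℝ)).smul_const (η' v)).const_add (η x)
      have hT0 : HasFDerivAt T (fderiv ℝ T (θ x, η x)) (θ x, η x + (0 : ℝ) • η' v) := by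
        simpa using hT
      exact hT0.comp_hasDerivAt (0 : ℝ) h4
    have h5 : HasDerivAt (fun s : ℝ => topVal b (θ x) (η x + s • η' v)) (topVal b (θ x) (η' v)) 0 := by
      simp only [topVal_add_right, topVal_smul_right]
      simpa using ((hasDerivAt_id (0 : ℝ)).mul_const (topVal b (θ x) (η' v))).const_add
        (topVal b (θ x) (η x))
    exact h5.unique h3
  rw [h1, h2, ← map_add]
  simp

theorem hasDerivWithinAt_topVal {θ : ℝ → E [⋀^Fin 2]→L[ℝ] ℝ} {θ' : E [⋀^Fin 2]→L[ℝ] ℝ}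
    (η : E →L[ℝ] ℝ) {s : Set ℝ} {t : ℝ} (hθ : HasDerivWithinAt θ θ' s t) :
    HasDerivWithinAt (fun t => topVal b (θ t) η) (topDeriv b (θ t) η θ') s t := by
  have h : HasFDerivAt (fun θ => topVal b θ η) (topDeriv b (θ t) η) (θ t) :=
    (((contDiff_topVal b).comp (contDiff_id.prodMk contDiff_const)).differentiable
      (by simp) _).hasFDerivAt
  exact h.comp_hasDerivWithinAt t hθ

/-- The lines θ + sα pull back to lines, and `topVal_comp` holds along them with the same
determinant. -/
theorem topDeriv_comp (θ α : E [⋀^Fin 2]→L[ℝ] ℝ) (η : E →L[ℝ] ℝ) (A : E →L[ℝ] E) :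
    topDeriv b (θ.compContinuousLinearMap A) (η.comp A) (α.compContinuousLinearMap A) =
      A.det * topDeriv b θ η α := by
  have aux : ∀ θ α : E [⋀^Fin 2]→L[ℝ] ℝ, HasDerivWithinAt (fun s : ℝ => θ + s • α) α univ 0 := by
    intro θ α
    simpa using ((hasDerivAt_id (0 : ℝ)).smul_const α).const_add θ
  have h1 := hasDerivWithinAt_topVal b (η.comp A)
    (aux (θ.compContinuousLinearMap A) (α.compContinuousLinearMap A))
  have h2 := (hasDerivWithinAt_topVal b η (aux θ α)).const_mul A.det
  have h3 : (fun s : ℝ => topVal b (θ.compContinuousLinearMap A + s • α.compContinuousLinearMap A)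
      (η.comp A)) = fun s : ℝ => A.det * topVal b (θ + s • α) η := by
    ext s
    rw [← topVal_comp]
    rfl
  rw [h3] at h1
  simpa using (hasDerivWithinAt_univ.1 h1).unique (hasDerivWithinAt_univ.1 h2)

/-- The infinitesimal action of an endomorphism on `2`-forms. -/
def act (B : E →L[ℝ] E) (θ : E [⋀^Fin 2]→L[ℝ] ℝ) : E [⋀^Fin 2]→L[ℝ] ℝ :=
  θ.fderivCompContinuousLinearMap (ContinuousLinearMap.id ℝ E) B

theorem act_apply (B : E →L[ℝ] E) (θ : E [⋀^Fin 2]→L[ℝ] ℝ) (X Y : E) :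
    act B θ ![X, Y] = θ ![B X, Y] + θ ![X, B Y] := by
  rw [act, ContinuousAlternatingMap.fderivCompContinuousLinearMap_apply, Fin.sum_univ_two]
  congr 2 <;> ext i : 1 <;> fin_cases i <;> simp

/-- In a basis det(1 + sB) = 1 + s tr B + s² P(s) with a polynomial P. -/
theorem hasDerivAt_det_one_add_smul {n : ℕ} (b : Module.Basis (Fin n) ℝ E) (B : E →L[ℝ] E) :
    HasDerivAt (fun s : ℝ => (ContinuousLinearMap.id ℝ E + s • B).det)
      (LinearMap.trace ℝ E (B : E →ₗ[ℝ] E)) 0 := by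
  set M := LinearMap.toMatrix b b (B : E →ₗ[ℝ] E)
  set P := Polynomial.divX (Polynomial.divX
    (1 + (Polynomial.X : Polynomial ℝ) • M.map Polynomial.C).det)
  have h : ∀ s : ℝ, (ContinuousLinearMap.id ℝ E + s • B).det =
      1 + M.trace * s + P.eval s * s ^ 2 := by
    intro s
    rw [ContinuousLinearMap.det, ← LinearMap.det_toMatrix b, ← Matrix.det_one_add_smul]
    congr 1
    simp [M]
  simp only [h]
  have htr : LinearMap.trace ℝ E (B : E →ₗ[ℝ] E) = M.trace :=
    LinearMap.trace_eq_matrix_trace ℝ b _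
  rw [htr]
  have hd : HasDerivAt (fun s : ℝ => 1 + M.trace * s + P.eval s * s ^ 2)
    (0 + M.trace * 1 + ((P.derivative.eval 0) * 0 ^ 2 + P.eval 0 * ((2 : ℕ) * 0 ^ (2 - 1)))) 0 :=
    ((hasDerivAt_const _ _).add ((hasDerivAt_id' (0 : ℝ)).const_mul _)).add
      ((P.hasDerivAt 0).mul (hasDerivAt_pow 2 0))
  simpa using hd

/-- The infinitesimal version of `topVal_comp`. -/
theorem topDeriv_act (θ : E [⋀^Fin 2]→L[ℝ] ℝ) (η : E →L[ℝ] ℝ) (B : E →L[ℝ] E) :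
    topDeriv b θ η (act B θ) + topVal b θ (η.comp B) =
      LinearMap.trace ℝ _ (B : E →ₗ[ℝ] E) * topVal b θ η := by
  set A : ℝ → E →L[ℝ] E := fun s => ContinuousLinearMap.id ℝ E + s • B
  have hA : HasDerivAt (fun s : ℝ => ContinuousLinearMap.id ℝ E + s • B) B 0 := by
    simpa using ((hasDerivAt_id (0 : ℝ)).smul_const B).const_add (ContinuousLinearMap.id ℝ E)
  have hA0 : A 0 = ContinuousLinearMap.id ℝ E := by simp [A]
  have h1 : HasDerivAt (fun s => θ.compContinuousLinearMap (A s)) (act B θ) 0 := by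
    have h := (hasDerivAt_const (0 : ℝ)
      θ).hasFDerivAt.continuousAlternatingMapCompContinuousLinearMap hA.hasFDerivAt
    convert h.hasDerivAt using 1
    ext v
    simp [act]
  have h2 : HasDerivAt (fun s => η.comp (A s)) (η.comp B) 0 := by
    have : HasDerivAt (fun s : ℝ => η + s • η.comp B) (η.comp B) 0 := by
      simpa using ((hasDerivAt_id (0 : ℝ)).smul_const (η.comp B)).const_add η
    convert this using 2 with s
    ext X; simp [A]
  obtain ⟨L, hL, hLv⟩ := hasFDerivAt_topVal b h1.hasFDerivAt.hasFDerivWithinAt (s := univ)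
    h2.hasFDerivAt.hasFDerivWithinAt
  have h3 := (hasFDerivWithinAt_univ.1 hL).hasDerivAt
  simp only [topVal_comp] at h3
  have h4 := (hasDerivAt_det_one_add_smul b B).mul_const (topVal b θ η)
  have h5 := h3.unique h4
  rw [hLv] at h5
  rw [← h5]
  simp [hA0]
  rfl

end TopValue

/-! ### Non-vanishing of θ^m ∧ η on a symplectic frame. -/

section Nonvanishing

variable {V : Type*} [AddCommGroup V] [Module ℝ V] [TopologicalSpace V]

/-- The wedge of two alternatizations is the alternatization of the tensor product. Passing to
multiples of α and β that are alternatizations replaces the sum over cosets by a sum over all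
permutations, where no representatives have to be chosen. -/
theorem wedge_alternatization {ιa ιb : Type*} [Fintype ιa] [Fintype ιb] [DecidableEq ιa]
    [DecidableEq ιb] {k l : ℕ} (ea : ιa ≃ Fin k) (eb : ιb ≃ Fin l)
    (α : V [⋀^Fin k]→L[ℝ] ℝ) (β : V [⋀^Fin l]→L[ℝ] ℝ) (a b : ℝ)
    (M : MultilinearMap ℝ (fun _ : Fin k => V) ℝ) (N : MultilinearMap ℝ (fun _ : Fin l => V) ℝ)
    (hM : a • α.toAlternatingMap = MultilinearMap.alternatization M)
    (hN : b • β.toAlternatingMap = MultilinearMap.alternatization N) (u : ιa ⊕ ιb → V) :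
    (a * b) * wedge α β (u ∘ ((ea.sumCongr eb).trans finSumFinEquiv).symm) =
      ∑ σ : Equiv.Perm (ιa ⊕ ιb), ((Equiv.Perm.sign σ : ℤ) : ℝ) *
        (M (fun i => u (σ (Sum.inl (ea.symm i)))) * N (fun i => u (σ (Sum.inr (eb.symm i))))) := by
  have h1 : (a * b) * wedge α β (u ∘ ((ea.sumCongr eb).trans finSumFinEquiv).symm) =
      LinearMap.mul' ℝ ℝ ((a • α.toAlternatingMap).domCoprod (b • β.toAlternatingMap)
        (u ∘ (ea.sumCongr eb).symm)) := by
    rw [wedge_apply, ← AlternatingMap.domCoprod'_apply, ← AlternatingMap.domCoprod'_apply,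
      TensorProduct.smul_tmul_smul, map_smul, AlternatingMap.smul_apply, map_smul, smul_eq_mul]
    congr 3
    ext i
    simp
  rw [h1, hM, hN, ← MultilinearMap.domCoprod_alternization, MultilinearMap.alternatization_apply,
    map_sum, ← Equiv.sum_comp (Equiv.permCongr (ea.sumCongr eb))]
  refine Finset.sum_congr rfl fun σ _ => ?_
  rw [Equiv.Perm.sign_permCongr, Units.smul_def, map_zsmul, zsmul_eq_mul]
  congr 1
  simp only [MultilinearMap.domDomCongr_apply, MultilinearMap.domCoprod_apply, LinearMap.mul'_apply]
  congr 2 <;> ext i <;> simp [Equiv.permCongr_apply]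

/-- Alternating θ as a bilinear map gives 2θ, so alternating θ ⊗ ⋯ ⊗ θ gives 2^j θ^j. The bijection
with pairs only records which arguments share a factor; it may stay unspecified, since its sign does
not matter for non-vanishing. -/
theorem exists_alternatization_pw (θ : V [⋀^Fin 2]→L[ℝ] ℝ) (j : ℕ) :
    ∃ (e : Fin j × Fin 2 ≃ Fin (2 * j)) (N : MultilinearMap ℝ (fun _ : Fin (2 * j) => V) ℝ),
      (∀ v, N v = ∏ i, θ ![v (e (i, 0)), v (e (i, 1))]) ∧
      (2 : ℝ) ^ j • (pw θ j).toAlternatingMap = MultilinearMap.alternatization N := by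
  induction j with
  | zero =>
    have : IsEmpty (Fin (2 * 0)) := inferInstanceAs (IsEmpty (Fin 0))
    refine ⟨Equiv.equivOfIsEmpty _ _, MultilinearMap.constOfIsEmpty ℝ _ 1, fun v => by simp, ?_⟩
    ext v
    simp [MultilinearMap.alternatization_apply, pw]
  | succ j ih =>
    obtain ⟨e, N, hN, hpw⟩ := ih
    have hθ : (2 : ℝ) • θ.toAlternatingMap =
        MultilinearMap.alternatization (θ.toAlternatingMap : MultilinearMap ℝ (fun _ => V) ℝ) := by
      rw [AlternatingMap.coe_alternatization]
      ext v
      simp [two_smul]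
    let N' : MultilinearMap ℝ (fun _ : Fin (2 * j + 2) => V) ℝ :=
      ((LinearMap.mul' ℝ ℝ).compMultilinearMap (N.domCoprod
        (θ.toAlternatingMap : MultilinearMap ℝ (fun _ => V) ℝ))).domDomCongr finSumFinEquiv
    let e' : Fin (j + 1) × Fin 2 ≃ Fin (2 * j + 2) :=
      ((finSumFinEquiv.symm.prodCongr (Equiv.refl _)).trans
        ((Equiv.sumProdDistrib (Fin j) (Fin 1) (Fin 2)).trans
          (e.sumCongr (Equiv.uniqueProd (Fin 2) (Fin 1))))).trans finSumFinEquiv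
    refine ⟨e', N', fun v => ?_, ?_⟩
    · rw [Fin.prod_univ_castSucc]
      simp only [N', MultilinearMap.domDomCongr_apply, LinearMap.compMultilinearMap_apply,
        MultilinearMap.domCoprod_apply, LinearMap.mul'_apply, hN]
      congr 1
      · refine Finset.prod_congr rfl fun i _ => ?_
        have : ∀ k, e' (i.castSucc, k) = finSumFinEquiv (Sum.inl (e (i, k))) := by
          intro k
          have : finSumFinEquiv.symm i.castSucc = (Sum.inl i : Fin j ⊕ Fin 1) := by
            rw [Equiv.symm_apply_eq]; rfl
          simp [e', this]
        simp [this]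
      · have : ∀ k, e' (Fin.last j, k) = finSumFinEquiv (Sum.inr k) := by
          intro k
          have : finSumFinEquiv.symm (Fin.last j) = (Sum.inr 0 : Fin j ⊕ Fin 1) := by
            rw [Equiv.symm_apply_eq]; rfl
          simp [e', this]
        simp only [this]
        change θ _ = θ _
        congr 1
        ext i
        fin_cases i <;> rfl
    · ext v
      have h := wedge_alternatization (Equiv.refl _) (Equiv.refl _) (pw θ j) θ _ _ _ _ hpw hθ
        (v ∘ finSumFinEquiv)
      rw [MultilinearMap.alternatization_apply]
      refine Eq.trans ?_ (Equiv.sum_comp (Equiv.permCongr (finSumFinEquiv (m := 2 * j) (n := 2)))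
        (fun σ : Equiv.Perm (Fin (2 * j + 2)) =>
          Equiv.Perm.sign σ • MultilinearMap.domDomCongr σ N' v))
      have h2 : (v ∘ finSumFinEquiv) ∘ (((Equiv.refl (Fin (2 * j))).sumCongr
          (Equiv.refl (Fin 2))).trans finSumFinEquiv).symm = v := by
        ext i
        simp
      rw [h2] at h
      rw [pow_succ]
      refine Eq.trans ?_ (h.trans ?_)
      · rfl
      · refine Finset.sum_congr rfl fun σ _ => ?_
        rw [Equiv.Perm.sign_permCongr, Units.smul_def, zsmul_eq_mul]
        congr 1
        simp only [N', MultilinearMap.domDomCongr_apply, LinearMap.compMultilinearMap_apply,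
          MultilinearMap.domCoprod_apply, LinearMap.mul'_apply, Equiv.permCongr_apply]
        simp

theorem exists_contactTop_eq_sum (m : ℕ) (θ : V [⋀^Fin 2]→L[ℝ] ℝ) (η : V →L[ℝ] ℝ) :
    ∃ e : (Fin m × Fin 2) ⊕ Fin 1 ≃ Fin (2 * m + 1), ∀ u : (Fin m × Fin 2) ⊕ Fin 1 → V,
      2 ^ m * contactTop m θ η (u ∘ e.symm) =
        ∑ σ : Equiv.Perm ((Fin m × Fin 2) ⊕ Fin 1), ((Equiv.Perm.sign σ : ℤ) : ℝ) *
          ((∏ i, θ ![u (σ (Sum.inl (i, 0))), u (σ (Sum.inl (i, 1)))]) *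
            η (u (σ (Sum.inr 0)))) := by
  obtain ⟨e, N, hN, hpw⟩ := exists_alternatization_pw θ m
  have hη : (1 : ℝ) • (ContinuousAlternatingMap.ofSubsingleton ℝ V ℝ (0 : Fin 1) η).toAlternatingMap
      = MultilinearMap.alternatization ((ContinuousAlternatingMap.ofSubsingleton ℝ V ℝ (0 : Fin 1)
        η).toAlternatingMap : MultilinearMap ℝ (fun _ => V) ℝ) := by
    rw [AlternatingMap.coe_alternatization]
    ext v
    simp
  refine ⟨(e.sumCongr (Equiv.refl _)).trans finSumFinEquiv, fun u => ?_⟩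
  have h := wedge_alternatization e (Equiv.refl (Fin 1)) _ _ _ _ _ _ hpw hη u
  rw [mul_one] at h
  refine Eq.trans ?_ (h.trans ?_)
  · rfl
  · refine Finset.sum_congr rfl fun σ _ => ?_
    rw [hN]
    simp

/-- A permutation of pairs that maps pairs to pairs has the sign one expects. -/
theorem sign_mul_prod_eq_one {m : ℕ} (σ : Equiv.Perm (Fin m × Fin 2))
    (h : ∀ i, (σ (i, 0)).1 = (σ (i, 1)).1) :
    ((Equiv.Perm.sign σ : ℤ) : ℝ) * ∏ i, (if (σ (i, 0)).2 = 0 then (1 : ℝ) else -1) = 1 := by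
  have hne : ∀ i, (σ (i, 0)).2 ≠ (σ (i, 1)).2 := fun i h2 => by
    have := σ.injective (Prod.ext (h i) h2)
    simp at this
  have hinj : Function.Injective fun i => (σ (i, 0)).1 := by
    intro i j hij
    have hij' : (σ (i, 0)).1 = (σ (j, 0)).1 := hij
    by_contra hne'
    have h1 : (σ (i, 0)).2 ≠ (σ (j, 0)).2 := fun h2 => by
      have := σ.injective (Prod.ext hij' h2)
      simp at this; exact hne' this
    have h2 : (σ (i, 1)).2 ≠ (σ (j, 0)).2 := fun h2 => by
      have := σ.injective (Prod.ext ((h i).symm.trans hij') h2)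
      simp at this
    have h3 := hne i
    omega
  -- σ first flips inside some of the pairs (κ) and then permutes the pairs (τ).
  let τ : Equiv.Perm (Fin m) := Equiv.ofBijective _ (Finite.injective_iff_bijective.1 hinj)
  let κ : Fin m → Equiv.Perm (Fin 2) := fun i =>
    if (σ (i, 0)).2 = 0 then 1 else Equiv.swap 0 1
  have hσ : σ = (Equiv.prodCongrLeft (fun _ => τ) * Equiv.prodCongrRight κ :
      Equiv.Perm (Fin m × Fin 2)) := by
    ext1 ⟨i, k⟩
    have hτ : (Equiv.prodCongrLeft (fun _ => τ) * Equiv.prodCongrRight κ :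
        Equiv.Perm (Fin m × Fin 2)) (i, k) =
        ((σ (i, 0)).1, κ i k) := rfl
    rw [hτ]
    have h3 := hne i
    fin_cases k
    · refine Prod.ext rfl ?_
      by_cases h0 : (σ (i, 0)).2 = 0 <;> simp [κ, h0]
      omega
    · refine Prod.ext (h i).symm ?_
      by_cases h0 : (σ (i, 0)).2 = 0 <;> simp [κ, h0] <;> omega
  -- Permuting whole pairs is τ acting on two copies, so its sign is (sign τ)² = 1; only the flips
  -- count.
  have hs : Equiv.Perm.sign σ = ∏ i, Equiv.Perm.sign (κ i) := by
    conv_lhs => rw [hσ]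
    rw [Equiv.Perm.sign_mul, Equiv.Perm.sign_prodCongrLeft, Equiv.Perm.sign_prodCongrRight]
    simp
  rw [hs]
  push_cast
  rw [← Finset.prod_mul_distrib]
  refine Finset.prod_eq_one fun i _ => ?_
  by_cases h0 : (σ (i, 0)).2 = 0 <;> simp [κ, h0]

/-- In the sum over permutations no term is negative. A term vanishes unless the permutation fixes
the Reeb slot and maps pairs to pairs, and then each flip changes both the sign of the permutation
and that of one factor. The identity contributes 1, so the sum is positive. -/
theorem contactTop_ne_zero_of_frame {m : ℕ} (θ : V [⋀^Fin 2]→L[ℝ] ℝ) (η : V →L[ℝ] ℝ)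
    (u : (Fin m × Fin 2) ⊕ Fin 1 → V) (hη0 : ∀ i, η (u (Sum.inl i)) = 0)
    (hη1 : η (u (Sum.inr 0)) = 1)
    (hθ : ∀ i j, θ ![u (Sum.inl i), u (Sum.inl j)] =
      if i.1 = j.1 ∧ i.2 ≠ j.2 then (if i.2 = 0 then 1 else -1) else 0) :
    contactTop m θ η ≠ 0 := by
  obtain ⟨e, he⟩ := exists_contactTop_eq_sum m θ η
  intro h0
  have h1 := he u
  rw [h0] at h1
  have hpos : 0 < ∑ σ : Equiv.Perm ((Fin m × Fin 2) ⊕ Fin 1), ((Equiv.Perm.sign σ : ℤ) : ℝ) *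
          ((∏ i, θ ![u (σ (Sum.inl (i, 0))), u (σ (Sum.inl (i, 1)))]) *
            η (u (σ (Sum.inr 0)))) := by
    refine Finset.sum_pos' (fun σ _ => ?_) ⟨1, Finset.mem_univ _, by simp [hθ, hη1]⟩
    -- If the last slot receives a vector other than the Reeb vector, the factor η vanishes.
    by_cases hr : σ (Sum.inr 0) = Sum.inr 0
    swap
    · have : η (u (σ (Sum.inr 0))) = 0 := by
        rcases hx : σ (Sum.inr 0) with i | i
        · exact hη0 i
        · exact absurd (hx.trans (by rw [Subsingleton.elim i 0])) hr
      simp [this]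
    have hmaps : Set.MapsTo σ (Set.range Sum.inl) (Set.range Sum.inl) := by
      rw [Equiv.Perm.perm_mapsTo_inl_iff_mapsTo_inr]
      rintro _ ⟨i, rfl⟩
      exact ⟨0, by rw [Subsingleton.elim i 0, hr]⟩
    obtain ⟨⟨σ₁, σ₂⟩, rfl⟩ := Equiv.Perm.mem_sumCongrHom_range_of_perm_mapsTo_inl hmaps
    have h2 : σ₂ = 1 := Subsingleton.elim _ _
    subst h2
    simp only [Equiv.Perm.sumCongrHom_apply, Equiv.Perm.sumCongr_apply, Sum.map_inl, Sum.map_inr,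
      Equiv.Perm.sign_sumCongr, hθ, Equiv.Perm.coe_one, id, hη1, mul_one, map_one]
    by_cases hp : ∀ i, (σ₁ (i, 0)).1 = (σ₁ (i, 1)).1
    · have hne : ∀ i, (σ₁ (i, 0)).2 ≠ (σ₁ (i, 1)).2 := fun i h2 => by
        have := σ₁.injective (Prod.ext (hp i) h2)
        simp at this
      have := sign_mul_prod_eq_one σ₁ hp
      simp only [hp, hne, ne_eq, not_false_eq_true, and_self, if_true]
      rw [this]
      exact zero_le_one
    · push Not at hp
      obtain ⟨i, hi⟩ := hp
      rw [Finset.prod_eq_zero (Finset.mem_univ i) (by simp [hi])]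
      simp
  rw [← h1] at hpos
  simp at hpos

end Nonvanishing

/-! ### Two-forms as antisymmetric bilinear maps. -/

section TwoForms

variable {E : Type*} [NormedAddCommGroup E] [NormedSpace ℝ E]

/-- Antisymmetrization of a bilinear form, as a continuous linear map to `2`-forms. -/
def alt₂ : (E →L[ℝ] E →L[ℝ] ℝ) →L[ℝ] E [⋀^Fin 2]→L[ℝ] ℝ :=
  (ContinuousAlternatingMap.alternatizeUncurryFinCLM ℝ E ℝ (n := 1)).comp
    ((ContinuousLinearMap.compL ℝ E (E →L[ℝ] ℝ) (E [⋀^Fin 1]→L[ℝ] ℝ)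
      ((ContinuousAlternatingMap.ofSubsingletonLIE (𝕜 := ℝ) (E := E) (F := ℝ) (0 : Fin 1)).toContinuousLinearEquiv :
        (E →L[ℝ] ℝ) →L[ℝ] E [⋀^Fin 1]→L[ℝ] ℝ)))

theorem alt₂_apply (T : E →L[ℝ] E →L[ℝ] ℝ) (X Y : E) : alt₂ T ![X, Y] = T X Y - T Y X := by
  simp [alt₂, ContinuousAlternatingMap.alternatizeUncurryFin_apply, Fin.sum_univ_two, sub_eq_add_neg]
  rfl

/-- A `2`-form as a continuous bilinear map, depending linearly on the form. -/
def bilCLM : (E [⋀^Fin 2]→L[ℝ] ℝ) →L[ℝ] E →L[ℝ] E →L[ℝ] ℝ :=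
  (ContinuousLinearMap.compL ℝ E (E [⋀^Fin 1]→L[ℝ] ℝ) (E →L[ℝ] ℝ)
      ((ContinuousAlternatingMap.ofSubsingletonLIE (𝕜 := ℝ) (E := E) (F := ℝ)
        (0 : Fin 1)).symm.toContinuousLinearEquiv : (E [⋀^Fin 1]→L[ℝ] ℝ) →L[ℝ] E →L[ℝ] ℝ)).comp
    (ContinuousAlternatingMap.curryLeftLI (𝕜 := ℝ) (E := E) (F := ℝ) (n := 1)).toContinuousLinearMap

theorem bilCLM_apply (θ : E [⋀^Fin 2]→L[ℝ] ℝ) (X Y : E) : bilCLM θ X Y = θ ![X, Y] := by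
  simp only [bilCLM, ContinuousLinearMap.comp_apply, ContinuousLinearMap.compL_apply]
  change θ _ = θ _
  congr 1
  ext i; fin_cases i <;> rfl

theorem two_form_swap (θ : E [⋀^Fin 2]→L[ℝ] ℝ) (X Y : E) : θ ![X, Y] = -θ ![Y, X] := by
  have h := θ.map_swap ![Y, X] (i := 0) (j := 1) (by decide)
  have h2 : ![Y, X] ∘ Equiv.swap (0 : Fin 2) 1 = ![X, Y] := by
    ext i; fin_cases i <;> rfl
  rw [h2] at h
  exact h

theorem two_form_ext {θ θ' : E [⋀^Fin 2]→L[ℝ] ℝ} (h : ∀ X Y, θ ![X, Y] = θ' ![X, Y]) :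
    θ = θ' := by
  ext v
  have : v = ![v 0, v 1] := by ext i; fin_cases i <;> rfl
  rw [this]; exact h _ _

theorem two_form_comp_apply {F : Type*} [NormedAddCommGroup F] [NormedSpace ℝ F]
    (θ : E [⋀^Fin 2]→L[ℝ] ℝ) (A : F →L[ℝ] E) (X Y : F) :
    θ.compContinuousLinearMap A ![X, Y] = θ ![A X, A Y] := by
  rw [ContinuousAlternatingMap.compContinuousLinearMap_apply]
  congr 1
  ext i; fin_cases i <;> rfl

end TwoForms

/-! ### Linear algebra of positive basic (1,1)-forms at a point. -/

section Transverse

variable {E : Type*} [NormedAddCommGroup E] [NormedSpace ℝ E]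

/-- The algebraic relations between `Φ`, `ξ` and `η` at a point. -/
structure IsAlmostContact (ξ : E) (η : E →L[ℝ] ℝ) (Φ : E →L[ℝ] E) : Prop where
  η_ξ : η ξ = 1
  Φ_ξ : Φ ξ = 0
  η_Φ : ∀ X, η (Φ X) = 0
  Φ_Φ : ∀ X, Φ (Φ X) = -X + η X • ξ

/-- Basic forms of type `(1,1)`. -/
structure IsTransverse (ξ : E) (Φ : E →L[ℝ] E) (θ : E [⋀^Fin 2]→L[ℝ] ℝ) : Prop where
  left : ∀ Y, θ ![ξ, Y] = 0
  invariant : ∀ X Y, θ ![Φ X, Φ Y] = θ ![X, Y]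

/-- Positive basic forms of type `(1,1)`. -/
structure IsPositive (ξ : E) (η : E →L[ℝ] ℝ) (Φ : E →L[ℝ] E) (θ : E [⋀^Fin 2]→L[ℝ] ℝ) : Prop
    extends IsTransverse ξ Φ θ where
  pos : ∀ X, η X = 0 → X ≠ 0 → 0 < θ ![X, Φ X]

variable {ξ : E} {η : E →L[ℝ] ℝ} {Φ : E →L[ℝ] E} {θ θ' : E [⋀^Fin 2]→L[ℝ] ℝ}

theorem IsTransverse.right (h : IsTransverse ξ Φ θ) (X : E) : θ ![X, ξ] = 0 := by
  rw [two_form_swap, h.left, neg_zero]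

theorem IsTransverse.add (h : IsTransverse ξ Φ θ) (h' : IsTransverse ξ Φ θ') :
    IsTransverse ξ Φ (θ + θ') :=
  ⟨fun Y => by simp [h.left, h'.left], fun X Y => by simp [h.invariant, h'.invariant]⟩

theorem IsTransverse.smul (h : IsTransverse ξ Φ θ) (c : ℝ) : IsTransverse ξ Φ (c • θ) :=
  ⟨fun Y => by simp [h.left], fun X Y => by simp [h.invariant]⟩

theorem IsPositive.convex (h : IsPositive ξ η Φ θ) (h' : IsPositive ξ η Φ θ') {s : ℝ}
    (hs : s ∈ Icc (0 : ℝ) 1) : IsPositive ξ η Φ ((1 - s) • θ + s • θ') := by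
  refine ⟨(h.toIsTransverse.smul _).add (h'.toIsTransverse.smul _), fun X hX hX0 => ?_⟩
  simp only [ContinuousAlternatingMap.add_apply, ContinuousAlternatingMap.smul_apply, smul_eq_mul]
  have h1 := h.pos X hX hX0
  have h2 := h'.pos X hX hX0
  rcases hs.1.eq_or_lt with rfl | h0
  · simpa using h1
  · have := mul_pos h0 h2
    have := mul_nonneg (sub_nonneg.2 hs.2) h1.le
    linarith

/-- The symmetric form `θ(X, Φ Y) + c η(X) η(Y)`. -/
def metricForm (η : E →L[ℝ] ℝ) (Φ : E →L[ℝ] E) (θ : E [⋀^Fin 2]→L[ℝ] ℝ) (c : ℝ) :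
    E →ₗ[ℝ] E →ₗ[ℝ] ℝ :=
  LinearMap.mk₂ ℝ (fun X Y => bilCLM θ X (Φ Y) + c * (η X * η Y))
    (fun X X' Y => by simp; ring) (fun a X Y => by simp; ring)
    (fun X Y Y' => by simp; ring) (fun a X Y => by simp; ring)

theorem metricForm_apply (c : ℝ) (X Y : E) :
    metricForm η Φ θ c X Y = θ ![X, Φ Y] + c * (η X * η Y) := by
  simp [metricForm, bilCLM_apply]

/-- Since Φ² = -1 modulo ξ, the form can be read off from its metric. The parameter c is irrelevant
because η ∘ Φ = 0. -/
theorem IsAlmostContact.two_form_eq (hc : IsAlmostContact ξ η Φ) (h : IsTransverse ξ Φ θ) (c : ℝ)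
    (X Y : E) : θ ![X, Y] = -metricForm η Φ θ c X (Φ Y) := by
  have h1 : θ ![X, Φ (Φ Y)] = -θ ![X, Y] := by
    rw [hc.Φ_Φ, ← bilCLM_apply, map_add, map_neg, map_smul, bilCLM_apply, bilCLM_apply, h.right]
    simp
  rw [metricForm_apply, hc.η_Φ, h1]
  simp

theorem IsAlmostContact.metricForm_symm (hc : IsAlmostContact ξ η Φ) (h : IsTransverse ξ Φ θ)
    (c : ℝ) (X Y : E) : metricForm η Φ θ c X Y = metricForm η Φ θ c Y X := by
  rw [metricForm_apply, metricForm_apply, ← h.invariant Y (Φ X), hc.Φ_Φ, ← bilCLM_apply,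
    ← bilCLM_apply]
  simp only [map_add, map_neg, map_smul, bilCLM_apply, two_form_swap θ (Φ Y) X,
    two_form_swap θ (Φ Y) ξ, h.left, smul_eq_mul]
  ring

/-- Φ is skew-adjoint for the metric of every transverse form; this forces the eigenvalue pairs used
later. -/
theorem IsAlmostContact.metricForm_Φ (hc : IsAlmostContact ξ η Φ) (h : IsTransverse ξ Φ θ)
    (c : ℝ) (X Y : E) : metricForm η Φ θ c (Φ X) Y = -metricForm η Φ θ c X (Φ Y) := by
  rw [metricForm_apply, h.invariant, hc.η_Φ, zero_mul, mul_zero, add_zero, hc.two_form_eq h c]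

theorem IsAlmostContact.metricForm_ξ (hc : IsAlmostContact ξ η Φ) (h : IsTransverse ξ Φ θ)
    (c : ℝ) (Y : E) : metricForm η Φ θ c ξ Y = c * η Y := by
  rw [metricForm_apply, h.left, hc.η_ξ]; ring

/-- Split X into its part in ker η and a multiple of ξ: the first part is measured by θ, the second
by the term with c. -/
theorem IsAlmostContact.metricForm_pos (hc : IsAlmostContact ξ η Φ) (h : IsPositive ξ η Φ θ)
    {c : ℝ} (hc0 : 0 < c) (X : E) (hX : X ≠ 0) : 0 < metricForm η Φ θ c X X := by
  obtain ⟨Y, hY, hXY⟩ : ∃ Y, η Y = 0 ∧ X = Y + η X • ξ :=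
    ⟨X - η X • ξ, by simp [hc.η_ξ], by simp⟩
  have h1 : θ ![X, Φ X] = θ ![Y, Φ Y] := by
    rw [hXY, ← bilCLM_apply, ← bilCLM_apply]
    simp [hc.Φ_ξ, bilCLM_apply, h.left]
  rw [metricForm_apply, h1]
  by_cases hY0 : Y = 0
  · have : η X ≠ 0 := fun h0 => hX (by rw [hXY, hY0, h0]; simp)
    have : 0 < η X * η X := mul_self_pos.2 this
    rw [hY0, map_zero, ← bilCLM_apply, map_zero, zero_add]
    positivity
  · have := h.pos Y hY hY0
    nlinarith [mul_self_nonneg (η X)]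

/-- The map `Z ↦ θ(Z, ·) + η(Z) η`. -/
def flat (θ : E [⋀^Fin 2]→L[ℝ] ℝ) (η : E →L[ℝ] ℝ) : E →L[ℝ] E →L[ℝ] ℝ :=
  bilCLM θ + η.smulRight η

theorem flat_apply (X Y : E) : flat θ η X Y = θ ![X, Y] + η X * η Y := by
  simp [flat, bilCLM_apply]

/-- Evaluating on ξ gives η(Z) = 0; then evaluating on ΦZ contradicts positivity unless Z = 0. The
summand η ⊗ η removes the kernel ℝξ of θ, so one invertible map defined on all of E can be used. -/
theorem IsAlmostContact.flat_injective (hc : IsAlmostContact ξ η Φ) (h : IsPositive ξ η Φ θ) :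
    Function.Injective (flat θ η) := by
  rw [injective_iff_map_eq_zero]
  intro Z hZ
  have hη : η Z = 0 := by
    have := congrArg (fun f => f ξ) hZ
    simpa [flat_apply, h.right, hc.η_ξ] using this
  by_contra hne
  have := congrArg (fun f => f (Φ Z)) hZ
  simp only [flat_apply, hη, zero_mul, add_zero, zero_apply] at this
  exact absurd this (h.pos Z hη hne).ne'

/-- The vector `Z` with `θ(Z, ·) = β` and `η(Z) = 0`. -/
def sharp (θ : E [⋀^Fin 2]→L[ℝ] ℝ) (η : E →L[ℝ] ℝ) (β : E →L[ℝ] ℝ) : E :=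
  (flat θ η).inverse β

theorem IsAlmostContact.flat_isInvertible [FiniteDimensional ℝ E] (hc : IsAlmostContact ξ η Φ)
    (h : IsPositive ξ η Φ θ) : (flat θ η).IsInvertible := by
  have hd : Module.finrank ℝ E = Module.finrank ℝ (E →L[ℝ] ℝ) := by
    rw [← (LinearMap.toContinuousLinearMap (𝕜 := ℝ) (E := E) (F' := ℝ)).finrank_eq]
    exact (Subspace.dual_finrank_eq (K := ℝ) (V := E)).symm
  refine ⟨(LinearEquiv.ofInjectiveOfFinrankEq (flat θ η : E →ₗ[ℝ] E →L[ℝ] ℝ)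
    (hc.flat_injective h) hd).toContinuousLinearEquiv, ?_⟩
  ext X Y
  rfl

theorem IsAlmostContact.flat_sharp [FiniteDimensional ℝ E] (hc : IsAlmostContact ξ η Φ)
    (h : IsPositive ξ η Φ θ) (β : E →L[ℝ] ℝ) : flat θ η (sharp θ η β) = β := by
  obtain ⟨e, he⟩ := hc.flat_isInvertible h
  rw [sharp, ← he, ContinuousLinearMap.inverse_equiv]
  exact e.apply_symm_apply β

theorem IsAlmostContact.η_sharp [FiniteDimensional ℝ E] (hc : IsAlmostContact ξ η Φ)
    (h : IsPositive ξ η Φ θ) {β : E →L[ℝ] ℝ} (hβ : β ξ = 0) : η (sharp θ η β) = 0 := by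
  have := congrArg (fun f => f ξ) (hc.flat_sharp h β)
  simpa [flat_apply, h.right, hc.η_ξ, hβ] using this

theorem IsAlmostContact.two_form_sharp [FiniteDimensional ℝ E] (hc : IsAlmostContact ξ η Φ)
    (h : IsPositive ξ η Φ θ) {β : E →L[ℝ] ℝ} (hβ : β ξ = 0) (Y : E) :
    θ ![sharp θ η β, Y] = β Y := by
  have := congrArg (fun f => f Y) (hc.flat_sharp h β)
  simpa [flat_apply, hc.η_sharp h hβ] using this

theorem IsAlmostContact.eq_sharp [FiniteDimensional ℝ E] (hc : IsAlmostContact ξ η Φ)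
    (h : IsPositive ξ η Φ θ) {β : E →L[ℝ] ℝ} {Z : E} (hZ : η Z = 0) (hZβ : ∀ Y, θ ![Z, Y] = β Y) :
    Z = sharp θ η β := by
  apply hc.flat_injective h
  rw [hc.flat_sharp h]
  ext Y
  simp [flat_apply, hZ, hZβ]

/-- The gradient in an orthogonal basis. -/
theorem IsAlmostContact.sharp_eq_sum [FiniteDimensional ℝ E] (hc : IsAlmostContact ξ η Φ)
    (h : IsPositive ξ η Φ θ) {c : ℝ} (hc0 : 0 < c) {ι : Type*} [Fintype ι] [DecidableEq ι]
    (e : Module.Basis ι ℝ E) (l : ι → ℝ)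
    (he : ∀ i j, metricForm η Φ θ c (e i) (e j) = if i = j then l i else 0)
    (α γ : E →L[ℝ] ℝ) (hγ : γ ξ = 0) :
    α (sharp θ η (-(1 / 2 : ℝ) • γ.comp Φ)) = 1 / 2 * ∑ i, α (e i) * γ (e i) / l i := by
  have hl : ∀ i, l i ≠ 0 := fun i => by
    have := hc.metricForm_pos h hc0 (e i) (e.ne_zero i)
    rw [he, if_pos rfl] at this
    exact this.ne'
  have hexp : ∀ X, X = ∑ i, (metricForm η Φ θ c (e i) X / l i) • e i := by
    intro X
    conv_lhs => rw [← e.sum_repr X]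
    refine Finset.sum_congr rfl fun i _ => ?_
    have h1 : metricForm η Φ θ c (e i) X = e.repr X i * l i := by
      conv_lhs => rw [← e.sum_repr X, map_sum]
      simp [he]
    rw [h1, mul_div_cancel_right₀ _ (hl i)]
  -- The vector dual to γ/2 for the metric. The factor 1/2 is that of d^c γ = -(1/2) γ ∘ Φ, and γ(ξ)
  -- = 0 makes Z horizontal.
  set Z := ∑ i, (1 / 2 * (γ (e i) / l i)) • e i
  have hZG : ∀ Y, metricForm η Φ θ c Z Y = 1 / 2 * γ Y := by
    intro Y
    conv_rhs => rw [hexp Y]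
    simp only [Z, map_sum, map_smul, LinearMap.sum_apply, LinearMap.smul_apply, smul_eq_mul,
      Finset.mul_sum]
    exact Finset.sum_congr rfl fun i _ => by ring
  have hZη : η Z = 0 := by
    have h1 := hZG ξ
    rw [hc.metricForm_symm h.toIsTransverse, hc.metricForm_ξ h.toIsTransverse, hγ] at h1
    simpa [hc0.ne'] using h1
  have hZ : Z = sharp θ η (-(1 / 2 : ℝ) • γ.comp Φ) := by
    refine hc.eq_sharp h hZη fun Y => ?_
    rw [hc.two_form_eq h.toIsTransverse c, hZG]
    simp
  rw [← hZ]
  simp only [Z, map_sum, map_smul, smul_eq_mul, Finset.mul_sum]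
  exact Finset.sum_congr rfl fun i _ => by ring

end Transverse

/-! ### Orthonormal frames, positivity of the volume ratio, and traces over frames. -/

section Frames

variable {E : Type*} [NormedAddCommGroup E] [NormedSpace ℝ E] {m : ℕ}
  {ξ : E} {η : E →L[ℝ] ℝ} {Φ : E →L[ℝ] E} {θ θ' : E [⋀^Fin 2]→L[ℝ] ℝ}

theorem IsAlmostContact.two_form_Φ_swap (hc : IsAlmostContact ξ η Φ) (h : IsTransverse ξ Φ θ)
    (X Y : E) : θ ![X, Φ Y] = θ ![Y, Φ X] := by
  have := hc.metricForm_symm h 0 X Y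
  simpa [metricForm_apply] using this

/-- Gram-Schmidt. A new vector must be annihilated by η and by the functionals θ(e_i, ·) and θ(e_i,
Φ·): these are 2k + 1 linear conditions in dimension 2m + 1, so a non-zero solution exists while k <
m. -/
theorem IsAlmostContact.exists_unitary_family [FiniteDimensional ℝ E]
    (hc : IsAlmostContact ξ η Φ) (h : IsPositive ξ η Φ θ) (hE : Module.finrank ℝ E = 2 * m + 1) :
    ∀ k ≤ m, ∃ e : Fin k → E, (∀ i, η (e i) = 0) ∧ (∀ i j, θ ![e i, e j] = 0) ∧
      ∀ i j, θ ![e i, Φ (e j)] = if i = j then 1 else 0 := by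
  intro k
  induction k with
  | zero => exact fun _ => ⟨Fin.elim0, fun i => i.elim0, fun i => i.elim0, fun i => i.elim0⟩
  | succ k ih =>
    intro hk
    obtain ⟨e, he0, he1, he2⟩ := ih (by omega)
    let f : E →ₗ[ℝ] ℝ × (Fin k → ℝ) × (Fin k → ℝ) :=
      (η : E →ₗ[ℝ] ℝ).prod ((LinearMap.pi fun i => (bilCLM θ (e i) : E →ₗ[ℝ] ℝ)).prod
        (LinearMap.pi fun i => ((bilCLM θ (e i)).comp Φ : E →ₗ[ℝ] ℝ)))
    have hker : LinearMap.ker f ≠ ⊥ := LinearMap.ker_ne_bot_of_finrank_lt (by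
      rw [hE]; simp; omega)
    obtain ⟨X, hX, hX0⟩ := (Submodule.ne_bot_iff _).1 hker
    have hf : f X = 0 := hX
    have hXη : η X = 0 := congrArg Prod.fst hf
    have hX1 : ∀ i, θ ![e i, X] = 0 := fun i => by
      rw [← bilCLM_apply]; exact congrFun (congrArg (fun q => q.2.1) hf) i
    have hX2 : ∀ i, θ ![e i, Φ X] = 0 := fun i => by
      rw [← bilCLM_apply]; exact congrFun (congrArg (fun q => q.2.2) hf) i
    have hpos := h.pos X hXη hX0
    set r := √(θ ![X, Φ X])
    have hr : r * r = θ ![X, Φ X] := Real.mul_self_sqrt hpos.le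
    have hr0 : r ≠ 0 := (Real.sqrt_pos.2 hpos).ne'
    have hXX : θ ![X, X] = 0 := by have := two_form_swap θ X X; linarith
    have hX3 : ∀ i, θ ![X, Φ (e i)] = 0 := fun i => by
      rw [hc.two_form_Φ_swap h.toIsTransverse]; exact hX2 i
    have hX4 : ∀ i, θ ![X, e i] = 0 := fun i => by rw [two_form_swap, hX1, neg_zero]
    refine ⟨Fin.snoc e (r⁻¹ • X), fun i => ?_, fun i j => ?_, fun i j => ?_⟩
    · refine Fin.lastCases ?_ (fun i => ?_) i <;> simp [he0, hXη]
    · rw [← bilCLM_apply]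
      refine Fin.lastCases ?_ (fun i => ?_) i <;> refine Fin.lastCases ?_ (fun j => ?_) j <;>
        simp [bilCLM_apply, he1, hX1, hX4, hXX]
    · rw [← bilCLM_apply]
      refine Fin.lastCases ?_ (fun i => ?_) i <;> refine Fin.lastCases ?_ (fun j => ?_) j
      · simp [bilCLM_apply, ← hr, hr0]
      · simp [bilCLM_apply, hX3, (Fin.castSucc_lt_last j).ne']
      · simp [bilCLM_apply, hX2, (Fin.castSucc_lt_last i).ne]
      · simp [bilCLM_apply, he2]

/-- A unitary family e together with Φe and ξ is a symplectic frame. -/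
theorem IsAlmostContact.topVal_ne_zero (hc : IsAlmostContact ξ η Φ) (h : IsPositive ξ η Φ θ)
    (b : Module.Basis (Fin (2 * m + 1)) ℝ E) : topVal b θ η ≠ 0 := by
  have := b.finiteDimensional_of_finite
  obtain ⟨e, he0, he1, he2⟩ := hc.exists_unitary_family h
    ((Module.finrank_eq_card_basis b).trans (Fintype.card_fin _)) m le_rfl
  have hne : contactTop m θ η ≠ 0 := by
    refine contactTop_ne_zero_of_frame θ η
      (Sum.elim (fun i : Fin m × Fin 2 => if i.2 = 0 then e i.1 else Φ (e i.1)) (fun _ => ξ))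
      (fun i => ?_) hc.η_ξ (fun i j => ?_)
    · by_cases h0 : i.2 = 0 <;> simp [h0, he0, hc.η_Φ]
    · obtain ⟨i, k⟩ := i
      obtain ⟨j, l⟩ := j
      fin_cases k <;> fin_cases l
      · simp [he1]
      · simp [he2]
      · simp [two_form_swap θ (Φ (e i)) (e j), he2, eq_comm (a := j)]
        split_ifs <;> simp
      · simp [h.invariant, he1]
  have h2 : (contactTop m θ η).toAlternatingMap ≠ 0 := fun h0 => hne (by
    ext v; exact congrArg (fun f => f v) h0)
  exact (AlternatingMap.map_basis_ne_zero_iff b _).2 h2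

/-- The segment between the two forms consists of positive forms, so the coefficient does not vanish
along it and keeps its sign. -/
theorem IsAlmostContact.topVal_div_pos (hc : IsAlmostContact ξ η Φ) (h : IsPositive ξ η Φ θ)
    (h' : IsPositive ξ η Φ θ') (b : Module.Basis (Fin (2 * m + 1)) ℝ E) :
    0 < topVal b θ' η / topVal b θ η := by
  by_contra hneg
  push Not at hneg
  set f : ℝ → ℝ := fun s => topVal b ((1 - s) • θ + s • θ') η / topVal b θ η
  have hf : Continuous f := by
    refine Continuous.div_const ?_ _
    refine Continuous.comp (g := fun q : (E [⋀^Fin 2]→L[ℝ] ℝ) × (E →L[ℝ] ℝ) => topVal b q.1 q.2)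
      (f := fun s : ℝ => ((1 - s) • θ + s • θ', η)) (contDiff_topVal b).continuous ?_
    fun_prop
  have h0 : f 0 = 1 := by simp [f, hc.topVal_ne_zero h b]
  have h1 : f 1 ≤ 0 := by simpa [f] using hneg
  obtain ⟨s, hs, hs0⟩ := intermediate_value_Icc' (zero_le_one' ℝ) hf.continuousOn
    (show (0 : ℝ) ∈ Icc (f 1) (f 0) from ⟨h1, by rw [h0]; exact zero_le_one⟩)
  rcases div_eq_zero_iff.1 hs0 with h2 | h2
  · exact hc.topVal_ne_zero (h.convex h' hs) b h2
  · exact hc.topVal_ne_zero h b h2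

/-- Both forms are degenerate along ξ. Apply `topDeriv_act` to a projection B onto ℝξ: it
annihilates θ and β infinitesimally, yet its trace is 1. -/
theorem topVal_eq_zero_of_horizontal (hθ : ∀ Y, θ ![ξ, Y] = 0) (hξ : ξ ≠ 0) {β : E →L[ℝ] ℝ}
    (hβ : β ξ = 0) (b : Module.Basis (Fin (2 * m + 1)) ℝ E) : topVal b θ β = 0 := by
  have : FiniteDimensional ℝ E := b.finiteDimensional_of_finite
  obtain ⟨f, hf⟩ : ∃ f : E →L[ℝ] ℝ, f ξ = 1 := SeparatingDual.exists_eq_one hξ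
  have h := topDeriv_act b θ β (f.smulRight ξ)
  have h1 : act (f.smulRight ξ) θ = 0 := two_form_ext fun X Y => by
    rw [act_apply, ← bilCLM_apply, ← bilCLM_apply]
    simp [bilCLM_apply, hθ, two_form_swap θ X ξ]
  have h2 : β.comp (f.smulRight ξ) = (0 : ℝ) • β := by ext X; simp [hβ]
  have h3 : LinearMap.trace ℝ E (f.smulRight ξ : E →L[ℝ] E) = 1 := by
    have : ((f.smulRight ξ : E →L[ℝ] E) : E →ₗ[ℝ] E) = (f : E →ₗ[ℝ] ℝ).smulRight ξ := rfl
    rw [this, LinearMap.trace_smulRight]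
    exact hf
  rw [h1, h2, h3, topVal_smul_right, map_zero] at h
  linarith

/-- Orthonormal frames of the contact distribution for the metric `θ(·, Φ ·)`. -/
def IsOrthonormalFrame (η : E →L[ℝ] ℝ) (Φ : E →L[ℝ] E) (θ : E [⋀^Fin 2]→L[ℝ] ℝ)
    (e : Fin (2 * m) → E) : Prop :=
  (∀ a, η (e a) = 0) ∧ ∀ a b, θ ![e a, Φ (e b)] = if a = b then 1 else 0

theorem IsAlmostContact.exists_orthonormalFrame [FiniteDimensional ℝ E]
    (hc : IsAlmostContact ξ η Φ) (h : IsPositive ξ η Φ θ) (hE : Module.finrank ℝ E = 2 * m + 1) :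
    ∃ e : Fin (2 * m) → E, IsOrthonormalFrame η Φ θ e := by
  obtain ⟨e, he0, he1, he2⟩ := hc.exists_unitary_family h hE m le_rfl
  let q : Fin (2 * m) ≃ Fin m × Fin 2 := (finCongr (mul_comm 2 m)).trans finProdFinEquiv.symm
  have key : ∀ i j : Fin m × Fin 2,
      θ ![if i.2 = 0 then e i.1 else Φ (e i.1), Φ (if j.2 = 0 then e j.1 else Φ (e j.1))] =
        if i = j then 1 else 0 := by
    rintro ⟨i, k⟩ ⟨j, l⟩
    fin_cases k <;> fin_cases l
    · simp [he2]
    · have : θ ![e i, Φ (Φ (e j))] = 0 := by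
        rw [hc.Φ_Φ, he0, zero_smul, add_zero, ← bilCLM_apply, map_neg, bilCLM_apply, he1, neg_zero]
      simp [this]
    · simp [h.invariant, he1]
    · simp [h.invariant, he2]
  refine ⟨fun a => if (q a).2 = 0 then e (q a).1 else Φ (e (q a).1), fun a => ?_, fun a b => ?_⟩
  · by_cases h0 : (q a).2 = 0 <;> simp [h0, he0, hc.η_Φ]
  · rw [key]; simp

/-- Adding ξ to the frame gives an orthonormal basis for the metric with c = 1, so
`IsAlmostContact.sharp_eq_sum` applies; the extra term dies because γ(ξ) = 0. In particular the left
side does not depend on the frame. -/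
theorem IsAlmostContact.sum_frame [FiniteDimensional ℝ E]
    (hc : IsAlmostContact ξ η Φ) (h : IsPositive ξ η Φ θ) (hE : Module.finrank ℝ E = 2 * m + 1)
    {e : Fin (2 * m) → E} (he : IsOrthonormalFrame η Φ θ e) (α γ : E →L[ℝ] ℝ) (hγ : γ ξ = 0) :
    ∑ a, α (e a) * γ (e a) = 2 * α (sharp θ η (-(1 / 2 : ℝ) • γ.comp Φ)) := by
  let u : Fin (2 * m) ⊕ Fin 1 → E := Sum.elim e fun _ => ξ
  have hu : ∀ i j, metricForm η Φ θ 1 (u i) (u j) = if i = j then 1 else 0 := by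
    rintro (i | i) (j | j)
    · simp [u, metricForm_apply, he.1, he.2]
    · simp [u, metricForm_apply, he.1, hc.Φ_ξ, ← bilCLM_apply]
    · simp [u, hc.metricForm_ξ h.toIsTransverse, he.1]
    · simp [u, hc.metricForm_ξ h.toIsTransverse, hc.η_ξ, Subsingleton.elim i j]
  have hli : LinearIndependent ℝ u := by
    rw [Fintype.linearIndependent_iff]
    intro g hg i
    have := congrArg (fun X => metricForm η Φ θ 1 X (u i)) hg
    simpa [hu, -Fintype.sum_sum_type] using this
  have hcard : Fintype.card (Fin (2 * m) ⊕ Fin 1) = Module.finrank ℝ E := by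
    rw [hE]; simp
  let ub := basisOfLinearIndependentOfCardEqFinrank hli hcard
  have hub : ⇑ub = u := coe_basisOfLinearIndependentOfCardEqFinrank hli hcard
  have h1 := hc.sharp_eq_sum h one_pos ub (fun _ => 1) (by rw [hub]; exact hu) α γ hγ
  rw [h1, hub]
  simp [u, hγ]

end Frames

/-! ### Simultaneous diagonalization and the monotone density. -/

section Diagonalization

/-- The spectral theorem for the endomorphism T with G(T·, ·) = G', which is symmetric for the inner
product G. -/
theorem exists_simultaneous_basis {V : Type*} [AddCommGroup V] [Module ℝ V]
    [FiniteDimensional ℝ V] {n : ℕ} (hn : Module.finrank ℝ V = n) (G G' : V →ₗ[ℝ] V →ₗ[ℝ] ℝ)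
    (hG : ∀ X Y, G X Y = G Y X) (hG' : ∀ X Y, G' X Y = G' Y X) (hpos : ∀ X, X ≠ 0 → 0 < G X X) :
    ∃ (e : Module.Basis (Fin n) ℝ V) (μ : Fin n → ℝ),
      (∀ i j, G (e i) (e j) = if i = j then 1 else 0) ∧
      ∀ i j, G' (e i) (e j) = if i = j then μ i else 0 := by
  let core : InnerProductSpace.Core ℝ V :=
    { inner := fun X Y => G X Y
      conj_inner_symm := fun X Y => hG Y X
      re_inner_nonneg := fun X => by
        by_cases h : X = 0
        · simp [h]
        · exact (hpos X h).le
      add_left := fun X Y Z => by simp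
      smul_left := fun X Y r => by simp
      definite := fun X h => by
        by_contra h0
        exact (hpos X h0).ne' h }
  let _ : NormedAddCommGroup V := core.toNormedAddCommGroup
  let _ : InnerProductSpace ℝ V := InnerProductSpace.ofCore core.toCore
  have hinner : ∀ X Y : V, inner ℝ X Y = G X Y := fun X Y => rfl
  have hinj : Function.Injective G := by
    rw [injective_iff_map_eq_zero]
    intro X hX
    by_contra h0
    have := hpos X h0
    rw [hX] at this
    simp at this
  let q : V ≃ₗ[ℝ] Module.Dual ℝ V :=
    LinearEquiv.ofInjectiveOfFinrankEq G hinj (Subspace.dual_finrank_eq).symm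
  let T : V →ₗ[ℝ] V := q.symm.toLinearMap ∘ₗ G'
  have hT : ∀ X Y, G (T X) Y = G' X Y := fun X Y => by
    have : q (T X) = G' X := q.apply_symm_apply _
    exact congrArg (fun f => f Y) this
  have hsymm : T.IsSymmetric := fun X Y => by
    rw [hinner, hinner, hT, hG X, hT, hG']
  refine ⟨(hsymm.eigenvectorBasis hn).toBasis, hsymm.eigenvalues hn, fun i j => ?_, fun i j => ?_⟩
  · rw [← hinner]
    simpa using orthonormal_iff_ite.1 (hsymm.eigenvectorBasis hn).orthonormal i j
  · rw [← hT, ← hinner]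
    have := orthonormal_iff_ite.1 (hsymm.eigenvectorBasis hn).orthonormal i j
    simp only [OrthonormalBasis.coe_toBasis, hsymm.apply_eigenvectorBasis, inner_smul_left, this]
    simp

variable {E : Type*} [NormedAddCommGroup E] [NormedSpace ℝ E] {m : ℕ}
  {ξ : E} {η : E →L[ℝ] ℝ} {Φ : E →L[ℝ] E} {θ θ' : E [⋀^Fin 2]→L[ℝ] ℝ}

theorem two_form_smul_smul (a c : ℝ) (X Y : E) : θ ![a • X, c • Y] = a * (c * θ ![X, Y]) := by
  rw [← bilCLM_apply, map_smul, map_smul, smul_apply, bilCLM_apply, smul_eq_mul, smul_eq_mul]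
  ring

theorem IsAlmostContact.two_form_self_nonneg (hc : IsAlmostContact ξ η Φ)
    (h : IsPositive ξ η Φ θ) (X : E) : 0 ≤ θ ![X, Φ X] := by
  by_cases hX : Φ X = 0
  · rw [hX, ← bilCLM_apply, map_zero]
  · have := h.pos (Φ X) (hc.η_Φ X) hX
    rw [h.invariant] at this
    exact this.le

/-- Bases that diagonalize two positive forms simultaneously. -/
structure IsDiagonalizing (η : E →L[ℝ] ℝ) (Φ : E →L[ℝ] E) (θ θ' : E [⋀^Fin 2]→L[ℝ] ℝ) {n : ℕ}
    (e : Module.Basis (Fin n) ℝ E) (μ : Fin n → ℝ) : Prop where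
  orthonormal : ∀ i j, metricForm η Φ θ 1 (e i) (e j) = if i = j then 1 else 0
  diagonal : ∀ i j, metricForm η Φ θ' 0 (e i) (e j) = if i = j then μ i else 0
  nonneg : ∀ i, 0 ≤ μ i

/-- The parameter is 1 for θ, to get a definite form on all of E, but 0 for θ', so that ξ is an
eigenvector with eigenvalue 0. The Reeb direction then needs no separate treatment. -/
theorem IsAlmostContact.exists_isDiagonalizing [FiniteDimensional ℝ E]
    (hc : IsAlmostContact ξ η Φ) (h : IsPositive ξ η Φ θ) (h' : IsPositive ξ η Φ θ') {n : ℕ}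
    (hE : Module.finrank ℝ E = n) :
    ∃ (e : Module.Basis (Fin n) ℝ E) (μ : Fin n → ℝ), IsDiagonalizing η Φ θ θ' e μ := by
  obtain ⟨e, μ, h1, h2⟩ := exists_simultaneous_basis hE (metricForm η Φ θ 1) (metricForm η Φ θ' 0)
    (hc.metricForm_symm h.toIsTransverse 1) (hc.metricForm_symm h'.toIsTransverse 0)
    (hc.metricForm_pos h one_pos)
  refine ⟨e, μ, h1, h2, fun i => ?_⟩
  have h3 := h2 i i
  rw [if_pos rfl] at h3
  rw [← h3]
  rw [metricForm_apply, zero_mul, add_zero]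
  exact hc.two_form_self_nonneg h' (e i)

variable {n : ℕ} {e : Module.Basis (Fin n) ℝ E} {μ : Fin n → ℝ}

theorem IsDiagonalizing.metricForm_right (hd : IsDiagonalizing η Φ θ θ' e μ) (X : E) (k : Fin n) :
    metricForm η Φ θ' 0 X (e k) = μ k * metricForm η Φ θ 1 X (e k) := by
  rw [← e.sum_repr X]
  simp only [map_sum, map_smul, LinearMap.sum_apply, LinearMap.smul_apply, hd.orthonormal,
    hd.diagonal, Finset.mul_sum]
  refine Finset.sum_congr rfl fun i _ => ?_
  by_cases hik : i = k
  · simp [hik]; ring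
  · simp [hik]

/-- Φ is skew for both metrics, hence commutes with the endomorphism relating them; these are the
matrix entries of that statement. -/
theorem IsDiagonalizing.commute (hd : IsDiagonalizing η Φ θ θ' e μ) (hc : IsAlmostContact ξ η Φ)
    (h : IsPositive ξ η Φ θ) (h' : IsPositive ξ η Φ θ') (i k : Fin n) :
    μ k * metricForm η Φ θ 1 (Φ (e i)) (e k) = μ i * metricForm η Φ θ 1 (Φ (e i)) (e k) := by
  rw [← hd.metricForm_right, hc.metricForm_Φ h'.toIsTransverse, hc.metricForm_Φ h.toIsTransverse,
    hc.metricForm_symm h'.toIsTransverse, hd.metricForm_right,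
    hc.metricForm_symm h.toIsTransverse]
  ring

theorem IsDiagonalizing.two_form (hd : IsDiagonalizing η Φ θ θ' e μ) (hc : IsAlmostContact ξ η Φ)
    (h : IsPositive ξ η Φ θ) (h' : IsPositive ξ η Φ θ') (i k : Fin n) :
    θ' ![e i, e k] = μ i * θ ![e i, e k] := by
  rw [hc.two_form_eq h'.toIsTransverse 0, hc.two_form_eq h.toIsTransverse 1,
    hc.metricForm_symm h'.toIsTransverse, hd.metricForm_right, hc.metricForm_symm h.toIsTransverse]
  ring

/-- The eigenvalues of `(1 - s) θ + s θ'`. -/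
def pencil (μ : Fin n → ℝ) (s : ℝ) (i : Fin n) : ℝ := 1 - s + s * μ i

theorem IsDiagonalizing.pencil_pos (hd : IsDiagonalizing η Φ θ θ' e μ) {s : ℝ}
    (hs : s ∈ Ico (0 : ℝ) 1) (i : Fin n) : 0 < pencil μ s i := by
  have := mul_nonneg hs.1 (hd.nonneg i)
  have := hs.2
  unfold pencil; linarith

/-- The coefficient of η ⊗ η interpolates between 1 and 0, which gives 1 - s. -/
theorem IsDiagonalizing.metricForm_pencil (hd : IsDiagonalizing η Φ θ θ' e μ) (s : ℝ)
    (i j : Fin n) : metricForm η Φ ((1 - s) • θ + s • θ') (1 - s) (e i) (e j) =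
      if i = j then pencil μ s i else 0 := by
  have h1 := hd.orthonormal i j
  have h2 := hd.diagonal i j
  rw [metricForm_apply] at h1 h2 ⊢
  simp only [ContinuousAlternatingMap.add_apply, ContinuousAlternatingMap.smul_apply, smul_eq_mul]
  have h3 : (1 - s) * θ ![e i, Φ (e j)] + s * θ' ![e i, Φ (e j)] + (1 - s) * (η (e i) * η (e j)) =
    (1 - s) * (θ ![e i, Φ (e j)] + 1 * (η (e i) * η (e j))) +
      s * (θ' ![e i, Φ (e j)] + 0 * (η (e i) * η (e j))) := by ring
  rw [h3, h1, h2]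
  unfold pencil
  split_ifs <;> ring

/-- The endomorphism A that scales each e_i by the square root of its eigenvalue pulls θ back to (1
- s)θ + sθ' and η back to √(1 - s) η; then apply `topVal_comp`. -/
theorem IsDiagonalizing.topVal_pencil {e : Module.Basis (Fin (2 * m + 1)) ℝ E}
    {μ : Fin (2 * m + 1) → ℝ} (hd : IsDiagonalizing η Φ θ θ' e μ)
    (hc : IsAlmostContact ξ η Φ) (h : IsPositive ξ η Φ θ) (h' : IsPositive ξ η Φ θ')
    (b : Module.Basis (Fin (2 * m + 1)) ℝ E) {s : ℝ} (hs : s ∈ Ico (0 : ℝ) 1) :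
    √(1 - s) * topVal b ((1 - s) • θ + s • θ') η =
      (∏ i, √(pencil μ s i)) * topVal b θ η := by
  have : FiniteDimensional ℝ E := b.finiteDimensional_of_finite
  let A₀ : E →ₗ[ℝ] E := e.constr ℝ fun i => √(pencil μ s i) • e i
  let A : E →L[ℝ] E := LinearMap.toContinuousLinearMap A₀
  have hA : ∀ i, A (e i) = √(pencil μ s i) • e i := fun i => e.constr_basis ℝ _ i
  have hdet : A.det = ∏ i, √(pencil μ s i) := by
    have : A.det = LinearMap.det A₀ := rfl
    rw [this, ← LinearMap.det_toMatrix e]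
    have h1 : LinearMap.toMatrix e e A₀ = Matrix.diagonal fun i => √(pencil μ s i) := by
      ext i j
      have : A₀ (e j) = √(pencil μ s j) • e j := hA j
      rw [LinearMap.toMatrix_apply, this]
      by_cases hij : i = j
      · simp [hij]
      · simp [hij]
    rw [h1, Matrix.det_diagonal]
  have hη : η.comp A = √(1 - s) • η := by
    have : ((η.comp A : E →L[ℝ] ℝ) : E →ₗ[ℝ] ℝ) = ((√(1 - s) • η : E →L[ℝ] ℝ) : E →ₗ[ℝ] ℝ) := by
      refine e.ext fun i => ?_
      -- Pairing with ξ: a basis vector with a component along ξ has eigenvalue 0, so it is scaled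
      -- by √(1 - s).
      have h1 : μ i * η (e i) = 0 := by
        have := hd.metricForm_right ξ i
        rw [hc.metricForm_ξ h'.toIsTransverse, hc.metricForm_ξ h.toIsTransverse] at this
        linarith
      simp only [ContinuousLinearMap.coe_coe, ContinuousLinearMap.comp_apply, hA, map_smul,
        _root_.smul_apply, smul_eq_mul]
      rcases mul_eq_zero.1 h1 with h1 | h1
      · simp [pencil, h1]
      · simp [h1]
    ext X
    exact congrArg (fun f => f X) this
  have hθ : θ.compContinuousLinearMap A = (1 - s) • θ + s • θ' := by
    refine two_form_ext fun X Y => ?_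
    rw [two_form_comp_apply]
    have h1 : ∀ i j, bilCLM θ (A (e i)) (A (e j)) = bilCLM ((1 - s) • θ + s • θ') (e i) (e j) := by
      intro i j
      rw [hA, hA, bilCLM_apply, bilCLM_apply, two_form_smul_smul, ContinuousAlternatingMap.add_apply,
        ContinuousAlternatingMap.smul_apply, ContinuousAlternatingMap.smul_apply, smul_eq_mul,
        smul_eq_mul]
      have h2 := hd.two_form hc h h' i j
      have h3 := hd.two_form hc h h' j i
      rw [two_form_swap, two_form_swap θ] at h3
      -- By antisymmetry θ'(e_i, e_j) is both μ_i and μ_j times θ(e_i, e_j). Either this entry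
      -- vanishes or the eigenvalues agree and the two square roots multiply to the eigenvalue.
      by_cases h0 : θ ![e i, e j] = 0
      · rw [h2, h0]; ring
      · have hij : μ i = μ j := mul_right_cancel₀ h0 (by rw [← h2]; linarith)
        have hp : pencil μ s i = pencil μ s j := by simp [pencil, hij]
        have hsq := Real.mul_self_sqrt (hd.pencil_pos hs j).le
        rw [hp, h2, ← mul_assoc, hsq, ← hp]
        unfold pencil
        ring
    rw [← bilCLM_apply, ← bilCLM_apply, ← e.sum_repr X, ← e.sum_repr Y]
    simp only [map_sum, map_smul, _root_.sum_apply, _root_.smul_apply, h1]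
  have h4 := topVal_comp b θ η A
  rw [hθ, hη, topVal_smul_right, hdet] at h4
  exact h4

/-- Φe_i lies in the same eigenspace as e_i and is orthogonal to it. The condition on α only ensures
that e_i is not a multiple of ξ, so that Φe_i ≠ 0. -/
theorem IsDiagonalizing.exists_ne (hd : IsDiagonalizing η Φ θ θ' e μ) (hc : IsAlmostContact ξ η Φ)
    (h : IsPositive ξ η Φ θ) (h' : IsPositive ξ η Φ θ') {α : E →L[ℝ] ℝ} (hα : α ξ = 0) {i : Fin n}
    (hi : α (e i) ≠ 0) : ∃ k, k ≠ i ∧ μ k = μ i := by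
  have h1 : Φ (e i) ≠ 0 := fun h0 => hi (by
    have := hc.Φ_Φ (e i)
    rw [h0, map_zero] at this
    have h2 := congrArg α this
    simp only [map_zero, map_add, map_neg, map_smul, hα, smul_zero, add_zero] at h2
    linarith)
  obtain ⟨k, hk⟩ : ∃ k, metricForm η Φ θ 1 (Φ (e i)) (e k) ≠ 0 := by
    by_contra hall
    push Not at hall
    have := hc.metricForm_pos h one_pos _ h1
    conv at this => enter [2, 2]; rw [← e.sum_repr (Φ (e i))]
    rw [map_sum] at this
    simp [hall] at this
  refine ⟨k, fun hki => hk ?_, mul_right_cancel₀ hk (hd.commute hc h h' i k)⟩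
  rw [hki]
  have h2 := hc.metricForm_Φ h.toIsTransverse 1 (e i) (e i)
  rw [hc.metricForm_symm h.toIsTransverse 1 (e i) (Φ (e i))] at h2
  linarith

/-- The normalized density of `|α|² θ_s^m ∧ η` along `θ_s = (1 - s) θ + s θ'` is monotone. -/
theorem IsAlmostContact.exists_monotone_density (hc : IsAlmostContact ξ η Φ)
    (h : IsPositive ξ η Φ θ) (h' : IsPositive ξ η Φ θ') (b : Module.Basis (Fin (2 * m + 1)) ℝ E)
    {α : E →L[ℝ] ℝ} (hα : α ξ = 0) :
    ∃ Q : ℝ → ℝ, MonotoneOn Q (Ico 0 1) ∧ ∀ s ∈ Ico (0 : ℝ) 1,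
      (1 - s) * (α (sharp ((1 - s) • θ + s • θ') η (-(1 / 2 : ℝ) • α.comp Φ)) *
        topVal b ((1 - s) • θ + s • θ') η) = (1 - s) ^ m * Q s * topVal b θ η := by
  have : FiniteDimensional ℝ E := b.finiteDimensional_of_finite
  obtain ⟨e, μ, hd⟩ := hc.exists_isDiagonalizing h h'
    ((Module.finrank_eq_card_basis b).trans (Fintype.card_fin _))
  -- The eigenvalues factor as (1 - s)(1 + rμ) with r increasing in s. The powers of 1 - s go
  -- outside, the rest forms Q.
  let r : ℝ → ℝ := fun s => s / (1 - s)
  have hr0 : ∀ s ∈ Ico (0 : ℝ) 1, 0 ≤ r s := fun s hs => div_nonneg hs.1 (by linarith [hs.2])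
  have hrm : ∀ s ∈ Ico (0 : ℝ) 1, ∀ t ∈ Ico (0 : ℝ) 1, s ≤ t → r s ≤ r t := by
    intro s hs t ht hst
    have h1 : (0 : ℝ) < 1 - s := by linarith [hs.2]
    have h2 : (0 : ℝ) < 1 - t := by linarith [ht.2]
    rw [div_le_div_iff₀ h1 h2]
    nlinarith
  have hpos : ∀ s ∈ Ico (0 : ℝ) 1, ∀ l, 0 < 1 + r s * μ l := fun s hs l => by
    have := mul_nonneg (hr0 s hs) (hd.nonneg l)
    linarith
  refine ⟨fun s => 1 / 2 * ∑ i, α (e i) * α (e i) * ((∏ l, √(1 + r s * μ l)) / (1 + r s * μ i)),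
    ?_, ?_⟩
  · intro s hs t ht hst
    refine mul_le_mul_of_nonneg_left (Finset.sum_le_sum fun i _ => ?_) (by norm_num)
    by_cases hi : α (e i) = 0
    · simp [hi]
    obtain ⟨k, hki, hk⟩ := hd.exists_ne hc h h' hα hi
    -- The square roots of the equal factors with indices i and k multiply to the denominator. What
    -- remains is a product of non-decreasing functions.
    have hq : ∀ s ∈ Ico (0 : ℝ) 1, (∏ l, √(1 + r s * μ l)) / (1 + r s * μ i) =
        ∏ l ∈ (Finset.univ.erase i).erase k, √(1 + r s * μ l) := by
      intro s hs
      rw [← Finset.mul_prod_erase _ _ (Finset.mem_univ i),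
        ← Finset.mul_prod_erase (Finset.univ.erase i) _ (Finset.mem_erase.2 ⟨hki, Finset.mem_univ k⟩),
        ← mul_assoc, hk, Real.mul_self_sqrt (hpos s hs i).le, mul_div_cancel_left₀ _ (hpos s hs i).ne']
    rw [hq s hs, hq t ht]
    refine mul_le_mul_of_nonneg_left (Finset.prod_le_prod (fun l _ => Real.sqrt_nonneg _)
      fun l _ => Real.sqrt_le_sqrt ?_) (mul_self_nonneg _)
    have := mul_le_mul_of_nonneg_right (hrm s hs t ht hst) (hd.nonneg l)
    linarith
  · intro s hs
    have hs1 : (0 : ℝ) < 1 - s := by linarith [hs.2]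
    have hp : ∀ l, pencil μ s l = (1 - s) * (1 + r s * μ l) := fun l => by
      simp only [pencil, r]; field_simp
    have h1 := hd.topVal_pencil hc h h' b hs
    -- There are 2m + 1 factors √(1 - s): m pairs give (1 - s)^m, and the odd one cancels against
    -- the scaling of η.
    have h2 : ∏ l, √(pencil μ s l) = √(1 - s) * ((1 - s) ^ m * ∏ l, √(1 + r s * μ l)) := by
      simp only [hp, Real.sqrt_mul hs1.le, Finset.prod_mul_distrib, Finset.prod_const,
        Finset.card_univ, Fintype.card_fin]
      rw [pow_succ, pow_mul, Real.sq_sqrt hs1.le]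
      ring
    rw [h2, mul_assoc] at h1
    have h3 := mul_left_cancel₀ (Real.sqrt_pos.2 hs1).ne' h1
    rw [h3, hc.sharp_eq_sum (h.convex h' ⟨hs.1, hs.2.le⟩) hs1 e (pencil μ s)
      (hd.metricForm_pencil s) α α hα]
    simp only [Finset.mul_sum, Finset.sum_mul]
    refine Finset.sum_congr rfl fun i _ => ?_
    rw [hp]
    have := (hpos s hs i).ne'
    field_simp

end Diagonalization

/-! ### Exterior and Lie derivatives in a vector space. -/

section LocalCalculus

variable {E : Type*} [NormedAddCommGroup E] [NormedSpace ℝ E]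

instance bilNormedAddCommGroup : NormedAddCommGroup (E →L[ℝ] E →L[ℝ] ℝ) :=
  ContinuousLinearMap.toNormedAddCommGroup

instance bilNormedSpace : NormedSpace ℝ (E →L[ℝ] E →L[ℝ] ℝ) :=
  ContinuousLinearMap.toNormedSpace

instance bilAddCommGroup : AddCommGroup (E →L[ℝ] E →L[ℝ] ℝ) :=
  ContinuousLinearMap.addCommGroup

theorem hasFDerivAt_clm_apply {G F : Type*} [NormedAddCommGroup F] [NormedSpace ℝ F]
    [NormedAddCommGroup G] [NormedSpace ℝ G] (L : G →L[ℝ] F) {γ : E → G} {γ' : E →L[ℝ] G} {y : E}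
    (h : HasFDerivAt γ γ' y) : HasFDerivAt (fun y => L (γ y)) (L.comp γ') y :=
  L.hasFDerivAt.comp y h

theorem hasFDerivAt_alt₂ {γ : E → E →L[ℝ] E →L[ℝ] ℝ} {γ' : E →L[ℝ] E →L[ℝ] E →L[ℝ] ℝ} {y : E}
    (h : HasFDerivAt γ γ' y) : HasFDerivAt (fun y => alt₂ (γ y)) (alt₂.comp γ') y :=
  hasFDerivAt_clm_apply (G := E →L[ℝ] E →L[ℝ] ℝ) (F := E [⋀^Fin 2]→L[ℝ] ℝ) alt₂ h

theorem hasFDerivAt_bilCLM {γ : E → E [⋀^Fin 2]→L[ℝ] ℝ} {γ' : E →L[ℝ] E [⋀^Fin 2]→L[ℝ] ℝ} {y : E}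
    (h : HasFDerivAt γ γ' y) : HasFDerivAt (fun y => bilCLM (γ y)) (bilCLM.comp γ') y :=
  hasFDerivAt_clm_apply (F := E →L[ℝ] E →L[ℝ] ℝ) (G := E [⋀^Fin 2]→L[ℝ] ℝ) bilCLM h

theorem extDeriv_ofSubsingleton (γ : E → E →L[ℝ] ℝ) (y : E) :
    extDeriv (fun y => ContinuousAlternatingMap.ofSubsingleton ℝ E ℝ (0 : Fin 1) (γ y)) y =
      alt₂ (fderiv ℝ γ y) := by
  have h := (ContinuousAlternatingMap.ofSubsingletonLIE (𝕜 := ℝ) (E := E) (F := ℝ)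
    (0 : Fin 1)).toContinuousLinearEquiv.comp_fderiv (f := γ) (x := y)
  have h2 : (fun y => ContinuousAlternatingMap.ofSubsingleton ℝ E ℝ (0 : Fin 1) (γ y)) =
    (ContinuousAlternatingMap.ofSubsingletonLIE (𝕜 := ℝ) (E := E) (F := ℝ)
    (0 : Fin 1)).toContinuousLinearEquiv ∘ γ := rfl
  rw [extDeriv, h2, h]
  rfl

/-- An exact `2`-form is closed. -/
theorem closed_of_exact {γ : E → E →L[ℝ] ℝ} {y : E} (hγ : ContDiffAt ℝ 2 γ y) (X Y Z : E) :
    fderiv ℝ (fun y => alt₂ (fderiv ℝ γ y)) y Z ![X, Y] =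
      fderiv ℝ (fun y => alt₂ (fderiv ℝ γ y)) y X ![Z, Y] -
        fderiv ℝ (fun y => alt₂ (fderiv ℝ γ y)) y Y ![Z, X] := by
  have hd : DifferentiableAt ℝ (fderiv ℝ γ) y :=
    (hγ.fderiv_right (m := 1) (by norm_num)).differentiableAt (by simp)
  have h : fderiv ℝ (fun y => alt₂ (fderiv ℝ γ y)) y = alt₂.comp (fderiv ℝ (fderiv ℝ γ) y) :=
    (hasFDerivAt_alt₂ hd.hasFDerivAt).fderiv
  have hs : IsSymmSndFDerivAt ℝ γ y := hγ.isSymmSndFDerivAt (by simp)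
  rw [h]
  simp only [ContinuousLinearMap.comp_apply, alt₂_apply]
  rw [hs.eq Z X, hs.eq Z Y, hs.eq X Y]
  ring

/-- Cartan's formula for the Lie derivative of a closed `2`-form. -/
theorem lie_two_form {θ : E → E [⋀^Fin 2]→L[ℝ] ℝ} {Z : E → E} {β : E → E →L[ℝ] ℝ} {y : E}
    (hθ : DifferentiableAt ℝ θ y) (hZ : DifferentiableAt ℝ Z y)
    (hclosed : ∀ X Y V, fderiv ℝ θ y V ![X, Y] =
      fderiv ℝ θ y X ![V, Y] - fderiv ℝ θ y Y ![V, X])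
    (hβ : ∀ᶠ z in nhds y, ∀ X, θ z ![Z z, X] = β z X) :
    fderiv ℝ θ y (Z y) + act (fderiv ℝ Z y) (θ y) = alt₂ (fderiv ℝ β y) := by
  have hβ' : β =ᶠ[nhds y] fun z => bilCLM (θ z) (Z z) := by
    filter_upwards [hβ] with z hz
    ext X; rw [bilCLM_apply, hz]
  have h1 : HasFDerivAt (fun z => bilCLM (θ z)) (bilCLM.comp (fderiv ℝ θ y)) y :=
    hasFDerivAt_bilCLM hθ.hasFDerivAt
  have h2 := h1.clm_apply hZ.hasFDerivAt
  refine two_form_ext fun X Y => ?_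
  rw [hβ'.fderiv_eq, h2.fderiv, alt₂_apply, ContinuousAlternatingMap.add_apply, act_apply,
    hclosed X Y]
  simp only [add_apply, ContinuousLinearMap.comp_apply, ContinuousLinearMap.flip_apply,
    bilCLM_apply, two_form_swap (θ y) X]
  ring

/-- The Lie derivative of the contact form along a field on which it is constant. -/
theorem lie_one_form {η : E → E →L[ℝ] ℝ} {Z : E → E} {y : E} {c : ℝ}
    (hη : DifferentiableAt ℝ η y) (hZ : DifferentiableAt ℝ Z y)
    (hc : ∀ᶠ z in nhds y, η z (Z z) = c) (X : E) :
    (fderiv ℝ η y (Z y) + (η y).comp (fderiv ℝ Z y)) X = alt₂ (fderiv ℝ η y) ![Z y, X] := by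
  have h1 : HasFDerivAt (fun z => η z (Z z)) _ y := hη.hasFDerivAt.clm_apply hZ.hasFDerivAt
  have h2 : HasFDerivAt (fun z => η z (Z z)) (0 : E →L[ℝ] ℝ) y :=
    (hasFDerivAt_const c y).congr_of_eventuallyEq hc
  have h3 := congrArg (fun f => f X) (h1.unique h2)
  simp only [add_apply, ContinuousLinearMap.comp_apply, ContinuousLinearMap.flip_apply,
    zero_apply] at h3
  rw [alt₂_apply, add_apply, ContinuousLinearMap.comp_apply]
  linarith

variable {m : ℕ} (b : Module.Basis (Fin (2 * m + 1)) ℝ E)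

/-- The divergence of the field `Z` with respect to `θ^m ∧ η` is `d(ι_Z θ)` inserted in place of
one factor `θ`. -/
theorem divergence_eq_topDeriv {θ : E → E [⋀^Fin 2]→L[ℝ] ℝ} {η : E → E →L[ℝ] ℝ} {Z : E → E}
    {β : E → E →L[ℝ] ℝ} {y ξ : E} {c : ℝ}
    (hθ : DifferentiableAt ℝ θ y) (hη : DifferentiableAt ℝ η y) (hZ : DifferentiableAt ℝ Z y)
    (hclosed : ∀ X Y V, fderiv ℝ θ y V ![X, Y] =
      fderiv ℝ θ y X ![V, Y] - fderiv ℝ θ y Y ![V, X])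
    (hβ : ∀ᶠ z in nhds y, ∀ X, θ z ![Z z, X] = β z X) (hc : ∀ᶠ z in nhds y, η z (Z z) = c)
    (hξ : ξ ≠ 0) (hθξ : ∀ X, θ y ![ξ, X] = 0) (hηξ : ∀ X, alt₂ (fderiv ℝ η y) ![ξ, X] = 0) :
    fderiv ℝ (fun z => topVal b (θ z) (η z)) y (Z y) +
      LinearMap.trace ℝ E (fderiv ℝ Z y : E →ₗ[ℝ] E) * topVal b (θ y) (η y) =
      topDeriv b (θ y) (η y) (alt₂ (fderiv ℝ β y)) := by
  obtain ⟨L, hL, hLv⟩ := hasFDerivAt_topVal b (s := univ) hθ.hasFDerivAt.hasFDerivWithinAt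
    hη.hasFDerivAt.hasFDerivWithinAt
  rw [(hasFDerivWithinAt_univ.1 hL).fderiv, hLv, ← topDeriv_act, ← lie_two_form hθ hZ hclosed hβ,
    map_add]
  -- The Lie derivative of η along Z is ι_Z dη because η(Z) is constant. It annihilates ξ, so it
  -- does not contribute to a top form.
  have h0 : topVal b (θ y) (fderiv ℝ η y (Z y) + (η y).comp (fderiv ℝ Z y)) = 0 := by
    refine topVal_eq_zero_of_horizontal hθξ hξ ?_ b
    rw [lie_one_form hη hZ hc, two_form_swap, hηξ, neg_zero]
  rw [topVal_add_right] at h0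
  linarith

/-- Coefficients of invariant densities of weight one. -/
theorem topDeriv_reeb {θ α : E → E [⋀^Fin 2]→L[ℝ] ℝ} {η : E → E →L[ℝ] ℝ} {Z : E → E} {y : E}
    (hθ : DifferentiableAt ℝ θ y) (hη : DifferentiableAt ℝ η y) (hα : DifferentiableAt ℝ α y)
    (hθ0 : fderiv ℝ θ y (Z y) + act (fderiv ℝ Z y) (θ y) = 0)
    (hα0 : fderiv ℝ α y (Z y) + act (fderiv ℝ Z y) (α y) = 0)
    (hη0 : fderiv ℝ η y (Z y) + (η y).comp (fderiv ℝ Z y) = 0) :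
    fderiv ℝ (fun z => topDeriv b (θ z) (η z) (α z)) y (Z y) +
      LinearMap.trace ℝ E (fderiv ℝ Z y : E →ₗ[ℝ] E) * topDeriv b (θ y) (η y) (α y) = 0 := by
  set B := fderiv ℝ Z y
  let T := fun q : (E [⋀^Fin 2]→L[ℝ] ℝ) × (E →L[ℝ] ℝ) × (E [⋀^Fin 2]→L[ℝ] ℝ) =>
      topDeriv b q.1 q.2.1 q.2.2
  have hT : HasFDerivAt T (fderiv ℝ T (θ y, η y, α y)) (θ y, η y, α y) :=
    ((contDiff_topDeriv b).differentiable (by simp) _).hasFDerivAt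
  have h1 : HasFDerivAt (fun z => topDeriv b (θ z) (η z) (α z)) _ y :=
    HasFDerivAt.comp (g := T) (f := fun z => (θ z, η z, α z)) y hT
      (hθ.hasFDerivAt.prodMk (hη.hasFDerivAt.prodMk hα.hasFDerivAt))
  -- The hypotheses identify the derivative of all three arguments along Z with minus the
  -- infinitesimal action of B = DZ, and by `topDeriv_comp` that action multiplies the value by tr
  -- B.
  set A : ℝ → E →L[ℝ] E := fun s => ContinuousLinearMap.id ℝ E + s • B
  have hA : HasDerivAt (fun s : ℝ => ContinuousLinearMap.id ℝ E + s • B) B 0 := by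
    simpa using ((hasDerivAt_id (0 : ℝ)).smul_const B).const_add (ContinuousLinearMap.id ℝ E)
  have hA0 : A 0 = ContinuousLinearMap.id ℝ E := by simp [A]
  have h2 : ∀ τ : E [⋀^Fin 2]→L[ℝ] ℝ,
      HasDerivAt (fun s => τ.compContinuousLinearMap (A s)) (act B τ) 0 := fun τ => by
    have h := (hasDerivAt_const (0 : ℝ)
      τ).hasFDerivAt.continuousAlternatingMapCompContinuousLinearMap hA.hasFDerivAt
    convert h.hasDerivAt using 1
    ext v
    simp [act]
  have h3 : HasDerivAt (fun s => (η y).comp (A s)) ((η y).comp B) 0 := by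
    have : HasDerivAt (fun s : ℝ => η y + s • (η y).comp B) ((η y).comp B) 0 := by
      simpa using ((hasDerivAt_id (0 : ℝ)).smul_const ((η y).comp B)).const_add (η y)
    convert this using 2 with s
    ext X; simp [A]
  have hT0 : HasFDerivAt T (fderiv ℝ T (θ y, η y, α y)) ((θ y).compContinuousLinearMap (A 0),
      (η y).comp (A 0), (α y).compContinuousLinearMap (A 0)) := by
    rw [hA0]
    exact hT
  have h4 : HasDerivAt (fun s => topDeriv b ((θ y).compContinuousLinearMap (A s))
      ((η y).comp (A s)) ((α y).compContinuousLinearMap (A s))) _ 0 :=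
    HasFDerivAt.comp_hasDerivAt (l := T) (f := fun s => ((θ y).compContinuousLinearMap (A s),
      (η y).comp (A s), (α y).compContinuousLinearMap (A s))) (0 : ℝ) hT0
      ((h2 (θ y)).prodMk (h3.prodMk (h2 (α y))))
  simp only [topDeriv_comp] at h4
  have h5 := (hasDerivAt_det_one_add_smul b B).mul_const (topDeriv b (θ y) (η y) (α y))
  have h6 := h4.unique h5
  rw [h1.fderiv, ← h6]
  simp only [ContinuousLinearMap.comp_apply, ContinuousLinearMap.prod_apply]
  rw [← map_add]
  simp only [Prod.mk_add_mk, hθ0, hα0, hη0]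
  exact map_zero _

end LocalCalculus

/-! ### The divergence theorem for compactly supported fields. -/

section Divergence

variable {E : Type*} [NormedAddCommGroup E] [NormedSpace ℝ E] [FiniteDimensional ℝ E]
  [MeasurableSpace E] [BorelSpace E] (μ : Measure E) [μ.IsAddHaarMeasure]

theorem integral_fderiv_eq_zero {f : E → ℝ} (hf : ContDiff ℝ 1 f) (hc : HasCompactSupport f)
    (v : E) : ∫ y, fderiv ℝ f y v ∂μ = 0 := by
  have hf' : Continuous fun y => fderiv ℝ f y v := (hf.continuous_fderiv (by simp)).clm_apply
    continuous_const
  have hc' : HasCompactSupport fun y => fderiv ℝ f y v :=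
    (hc.fderiv (𝕜 := ℝ)).comp_left (g := fun L : E →L[ℝ] ℝ => L v) (zero_apply v)
  have h := integral_mul_fderiv_eq_neg_fderiv_mul_of_integrable (μ := μ) (𝕜 := ℝ)
    (f := fun _ : E => (1 : ℝ)) (g := f) (v := v) (by simp)
    (by simpa using hf'.integrable_of_hasCompactSupport hc')
    (by simpa using hf.continuous.integrable_of_hasCompactSupport hc)
    (fun x _ => differentiableAt_const _) (fun x _ => hf.differentiable (by simp) x)
  simpa using h

/-- The divergence theorem for compactly supported fields. -/
theorem integral_trace_fderiv_eq_zero {W : E → E} (hW : ContDiff ℝ 1 W)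
    (hc : HasCompactSupport W) :
    ∫ y, LinearMap.trace ℝ E (fderiv ℝ W y : E →ₗ[ℝ] E) ∂μ = 0 := by
  let b := Module.finBasis ℝ E
  have h1 : ∀ y, LinearMap.trace ℝ E (fderiv ℝ W y : E →ₗ[ℝ] E) =
      ∑ i, fderiv ℝ (fun z => LinearMap.toContinuousLinearMap (b.coord i) (W z)) y (b i) := by
    intro y
    rw [LinearMap.trace_eq_matrix_trace ℝ b, Matrix.trace]
    refine Finset.sum_congr rfl fun i _ => ?_
    have := ((LinearMap.toContinuousLinearMap (b.coord i)).hasFDerivAt.comp y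
      (hW.differentiable (by simp) y).hasFDerivAt)
    rw [show (fun z => LinearMap.toContinuousLinearMap (b.coord i) (W z)) =
      LinearMap.toContinuousLinearMap (b.coord i) ∘ W from rfl, this.fderiv, Matrix.diag_apply,
      LinearMap.toMatrix_apply]
    rfl
  have hd : ∀ i, ContDiff ℝ 1 fun z => LinearMap.toContinuousLinearMap (b.coord i) (W z) :=
    fun i => (LinearMap.toContinuousLinearMap (b.coord i)).contDiff.comp hW
  have hs : ∀ i, HasCompactSupport fun z => LinearMap.toContinuousLinearMap (b.coord i) (W z) :=
    fun i => hc.comp_left (map_zero _)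
  simp only [h1]
  rw [integral_finsetSum]
  · exact Finset.sum_eq_zero fun i _ => integral_fderiv_eq_zero μ (hd i) (hs i) _
  · intro i _
    exact (((hd i).continuous_fderiv (by simp)).clm_apply
      continuous_const).integrable_of_hasCompactSupport
        (((hs i).fderiv (𝕜 := ℝ)).comp_left (g := fun L : E →L[ℝ] ℝ => L (b i)) (zero_apply _))

end Divergence

/-! ### Time and space derivatives on a cylinder [a, b] × U. -/

section MixedPartials

variable {E F : Type*} [NormedAddCommGroup E] [NormedSpace ℝ E] [NormedAddCommGroup F]
  [NormedSpace ℝ F] {u : ℝ × E → F} {a b : ℝ} {U : Set E}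

theorem hasFDerivAt_slice_right (hu : ContDiffOn ℝ ∞ u (Icc a b ×ˢ U)) (hU : IsOpen U)
    {q : ℝ × E} (hq : q ∈ Icc a b ×ˢ U) :
    HasFDerivAt (fun y => u (q.1, y))
      ((fderivWithin ℝ u (Icc a b ×ˢ U) q).comp (ContinuousLinearMap.inr ℝ ℝ E)) q.2 := by
  have h1 := ((hu.differentiableOn (by simp)) q hq).hasFDerivWithinAt
  have h2 : HasFDerivWithinAt (fun y : E => (q.1, y)) (ContinuousLinearMap.inr ℝ ℝ E) U q.2 :=
    (hasFDerivAt_prodMk_right q.1 q.2).hasFDerivWithinAt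
  exact (HasFDerivWithinAt.comp (g := u) (f := fun y : E => (q.1, y)) q.2 h1 h2
    (fun y hy => ⟨hq.1, hy⟩)).hasFDerivAt (hU.mem_nhds hq.2)

theorem hasDerivWithinAt_slice_left (hu : ContDiffOn ℝ ∞ u (Icc a b ×ˢ U))
    {q : ℝ × E} (hq : q ∈ Icc a b ×ˢ U) :
    HasDerivWithinAt (fun t => u (t, q.2)) (fderivWithin ℝ u (Icc a b ×ˢ U) q (1, 0))
      (Icc a b) q.1 := by
  have h1 := ((hu.differentiableOn (by simp)) q hq).hasFDerivWithinAt
  have h2 : HasDerivWithinAt (fun t : ℝ => (t, q.2)) ((1 : ℝ), (0 : E)) (Icc a b) q.1 :=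
    ((hasDerivAt_id q.1).prodMk (hasDerivAt_const q.1 q.2)).hasDerivWithinAt
  exact HasFDerivWithinAt.comp_hasDerivWithinAt (l := u) (f := fun t : ℝ => (t, q.2)) q.1 h1 h2
    (fun t ht => ⟨ht, hq.2⟩)

theorem uniqueDiffOn_cylinder (hab : a < b) (hU : IsOpen U) :
    UniqueDiffOn ℝ (Icc a b ×ˢ U) :=
  (uniqueDiffOn_Icc hab).prod hU.uniqueDiffOn

theorem contDiffOn_fderiv_slice (hab : a < b) (hu : ContDiffOn ℝ ∞ u (Icc a b ×ˢ U))
    (hU : IsOpen U) :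
    ContDiffOn ℝ ∞ (fun q : ℝ × E => fderiv ℝ (fun y => u (q.1, y)) q.2) (Icc a b ×ˢ U) := by
  have h : ContDiffOn ℝ ∞ (fderivWithin ℝ u (Icc a b ×ˢ U)) (Icc a b ×ˢ U) :=
    hu.fderivWithin (uniqueDiffOn_cylinder hab hU) (by simp)
  exact (h.clm_comp contDiffOn_const).congr
    fun q hq => (hasFDerivAt_slice_right hu hU hq).fderiv

theorem contDiffOn_derivWithin_slice (hab : a < b) (hu : ContDiffOn ℝ ∞ u (Icc a b ×ˢ U))
    (hU : IsOpen U) :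
    ContDiffOn ℝ ∞ (fun q : ℝ × E => derivWithin (fun t => u (t, q.2)) (Icc a b) q.1)
      (Icc a b ×ˢ U) := by
  have h : ContDiffOn ℝ ∞ (fderivWithin ℝ u (Icc a b ×ˢ U)) (Icc a b ×ˢ U) :=
    hu.fderivWithin (uniqueDiffOn_cylinder hab hU) (by simp)
  exact (h.clm_apply contDiffOn_const).congr fun q hq =>
    (hasDerivWithinAt_slice_left hu hq).derivWithin (uniqueDiffOn_Icc hab q.1 hq.1)

/-- Symmetry of the second derivative. It persists on the faces t = a and t = b because the cylinder
has unique derivatives and lies in the closure of its interior. -/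
theorem hasDerivWithinAt_fderiv_slice (hab : a < b) (hu : ContDiffOn ℝ ∞ u (Icc a b ×ˢ U))
    (hU : IsOpen U) {t : ℝ} (ht : t ∈ Icc a b) {y : E} (hy : y ∈ U) :
    HasDerivWithinAt (fun s => fderiv ℝ (fun y => u (s, y)) y)
      (fderiv ℝ (fun y => derivWithin (fun s => u (s, y)) (Icc a b) t) y) (Icc a b) t := by
  have hs := uniqueDiffOn_cylinder hab hU
  have hq : (t, y) ∈ Icc a b ×ˢ U := ⟨ht, hy⟩
  have hG : ContDiffOn ℝ ∞ (fderivWithin ℝ u (Icc a b ×ˢ U)) (Icc a b ×ˢ U) :=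
    hu.fderivWithin hs (by simp)
  have hcl : (t, y) ∈ closure (interior (Icc a b ×ˢ U)) := by
    rw [interior_prod_eq, closure_prod_eq, interior_Icc, closure_Ioo hab.ne, hU.interior_eq]
    exact ⟨ht, subset_closure hy⟩
  have hsym : IsSymmSndFDerivWithinAt ℝ u (Icc a b ×ˢ U) (t, y) :=
    (hu (t, y) hq).isSymmSndFDerivWithinAt
      (by rw [minSmoothness_of_isRCLikeNormedField]; exact WithTop.coe_le_coe.2 le_top) hs hcl hq
  have h1 := hasDerivWithinAt_slice_left hG hq
  have h2 := hasFDerivAt_slice_right hG hU hq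
  have h3 : HasDerivWithinAt (fun s => (fderivWithin ℝ u (Icc a b ×ˢ U) (s, y)).comp
      (ContinuousLinearMap.inr ℝ ℝ E))
      ((fderivWithin ℝ (fderivWithin ℝ u (Icc a b ×ˢ U)) (Icc a b ×ˢ U) (t, y) (1, 0)).comp
        (ContinuousLinearMap.inr ℝ ℝ E)) (Icc a b) t := by
    have := (((ContinuousLinearMap.compL ℝ E (ℝ × E) F).flip
      (ContinuousLinearMap.inr ℝ ℝ E)).hasFDerivAt.comp_hasDerivWithinAt t h1)
    exact this
  have h4 : HasFDerivAt (fun y => derivWithin (fun s => u (s, y)) (Icc a b) t)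
      ((ContinuousLinearMap.apply ℝ F ((1 : ℝ), (0 : E))).comp
        ((fderivWithin ℝ (fderivWithin ℝ u (Icc a b ×ˢ U)) (Icc a b ×ˢ U) (t, y)).comp
          (ContinuousLinearMap.inr ℝ ℝ E))) y := by
    refine HasFDerivAt.congr_of_eventuallyEq
      ((ContinuousLinearMap.apply ℝ F ((1 : ℝ), (0 : E))).hasFDerivAt.comp y h2) ?_
    filter_upwards [hU.mem_nhds hy] with z hz
    exact (hasDerivWithinAt_slice_left hu (q := (t, z)) ⟨ht, hz⟩).derivWithin
      (uniqueDiffOn_Icc hab t ht)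
  rw [h4.fderiv]
  refine (h3.congr_of_mem (fun s hs => (hasFDerivAt_slice_right hu hU (q := (s, y))
    ⟨hs, hy⟩).fderiv) ht).congr_deriv ?_
  ext v
  exact hsym.eq _ _

end MixedPartials

theorem trace_smulRight_add {E : Type*} [NormedAddCommGroup E] [NormedSpace ℝ E]
    [FiniteDimensional ℝ E] (L : E →L[ℝ] ℝ) (Z : E) (c : ℝ) (B : E →L[ℝ] E) :
    LinearMap.trace ℝ E ((c • B + L.smulRight Z : E →L[ℝ] E) : E →ₗ[ℝ] E) =
      c * LinearMap.trace ℝ E (B : E →ₗ[ℝ] E) + L Z := by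
  rw [ContinuousLinearMap.toLinearMap_add, ContinuousLinearMap.toLinearMap_smul, map_add, map_smul]
  congr 1
  exact LinearMap.trace_smulRight (L : E →ₗ[ℝ] ℝ) Z

/-! ### Divergence of a weighted field times a cut-off function. -/

section LocalStokes

variable {E : Type*} [NormedAddCommGroup E] [NormedSpace ℝ E] [FiniteDimensional ℝ E]
  [MeasurableSpace E] [BorelSpace E] (μ : Measure E) [μ.IsAddHaarMeasure]

/-- The divergence theorem for a field `h Z` multiplied by a compactly supported function. -/
theorem integral_divergence_eq_zero {U : Set E} (hU : IsOpen U) {f h : E → ℝ} {Z : E → E}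
    (hf : ContDiff ℝ ∞ f) (hfc : HasCompactSupport f) (hfU : tsupport f ⊆ U)
    (hh : ContDiffOn ℝ ∞ h U) (hZ : ContDiffOn ℝ ∞ Z U) :
    ∫ y in U, (fderiv ℝ f y (Z y) * h y + f y * (fderiv ℝ h y (Z y) +
      LinearMap.trace ℝ E (fderiv ℝ Z y : E →ₗ[ℝ] E) * h y)) ∂μ = 0 := by
  have hout : ∀ y ∉ tsupport f, (fun y => f y • h y • Z y) =ᶠ[nhds y] fun _ => 0 := fun y hy => by
    filter_upwards [(isClosed_tsupport f).isOpen_compl.mem_nhds hy] with z hz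
    rw [image_eq_zero_of_notMem_tsupport hz, zero_smul]
  have hW : ContDiff ℝ 1 fun y => f y • h y • Z y := by
    rw [contDiff_iff_contDiffAt]
    intro y
    by_cases hy : y ∈ tsupport f
    · have hyU := hU.mem_nhds (hfU hy)
      exact (hf.contDiffAt.smul ((hh.contDiffAt hyU).smul (hZ.contDiffAt hyU))).of_le
        (mod_cast le_top)
    · exact contDiffAt_const.congr_of_eventuallyEq (hout y hy)
  have hWc : HasCompactSupport fun y => f y • h y • Z y := hfc.smul_right
  rw [← integral_trace_fderiv_eq_zero μ hW hWc, ← integral_indicator hU.measurableSet]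
  congr 1
  ext y
  by_cases hy : y ∈ tsupport f
  · have hyU := hU.mem_nhds (hfU hy)
    rw [indicator_of_mem (hfU hy)]
    have h1 := (hf.differentiable (by simp) y).hasFDerivAt
    have h2 := ((hh.contDiffAt hyU).differentiableAt (by simp)).hasFDerivAt
    have h3 := ((hZ.contDiffAt hyU).differentiableAt (by simp)).hasFDerivAt
    have h4 : HasFDerivAt (fun y => f y • h y • Z y) _ y := h1.smul (h2.smul h3)
    rw [h4.fderiv]
    -- The derivative of the product field is a multiple of DZ plus a map of rank one, whose trace
    -- is an evaluation.
    have : f y • (h y • fderiv ℝ Z y + (fderiv ℝ h y).smulRight (Z y)) +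
        (fderiv ℝ f y).smulRight (h y • Z y) = (f y * h y) • fderiv ℝ Z y +
          (f y • fderiv ℝ h y + h y • fderiv ℝ f y).smulRight (Z y) := by
      ext v
      simp only [add_apply, smul_apply, ContinuousLinearMap.smulRight_apply, smul_eq_mul]
      module
    rw [this, trace_smulRight_add]
    simp
    ring
  · rw [(hout y hy).fderiv_eq]
    have h1 : f =ᶠ[nhds y] fun _ => 0 := by
      filter_upwards [(isClosed_tsupport f).isOpen_compl.mem_nhds hy] with z hz
      exact image_eq_zero_of_notMem_tsupport hz
    by_cases hyU : y ∈ U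
    · rw [indicator_of_mem hyU, h1.fderiv_eq, h1.eq_of_nhds]
      simp
    · rw [indicator_of_notMem hyU]
      simp

end LocalStokes

/-! ### Forms, fields and endomorphisms in the preferred charts. -/

section Charts

/-- The model space. -/
abbrev Model (n : ℕ) : Type := EuclideanSpace ℝ (Fin n)

variable {n : ℕ} {S : Type*} [TopologicalSpace S] [ChartedSpace (EuclideanSpace ℝ (Fin n)) S]

/-- The differential of the inverse of the preferred chart at `x`. -/
def chartInv (x : S) (y : Model n) : Model n →L[ℝ] Model n :=
  mfderiv 𝓘(ℝ, Model n) (𝓡 n) (extChartAt (𝓡 n) x).symm y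

/-- The differential of the preferred chart at `x`. -/
def chartDiff (x p : S) : Model n →L[ℝ] Model n :=
  mfderiv (𝓡 n) 𝓘(ℝ, Model n) (extChartAt (𝓡 n) x) p

/-- A field of covectors, in the preferred chart at `x`. -/
def OneForm.loc (β : OneForm n S) (x : S) (y : Model n) : Model n →L[ℝ] ℝ :=
  ContinuousLinearMap.comp (M₂ := Model n) (β ((extChartAt (𝓡 n) x).symm y)) (chartInv x y)

/-- A field of endomorphisms, in the preferred chart at `x`. -/
def endLoc (Φ : ∀ p : S, TangentSpace (𝓡 n) p →L[ℝ] TangentSpace (𝓡 n) p) (x : S) (y : Model n) :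
    Model n →L[ℝ] Model n :=
  ContinuousLinearMap.comp (M₂ := Model n) (chartDiff x ((extChartAt (𝓡 n) x).symm y))
    (ContinuousLinearMap.comp (M₂ := Model n) (M₃ := Model n) (Φ ((extChartAt (𝓡 n) x).symm y))
      (chartInv x y))

/-- A vector field, in the preferred chart at `x`. -/
def fieldLoc (Z : ∀ p : S, TangentSpace (𝓡 n) p) (x : S) (y : Model n) : Model n :=
  chartDiff x ((extChartAt (𝓡 n) x).symm y) (Z ((extChartAt (𝓡 n) x).symm y))

/-- The differential of a function. -/
def grad {F : Type*} [NormedAddCommGroup F] [NormedSpace ℝ F] (f : S → F) (p : S) :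
    TangentSpace (𝓡 n) p →L[ℝ] F :=
  mfderiv (𝓡 n) 𝓘(ℝ, F) f p

theorem isOpen_target (x : S) : IsOpen (extChartAt (𝓡 n) x).target :=
  isOpen_extChartAt_target x

variable [IsManifold (𝓡 n) ∞ S]

theorem chartDiff_chartInv (x : S) {y : Model n} (hy : y ∈ (extChartAt (𝓡 n) x).target)
    (X : Model n) : chartDiff x ((extChartAt (𝓡 n) x).symm y) (chartInv x y X) = X := by
  have : IsManifold (𝓡 n) 1 S := IsManifold.of_le (n := ∞) (by simp)
  have h := mfderiv_extChartAt_comp_mfderivWithin_extChartAt_symm hy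
  rw [ModelWithCorners.range_eq_univ, mfderivWithin_univ] at h
  exact congrArg (fun f => f X) h

theorem chartInv_chartDiff (x : S) {y : Model n} (hy : y ∈ (extChartAt (𝓡 n) x).target)
    (X : Model n) : chartInv x y (chartDiff x ((extChartAt (𝓡 n) x).symm y) X) = X := by
  have : IsManifold (𝓡 n) 1 S := IsManifold.of_le (n := ∞) (by simp)
  have h := mfderivWithin_extChartAt_symm_comp_mfderiv_extChartAt hy
  rw [ModelWithCorners.range_eq_univ, mfderivWithin_univ] at h
  exact congrArg (fun f => f X) h

theorem chartDiff_self (x : S) (X : Model n) : chartDiff x x X = X := by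
  have : IsManifold (𝓡 n) 1 S := IsManifold.of_le (n := ∞) (by simp)
  exact congrArg (fun f => f X) (mfderiv_extChartAt_self (I := 𝓡 n) (x := x))

theorem chartInv_self (x : S) (X : Model n) : chartInv x (extChartAt (𝓡 n) x x) X = X := by
  have h := chartInv_chartDiff x (mem_extChartAt_target (I := 𝓡 n) x) X
  rwa [extChartAt_to_inv, chartDiff_self] at h

theorem det_chartInv_ne_zero (x : S) {y : Model n} (hy : y ∈ (extChartAt (𝓡 n) x).target) :
    (chartInv x y).det ≠ 0 := by
  have h : (chartDiff x ((extChartAt (𝓡 n) x).symm y)).comp (chartInv x y) =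
      ContinuousLinearMap.id ℝ _ := ContinuousLinearMap.ext (chartDiff_chartInv x hy)
  intro h0
  have h1 := congrArg ContinuousLinearMap.det h
  have h2 : ((chartDiff x ((extChartAt (𝓡 n) x).symm y)).comp (chartInv x y)).det =
    (chartDiff x ((extChartAt (𝓡 n) x).symm y)).det * (chartInv x y).det :=
    LinearMap.det_comp (M := Model n) _ _
  rw [h2, h0, mul_zero] at h1
  have h3 : (ContinuousLinearMap.id ℝ (Model n)).det = 1 := LinearMap.det_id
  rw [h3] at h1
  exact zero_ne_one h1

/-! #### Changes of charts -/

/-- The change of charts from the preferred chart at `x` to the one at `x'`. -/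
def transition (x x' : S) (y : Model n) : Model n :=
  extChartAt (𝓡 n) x' ((extChartAt (𝓡 n) x).symm y)

theorem mdifferentiableAt_chart (x' : S) {p : S} (hp : p ∈ (extChartAt (𝓡 n) x').source) :
    MDifferentiableAt (𝓡 n) 𝓘(ℝ, Model n) (extChartAt (𝓡 n) x') p := by
  have : IsManifold (𝓡 n) 1 S := IsManifold.of_le (n := ∞) (by simp)
  rw [extChartAt_source] at hp
  exact mdifferentiableAt_extChartAt hp

theorem contMDiffAt_chart_symm (x : S) {y : Model n} (hy : y ∈ (extChartAt (𝓡 n) x).target) :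
    ContMDiffAt 𝓘(ℝ, Model n) (𝓡 n) ∞ (extChartAt (𝓡 n) x).symm y :=
  (contMDiffOn_extChartAt_symm x).contMDiffAt ((isOpen_target x).mem_nhds hy)

theorem mdifferentiableAt_chart_symm (x : S) {y : Model n}
    (hy : y ∈ (extChartAt (𝓡 n) x).target) :
    MDifferentiableAt 𝓘(ℝ, Model n) (𝓡 n) (extChartAt (𝓡 n) x).symm y :=
  (contMDiffAt_chart_symm x hy).mdifferentiableAt (by simp)

theorem contDiffAt_transition (x x' : S) {y : Model n} (hy : y ∈ (extChartAt (𝓡 n) x).target)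
    (hy' : (extChartAt (𝓡 n) x).symm y ∈ (extChartAt (𝓡 n) x').source) :
    ContDiffAt ℝ ∞ (transition x x') y := by
  rw [← contMDiffAt_iff_contDiffAt]
  rw [extChartAt_source] at hy'
  exact (contMDiffAt_extChartAt' hy').comp y (contMDiffAt_chart_symm x hy)

theorem fderiv_transition (x x' : S) {y : Model n} (hy : y ∈ (extChartAt (𝓡 n) x).target)
    (hy' : (extChartAt (𝓡 n) x).symm y ∈ (extChartAt (𝓡 n) x').source) :
    fderiv ℝ (transition x x') y =
      (chartDiff x' ((extChartAt (𝓡 n) x).symm y)).comp (chartInv x y) := by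
  rw [← mfderiv_eq_fderiv]
  exact mfderiv_comp y (mdifferentiableAt_chart x' hy') (mdifferentiableAt_chart_symm x hy)

theorem transition_mem_target (x x' : S) {y : Model n}
    (hy' : (extChartAt (𝓡 n) x).symm y ∈ (extChartAt (𝓡 n) x').source) :
    transition x x' y ∈ (extChartAt (𝓡 n) x').target :=
  (extChartAt (𝓡 n) x').map_source hy'

theorem symm_transition (x x' : S) {y : Model n}
    (hy' : (extChartAt (𝓡 n) x).symm y ∈ (extChartAt (𝓡 n) x').source) :
    (extChartAt (𝓡 n) x').symm (transition x x' y) = (extChartAt (𝓡 n) x).symm y :=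
  (extChartAt (𝓡 n) x').left_inv hy'

theorem chartInv_transition (x x' : S) {y : Model n} (hy : y ∈ (extChartAt (𝓡 n) x).target)
    (hy' : (extChartAt (𝓡 n) x).symm y ∈ (extChartAt (𝓡 n) x').source) :
    chartInv x y = (chartInv x' (transition x x' y)).comp (fderiv ℝ (transition x x') y) := by
  rw [fderiv_transition x x' hy hy']
  ext1 X
  have h := chartInv_chartDiff x' (transition_mem_target x x' hy') (chartInv x y X)
  rw [symm_transition x x' hy'] at h
  exact h.symm

theorem eventually_mem_source (x x' : S) {y : Model n} (hy : y ∈ (extChartAt (𝓡 n) x).target)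
    (hy' : (extChartAt (𝓡 n) x).symm y ∈ (extChartAt (𝓡 n) x').source) :
    ∀ᶠ z in nhds y, z ∈ (extChartAt (𝓡 n) x).target ∧
      (extChartAt (𝓡 n) x).symm z ∈ (extChartAt (𝓡 n) x').source :=
  Filter.Eventually.and ((isOpen_target x).mem_nhds hy)
    ((contMDiffAt_chart_symm x hy).continuousAt.preimage_mem_nhds
      ((isOpen_extChartAt_source x').mem_nhds hy'))

theorem inChart_transition {k : ℕ} (α : DForm n S k) (x x' : S) {y : Model n}
    (hy : y ∈ (extChartAt (𝓡 n) x).target)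
    (hy' : (extChartAt (𝓡 n) x).symm y ∈ (extChartAt (𝓡 n) x').source) :
    α.inChart x y = (α.inChart x' (transition x x' y)).compContinuousLinearMap
      (fderiv ℝ (transition x x') y) := by
  have h := chartInv_transition x x' hy hy'
  have h1 : α.inChart x y = ContinuousAlternatingMap.compContinuousLinearMap (M' := Model n)
      (α ((extChartAt (𝓡 n) x).symm y)) (chartInv x y) := rfl
  have h2 : α.inChart x' (transition x x' y) =
      ContinuousAlternatingMap.compContinuousLinearMap (M' := Model n)
      (α ((extChartAt (𝓡 n) x').symm (transition x x' y))) (chartInv x' (transition x x' y)) := rfl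
  rw [h1, h2, symm_transition x x' hy', h]
  rfl

theorem toDForm_inChart (β : OneForm n S) (x : S) (y : Model n) :
    β.toDForm.inChart x y =
      ContinuousAlternatingMap.ofSubsingleton ℝ (Model n) ℝ (0 : Fin 1) (β.loc x y) := rfl

/-- The exterior derivative of a `1`-form may be computed in any chart. -/
theorem inChart_d (β : OneForm n S) (x : S) {y : Model n} (hy : y ∈ (extChartAt (𝓡 n) x).target)
    (hβ : DifferentiableAt ℝ (β.loc ((extChartAt (𝓡 n) x).symm y))
      (extChartAt (𝓡 n) ((extChartAt (𝓡 n) x).symm y) ((extChartAt (𝓡 n) x).symm y))) :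
    β.toDForm.d.inChart x y = alt₂ (fderiv ℝ (β.loc x) y) := by
  set p := (extChartAt (𝓡 n) x).symm y with hp
  have hp' : (extChartAt (𝓡 n) x).symm y ∈ (extChartAt (𝓡 n) p).source :=
    mem_extChartAt_source p
  -- By definition d at p is taken in the preferred chart at p. Naturality of the exterior
  -- derivative under the transition map carries it to the chart at x.
  have h1 : β.toDForm.d.inChart x y =
      (extDeriv (β.toDForm.inChart p) (transition x p y)).compContinuousLinearMap
        (fderiv ℝ (transition x p) y) := by
    rw [fderiv_transition x p hy hp']
    rfl
  have hω : DifferentiableAt ℝ (β.toDForm.inChart p) (transition x p y) :=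
    ((ContinuousAlternatingMap.ofSubsingletonLIE (𝕜 := ℝ) (E := Model n) (F := ℝ)
    (0 : Fin 1)).toContinuousLinearEquiv.differentiableAt).comp _ hβ
  rw [h1, ← extDeriv_pullback hω (contDiffAt_transition x p hy hp')
    (by rw [minSmoothness_of_isRCLikeNormedField]; exact WithTop.coe_le_coe.2 le_top),
    ← extDeriv_ofSubsingleton]
  refine Filter.EventuallyEq.extDeriv_eq ?_
  filter_upwards [eventually_mem_source x p hy hp'] with z hz
  rw [← toDForm_inChart, inChart_transition _ x p hz.1 hz.2]

/-! #### Smoothness -/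

/-- Smooth fields of covectors. -/
def OneForm.IsSmooth (β : OneForm n S) : Prop :=
  ∀ x : S, ContDiffOn ℝ ∞ (β.loc x) (extChartAt (𝓡 n) x).target

theorem OneForm.IsSmooth.inChart_d {β : OneForm n S} (hβ : β.IsSmooth) (x : S) {y : Model n}
    (hy : y ∈ (extChartAt (𝓡 n) x).target) :
    β.toDForm.d.inChart x y = alt₂ (fderiv ℝ (β.loc x) y) :=
  Sasaki.inChart_d β x hy (((hβ _).contDiffAt ((isOpen_target _).mem_nhds
    (mem_extChartAt_target _))).differentiableAt (by simp))

theorem OneForm.IsSmooth.contDiffOn_d {β : OneForm n S} (hβ : β.IsSmooth) (x : S) :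
    ContDiffOn ℝ ∞ (β.toDForm.d.inChart x) (extChartAt (𝓡 n) x).target := by
  refine ContDiffOn.congr (f := fun y => alt₂ (fderiv ℝ (β.loc x) y)) ?_
    fun y hy => hβ.inChart_d x hy
  have h : ContDiffOn ℝ ∞ (fderiv ℝ (β.loc x)) (extChartAt (𝓡 n) x).target :=
    (hβ x).fderiv_of_isOpen (isOpen_target x) (by simp)
  exact (ContinuousLinearMap.contDiff (alt₂ (E := Model n))).comp_contDiffOn h

theorem contDiffOn_comp_chart_symm {F : Type*} [NormedAddCommGroup F] [NormedSpace ℝ F] {f : S → F}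
    (hf : ContMDiff (𝓡 n) 𝓘(ℝ, F) ∞ f) (x : S) :
    ContDiffOn ℝ ∞ (fun y => f ((extChartAt (𝓡 n) x).symm y)) (extChartAt (𝓡 n) x).target := by
  rw [← contMDiffOn_iff_contDiffOn]
  exact hf.comp_contMDiffOn (contMDiffOn_extChartAt_symm x)

theorem contMDiff_of_chart {F : Type*} [NormedAddCommGroup F] [NormedSpace ℝ F] {f : S → F}
    (hf : ∀ x : S, ContDiffOn ℝ ∞ (fun y => f ((extChartAt (𝓡 n) x).symm y))
      (extChartAt (𝓡 n) x).target) : ContMDiff (𝓡 n) 𝓘(ℝ, F) ∞ f := by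
  intro x
  have h1 : ContMDiffAt 𝓘(ℝ, Model n) 𝓘(ℝ, F) ∞ (fun y => f ((extChartAt (𝓡 n) x).symm y))
      (extChartAt (𝓡 n) x x) := by
    rw [contMDiffAt_iff_contDiffAt]
    exact (hf x).contDiffAt ((isOpen_target x).mem_nhds (mem_extChartAt_target x))
  refine (h1.comp x (contMDiffAt_extChartAt (I := 𝓡 n))).congr_of_eventuallyEq ?_
  filter_upwards [(isOpen_extChartAt_source x).mem_nhds (mem_extChartAt_source (I := 𝓡 n) x)]
    with z hz
  exact (congrArg f ((extChartAt (𝓡 n) x).left_inv hz)).symm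

theorem fderiv_comp_chart_symm {F : Type*} [NormedAddCommGroup F] [NormedSpace ℝ F] {f : S → F}
    (hf : ContMDiff (𝓡 n) 𝓘(ℝ, F) ∞ f) (x : S) {y : Model n}
    (hy : y ∈ (extChartAt (𝓡 n) x).target) (X : Model n) :
    fderiv ℝ (fun y => f ((extChartAt (𝓡 n) x).symm y)) y X =
      grad f ((extChartAt (𝓡 n) x).symm y) (chartInv x y X) := by
  rw [← mfderiv_eq_fderiv]
  exact congrArg (fun L => L X) (mfderiv_comp y ((hf _).mdifferentiableAt (by simp))
    (mdifferentiableAt_chart_symm x hy))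

theorem loc_grad {f : S → ℝ} (hf : ContMDiff (𝓡 n) 𝓘(ℝ, ℝ) ∞ f) (x : S) {y : Model n}
    (hy : y ∈ (extChartAt (𝓡 n) x).target) :
    OneForm.loc (grad f) x y = fderiv ℝ (fun y => f ((extChartAt (𝓡 n) x).symm y)) y := by
  ext1 X
  rw [fderiv_comp_chart_symm hf x hy]
  rfl

theorem isSmooth_grad {f : S → ℝ} (hf : ContMDiff (𝓡 n) 𝓘(ℝ, ℝ) ∞ f) :
    OneForm.IsSmooth (n := n) (grad f) := fun x =>
  ((contDiffOn_comp_chart_symm hf x).fderiv_of_isOpen (isOpen_target x) (by simp)).congr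
    fun _ hy => loc_grad hf x hy

theorem continuousLinearMapAt_eq (x : S) {y : Model n} (hy : y ∈ (extChartAt (𝓡 n) x).target) :
    (trivializationAt (Model n) (TangentSpace (𝓡 n)) x).continuousLinearMapAt ℝ
      ((extChartAt (𝓡 n) x).symm y) = chartDiff x ((extChartAt (𝓡 n) x).symm y) := by
  have : IsManifold (𝓡 n) 1 S := IsManifold.of_le (n := ∞) (by simp)
  have h : (extChartAt (𝓡 n) x).symm y ∈ (chartAt (Model n) x).source := by
    rw [← extChartAt_source (𝓡 n)]; exact (extChartAt (𝓡 n) x).map_target hy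
  exact TangentBundle.continuousLinearMapAt_trivializationAt h

theorem symmL_eq (x : S) {y : Model n} (hy : y ∈ (extChartAt (𝓡 n) x).target) :
    (trivializationAt (Model n) (TangentSpace (𝓡 n)) x).symmL ℝ
      ((extChartAt (𝓡 n) x).symm y) = chartInv x y := by
  have : IsManifold (𝓡 n) 1 S := IsManifold.of_le (n := ∞) (by simp)
  have h : (extChartAt (𝓡 n) x).symm y ∈ (chartAt (Model n) x).source := by
    rw [← extChartAt_source (𝓡 n)]; exact (extChartAt (𝓡 n) x).map_target hy
  have h2 := TangentBundle.symmL_trivializationAt h (𝕜 := ℝ) (I := 𝓡 n)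
  rw [(extChartAt (𝓡 n) x).right_inv hy, ModelWithCorners.range_eq_univ, mfderivWithin_univ] at h2
  exact h2

theorem mem_baseSet (x : S) {y : Model n} (hy : y ∈ (extChartAt (𝓡 n) x).target) :
    (extChartAt (𝓡 n) x).symm y ∈
      (trivializationAt (Model n) (TangentSpace (𝓡 n)) x).baseSet := by
  rw [TangentBundle.trivializationAt_baseSet, ← extChartAt_source (𝓡 n)]
  exact (extChartAt (𝓡 n) x).map_target hy

theorem trivializationAt_apply_snd (x : S) {y : Model n} (hy : y ∈ (extChartAt (𝓡 n) x).target)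
    (v : TangentSpace (𝓡 n) ((extChartAt (𝓡 n) x).symm y)) :
    (trivializationAt (Model n) (TangentSpace (𝓡 n)) x ⟨(extChartAt (𝓡 n) x).symm y, v⟩).2 =
      chartDiff x ((extChartAt (𝓡 n) x).symm y) v := by
  have h : (trivializationAt (Model n) (TangentSpace (𝓡 n)) x).continuousLinearMapAt ℝ
      ((extChartAt (𝓡 n) x).symm y) v =
      (trivializationAt (Model n) (TangentSpace (𝓡 n)) x ⟨(extChartAt (𝓡 n) x).symm y, v⟩).2 := by
    rw [Bundle.Trivialization.continuousLinearMapAt_apply,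
      Bundle.Trivialization.linearMapAt_apply, if_pos (mem_baseSet x hy)]
  exact h.symm.trans (congrArg (fun L => L v) (continuousLinearMapAt_eq x hy))

/-- The local trivializations of the tangent bundle are the differentials of the preferred charts,
so smoothness as a section is smoothness of the coordinate expression. The same argument serves for
endomorphisms and vector fields below. -/
theorem isSmooth_of_contMDiff {β : OneForm n S} (h : ContMDiff (𝓡 n)
    ((𝓡 n).prod 𝓘(ℝ, EuclideanSpace ℝ (Fin n) →L[ℝ] ℝ)) ∞
    (fun p => TotalSpace.mk' (EuclideanSpace ℝ (Fin n) →L[ℝ] ℝ)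
      (E := fun p : S => TangentSpace (𝓡 n) p →L[ℝ] ℝ) p (β p))) : β.IsSmooth := by
  intro x y hy
  have h1 := h ((extChartAt (𝓡 n) x).symm y)
  rw [Bundle.Trivialization.contMDiffAt_iff (e := trivializationAt (Model n →L[ℝ] ℝ)
    (fun p : S => TangentSpace (𝓡 n) p →L[ℝ] ℝ) x)
    ⟨mem_baseSet x hy, mem_univ _⟩] at h1
  have h2 := h1.2.comp y (contMDiffAt_chart_symm x hy)
  rw [contMDiffAt_iff_contDiffAt] at h2
  refine (h2.congr_of_eventuallyEq ?_).contDiffWithinAt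
  filter_upwards [(isOpen_target x).mem_nhds hy] with z hz
  rw [Function.comp_apply, hom_trivializationAt_apply]
  change _ = ContinuousLinearMap.inCoordinates _ _ _ _ _ _ _ _ _
  rw [ContinuousLinearMap.inCoordinates, symmL_eq x hz]
  ext1 X
  simp [OneForm.loc]
  rfl

theorem contDiffOn_endLoc {Φ : ∀ p : S, TangentSpace (𝓡 n) p →L[ℝ] TangentSpace (𝓡 n) p}
    (h : ContMDiff (𝓡 n) ((𝓡 n).prod
      𝓘(ℝ, EuclideanSpace ℝ (Fin n) →L[ℝ] EuclideanSpace ℝ (Fin n))) ∞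
    (fun p => TotalSpace.mk' (EuclideanSpace ℝ (Fin n) →L[ℝ] EuclideanSpace ℝ (Fin n))
      (E := fun p : S => TangentSpace (𝓡 n) p →L[ℝ] TangentSpace (𝓡 n) p) p (Φ p))) (x : S) :
    ContDiffOn ℝ ∞ (endLoc Φ x) (extChartAt (𝓡 n) x).target := by
  intro y hy
  have h1 := h ((extChartAt (𝓡 n) x).symm y)
  rw [Bundle.Trivialization.contMDiffAt_iff (e := trivializationAt (Model n →L[ℝ] Model n)
    (fun p : S => TangentSpace (𝓡 n) p →L[ℝ] TangentSpace (𝓡 n) p) x)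
    ⟨mem_baseSet x hy, mem_baseSet x hy⟩] at h1
  have h2 := h1.2.comp y (contMDiffAt_chart_symm x hy)
  rw [contMDiffAt_iff_contDiffAt] at h2
  refine (h2.congr_of_eventuallyEq ?_).contDiffWithinAt
  filter_upwards [(isOpen_target x).mem_nhds hy] with z hz
  rw [Function.comp_apply, hom_trivializationAt_apply]
  change _ = ContinuousLinearMap.inCoordinates _ _ _ _ _ _ _ _ _
  rw [ContinuousLinearMap.inCoordinates, symmL_eq x hz, continuousLinearMapAt_eq x hz]
  rfl

theorem contDiffOn_fieldLoc {Z : ∀ p : S, TangentSpace (𝓡 n) p}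
    (h : ContMDiff (𝓡 n) (𝓡 n).tangent ∞ (fun p => (⟨p, Z p⟩ : TangentBundle (𝓡 n) S))) (x : S) :
    ContDiffOn ℝ ∞ (fieldLoc Z x) (extChartAt (𝓡 n) x).target := by
  intro y hy
  have h1 := h ((extChartAt (𝓡 n) x).symm y)
  rw [ModelWithCorners.tangent, Bundle.Trivialization.contMDiffAt_iff (e := trivializationAt (Model n)
    (TangentSpace (𝓡 n)) x)
    ((Bundle.Trivialization.mem_source _).2 (mem_baseSet x hy))] at h1
  have h2 := h1.2.comp y (contMDiffAt_chart_symm x hy)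
  rw [contMDiffAt_iff_contDiffAt] at h2
  refine (h2.congr_of_eventuallyEq ?_).contDiffWithinAt
  filter_upwards [(isOpen_target x).mem_nhds hy] with z hz
  exact (trivializationAt_apply_snd x hz _).symm

/-- A field of tangent vectors that is constant in the preferred chart at `x` near `x`. -/
theorem exists_constant_field (x : S) (X : Model n) :
    ∃ Z : ∀ p : S, TangentSpace (𝓡 n) p,
      (∀ y ∈ (extChartAt (𝓡 n) x).target, Z ((extChartAt (𝓡 n) x).symm y) = chartInv x y X) ∧
      ContMDiffAt (𝓡 n) (𝓡 n).tangent ∞ (fun p => (⟨p, Z p⟩ : TangentBundle (𝓡 n) S)) x := by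
  refine ⟨fun p => chartInv x (extChartAt (𝓡 n) x p) X, fun y hy => ?_, ?_⟩
  · change chartInv x (extChartAt (𝓡 n) x ((extChartAt (𝓡 n) x).symm y)) X = _
    rw [(extChartAt (𝓡 n) x).right_inv hy]
  · rw [ModelWithCorners.tangent, Bundle.Trivialization.contMDiffAt_iff (e := trivializationAt (Model n)
      (TangentSpace (𝓡 n)) x) ((Bundle.Trivialization.mem_source _).2
        (FiberBundle.mem_baseSet_trivializationAt' x))]
    refine ⟨contMDiffAt_id, (contMDiffAt_const (c := X)).congr_of_eventuallyEq ?_⟩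
    filter_upwards [(isOpen_extChartAt_source x).mem_nhds (mem_extChartAt_source (I := 𝓡 n) x)]
      with z hz
    have hy := (extChartAt (𝓡 n) x).map_source hz
    have h2 := trivializationAt_apply_snd x hy
    have h3 := chartDiff_chartInv x hy X
    rw [(extChartAt (𝓡 n) x).left_inv hz] at h2 h3
    exact (h2 _).trans h3

end Charts

/-! ### Normality in coordinates. -/

section LocalNormality

variable {E : Type*} [NormedAddCommGroup E] [NormedSpace ℝ E]

/-- Normality implies that `d(df ∘ Φ)` is invariant under `Φ` for a basic function `f`. -/
theorem invariant_of_normal {Φ : E → E →L[ℝ] E} {η : E → E →L[ℝ] ℝ} {ξ : E → E} {f : E → ℝ}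
    {ν : E → E → ℝ} {y : E} (hf : ContDiffAt ℝ 2 f y) (hΦ : DifferentiableAt ℝ Φ y)
    (hη : DifferentiableAt ℝ η y) (hξ : DifferentiableAt ℝ ξ y)
    (hΦΦ : ∀ᶠ z in nhds y, ∀ X, Φ z (Φ z X) = -X + η z X • ξ z)
    (hΦξ : Φ y (ξ y) = 0) (hb : ∀ᶠ z in nhds y, fderiv ℝ f z (ξ z) = 0)
    (hN : ∀ X Y, fderiv ℝ Φ y (Φ y X) Y - fderiv ℝ Φ y (Φ y Y) X + Φ y (fderiv ℝ Φ y Y X)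
      - Φ y (fderiv ℝ Φ y X Y) + ν X Y • ξ y = 0) (X Y : E) :
    alt₂ (fderiv ℝ (fun z => -(1 / 2 : ℝ) • (fderiv ℝ f z).comp (Φ z)) y) ![Φ y X, Φ y Y] =
      alt₂ (fderiv ℝ (fun z => -(1 / 2 : ℝ) • (fderiv ℝ f z).comp (Φ z)) y) ![X, Y] := by
  have hd : HasFDerivAt (fderiv ℝ f) (fderiv ℝ (fderiv ℝ f) y) y :=
    ((hf.fderiv_right (m := 1) (by norm_num)).differentiableAt (by simp)).hasFDerivAt
  have hs : IsSymmSndFDerivAt ℝ f y := hf.isSymmSndFDerivAt (by simp)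
  have h1 : ∀ V W, fderiv ℝ (fun z => -(1 / 2 : ℝ) • (fderiv ℝ f z).comp (Φ z)) y V W =
      -(1 / 2) * (fderiv ℝ (fderiv ℝ f) y V (Φ y W) + fderiv ℝ f y (fderiv ℝ Φ y V W)) := by
    intro V W
    have h := (hd.clm_comp hΦ.hasFDerivAt).const_smul (-(1 / 2 : ℝ))
    rw [show (fun z => -(1 / 2 : ℝ) • (fderiv ℝ f z).comp (Φ z)) =
      -(1 / 2 : ℝ) • fun z => (fderiv ℝ f z).comp (Φ z) from rfl, h.fderiv]
    simp
    ring
  -- The derivative of the identity ξf = 0.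
  have h2 : ∀ V, fderiv ℝ (fderiv ℝ f) y V (ξ y) + fderiv ℝ f y (fderiv ℝ ξ y V) = 0 := by
    intro V
    have h := hd.clm_apply hξ.hasFDerivAt
    have h0 : HasFDerivAt (fun z => fderiv ℝ f z (ξ z)) (0 : E →L[ℝ] ℝ) y :=
      (hasFDerivAt_const (0 : ℝ) y).congr_of_eventuallyEq hb
    have := congrArg (fun L => L V) (h.unique h0)
    simp at this
    linarith
  -- The derivative of the identity Φ² = -1 + η ⊗ ξ.
  have h3 : ∀ V W, fderiv ℝ Φ y V (Φ y W) + Φ y (fderiv ℝ Φ y V W) =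
      fderiv ℝ η y V W • ξ y + η y W • fderiv ℝ ξ y V := by
    intro V W
    have hW : HasFDerivAt (fun z => Φ z W) _ y := hΦ.hasFDerivAt.clm_apply (hasFDerivAt_const W y)
    have h := hΦ.hasFDerivAt.clm_apply hW
    have hηW : HasFDerivAt (fun z => η z W) _ y := hη.hasFDerivAt.clm_apply (hasFDerivAt_const W y)
    have h' := (hηW.smul hξ.hasFDerivAt).const_add (-W)
    have h0 : HasFDerivAt (fun z => Φ z (Φ z W)) _ y :=
      h'.congr_of_eventuallyEq (hΦΦ.mono fun z hz => hz W)
    have := congrArg (fun L => L V) (h.unique h0)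
    simp at this
    rw [add_comm, this, add_comm]
  have h4 : fderiv ℝ f y (ξ y) = 0 := hb.self_of_nhds
  have h5 : ∀ V, Φ y (Φ y V) = -V + η y V • ξ y := hΦΦ.self_of_nhds
  -- The torsion identity is composed with df ∘ Φ, which removes the term along ξ because Φξ = 0.
  -- What remains is linear in the second derivatives of f and the first derivatives of Φ.
  have h6 := congrArg (fun v => fderiv ℝ f y (Φ y v)) (hN X Y)
  simp only [map_add, map_sub, map_smul, h5, hΦξ, map_zero, map_neg, h4, smul_eq_mul, mul_zero,
    add_zero] at h6
  have h7 := congrArg (fderiv ℝ f y) (h3 (Φ y X) Y)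
  have h8 := congrArg (fderiv ℝ f y) (h3 (Φ y Y) X)
  simp only [map_add, map_smul, h4, smul_eq_mul, mul_zero, zero_add] at h7 h8
  rw [alt₂_apply, alt₂_apply, h1, h1, h1, h1, h5, h5]
  simp only [map_add, map_neg, map_smul, smul_eq_mul]
  have e1 := h2 (Φ y X)
  have e2 := h2 (Φ y Y)
  have e3 := hs.eq (Φ y X) Y
  have e4 := hs.eq (Φ y Y) X
  linear_combination (-1/2) * (h7 - h8 + η y Y * e1 - η y X * e2 - e3 + e4 - h6)

theorem lieBracket_const_left {E : Type*} [NormedAddCommGroup E] [NormedSpace ℝ E] 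
    {V W : E → E} {y : E} {X : E} (hV : V =ᶠ[nhds y] fun _ => X) :
    VectorField.lieBracket ℝ V W y = fderiv ℝ W y X := by
  rw [VectorField.lieBracket, hV.fderiv_eq, hV.eq_of_nhds]
  simp

theorem lieBracket_const_right {E : Type*} [NormedAddCommGroup E] [NormedSpace ℝ E]
    {V W : E → E} {y : E} {X : E} (hW : W =ᶠ[nhds y] fun _ => X) :
    VectorField.lieBracket ℝ V W y = -fderiv ℝ V y X := by
  rw [VectorField.lieBracket, hW.fderiv_eq, hW.eq_of_nhds]
  simp

/-- At the centre of its own preferred chart the differential of the chart is the identity, so no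
pull-back is left. -/
theorem mlieBracket_self_chart {n : ℕ} {S : Type*} [TopologicalSpace S]
    [ChartedSpace (EuclideanSpace ℝ (Fin n)) S] [IsManifold (𝓡 n) ∞ S] 
    (V W : ∀ p : S, TangentSpace (𝓡 n) p) (p : S) :
    VectorField.mlieBracket (𝓡 n) V W p =
      VectorField.lieBracket ℝ (fieldLoc V p) (fieldLoc W p) (extChartAt (𝓡 n) p p) := by
  have : IsManifold (𝓡 n) 1 S := IsManifold.of_le (n := ∞) (by simp)
  have hinv : ∀ (V : ∀ p : S, TangentSpace (𝓡 n) p), ∀ y ∈ (extChartAt (𝓡 n) p).target,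
      VectorField.mpullbackWithin 𝓘(ℝ, Model n) (𝓡 n) (extChartAt (𝓡 n) p).symm V univ y =
        fieldLoc V p y := by
    intro V y hy
    rw [VectorField.mpullbackWithin_apply, mfderivWithin_univ]
    have h : chartInv p y = ((ContinuousLinearEquiv.equivOfInverse (chartInv p y)
      (chartDiff p ((extChartAt (𝓡 n) p).symm y)) (chartDiff_chartInv p hy)
      (chartInv_chartDiff p hy) : Model n ≃L[ℝ] Model n) : Model n →L[ℝ] Model n) := rfl
    change (chartInv p y).inverse _ = _
    rw [h, ContinuousLinearMap.inverse_equiv]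
    rfl
  have h2 : ∀ (V : ∀ p : S, TangentSpace (𝓡 n) p),
      VectorField.mpullbackWithin 𝓘(ℝ, Model n) (𝓡 n) (extChartAt (𝓡 n) p).symm V univ
        =ᶠ[nhds (extChartAt (𝓡 n) p p)] fieldLoc V p := fun V =>
    Filter.eventually_of_mem ((isOpen_target p).mem_nhds (mem_extChartAt_target p)) (hinv V)
  have hid : chartDiff p p = ContinuousLinearMap.id ℝ (Model n) :=
    ContinuousLinearMap.ext (chartDiff_self p)
  rw [← VectorField.mlieBracketWithin_univ, VectorField.mlieBracketWithin_apply,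
    ModelWithCorners.range_eq_univ, preimage_univ, inter_univ]
  change (chartDiff p p).inverse (VectorField.lieBracketWithin ℝ (E := Model n) _ _ univ _) = _
  rw [hid, ContinuousLinearMap.inverse_id]
  exact (congrFun VectorField.lieBracketWithin_univ _).trans
    ((h2 V).lieBracket_vectorField_eq (h2 W))

end LocalNormality

/-! ### The pointwise structure of a Sasakian manifold, and normality in a chart. -/

namespace SasakianStructure

variable {m : ℕ} {S : Type*} [TopologicalSpace S]
  [ChartedSpace (EuclideanSpace ℝ (Fin (2 * m + 1))) S] [IsManifold (𝓡 (2 * m + 1)) ∞ S]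
  (σ : SasakianStructure m S)

/-- The Reeb vector at `p`, as a vector of the model space. -/
def xi (p : S) : Model (2 * m + 1) := σ.ξ p

/-- The contact form at `p`, as a covector of the model space. -/
def eta (p : S) : Model (2 * m + 1) →L[ℝ] ℝ := σ.η p

/-- The endomorphism `Φ` at `p`, on the model space. -/
def phi (p : S) : Model (2 * m + 1) →L[ℝ] Model (2 * m + 1) := σ.Φ p

/-- The `2`-form `dη` at `p`, on the model space. -/
def deta (p : S) : Model (2 * m + 1) [⋀^Fin 2]→L[ℝ] ℝ := σ.η.toDForm.d p

/-- The `2`-form `d d_B^c φ` at `p`, on the model space. -/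
def ddc (φ : S → ℝ) (p : S) : Model (2 * m + 1) [⋀^Fin 2]→L[ℝ] ℝ := (σ.dc φ).toDForm.d p

/-- The `2`-form `dη_φ` at `p`, on the model space. -/
def omega (φ : S → ℝ) (p : S) : Model (2 * m + 1) [⋀^Fin 2]→L[ℝ] ℝ := σ.omegaOf φ p

/-- Φ²ξ = 0, so applying the formula for Φ² to Φξ gives Φξ = λξ, and then λΦξ = 0 forces Φξ = 0.
Computing Φ³X in two ways now gives η(ΦX)ξ = 0. -/
theorem isAlmostContact (p : S) : IsAlmostContact (σ.xi p) (σ.eta p) (σ.phi p) := by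
  have h0 : ∀ X, σ.phi p (σ.phi p X) = -X + σ.eta p X • σ.xi p := σ.Φ_Φ p
  have h1 : σ.eta p (σ.xi p) = 1 := σ.η_ξ p
  have hne : σ.xi p ≠ 0 := fun h => by rw [h, map_zero] at h1; exact zero_ne_one h1
  have h2 : σ.phi p (σ.phi p (σ.xi p)) = 0 := by rw [h0, h1]; simp
  have h3 : σ.phi p (σ.xi p) = σ.eta p (σ.phi p (σ.xi p)) • σ.xi p := by
    have := h0 (σ.phi p (σ.xi p))
    rw [h2, map_zero] at this
    exact neg_add_eq_zero.1 this.symm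
  have h4 : σ.phi p (σ.xi p) = 0 := by
    rw [h3, map_smul] at h2
    rcases smul_eq_zero.1 h2 with h | h
    · rw [h3, h, zero_smul]
    · exact h
  refine ⟨h1, h4, fun X => ?_, h0⟩
  have h5 := h0 (σ.phi p X)
  rw [h0 X, map_add, map_neg, map_smul, h4, smul_zero, add_zero] at h5
  have h6 : σ.eta p (σ.phi p X) • σ.xi p = 0 := by simpa using h5
  exact (smul_eq_zero.1 h6).resolve_right hne

theorem xi_ne_zero (p : S) : σ.xi p ≠ 0 := fun h => by
  have := (σ.isAlmostContact p).η_ξ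
  rw [h, map_zero] at this
  exact zero_ne_one this

/-- On ker η the compatibility of g with Φ gives dη(X, ΦX) = 2 g(ΦX, ΦX) = 2 g(X, X). -/
theorem isPositive_deta (p : S) : IsPositive (σ.xi p) (σ.eta p) (σ.phi p) (σ.deta p) := by
  have hc := σ.isAlmostContact p
  have h : ∀ X Y, σ.deta p ![X, Y] = 2 * σ.g.inner p (σ.phi p X) Y := σ.dη_eq p
  have hg : ∀ X Y, σ.g.inner p (σ.phi p X) (σ.phi p Y) =
    σ.g.inner p X Y - σ.eta p X * σ.eta p Y := σ.g_Φ_Φ p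
  refine ⟨⟨fun Y => ?_, fun X Y => ?_⟩, fun X hX hX0 => ?_⟩
  · rw [h, hc.Φ_ξ]
    exact (congrArg (2 * ·) (congrArg (fun L => L Y) (map_zero (σ.g.inner p)))).trans (mul_zero 2)
  · rw [h, h, hg, hc.η_Φ]; simp
  · rw [h, hg, hX]
    have := σ.g.pos p X hX0
    simp only [mul_zero, sub_zero]
    exact mul_pos two_pos this

theorem isSmooth_η : σ.η.IsSmooth := isSmooth_of_contMDiff σ.η_smooth

theorem contDiffOn_Φ (x : S) :
    ContDiffOn ℝ ∞ (endLoc σ.Φ x) (extChartAt (𝓡 (2 * m + 1)) x).target :=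
  contDiffOn_endLoc σ.Φ_smooth x

theorem contDiffOn_ξ (x : S) :
    ContDiffOn ℝ ∞ (fieldLoc σ.ξ x) (extChartAt (𝓡 (2 * m + 1)) x).target :=
  contDiffOn_fieldLoc σ.ξ_smooth x

/-- Extend X and Y by fields that are constant in the chart at p. Their bracket vanishes there, and
the other brackets in the torsion become derivatives of Φ. -/
theorem normal_chart (p : S) (X Y : Model (2 * m + 1)) :
    fderiv ℝ (endLoc σ.Φ p) (extChartAt (𝓡 (2 * m + 1)) p p) (σ.phi p X) Y -
      fderiv ℝ (endLoc σ.Φ p) (extChartAt (𝓡 (2 * m + 1)) p p) (σ.phi p Y) X +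
      σ.phi p (fderiv ℝ (endLoc σ.Φ p) (extChartAt (𝓡 (2 * m + 1)) p p) Y X) -
      σ.phi p (fderiv ℝ (endLoc σ.Φ p) (extChartAt (𝓡 (2 * m + 1)) p p) X Y) +
      σ.deta p ![X, Y] • σ.xi p = 0 := by
  obtain ⟨V, hV, hVs⟩ := exists_constant_field p X
  obtain ⟨W, hW, hWs⟩ := exists_constant_field p Y
  have hmem := (isOpen_target p).mem_nhds (mem_extChartAt_target (I := 𝓡 (2 * m + 1)) p)
  have hVl : fieldLoc V p =ᶠ[nhds (extChartAt (𝓡 (2 * m + 1)) p p)] fun _ => X := by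
    filter_upwards [hmem] with z hz
    rw [fieldLoc, hV z hz, chartDiff_chartInv p hz]
  have hWl : fieldLoc W p =ᶠ[nhds (extChartAt (𝓡 (2 * m + 1)) p p)] fun _ => Y := by
    filter_upwards [hmem] with z hz
    rw [fieldLoc, hW z hz, chartDiff_chartInv p hz]
  have hΦl : ∀ (V : ∀ p : S, TangentSpace (𝓡 (2 * m + 1)) p) (X : Model (2 * m + 1)),
      (∀ y ∈ (extChartAt (𝓡 (2 * m + 1)) p).target,
        V ((extChartAt (𝓡 (2 * m + 1)) p).symm y) = chartInv p y X) →
      fieldLoc (fun q => σ.Φ q (V q)) p =ᶠ[nhds (extChartAt (𝓡 (2 * m + 1)) p p)]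
        fun z => endLoc σ.Φ p z X := by
    intro V X hV
    filter_upwards [hmem] with z hz
    rw [fieldLoc, hV z hz]
    rfl
  have hd : DifferentiableAt ℝ (endLoc σ.Φ p) (extChartAt (𝓡 (2 * m + 1)) p p) :=
    ((σ.contDiffOn_Φ p).contDiffAt hmem).differentiableAt (by simp)
  have hdX : ∀ X : Model (2 * m + 1), HasFDerivAt (fun z => endLoc σ.Φ p z X) _
      (extChartAt (𝓡 (2 * m + 1)) p p) := fun X =>
    hd.hasFDerivAt.clm_apply (hasFDerivAt_const X _)
  have h0 : ∀ X, endLoc σ.Φ p (extChartAt (𝓡 (2 * m + 1)) p p) X = σ.phi p X := by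
    intro X
    change chartDiff p ((extChartAt (𝓡 (2 * m + 1)) p).symm (extChartAt (𝓡 (2 * m + 1)) p p))
      (σ.phi ((extChartAt (𝓡 (2 * m + 1)) p).symm (extChartAt (𝓡 (2 * m + 1)) p p))
        (chartInv p (extChartAt (𝓡 (2 * m + 1)) p p) X)) = _
    rw [chartInv_self, extChartAt_to_inv, chartDiff_self]
  have hX : fderiv ℝ (fun z => endLoc σ.Φ p z X) (extChartAt (𝓡 (2 * m + 1)) p p) =
      (fderiv ℝ (endLoc σ.Φ p) (extChartAt (𝓡 (2 * m + 1)) p p)).flip X := by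
    rw [(hdX X).fderiv]; simp
  have hY : fderiv ℝ (fun z => endLoc σ.Φ p z Y) (extChartAt (𝓡 (2 * m + 1)) p p) =
      (fderiv ℝ (endLoc σ.Φ p) (extChartAt (𝓡 (2 * m + 1)) p p)).flip Y := by
    rw [(hdX Y).fderiv]; simp
  have h1 : VectorField.mlieBracket (𝓡 (2 * m + 1)) V W p = (0 : Model (2 * m + 1)) := by
    refine (mlieBracket_self_chart V W p).trans ?_
    rw [lieBracket_const_left hVl, hWl.fderiv_eq, fderiv_fun_const]
    rfl
  have h2 : VectorField.mlieBracket (𝓡 (2 * m + 1)) (fun q => σ.Φ q (V q)) (fun q => σ.Φ q (W q)) p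
      = (fderiv ℝ (endLoc σ.Φ p) (extChartAt (𝓡 (2 * m + 1)) p p) (σ.phi p X) Y -
        fderiv ℝ (endLoc σ.Φ p) (extChartAt (𝓡 (2 * m + 1)) p p) (σ.phi p Y) X :
          Model (2 * m + 1)) := by
    refine (mlieBracket_self_chart _ _ p).trans ?_
    rw [(hΦl V X hV).lieBracket_vectorField_eq (hΦl W Y hW), VectorField.lieBracket, hX, hY, h0, h0,
      ContinuousLinearMap.flip_apply, ContinuousLinearMap.flip_apply]
  have h3 : VectorField.mlieBracket (𝓡 (2 * m + 1)) V (fun q => σ.Φ q (W q)) p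
      = (fderiv ℝ (endLoc σ.Φ p) (extChartAt (𝓡 (2 * m + 1)) p p) X Y : Model (2 * m + 1)) := by
    refine (mlieBracket_self_chart _ _ p).trans ?_
    rw [lieBracket_const_left hVl, (hΦl W Y hW).fderiv_eq, hY, ContinuousLinearMap.flip_apply]
  have h4 : VectorField.mlieBracket (𝓡 (2 * m + 1)) (fun q => σ.Φ q (V q)) W p
      = (-fderiv ℝ (endLoc σ.Φ p) (extChartAt (𝓡 (2 * m + 1)) p p) Y X : Model (2 * m + 1)) := by
    refine (mlieBracket_self_chart _ _ p).trans ?_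
    rw [lieBracket_const_right hWl, (hΦl V X hV).fderiv_eq, hX, ContinuousLinearMap.flip_apply]
  have hVp : V p = (X : Model (2 * m + 1)) := by
    have := hV _ (mem_extChartAt_target (I := 𝓡 (2 * m + 1)) p)
    rw [chartInv_self, extChartAt_to_inv] at this
    exact this
  have hWp : W p = (Y : Model (2 * m + 1)) := by
    have := hW _ (mem_extChartAt_target (I := 𝓡 (2 * m + 1)) p)
    rw [chartInv_self, extChartAt_to_inv] at this
    exact this
  have hn := σ.normal V W p hVs hWs
  rw [h1, h2, h3, h4, hVp, hWp] at hn
  have hn' : σ.phi p (σ.phi p 0) + (fderiv ℝ (endLoc σ.Φ p) (extChartAt (𝓡 (2 * m + 1)) p p)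
      (σ.phi p X) Y - fderiv ℝ (endLoc σ.Φ p) (extChartAt (𝓡 (2 * m + 1)) p p) (σ.phi p Y) X) -
      σ.phi p (-fderiv ℝ (endLoc σ.Φ p) (extChartAt (𝓡 (2 * m + 1)) p p) Y X) -
      σ.phi p (fderiv ℝ (endLoc σ.Φ p) (extChartAt (𝓡 (2 * m + 1)) p p) X Y) +
      σ.deta p ![X, Y] • σ.xi p = 0 := hn
  rw [map_zero, map_zero, map_neg, zero_add, sub_neg_eq_add] at hn'
  exact hn'

end SasakianStructure

/-! ### Behaviour of the transverse structure and of `sharp` under linear isomorphisms; smoothness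
of `sharp`. -/

section PullBack

variable {E F : Type*} [NormedAddCommGroup E] [NormedSpace ℝ E] [NormedAddCommGroup F]
  [NormedSpace ℝ F] {ξ : F} {η : F →L[ℝ] ℝ} {Φ : F →L[ℝ] F} {θ : F [⋀^Fin 2]→L[ℝ] ℝ}
  {A : E →L[ℝ] F} {A' : F →L[ℝ] E}

theorem IsAlmostContact.pullback (hc : IsAlmostContact ξ η Φ) (h1 : ∀ X, A' (A X) = X)
    (h2 : ∀ X, A (A' X) = X) :
    IsAlmostContact (A' ξ) (η.comp A) (A'.comp (Φ.comp A)) := by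
  refine ⟨?_, ?_, fun X => ?_, fun X => ?_⟩
  · simp [h2, hc.η_ξ]
  · simp [h2, hc.Φ_ξ]
  · simp [h2, hc.η_Φ]
  · simp [h2, hc.Φ_Φ, h1]

theorem IsPositive.pullback (h : IsPositive ξ η Φ θ) (h1 : ∀ X, A' (A X) = X)
    (h2 : ∀ X, A (A' X) = X) :
    IsPositive (A' ξ) (η.comp A) (A'.comp (Φ.comp A)) (θ.compContinuousLinearMap A) := by
  refine ⟨⟨fun Y => ?_, fun X Y => ?_⟩, fun X hX hX0 => ?_⟩
  · rw [two_form_comp_apply, h2, h.left]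
  · simp only [two_form_comp_apply, ContinuousLinearMap.comp_apply, h2, h.invariant]
  · simp only [two_form_comp_apply, ContinuousLinearMap.comp_apply, h2]
    refine h.pos _ hX fun h0 => hX0 ?_
    rw [← h1 X, h0, map_zero]

/-- The transported vector satisfies the equations that characterize `sharp`
(`IsAlmostContact.eq_sharp`). -/
theorem IsAlmostContact.sharp_pullback [FiniteDimensional ℝ E] [FiniteDimensional ℝ F]
    (hc : IsAlmostContact ξ η Φ)
    (h : IsPositive ξ η Φ θ) (h1 : ∀ X, A' (A X) = X) (h2 : ∀ X, A (A' X) = X) {β : F →L[ℝ] ℝ}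
    (hβ : β ξ = 0) :
    A (sharp (θ.compContinuousLinearMap A) (η.comp A) (β.comp A)) = sharp θ η β := by
  have hc' := hc.pullback h1 h2
  have h' := h.pullback h1 h2
  have hβ' : (β.comp A) (A' ξ) = 0 := by simp [h2, hβ]
  refine hc.eq_sharp h (hc'.η_sharp h' hβ') fun Y => ?_
  have := hc'.two_form_sharp h' hβ' (A' Y)
  rw [two_form_comp_apply] at this
  simpa [h2] using this

/-- Inversion of linear maps is smooth at invertible ones. -/
theorem contDiffOn_sharp [FiniteDimensional ℝ E] [CompleteSpace E]
    {θ : E → E [⋀^Fin 2]→L[ℝ] ℝ} {η β : E → E →L[ℝ] ℝ} {U : Set E}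
    (hθ : ContDiffOn ℝ ∞ θ U) (hη : ContDiffOn ℝ ∞ η U) (hβ : ContDiffOn ℝ ∞ β U)
    (hinv : ∀ y ∈ U, (flat (θ y) (η y)).IsInvertible) :
    ContDiffOn ℝ ∞ (fun y => sharp (θ y) (η y) (β y)) U := by
  have hfl : ContDiffOn ℝ ∞ (fun y => flat (θ y) (η y)) U := by
    have h1 : ContDiffOn ℝ ∞ (fun y => bilCLM (θ y)) U :=
      (ContinuousLinearMap.contDiff (𝕜 := ℝ) (E := E [⋀^Fin 2]→L[ℝ] ℝ) (F := E →L[ℝ] E →L[ℝ] ℝ)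
        bilCLM).comp_contDiffOn hθ
    exact h1.add (hη.smulRight hη)
  refine ContDiffOn.clm_apply ?_ hβ
  intro y hy
  obtain ⟨e, he⟩ := hinv y hy
  have h2 : ContDiffAt ℝ ∞ ContinuousLinearMap.inverse (flat (θ y) (η y)) := by
    rw [← he]
    exact contDiffAt_map_inverse e
  exact h2.comp_contDiffWithinAt y (hfl y hy)

end PullBack

/-! ### Evaluation at the centre of the preferred chart. -/

section Center

variable {n : ℕ} {S : Type*} [TopologicalSpace S] [ChartedSpace (EuclideanSpace ℝ (Fin n)) S]

/-- The differential of a function, on the model space. -/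
def dif {F : Type*} [NormedAddCommGroup F] [NormedSpace ℝ F] (f : S → F) (p : S) :
    Model n →L[ℝ] F :=
  grad f p

/-- The exterior derivative of a `1`-form at a point, on the model space. -/
def OneForm.dAt (β : OneForm n S) (p : S) : Model n [⋀^Fin 2]→L[ℝ] ℝ := β.toDForm.d p

variable [IsManifold (𝓡 n) ∞ S]

theorem inChart_self {k : ℕ} (α : DForm n S k) (p : S) :
    α.inChart p (extChartAt (𝓡 n) p p) = α p := by
  have h : chartInv p (extChartAt (𝓡 n) p p) = ContinuousLinearMap.id ℝ (Model n) :=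
    ContinuousLinearMap.ext (chartInv_self p)
  have h1 : α.inChart p (extChartAt (𝓡 n) p p) =
      ContinuousAlternatingMap.compContinuousLinearMap (M' := Model n)
      (α ((extChartAt (𝓡 n) p).symm (extChartAt (𝓡 n) p p)))
      (chartInv p (extChartAt (𝓡 n) p p)) := rfl
  rw [h1, h, extChartAt_to_inv]
  rfl

theorem endLoc_self (Φ : ∀ p : S, TangentSpace (𝓡 n) p →L[ℝ] TangentSpace (𝓡 n) p) (p : S) :
    endLoc Φ p (extChartAt (𝓡 n) p p) = Φ p := by
  have h : chartInv p (extChartAt (𝓡 n) p p) = ContinuousLinearMap.id ℝ (Model n) :=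
    ContinuousLinearMap.ext (chartInv_self p)
  have h' : chartDiff p p = ContinuousLinearMap.id ℝ (Model n) :=
    ContinuousLinearMap.ext (chartDiff_self p)
  rw [endLoc, h, extChartAt_to_inv, h']
  rfl

theorem fieldLoc_self (Z : ∀ p : S, TangentSpace (𝓡 n) p) (p : S) :
    fieldLoc Z p (extChartAt (𝓡 n) p p) = Z p := by
  rw [fieldLoc, extChartAt_to_inv]
  exact chartDiff_self p _

theorem dif_eq_fderiv {F : Type*} [NormedAddCommGroup F] [NormedSpace ℝ F] {f : S → F}
    (hf : ContMDiff (𝓡 n) 𝓘(ℝ, F) ∞ f) (p : S) :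
    dif f p = fderiv ℝ (fun y => f ((extChartAt (𝓡 n) p).symm y)) (extChartAt (𝓡 n) p p) := by
  ext1 X
  rw [fderiv_comp_chart_symm hf p (mem_extChartAt_target p), chartInv_self, extChartAt_to_inv]
  rfl

/-- The exterior derivative at the centre of a chart. -/
theorem d_eq (β : OneForm n S) (hβ : β.IsSmooth) (p : S) :
    β.dAt p = alt₂ (fderiv ℝ (β.loc p) (extChartAt (𝓡 n) p p)) := by
  rw [← hβ.inChart_d p (mem_extChartAt_target p)]
  exact (inChart_self β.toDForm.d p).symm

theorem differentiableAt_loc {β : OneForm n S} (hβ : β.IsSmooth) (x : S) {y : Model n}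
    (hy : y ∈ (extChartAt (𝓡 n) x).target) : DifferentiableAt ℝ (β.loc x) y :=
  ((hβ x).contDiffAt ((isOpen_target x).mem_nhds hy)).differentiableAt (by simp)

theorem d_linear {α β γ : OneForm n S} (hα : α.IsSmooth) (hβ : β.IsSmooth) (a c : ℝ)
    (h : ∀ p, γ p = a • α p + c • β p) (p : S) :
    γ.dAt p = a • α.dAt p + c • β.dAt p := by
  have hloc : γ.loc p = fun y => a • α.loc p y + c • β.loc p y := by
    funext y
    rw [OneForm.loc, h]
    rfl
  have hγ : γ.IsSmooth := fun x => by
    have hx : γ.loc x = fun y => a • α.loc x y + c • β.loc x y := by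
      funext y
      rw [OneForm.loc, h]
      rfl
    rw [hx]
    exact ((hα x).const_smul a).add ((hβ x).const_smul c)
  have hm := mem_extChartAt_target (I := 𝓡 n) p
  have hd := ((differentiableAt_loc hα p hm).hasFDerivAt.const_smul a).add
    ((differentiableAt_loc hβ p hm).hasFDerivAt.const_smul c)
  have hd' : fderiv ℝ (γ.loc p) (extChartAt (𝓡 n) p p) =
      a • fderiv ℝ (α.loc p) (extChartAt (𝓡 n) p p) +
        c • fderiv ℝ (β.loc p) (extChartAt (𝓡 n) p p) := by
    rw [hloc]; exact hd.fderiv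
  rw [d_eq γ hγ, d_eq α hα, d_eq β hβ, hd', map_add, map_smul, map_smul]

end Center

/-! ### The operator d^c, the form dη_φ, and its type. -/

namespace SasakianStructure

variable {m : ℕ} {S : Type*} [TopologicalSpace S]
  [ChartedSpace (EuclideanSpace ℝ (Fin (2 * m + 1))) S] [IsManifold (𝓡 (2 * m + 1)) ∞ S]
  (σ : SasakianStructure m S)

theorem dC_ofReal {φ : S → ℝ} (hφ : ContMDiff (𝓡 (2 * m + 1)) 𝓘(ℝ, ℝ) ∞ φ) (p : S)
    (X : Model (2 * m + 1)) : dC (fun q => (φ q : ℂ)) p X = (dif φ p X : ℝ) := by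
  have h : HasMFDerivAt 𝓘(ℝ, ℝ) 𝓘(ℝ, ℂ) (fun r : ℝ => (r : ℂ)) (φ p) Complex.ofRealCLM :=
    Complex.ofRealCLM.hasFDerivAt.hasMFDerivAt
  have h1 : HasMFDerivAt (𝓡 (2 * m + 1)) 𝓘(ℝ, ℝ) φ p (grad φ p) :=
    ((hφ p).mdifferentiableAt (by simp)).hasMFDerivAt
  have h2 := (h.comp p h1).mfderiv
  exact congrArg (fun L => L X) h2

/-- ∂̄φ - ∂φ = √-1 dφ ∘ Φ, and multiplication by √-1/2 gives the real covector -(1/2) dφ ∘ Φ. -/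
theorem dc_apply {φ : S → ℝ} (hφ : ContMDiff (𝓡 (2 * m + 1)) 𝓘(ℝ, ℝ) ∞ φ) (p : S)
    (X : Model (2 * m + 1)) : σ.dc φ p X = -(1 / 2) * dif φ p (σ.phi p X) := by
  have h1 : σ.dc φ p X = ((Complex.I / 2) * ((1 / 2 : ℂ) * (dC (fun q => (φ q : ℂ)) p X +
      Complex.I * dC (fun q => (φ q : ℂ)) p (σ.phi p X)) - (1 / 2 : ℂ) *
      (dC (fun q => (φ q : ℂ)) p X - Complex.I * dC (fun q => (φ q : ℂ)) p (σ.phi p X)))).re := rfl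
  rw [h1, dC_ofReal hφ, dC_ofReal hφ]
  simp [Complex.mul_re, Complex.mul_im]
  ring

theorem dc_eq {φ : S → ℝ} (hφ : ContMDiff (𝓡 (2 * m + 1)) 𝓘(ℝ, ℝ) ∞ φ) (p : S) :
    σ.dc φ p = -(1 / 2 : ℝ) • (dif φ p).comp (σ.phi p) := by
  exact ContinuousLinearMap.ext fun X => σ.dc_apply hφ p X

theorem dc_linear {φ ψ χ : S → ℝ} (hφ : ContMDiff (𝓡 (2 * m + 1)) 𝓘(ℝ, ℝ) ∞ φ)
    (hψ : ContMDiff (𝓡 (2 * m + 1)) 𝓘(ℝ, ℝ) ∞ ψ) (a c : ℝ) (h : ∀ p, χ p = a * φ p + c * ψ p)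
    (p : S) : σ.dc χ p = a • σ.dc φ p + c • σ.dc ψ p := by
  obtain rfl : χ = fun p => a * φ p + c * ψ p := funext h
  have hχ : ContMDiff (𝓡 (2 * m + 1)) 𝓘(ℝ, ℝ) ∞ fun p => a * φ p + c * ψ p :=
    (contMDiff_const.mul hφ).add (contMDiff_const.mul hψ)
  have hd : dif (n := 2 * m + 1) (fun p => a * φ p + c * ψ p) p = a • dif φ p + c • dif ψ p := by
    have hm := (isOpen_target p).mem_nhds (mem_extChartAt_target (I := 𝓡 (2 * m + 1)) p)
    have h1 := (((contDiffOn_comp_chart_symm hφ p).contDiffAt hm).differentiableAt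
      (by simp)).hasFDerivAt
    have h2 := (((contDiffOn_comp_chart_symm hψ p).contDiffAt hm).differentiableAt
      (by simp)).hasFDerivAt
    rw [dif_eq_fderiv hχ, dif_eq_fderiv hφ, dif_eq_fderiv hψ]
    exact ((h1.const_mul a).add (h2.const_mul c)).fderiv
  refine ContinuousLinearMap.ext fun X => (σ.dc_apply hχ p X).trans ?_
  have e1 := σ.dc_apply hφ p X
  have e2 := σ.dc_apply hψ p X
  refine Eq.trans ?_ (congrArg₂ (fun r s => a * r + c * s) e1 e2).symm
  rw [hd]
  simp only [add_apply, smul_apply, smul_eq_mul]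
  ring

theorem loc_dc {φ : S → ℝ} (hφ : ContMDiff (𝓡 (2 * m + 1)) 𝓘(ℝ, ℝ) ∞ φ) (x : S)
    {y : Model (2 * m + 1)} (hy : y ∈ (extChartAt (𝓡 (2 * m + 1)) x).target) :
    (σ.dc φ).loc x y = -(1 / 2 : ℝ) •
      (fderiv ℝ (fun y => φ ((extChartAt (𝓡 (2 * m + 1)) x).symm y)) y).comp
        (endLoc σ.Φ x y) := by
  ext1 X
  have h1 : (σ.dc φ).loc x y X =
    σ.dc φ ((extChartAt (𝓡 (2 * m + 1)) x).symm y) (chartInv x y X) := rfl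
  rw [h1, σ.dc_apply hφ]
  simp only [smul_apply, ContinuousLinearMap.comp_apply, smul_eq_mul]
  rw [fderiv_comp_chart_symm hφ x hy]
  congr 2
  exact (chartInv_chartDiff x hy _).symm

theorem isSmooth_dc {φ : S → ℝ} (hφ : ContMDiff (𝓡 (2 * m + 1)) 𝓘(ℝ, ℝ) ∞ φ) :
    (σ.dc φ).IsSmooth := fun x =>
  ((((contDiffOn_comp_chart_symm hφ x).fderiv_of_isOpen (isOpen_target x)
    (by simp)).clm_comp (σ.contDiffOn_Φ x)).const_smul (-(1 / 2 : ℝ))).congr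
    fun _ hy => σ.loc_dc hφ x hy

theorem omega_eq {φ : S → ℝ} (hφ : ContMDiff (𝓡 (2 * m + 1)) 𝓘(ℝ, ℝ) ∞ φ) (p : S) :
    σ.omega φ p = σ.deta p + σ.ddc φ p := by
  have h := d_linear (γ := σ.etaOf φ) σ.isSmooth_η (σ.isSmooth_dc hφ) 1 1
    (fun p => by rw [one_smul, one_smul]; rfl) p
  rw [one_smul, one_smul] at h
  exact h

theorem ddc_linear {φ ψ χ : S → ℝ} (hφ : ContMDiff (𝓡 (2 * m + 1)) 𝓘(ℝ, ℝ) ∞ φ)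
    (hψ : ContMDiff (𝓡 (2 * m + 1)) 𝓘(ℝ, ℝ) ∞ ψ) (a c : ℝ) (h : ∀ p, χ p = a * φ p + c * ψ p)
    (p : S) : σ.ddc χ p = a • σ.ddc φ p + c • σ.ddc ψ p :=
  d_linear (σ.isSmooth_dc hφ) (σ.isSmooth_dc hψ) a c (σ.dc_linear hφ hψ a c h) p

theorem dif_ξ {φ : S → ℝ} (hφ : σ.IsBasic φ) (p : S) : dif φ p (σ.xi p) = 0 := hφ.2 p

theorem dc_ξ {φ : S → ℝ} (hφ : σ.IsBasic φ) (p : S) : σ.dc φ p (σ.xi p) = 0 := by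
  rw [σ.dc_apply hφ.1, (σ.isAlmostContact p).Φ_ξ, map_zero, mul_zero]

theorem fderiv_ξ {φ : S → ℝ} (hφ : σ.IsBasic φ) (x : S) {y : Model (2 * m + 1)}
    (hy : y ∈ (extChartAt (𝓡 (2 * m + 1)) x).target) :
    fderiv ℝ (fun y => φ ((extChartAt (𝓡 (2 * m + 1)) x).symm y)) y (fieldLoc σ.ξ x y) = 0 := by
  rw [fderiv_comp_chart_symm hφ.1 x hy]
  exact (congrArg (dif φ _) (chartInv_chartDiff x hy _)).trans (hφ.2 _)

theorem isAlmostContact_loc (x : S) {y : Model (2 * m + 1)}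
    (hy : y ∈ (extChartAt (𝓡 (2 * m + 1)) x).target) :
    IsAlmostContact (fieldLoc σ.ξ x y) (σ.η.loc x y) (endLoc σ.Φ x y) :=
  (σ.isAlmostContact ((extChartAt (𝓡 (2 * m + 1)) x).symm y)).pullback
    (chartDiff_chartInv x hy) (chartInv_chartDiff x hy)

/-- The only place where normality enters: it gives the invariance under Φ. Horizontality follows
from it, since Φξ = 0. -/
theorem isTransverse_ddc {φ : S → ℝ} (hφ : σ.IsBasic φ) (p : S) :
    IsTransverse (σ.xi p) (σ.phi p) (σ.ddc φ p) := by
  have hm := mem_extChartAt_target (I := 𝓡 (2 * m + 1)) p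
  have hmem := (isOpen_target p).mem_nhds hm
  have hc := σ.isAlmostContact p
  have hinv : ∀ X Y, σ.ddc φ p ![σ.phi p X, σ.phi p Y] = σ.ddc φ p ![X, Y] := by
    have h0 : σ.ddc φ p = alt₂ (fderiv ℝ (fun z => -(1 / 2 : ℝ) •
      (fderiv ℝ (fun y => φ ((extChartAt (𝓡 (2 * m + 1)) p).symm y)) z).comp
        (endLoc σ.Φ p z)) (extChartAt (𝓡 (2 * m + 1)) p p)) := by
      have h1 : (σ.dc φ).loc p =ᶠ[nhds (extChartAt (𝓡 (2 * m + 1)) p p)] _ :=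
        Filter.eventually_of_mem hmem fun y hy => σ.loc_dc hφ.1 p hy
      rw [← h1.fderiv_eq]
      exact d_eq _ (σ.isSmooth_dc hφ.1) p
    have e1 : endLoc σ.Φ p (extChartAt (𝓡 (2 * m + 1)) p p) = σ.phi p := endLoc_self σ.Φ p
    have e2 : fieldLoc σ.ξ p (extChartAt (𝓡 (2 * m + 1)) p p) = σ.xi p := fieldLoc_self σ.ξ p
    intro X Y
    rw [h0, ← e1]
    refine invariant_of_normal (η := σ.η.loc p) (ξ := fieldLoc σ.ξ p)
      (ν := fun X Y => σ.deta p ![X, Y])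
      (((contDiffOn_comp_chart_symm hφ.1 p).contDiffAt hmem).of_le (WithTop.coe_le_coe.2 le_top))
      (((σ.contDiffOn_Φ p).contDiffAt hmem).differentiableAt (by simp))
      (differentiableAt_loc σ.isSmooth_η p hm)
      (((σ.contDiffOn_ξ p).contDiffAt hmem).differentiableAt (by simp))
      (Filter.eventually_of_mem hmem fun y hy => (σ.isAlmostContact_loc p hy).Φ_Φ) ?_
      (Filter.eventually_of_mem hmem fun y hy => σ.fderiv_ξ hφ p hy) ?_ X Y
    · rw [e1, e2, hc.Φ_ξ]
    · rw [e1, e2]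
      exact σ.normal_chart p
  refine ⟨fun Y => ?_, hinv⟩
  rw [← hinv, hc.Φ_ξ, ← bilCLM_apply, map_zero, zero_apply]

theorem isTransverse_omega {φ : S → ℝ} (hφ : σ.IsBasic φ) (p : S) :
    IsTransverse (σ.xi p) (σ.phi p) (σ.omega φ p) := by
  rw [σ.omega_eq hφ.1]
  exact (σ.isPositive_deta p).toIsTransverse.add (σ.isTransverse_ddc hφ p)

/-- Type (1,1) and horizontality hold for every basic function, so positivity on ker η is the only
condition. -/
theorem mem_potentials_iff {φ : S → ℝ} : φ ∈ σ.potentials ↔ σ.IsBasic φ ∧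
    ∀ p, IsPositive (σ.xi p) (σ.eta p) (σ.phi p) (σ.omega φ p) :=
  ⟨fun h => ⟨h.1, fun p => ⟨σ.isTransverse_omega h.1 p, h.2 p⟩⟩,
    fun h => ⟨h.1, fun p => (h.2 p).pos⟩⟩

end SasakianStructure

/-! ### Integration of forms as integration against a finite measure. -/

section VolumeMeasure

/-- The standard basis of the model space. -/
def stdBasis (n : ℕ) : Module.Basis (Fin n) ℝ (Model n) :=
  (EuclideanSpace.basisFun (Fin n) ℝ).toBasis

variable {n : ℕ} {S : Type*} [TopologicalSpace S] [ChartedSpace (EuclideanSpace ℝ (Fin n)) S]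

/-- The value of a form of top degree on the standard basis. -/
def topCoeff (α : DForm n S n) (p : S) : ℝ :=
  (show Model n [⋀^Fin n]→L[ℝ] ℝ from α p) (stdBasis n)

theorem coeff_eq (α : DForm n S n) (x : S) (y : Model n) :
    α.coeff x y = α.inChart x y (stdBasis n) := by
  rw [DForm.coeff, stdBasis, OrthonormalBasis.coe_toBasis]

theorem coeff_eq_det_mul (α : DForm n S n) (x : S) (y : Model n) :
    α.coeff x y = (chartInv x y).det * topCoeff α ((extChartAt (𝓡 n) x).symm y) := by
  rw [coeff_eq]
  exact topForm_comp_basis (stdBasis n) _ (chartInv x y)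

/-- `topCoeff` is taken on the fixed basis of the model space, that is in the preferred chart at
each point, so it need not be continuous in the point. Ratios of two such coefficients are honest
functions, and only these are used. -/
theorem coeff_eq_mul {α ν : DForm n S n} {r : S → ℝ} (h : ∀ p, topCoeff α p = r p * topCoeff ν p)
    (x : S) (y : Model n) :
    α.coeff x y = r ((extChartAt (𝓡 n) x).symm y) * ν.coeff x y := by
  rw [coeff_eq_det_mul, coeff_eq_det_mul, h]
  ring

variable [IsManifold (𝓡 n) ∞ S]

theorem coeff_transition (ν : DForm n S n) (x x' : S) {y : Model n}
    (hy : y ∈ (extChartAt (𝓡 n) x).target)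
    (hy' : (extChartAt (𝓡 n) x).symm y ∈ (extChartAt (𝓡 n) x').source) :
    ν.coeff x y = (fderiv ℝ (transition x x') y).det * ν.coeff x' (transition x x' y) := by
  rw [coeff_eq, coeff_eq, inChart_transition ν x x' hy hy']
  exact topForm_comp_basis (stdBasis n) _ _

/-- Volume forms with continuous coefficients. -/
structure IsVolumeForm (ν : DForm n S n) : Prop where
  continuousOn : ∀ x, ContinuousOn (ν.coeff x) (extChartAt (𝓡 n) x).target
  ne_zero : ∀ p, topCoeff ν p ≠ 0

theorem IsVolumeForm.coeff_ne_zero {ν : DForm n S n} (hν : IsVolumeForm ν) (x : S) {y : Model n}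
    (hy : y ∈ (extChartAt (𝓡 n) x).target) : ν.coeff x y ≠ 0 := by
  rw [coeff_eq_det_mul]
  exact mul_ne_zero (det_chartInv_ne_zero x hy) (hν.ne_zero _)

theorem isCompact_chart_image [CompactSpace S] {h : S → ℝ} (x : S)
    (hs : tsupport h ⊆ (extChartAt (𝓡 n) x).source) :
    IsCompact (extChartAt (𝓡 n) x '' tsupport h) :=
  (isClosed_tsupport h).isCompact.image_of_continuousOn
    ((continuousOn_extChartAt x).mono hs)

theorem eq_zero_of_notMem_chart_image {h : S → ℝ} (x : S) {y : Model n}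
    (hy : y ∈ (extChartAt (𝓡 n) x).target) (hy' : y ∉ extChartAt (𝓡 n) x '' tsupport h) :
    h ((extChartAt (𝓡 n) x).symm y) = 0 := by
  by_contra hne
  exact hy' ⟨_, subset_tsupport _ hne, (extChartAt (𝓡 n) x).right_inv hy⟩

theorem continuousOn_comp_symm {F : Type*} [TopologicalSpace F] {h : S → F} (hh : Continuous h)
    (x : S) : ContinuousOn (fun y => h ((extChartAt (𝓡 n) x).symm y))
      (extChartAt (𝓡 n) x).target :=
  hh.comp_continuousOn (continuousOn_extChartAt_symm x)

theorem integrableOn_target [CompactSpace S] {h : S → ℝ} (hh : Continuous h) (x : S)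
    (hs : tsupport h ⊆ (extChartAt (𝓡 n) x).source) {w : Model n → ℝ}
    (hw : ContinuousOn w (extChartAt (𝓡 n) x).target) :
    IntegrableOn (fun y => h ((extChartAt (𝓡 n) x).symm y) * w y) (extChartAt (𝓡 n) x).target := by
  have hK := isCompact_chart_image x hs
  have hKt : extChartAt (𝓡 n) x '' tsupport h ⊆ (extChartAt (𝓡 n) x).target := by
    rintro _ ⟨p, hp, rfl⟩
    exact (extChartAt (𝓡 n) x).map_source (hs hp)
  have h1 : IntegrableOn (fun y => h ((extChartAt (𝓡 n) x).symm y) * w y)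
      (extChartAt (𝓡 n) x '' tsupport h) :=
    (((continuousOn_comp_symm hh x).mul hw).mono hKt).integrableOn_compact hK
  refine h1.of_forall_diff_eq_zero (isOpen_target x).measurableSet fun y hy => ?_
  rw [eq_zero_of_notMem_chart_image x hy.1 hy.2, zero_mul]

/-- The integral over two charts of a function supported in both. -/
theorem integral_target_eq (ν : DForm n S n) (x x' : S) {k : S → ℝ}
    (hk : Function.support k ⊆ (extChartAt (𝓡 n) x).source)
    (hk' : Function.support k ⊆ (extChartAt (𝓡 n) x').source) :
    ∫ y in (extChartAt (𝓡 n) x').target, |ν.coeff x' y| * k ((extChartAt (𝓡 n) x').symm y) =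
      ∫ y in (extChartAt (𝓡 n) x).target, |ν.coeff x y| * k ((extChartAt (𝓡 n) x).symm y) := by
  let A : S → S → Set (Model n) := fun x x' =>
    (extChartAt (𝓡 n) x).target ∩ (extChartAt (𝓡 n) x).symm ⁻¹' (extChartAt (𝓡 n) x').source
  have hA : ∀ x x' : S, MeasurableSet (A x x') := fun x x' =>
    ((continuousOn_extChartAt_symm x).isOpen_inter_preimage (isOpen_target x)
      (isOpen_extChartAt_source x')).measurableSet
  have hres : ∀ x x' : S, Function.support k ⊆ (extChartAt (𝓡 n) x').source →
      ∫ y in (extChartAt (𝓡 n) x).target, |ν.coeff x y| * k ((extChartAt (𝓡 n) x).symm y) =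
        ∫ y in A x x', |ν.coeff x y| * k ((extChartAt (𝓡 n) x).symm y) := by
    intro x x' hk
    apply setIntegral_eq_of_subset_of_forall_sdiff_eq_zero (isOpen_target (n := n) x).measurableSet
      (t := (extChartAt (𝓡 n) x).target) (s := A x x') inter_subset_left
    intro y hy
    by_contra hne
    exact hy.2 ⟨hy.1, hk (right_ne_zero_of_mul hne)⟩
  rw [hres x' x hk, hres x x' hk']
  have himg : transition x x' '' A x x' = A x' x := by
    ext z
    constructor
    · rintro ⟨y, ⟨hy, hy'⟩, rfl⟩
      refine ⟨transition_mem_target x x' hy', ?_⟩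
      rw [mem_preimage, symm_transition x x' hy']
      exact (extChartAt (𝓡 n) x).map_target hy
    · rintro ⟨hz, hz'⟩
      refine ⟨transition x' x z, ⟨transition_mem_target x' x hz', ?_⟩, ?_⟩
      · rw [mem_preimage, symm_transition x' x hz']
        exact (extChartAt (𝓡 n) x').map_target hz
      · rw [transition, symm_transition x' x hz']
        exact (extChartAt (𝓡 n) x').right_inv hz
  have hinj : InjOn (transition x x') (A x x') := by
    intro y hy z hz hyz
    have := congrArg (extChartAt (𝓡 n) x').symm hyz
    rw [symm_transition x x' hy.2, symm_transition x x' hz.2] at this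
    exact (extChartAt (𝓡 n) x).symm.injOn hy.1 hz.1 this
  -- Change of variables by the transition map; its Jacobian is the factor by which the coefficient
  -- of ν changes.
  rw [← himg, integral_image_eq_integral_abs_det_fderiv_smul volume (hA x x')
    (fun y hy => (((contDiffAt_transition x x' hy.1 hy.2).differentiableAt
      (by simp)).hasFDerivAt).hasFDerivWithinAt) hinj]
  refine setIntegral_congr_fun (hA x x') fun y hy => ?_
  rw [coeff_transition ν x x' hy.1 hy.2, abs_mul, symm_transition x x' hy.2, smul_eq_mul, mul_assoc]

variable [CompactSpace S] [T2Space S]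

theorem finite_chartPartition : {x : S | ∃ p, chartPartition n S x p ≠ 0}.Finite := by
  have h := (chartPartition n S).locallyFinite.finite_nonempty_of_compact
  refine h.subset ?_
  rintro x ⟨p, hp⟩
  exact ⟨p, hp⟩

variable (n S) in
/-- The indices of the charts that meet the support of the partition of unity. -/
def chartIndices : Finset S := (finite_chartPartition (n := n) (S := S)).toFinset

theorem chartPartition_eq_zero {x : S} (hx : x ∉ chartIndices n S) (p : S) :
    chartPartition n S x p = 0 := by
  by_contra h
  exact hx ((finite_chartPartition (n := n) (S := S)).mem_toFinset.2 ⟨p, h⟩)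

theorem sum_chartPartition (p : S) : ∑ x ∈ chartIndices n S, chartPartition n S x p = 1 := by
  have h := (chartPartition n S).sum_eq_one (mem_univ p)
  rw [← h]
  refine (finsum_eq_sum_of_support_subset _ fun x hx => ?_).symm
  by_contra hx'
  exact hx (chartPartition_eq_zero hx' p)

theorem tsupport_chartPartition (x : S) :
    tsupport (chartPartition n S x) ⊆ (extChartAt (𝓡 n) x).source := by
  rw [extChartAt_source]
  exact (SmoothPartitionOfUnity.exists_isSubordinate_chartAt_source (𝓡 n) S).choose_spec x

theorem continuous_chartPartition (x : S) : Continuous (chartPartition n S x) :=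
  (chartPartition n S x).2.continuous

/-- The density of the volume measure in a chart. -/
def chartDensity (ν : DForm n S n) (x : S) (y : Model n) : ℝ :=
  chartPartition n S x ((extChartAt (𝓡 n) x).symm y) * |ν.coeff x y|

theorem chartDensity_nonneg (ν : DForm n S n) (x : S) (y : Model n) : 0 ≤ chartDensity ν x y :=
  mul_nonneg ((chartPartition n S).nonneg x _) (abs_nonneg _)

variable [MeasurableSpace S] [BorelSpace S]

/-- The part of the volume measure in a chart. -/
def chartMeasure (ν : DForm n S n) (x : S) : Measure S :=
  ((volume.restrict (extChartAt (𝓡 n) x).target).withDensity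
    fun y => ENNReal.ofReal (chartDensity ν x y)).map (extChartAt (𝓡 n) x).symm

/-- The measure of integration against a volume form. -/
def volMeasure (ν : DForm n S n) : Measure S := ∑ x ∈ chartIndices n S, chartMeasure ν x

variable {ν : DForm n S n}

theorem IsVolumeForm.continuousOn_chartDensity (hν : IsVolumeForm ν) (x : S) :
    ContinuousOn (chartDensity ν x) (extChartAt (𝓡 n) x).target :=
  (continuousOn_comp_symm (continuous_chartPartition x) x).mul (hν.continuousOn x).abs

theorem aemeasurable_chart_symm (x : S) :
    AEMeasurable (extChartAt (𝓡 n) x).symm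
      (volume.restrict (extChartAt (𝓡 n) x).target) :=
  (continuousOn_extChartAt_symm x).aemeasurable (isOpen_target x).measurableSet

theorem IsVolumeForm.aemeasurable_density (hν : IsVolumeForm ν) (x : S) :
    AEMeasurable (fun y => ENNReal.ofReal (chartDensity ν x y))
      (volume.restrict (extChartAt (𝓡 n) x).target) :=
  ((hν.continuousOn_chartDensity x).aemeasurable (isOpen_target x).measurableSet).ennreal_ofReal

theorem IsVolumeForm.integrableOn_chartDensity (hν : IsVolumeForm ν) (x : S) :
    IntegrableOn (chartDensity ν x) (extChartAt (𝓡 n) x).target :=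
  integrableOn_target (continuous_chartPartition x) x (tsupport_chartPartition x)
    (hν.continuousOn x).abs

theorem IsVolumeForm.isFiniteMeasure_chartMeasure (hν : IsVolumeForm ν) (x : S) :
    IsFiniteMeasure (chartMeasure ν x) := by
  have : IsFiniteMeasure ((volume.restrict (extChartAt (𝓡 n) x).target).withDensity
      fun y => ENNReal.ofReal (chartDensity ν x y)) :=
    isFiniteMeasure_withDensity_ofReal (hν.integrableOn_chartDensity x).2
  exact Measure.isFiniteMeasure_map _ _

theorem IsVolumeForm.isFiniteMeasure (hν : IsVolumeForm ν) : IsFiniteMeasure (volMeasure ν) := by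
  constructor
  rw [volMeasure, Measure.finsetSum_apply]
  refine ENNReal.sum_lt_top.2 fun x _ => ?_
  have := hν.isFiniteMeasure_chartMeasure x
  exact measure_lt_top _ _

theorem IsVolumeForm.integral_chartMeasure (hν : IsVolumeForm ν) {F : Type*}
    [NormedAddCommGroup F] [NormedSpace ℝ F] [SecondCountableTopology F] {k : S → F}
    (hk : Continuous k) (x : S) : ∫ p, k p ∂chartMeasure ν x =
      ∫ y in (extChartAt (𝓡 n) x).target, chartDensity ν x y • k ((extChartAt (𝓡 n) x).symm y) := by
  rw [chartMeasure, integral_map ((aemeasurable_chart_symm x).mono_ac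
      (withDensity_absolutelyContinuous _ _)) hk.aestronglyMeasurable,
    integral_withDensity_eq_integral_toReal_smul₀ (hν.aemeasurable_density x) (by simp)]
  simp only [ENNReal.toReal_ofReal (chartDensity_nonneg ν x _)]

theorem integrable_of_continuous {F : Type*}
    [NormedAddCommGroup F] [SecondCountableTopology F] {k : S → F}
    (hk : Continuous k) {μ : Measure S} [IsFiniteMeasure μ] : Integrable k μ := by
  obtain ⟨C, hC⟩ := isCompact_univ.exists_bound_of_continuousOn hk.continuousOn
  exact Integrable.of_bound hk.aestronglyMeasurable C (Filter.Eventually.of_forall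
    fun p => hC p (mem_univ p))

theorem IsVolumeForm.integral_eq_sum (hν : IsVolumeForm ν) {F : Type*}
    [NormedAddCommGroup F] [NormedSpace ℝ F] [SecondCountableTopology F] {k : S → F}
    (hk : Continuous k) : ∫ p, k p ∂volMeasure ν = ∑ x ∈ chartIndices n S,
      ∫ y in (extChartAt (𝓡 n) x).target,
        chartDensity ν x y • k ((extChartAt (𝓡 n) x).symm y) := by
  rw [volMeasure, integral_finsetSum_measure]
  · exact Finset.sum_congr rfl fun x _ => hν.integral_chartMeasure hk x
  · intro x _
    have := hν.isFiniteMeasure_chartMeasure x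
    exact integrable_of_continuous hk

/-- Integration of forms as integration against a measure. -/
theorem IsVolumeForm.formIntegral_eq (hν : IsVolumeForm ν) {F : Type*}
    [NormedAddCommGroup F] [NormedSpace ℝ F] [SecondCountableTopology F] {f : S → F}
    (hf : Continuous f) {α : DForm n S n} {r : S → ℝ} (hr : Continuous r)
    (h : ∀ p, topCoeff α p = r p * topCoeff ν p) :
    formIntegral ν f α = ∫ p, r p • f p ∂volMeasure ν := by
  rw [hν.integral_eq_sum (k := fun p => r p • f p) (hr.smul hf), formIntegral]
  have hsum : ∀ x : S, (∫ y in (extChartAt (𝓡 n) x).target,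
      (chartPartition n S x ((extChartAt (𝓡 n) x).symm y) *
        (SignType.sign (ν.coeff x y) : ℝ) * α.coeff x y) • f ((extChartAt (𝓡 n) x).symm y)) =
      ∫ y in (extChartAt (𝓡 n) x).target, chartDensity ν x y •
        (r ((extChartAt (𝓡 n) x).symm y) • f ((extChartAt (𝓡 n) x).symm y)) := by
    intro x
    refine integral_congr_ae (Filter.Eventually.of_forall fun y => ?_)
    simp only
    -- The orientation sign turns the coefficient of ν into its absolute value, so the orientation
    -- disappears from the density.
    rw [coeff_eq_mul h, smul_smul, chartDensity, ← sign_mul_self (ν.coeff x y)]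
    congr 1
    ring
  rw [finsum_congr hsum]
  refine finsum_eq_sum_of_support_subset _ fun x hx => ?_
  by_contra hx'
  refine hx ?_
  simp [chartDensity, chartPartition_eq_zero hx']

/-- The integral of a function supported in a chart. -/
theorem IsVolumeForm.integral_eq_chart (hν : IsVolumeForm ν) {k : S → ℝ} (hk : Continuous k) (x : S)
    (hs : tsupport k ⊆ (extChartAt (𝓡 n) x).source) :
    ∫ p, k p ∂volMeasure ν = ∫ y in (extChartAt (𝓡 n) x).target,
      |ν.coeff x y| * k ((extChartAt (𝓡 n) x).symm y) := by
  rw [hν.integral_eq_sum hk]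
  -- Each piece of the partition of unity times k is supported in both charts, so its integral can
  -- be moved to the chart at x, where the pieces add up to k.
  have h1 : ∀ x' : S, (∫ y in (extChartAt (𝓡 n) x').target, chartDensity ν x' y •
      k ((extChartAt (𝓡 n) x').symm y)) = ∫ y in (extChartAt (𝓡 n) x).target,
      |ν.coeff x y| * (chartPartition n S x' ((extChartAt (𝓡 n) x).symm y) *
        k ((extChartAt (𝓡 n) x).symm y)) := by
    intro x'
    rw [← integral_target_eq ν x x' (k := fun p => chartPartition n S x' p * k p)]
    · refine integral_congr_ae (Filter.Eventually.of_forall fun y => ?_)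
      simp only [chartDensity, smul_eq_mul]
      ring
    · exact fun p hp => hs (subset_tsupport _ (right_ne_zero_of_mul hp))
    · exact fun p hp => tsupport_chartPartition x' (subset_tsupport _ (left_ne_zero_of_mul hp))
  rw [Finset.sum_congr rfl fun x' _ => h1 x', ← integral_finsetSum]
  · refine integral_congr_ae (Filter.Eventually.of_forall fun y => ?_)
    simp only
    rw [← Finset.mul_sum, ← Finset.sum_mul, sum_chartPartition, one_mul]
  · intro x' _
    have hc : Continuous fun p => chartPartition n S x' p * k p :=
      (continuous_chartPartition x').mul hk
    have ht : tsupport (fun p => chartPartition n S x' p * k p) ⊆ (extChartAt (𝓡 n) x).source :=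
      (closure_mono fun p hp => right_ne_zero_of_mul hp).trans hs
    refine (integrableOn_target hc x ht (hν.continuousOn x).abs).congr
      (Filter.Eventually.of_forall fun y => ?_)
    simp only
    ring

/-- Some function of the partition is positive at a given point of the open set. Near the image of
that point the chart density is positive, so a null set would contain a non-empty open set of the
model space. -/
theorem IsVolumeForm.isOpenPosMeasure (hν : IsVolumeForm ν) :
    (volMeasure ν).IsOpenPosMeasure := by
  constructor
  rintro U hU ⟨p, hp⟩ h0
  obtain ⟨x, hx, hxp⟩ : ∃ x ∈ chartIndices n S, chartPartition n S x p ≠ 0 := by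
    by_contra! hcon
    have := sum_chartPartition (n := n) p
    rw [Finset.sum_eq_zero hcon] at this
    exact zero_ne_one this
  have hps : p ∈ (extChartAt (𝓡 n) x).source :=
    tsupport_chartPartition x (subset_tsupport _ hxp)
  rw [volMeasure, Measure.finsetSum_apply, Finset.sum_eq_zero_iff] at h0
  have h1 := h0 x hx
  rw [chartMeasure, Measure.map_apply_of_aemeasurable ((aemeasurable_chart_symm x).mono_ac
      (withDensity_absolutelyContinuous _ _)) hU.measurableSet] at h1
  have h2 := (withDensity_apply_eq_zero' (hν.aemeasurable_density x)).1 h1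
  set W := (extChartAt (𝓡 n) x).target ∩
    (extChartAt (𝓡 n) x).symm ⁻¹' (U ∩ {q | chartPartition n S x q ≠ 0})
  have hW : IsOpen W := (continuousOn_extChartAt_symm x).isOpen_inter_preimage (isOpen_target x)
    (hU.inter ((continuous_chartPartition x).isOpen_preimage _ isOpen_ne))
  have hWne : W.Nonempty := ⟨extChartAt (𝓡 n) x p, (extChartAt (𝓡 n) x).map_source hps, by
    rw [mem_preimage, (extChartAt (𝓡 n) x).left_inv hps]; exact ⟨hp, hxp⟩⟩
  have h3 := hW.measure_pos volume hWne
  have h4 : volume.restrict (extChartAt (𝓡 n) x).target W = 0 := by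
    refine measure_mono_null ?_ h2
    rintro y ⟨hy, hyU, hyρ⟩
    refine ⟨?_, hyU⟩
    have : 0 < chartDensity ν x y := mul_pos (lt_of_le_of_ne ((chartPartition n S).nonneg x _)
      (Ne.symm hyρ)) (abs_pos.2 (hν.coeff_ne_zero x hy))
    simpa using this
  rw [Measure.restrict_apply hW.measurableSet, inter_eq_left.2 inter_subset_left] at h4
  exact h3.ne' h4

end VolumeMeasure

/-! ### Smoothness of top coefficients along smooth data. -/

section SmoothValues

variable {E F : Type*} [NormedAddCommGroup E] [NormedSpace ℝ E] [NormedAddCommGroup F]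
  [NormedSpace ℝ F] {m : ℕ} (b : Module.Basis (Fin (2 * m + 1)) ℝ E) {U : Set F}
  {θ κ : F → E [⋀^Fin 2]→L[ℝ] ℝ} {η : F → E →L[ℝ] ℝ}

theorem contDiffOn_topVal (hθ : ContDiffOn ℝ ∞ θ U) (hη : ContDiffOn ℝ ∞ η U) :
    ContDiffOn ℝ ∞ (fun y => topVal b (θ y) (η y)) U :=
  ContDiff.comp_contDiffOn
    (g := fun q : (E [⋀^Fin 2]→L[ℝ] ℝ) × (E →L[ℝ] ℝ) => topVal b q.1 q.2)
    (f := fun y => (θ y, η y)) (contDiff_topVal b) (hθ.prodMk hη)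

theorem contDiffOn_topDeriv (hθ : ContDiffOn ℝ ∞ θ U) (hη : ContDiffOn ℝ ∞ η U)
    (hκ : ContDiffOn ℝ ∞ κ U) : ContDiffOn ℝ ∞ (fun y => topDeriv b (θ y) (η y) (κ y)) U :=
  ContDiff.comp_contDiffOn
    (g := fun q : (E [⋀^Fin 2]→L[ℝ] ℝ) × (E →L[ℝ] ℝ) × (E [⋀^Fin 2]→L[ℝ] ℝ) =>
      topDeriv b q.1 q.2.1 q.2.2)
    (f := fun y => (θ y, η y, κ y)) (contDiff_topDeriv b) (hθ.prodMk (hη.prodMk hκ))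

end SmoothValues

/-! ### Fields of 2-forms in charts, and extension of functions by zero. -/

section FormsInCharts

variable {n : ℕ} {S : Type*} [TopologicalSpace S] [ChartedSpace (EuclideanSpace ℝ (Fin n)) S]

/-- A field of `2`-forms, in the preferred chart at `x`. -/
def formLoc (α : S → Model n [⋀^Fin 2]→L[ℝ] ℝ) (x : S) (y : Model n) :
    Model n [⋀^Fin 2]→L[ℝ] ℝ :=
  (α ((extChartAt (𝓡 n) x).symm y)).compContinuousLinearMap (chartInv x y)

/-- Smooth fields of `2`-forms. -/
def IsSmoothForm (α : S → Model n [⋀^Fin 2]→L[ℝ] ℝ) : Prop :=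
  ∀ x : S, ContDiffOn ℝ ∞ (formLoc α x) (extChartAt (𝓡 n) x).target

variable [IsManifold (𝓡 n) ∞ S]

theorem OneForm.IsSmooth.formLoc_dAt {β : OneForm n S} (hβ : β.IsSmooth) (x : S) {y : Model n}
    (hy : y ∈ (extChartAt (𝓡 n) x).target) :
    formLoc β.dAt x y = alt₂ (fderiv ℝ (β.loc x) y) := hβ.inChart_d x hy

theorem OneForm.IsSmooth.isSmoothForm {β : OneForm n S} (hβ : β.IsSmooth) :
    IsSmoothForm β.dAt := hβ.contDiffOn_d

theorem dAt_grad {f : S → ℝ} (hf : ContMDiff (𝓡 n) 𝓘(ℝ, ℝ) ∞ f) (p : S) :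
    OneForm.dAt (n := n) (grad f) p = 0 := by
  have hmem := (isOpen_target p).mem_nhds (mem_extChartAt_target (I := 𝓡 n) p)
  have h : OneForm.loc (n := n) (grad f) p =ᶠ[nhds (extChartAt (𝓡 n) p p)] _ :=
    Filter.eventually_of_mem hmem fun y hy => loc_grad hf p hy
  have hs : IsSymmSndFDerivAt ℝ (fun y => f ((extChartAt (𝓡 n) p).symm y))
      (extChartAt (𝓡 n) p p) :=
    (((contDiffOn_comp_chart_symm hf p).contDiffAt hmem).of_le
      (WithTop.coe_le_coe.2 le_top)).isSymmSndFDerivAt (n := 2) (by simp)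
  rw [d_eq _ (isSmooth_grad hf), h.fderiv_eq]
  refine two_form_ext fun X Y => ?_
  rw [alt₂_apply, hs.eq X Y, sub_self]
  rfl

theorem dif_sum {ι : Type*} (s : Finset ι) {f : ι → S → ℝ}
    (hf : ∀ i, ContMDiff (𝓡 n) 𝓘(ℝ, ℝ) ∞ (f i)) (p : S) :
    dif (n := n) (fun q => ∑ i ∈ s, f i q) p = ∑ i ∈ s, dif (f i) p := by
  have hm := (isOpen_target p).mem_nhds (mem_extChartAt_target (I := 𝓡 n) p)
  have hs : ContMDiff (𝓡 n) 𝓘(ℝ, ℝ) ∞ (fun q => ∑ i ∈ s, f i q) :=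
    contMDiff_finsetSum fun i _ => hf i
  rw [dif_eq_fderiv hs, Finset.sum_congr rfl fun i _ => dif_eq_fderiv (hf i) p]
  exact fderiv_fun_sum fun i _ => ((contDiffOn_comp_chart_symm (hf i) p).contDiffAt
    hm).differentiableAt (by simp)

/-- The extension by zero of a function supported in a chart. -/
theorem exists_chart_extension [CompactSpace S] {f : S → ℝ}
    (hf : ContMDiff (𝓡 n) 𝓘(ℝ, ℝ) ∞ f) (x : S) (hs : tsupport f ⊆ (extChartAt (𝓡 n) x).source) :
    ∃ g : Model n → ℝ, ContDiff ℝ ∞ g ∧ HasCompactSupport g ∧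
      tsupport g ⊆ (extChartAt (𝓡 n) x).target ∧
      EqOn g (fun y => f ((extChartAt (𝓡 n) x).symm y)) (extChartAt (𝓡 n) x).target := by
  have hK := isCompact_chart_image x hs
  have hKt : extChartAt (𝓡 n) x '' tsupport f ⊆ (extChartAt (𝓡 n) x).target := by
    rintro _ ⟨p, hp, rfl⟩
    exact (extChartAt (𝓡 n) x).map_source (hs hp)
  let g := indicator (extChartAt (𝓡 n) x).target fun y => f ((extChartAt (𝓡 n) x).symm y)
  have hg : EqOn g (fun y => f ((extChartAt (𝓡 n) x).symm y)) (extChartAt (𝓡 n) x).target :=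
    fun y hy => indicator_of_mem hy _
  have h0 : ∀ y ∉ extChartAt (𝓡 n) x '' tsupport f, g y = 0 := by
    intro y hy
    by_cases hyt : y ∈ (extChartAt (𝓡 n) x).target
    · rw [hg hyt]
      exact eq_zero_of_notMem_chart_image x hyt hy
    · exact indicator_of_notMem hyt _
  have hsupp : tsupport g ⊆ extChartAt (𝓡 n) x '' tsupport f :=
    closure_minimal (fun y hy => by_contra fun h => hy (h0 y h)) hK.isClosed
  refine ⟨g, ?_, hK.of_isClosed_subset (isClosed_tsupport g) hsupp, hsupp.trans hKt, hg⟩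
  rw [contDiff_iff_contDiffAt]
  intro y
  by_cases hy : y ∈ extChartAt (𝓡 n) x '' tsupport f
  · have hm := (isOpen_target x).mem_nhds (hKt hy)
    exact ((contDiffOn_comp_chart_symm hf x).contDiffAt hm).congr_of_eventuallyEq
      (Filter.eventually_of_mem hm hg)
  · exact contDiffAt_const.congr_of_eventuallyEq
      (Filter.eventually_of_mem (hK.isClosed.isOpen_compl.mem_nhds hy) h0)

end FormsInCharts

/-! ### The densities of (dη_φ)^m ∧ η and of its variation. -/

namespace SasakianStructure

variable {m : ℕ} {S : Type*} [TopologicalSpace S]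
  [ChartedSpace (EuclideanSpace ℝ (Fin (2 * m + 1))) S] [IsManifold (𝓡 (2 * m + 1)) ∞ S]
  (σ : SasakianStructure m S)

/-- The coefficient of `(dη)^m ∧ η` on the standard basis. -/
def base (p : S) : ℝ := topVal (stdBasis (2 * m + 1)) (σ.deta p) (σ.eta p)

/-- The density of `(dη_φ)^m ∧ η` with respect to `(dη)^m ∧ η`. -/
def dens (φ : S → ℝ) (p : S) : ℝ :=
  topVal (stdBasis (2 * m + 1)) (σ.omega φ p) (σ.eta p) / σ.base p

/-- The density of `m (dη_φ)^(m-1) ∧ κ ∧ η` with respect to `(dη)^m ∧ η`. -/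
def densDeriv (φ : S → ℝ) (κ : S → Model (2 * m + 1) [⋀^Fin 2]→L[ℝ] ℝ) (p : S) : ℝ :=
  topDeriv (stdBasis (2 * m + 1)) (σ.omega φ p) (σ.eta p) (κ p) / σ.base p

theorem base_ne_zero (p : S) : σ.base p ≠ 0 :=
  (σ.isAlmostContact p).topVal_ne_zero (σ.isPositive_deta p) _

theorem dens_pos {φ : S → ℝ} (hφ : φ ∈ σ.potentials) (p : S) : 0 < σ.dens φ p :=
  (σ.isAlmostContact p).topVal_div_pos (σ.isPositive_deta p)
    ((σ.mem_potentials_iff.1 hφ).2 p) _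

theorem topCoeff_vol (p : S) : topCoeff σ.vol p = σ.base p := by
  have h : σ.vol p = wedge (σ.η.toDForm.d.wpow m p) (σ.η.toDForm p) := rfl
  rw [topCoeff, h, wpow_eq_pw]
  rfl

theorem topCoeff_volOf (φ : S → ℝ) (p : S) :
    topCoeff (σ.volOf φ) p = σ.dens φ p * topCoeff σ.vol p := by
  have h : σ.volOf φ p = wedge ((σ.omegaOf φ).wpow m p) (σ.η.toDForm p) := rfl
  rw [topCoeff_vol, dens, div_mul_cancel₀ _ (σ.base_ne_zero p), topCoeff, h, wpow_eq_pw]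
  rfl

/-- Wedging with η_φ instead of η changes nothing: d^c φ and dη_φ are both horizontal, so (dη_φ)^m ∧
d^c φ = 0. This is what links L, which uses η_φ, with J. -/
theorem topCoeff_volOf' {φ : S → ℝ} (hφ : σ.IsBasic φ) (p : S) :
    topCoeff (σ.volOf' φ) p = σ.dens φ p * topCoeff σ.vol p := by
  have h : σ.volOf' φ p = wedge ((σ.omegaOf φ).wpow m p) ((σ.etaOf φ).toDForm p) := rfl
  rw [topCoeff_vol, dens, div_mul_cancel₀ _ (σ.base_ne_zero p), topCoeff, h, wpow_eq_pw]
  have h0 : topVal (stdBasis (2 * m + 1)) (σ.omega φ p) (σ.dc φ p) = 0 :=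
    topVal_eq_zero_of_horizontal (σ.isTransverse_omega hφ p).left (σ.xi_ne_zero p) (σ.dc_ξ hφ p) _
  have h1 := topVal_add_right (stdBasis (2 * m + 1)) (σ.omega φ p) (σ.eta p) (σ.dc φ p)
  rw [h0, add_zero] at h1
  exact h1

theorem topCoeff_volDiff (φ φ' : S → ℝ) (p : S) :
    topCoeff (σ.volDiff φ φ') p = (σ.dens φ p - σ.dens φ' p) * topCoeff σ.vol p := by
  have h : σ.volDiff φ φ' p =
    wedge ((σ.omegaOf φ).wpow m p - (σ.omegaOf φ').wpow m p) (σ.η.toDForm p) := rfl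
  rw [sub_mul, ← topCoeff_volOf, ← topCoeff_volOf, topCoeff, h, wedge_sub_left]
  rfl

variable {σ}

theorem contDiffOn_topVal_loc {α : S → Model (2 * m + 1) [⋀^Fin 2]→L[ℝ] ℝ}
    (hα : IsSmoothForm α) (x : S) : ContDiffOn ℝ ∞ (fun y => topVal (stdBasis (2 * m + 1))
      (formLoc α x y) (σ.η.loc x y)) (extChartAt (𝓡 (2 * m + 1)) x).target :=
  contDiffOn_topVal _ (hα x) (σ.isSmooth_η x)

theorem contDiffOn_topDeriv_loc {α κ : S → Model (2 * m + 1) [⋀^Fin 2]→L[ℝ] ℝ}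
    (hα : IsSmoothForm α) (hκ : IsSmoothForm κ) (x : S) :
    ContDiffOn ℝ ∞ (fun y => topDeriv (stdBasis (2 * m + 1))
      (formLoc α x y) (σ.η.loc x y) (formLoc κ x y)) (extChartAt (𝓡 (2 * m + 1)) x).target :=
  contDiffOn_topDeriv _ (hα x) (σ.isSmooth_η x) (hκ x)

variable (σ)

theorem isSmooth_etaOf {φ : S → ℝ} (hφ : ContMDiff (𝓡 (2 * m + 1)) 𝓘(ℝ, ℝ) ∞ φ) :
    (σ.etaOf φ).IsSmooth := fun x =>
  ((σ.isSmooth_η x).add (σ.isSmooth_dc hφ x)).congr fun _ _ => rfl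

theorem isSmoothForm_deta : IsSmoothForm σ.deta := σ.isSmooth_η.isSmoothForm

theorem isSmoothForm_omega {φ : S → ℝ} (hφ : ContMDiff (𝓡 (2 * m + 1)) 𝓘(ℝ, ℝ) ∞ φ) :
    IsSmoothForm (σ.omega φ) := (σ.isSmooth_etaOf hφ).isSmoothForm

theorem isSmoothForm_ddc {φ : S → ℝ} (hφ : ContMDiff (𝓡 (2 * m + 1)) 𝓘(ℝ, ℝ) ∞ φ) :
    IsSmoothForm (σ.ddc φ) := (σ.isSmooth_dc hφ).isSmoothForm

/-- The coefficient of `(dη)^m ∧ η` in a chart. -/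
def baseLoc (x : S) (y : Model (2 * m + 1)) : ℝ :=
  topVal (stdBasis (2 * m + 1)) (formLoc σ.deta x y) (σ.η.loc x y)

theorem coeff_vol (x : S) (y : Model (2 * m + 1)) : σ.vol.coeff x y = σ.baseLoc x y := by
  rw [coeff_eq_det_mul, topCoeff_vol]
  exact (topVal_comp (stdBasis (2 * m + 1)) _ _ (chartInv x y)).symm

theorem isVolumeForm_vol : IsVolumeForm σ.vol :=
  ⟨fun x => ((contDiffOn_topVal_loc σ.isSmoothForm_deta x).continuousOn).congr
    fun y _ => σ.coeff_vol x y, fun p => by rw [topCoeff_vol]; exact σ.base_ne_zero p⟩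

theorem baseLoc_ne_zero (x : S) {y : Model (2 * m + 1)}
    (hy : y ∈ (extChartAt (𝓡 (2 * m + 1)) x).target) : σ.baseLoc x y ≠ 0 := by
  rw [← coeff_vol]
  exact σ.isVolumeForm_vol.coeff_ne_zero x hy

/-- The determinant of the chart cancels in the quotient. The density can therefore be computed in
any chart, which is how its smoothness is obtained. -/
theorem dens_loc (φ : S → ℝ) (x : S) {y : Model (2 * m + 1)}
    (hy : y ∈ (extChartAt (𝓡 (2 * m + 1)) x).target) :
    σ.dens φ ((extChartAt (𝓡 (2 * m + 1)) x).symm y) = topVal (stdBasis (2 * m + 1))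
      (formLoc (σ.omega φ) x y) (σ.η.loc x y) / σ.baseLoc x y := by
  have h1 := topVal_comp (stdBasis (2 * m + 1)) (σ.omega φ ((extChartAt (𝓡 (2 * m + 1)) x).symm y))
    (σ.eta ((extChartAt (𝓡 (2 * m + 1)) x).symm y)) (chartInv x y)
  have h2 := topVal_comp (stdBasis (2 * m + 1)) (σ.deta ((extChartAt (𝓡 (2 * m + 1)) x).symm y))
    (σ.eta ((extChartAt (𝓡 (2 * m + 1)) x).symm y)) (chartInv x y)
  have h3 : topVal (stdBasis (2 * m + 1)) (formLoc (σ.omega φ) x y) (σ.η.loc x y) = _ := h1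
  have h4 : σ.baseLoc x y = _ := h2
  rw [h3, h4, mul_div_mul_left _ _ (det_chartInv_ne_zero x hy)]
  rfl

theorem densDeriv_loc (φ : S → ℝ) (κ : S → Model (2 * m + 1) [⋀^Fin 2]→L[ℝ] ℝ) (x : S)
    {y : Model (2 * m + 1)} (hy : y ∈ (extChartAt (𝓡 (2 * m + 1)) x).target) :
    σ.densDeriv φ κ ((extChartAt (𝓡 (2 * m + 1)) x).symm y) = topDeriv (stdBasis (2 * m + 1))
      (formLoc (σ.omega φ) x y) (σ.η.loc x y) (formLoc κ x y) / σ.baseLoc x y := by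
  have h1 := topDeriv_comp (stdBasis (2 * m + 1))
    (σ.omega φ ((extChartAt (𝓡 (2 * m + 1)) x).symm y))
    (κ ((extChartAt (𝓡 (2 * m + 1)) x).symm y))
    (σ.eta ((extChartAt (𝓡 (2 * m + 1)) x).symm y)) (chartInv x y)
  have h2 := topVal_comp (stdBasis (2 * m + 1)) (σ.deta ((extChartAt (𝓡 (2 * m + 1)) x).symm y))
    (σ.eta ((extChartAt (𝓡 (2 * m + 1)) x).symm y)) (chartInv x y)
  have h3 : topDeriv (stdBasis (2 * m + 1)) (formLoc (σ.omega φ) x y) (σ.η.loc x y)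
    (formLoc κ x y) = _ := h1
  have h4 : σ.baseLoc x y = _ := h2
  rw [h3, h4, mul_div_mul_left _ _ (det_chartInv_ne_zero x hy)]
  rfl

theorem contMDiff_dens {φ : S → ℝ} (hφ : ContMDiff (𝓡 (2 * m + 1)) 𝓘(ℝ, ℝ) ∞ φ) :
    ContMDiff (𝓡 (2 * m + 1)) 𝓘(ℝ, ℝ) ∞ (σ.dens φ) :=
  contMDiff_of_chart fun x => ((contDiffOn_topVal_loc (σ.isSmoothForm_omega hφ) x).div
    (contDiffOn_topVal_loc σ.isSmoothForm_deta x) fun _ hy => σ.baseLoc_ne_zero x hy).congr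
    fun _ hy => σ.dens_loc φ x hy

theorem contMDiff_densDeriv {φ : S → ℝ} (hφ : ContMDiff (𝓡 (2 * m + 1)) 𝓘(ℝ, ℝ) ∞ φ)
    {κ : S → Model (2 * m + 1) [⋀^Fin 2]→L[ℝ] ℝ} (hκ : IsSmoothForm κ) :
    ContMDiff (𝓡 (2 * m + 1)) 𝓘(ℝ, ℝ) ∞ (σ.densDeriv φ κ) :=
  contMDiff_of_chart fun x => ((contDiffOn_topDeriv_loc (σ.isSmoothForm_omega hφ) hκ x).div
    (contDiffOn_topVal_loc σ.isSmoothForm_deta x) fun _ hy => σ.baseLoc_ne_zero x hy).congr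
    fun _ hy => σ.densDeriv_loc φ κ x hy

/-- The derivative of `f` along the field dual to the `1`-form `β`. -/
def pairing (φ f : S → ℝ) (β : OneForm (2 * m + 1) S) (p : S) : ℝ :=
  dif f p (sharp (σ.omega φ p) (σ.eta p) (β p))

theorem isPositive_loc {φ : S → ℝ} (hφ : φ ∈ σ.potentials) (x : S) {y : Model (2 * m + 1)}
    (hy : y ∈ (extChartAt (𝓡 (2 * m + 1)) x).target) :
    IsPositive (fieldLoc σ.ξ x y) (σ.η.loc x y) (endLoc σ.Φ x y) (formLoc (σ.omega φ) x y) :=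
  ((σ.mem_potentials_iff.1 hφ).2 ((extChartAt (𝓡 (2 * m + 1)) x).symm y)).pullback
    (chartDiff_chartInv x hy) (chartInv_chartDiff x hy)

theorem pairing_loc {φ f : S → ℝ} (hφ : φ ∈ σ.potentials)
    (hf : ContMDiff (𝓡 (2 * m + 1)) 𝓘(ℝ, ℝ) ∞ f) {β : OneForm (2 * m + 1) S}
    (hβ : ∀ p, β p (σ.ξ p) = 0) (x : S) {y : Model (2 * m + 1)}
    (hy : y ∈ (extChartAt (𝓡 (2 * m + 1)) x).target) :
    σ.pairing φ f β ((extChartAt (𝓡 (2 * m + 1)) x).symm y) =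
      fderiv ℝ (fun y => f ((extChartAt (𝓡 (2 * m + 1)) x).symm y)) y
        (sharp (formLoc (σ.omega φ) x y) (σ.η.loc x y) (β.loc x y)) := by
  rw [fderiv_comp_chart_symm hf x hy]
  exact congrArg (dif f _) ((σ.isAlmostContact _).sharp_pullback
    ((σ.mem_potentials_iff.1 hφ).2 ((extChartAt (𝓡 (2 * m + 1)) x).symm y))
    (chartDiff_chartInv x hy) (chartInv_chartDiff x hy) (hβ _)).symm

theorem contDiffOn_sharp_loc {φ : S → ℝ} (hφ : φ ∈ σ.potentials) {β : OneForm (2 * m + 1) S}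
    (hβ : β.IsSmooth) (x : S) :
    ContDiffOn ℝ ∞ (fun y => sharp (formLoc (σ.omega φ) x y) (σ.η.loc x y) (β.loc x y))
      (extChartAt (𝓡 (2 * m + 1)) x).target :=
  contDiffOn_sharp (σ.isSmoothForm_omega hφ.1.1 x) (σ.isSmooth_η x) (hβ x) fun _ hy =>
    (σ.isAlmostContact_loc x hy).flat_isInvertible (σ.isPositive_loc hφ x hy)

theorem contMDiff_pairing {φ f : S → ℝ} (hφ : φ ∈ σ.potentials)
    (hf : ContMDiff (𝓡 (2 * m + 1)) 𝓘(ℝ, ℝ) ∞ f) {β : OneForm (2 * m + 1) S}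
    (hβ : ∀ p, β p (σ.ξ p) = 0) (hβs : β.IsSmooth) :
    ContMDiff (𝓡 (2 * m + 1)) 𝓘(ℝ, ℝ) ∞ (σ.pairing φ f β) :=
  contMDiff_of_chart fun x => (((contDiffOn_comp_chart_symm hf x).fderiv_of_isOpen
    (isOpen_target x) (by simp)).clm_apply (σ.contDiffOn_sharp_loc hφ hβs x)).congr
      fun _ hy => σ.pairing_loc hφ hf hβ x hy

end SasakianStructure

/-! ### Divergence of horizontal fields and Stokes' theorem on S. -/

namespace SasakianStructure

variable {m : ℕ} {S : Type*} [TopologicalSpace S]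
  [ChartedSpace (EuclideanSpace ℝ (Fin (2 * m + 1))) S] [IsManifold (𝓡 (2 * m + 1)) ∞ S]
  (σ : SasakianStructure m S)

theorem chartInv_fieldLoc_ξ (x : S) {y : Model (2 * m + 1)}
    (hy : y ∈ (extChartAt (𝓡 (2 * m + 1)) x).target) :
    chartInv x y (fieldLoc σ.ξ x y) = σ.xi ((extChartAt (𝓡 (2 * m + 1)) x).symm y) :=
  chartInv_chartDiff x hy _

theorem two_form_horizontal_loc {φ : S → ℝ} (hφ : σ.IsBasic φ) (x : S) {y : Model (2 * m + 1)}
    (hy : y ∈ (extChartAt (𝓡 (2 * m + 1)) x).target) (X : Model (2 * m + 1)) :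
    formLoc (σ.omega φ) x y ![fieldLoc σ.ξ x y, X] = 0 := by
  rw [formLoc, two_form_comp_apply, σ.chartInv_fieldLoc_ξ x hy]
  exact (σ.isTransverse_omega hφ _).left _

theorem deta_horizontal_loc (x : S) {y : Model (2 * m + 1)}
    (hy : y ∈ (extChartAt (𝓡 (2 * m + 1)) x).target) (X : Model (2 * m + 1)) :
    alt₂ (fderiv ℝ (σ.η.loc x) y) ![fieldLoc σ.ξ x y, X] = 0 := by
  rw [← σ.isSmooth_η.formLoc_dAt x hy, formLoc, two_form_comp_apply,
    σ.chartInv_fieldLoc_ξ x hy]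
  exact (σ.isPositive_deta _).left _

theorem fieldLoc_ξ_ne_zero (x : S) {y : Model (2 * m + 1)}
    (hy : y ∈ (extChartAt (𝓡 (2 * m + 1)) x).target) : fieldLoc σ.ξ x y ≠ 0 := fun h => by
  have h1 := (σ.isAlmostContact_loc x hy).η_ξ
  rw [h, map_zero] at h1
  exact zero_ne_one h1

theorem differentiableAt_formLoc {α : S → Model (2 * m + 1) [⋀^Fin 2]→L[ℝ] ℝ}
    (hα : IsSmoothForm α) (x : S) {y : Model (2 * m + 1)}
    (hy : y ∈ (extChartAt (𝓡 (2 * m + 1)) x).target) : DifferentiableAt ℝ (formLoc α x) y :=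
  ((hα x).contDiffAt ((isOpen_target x).mem_nhds hy)).differentiableAt (by simp)

theorem closed_loc {β : OneForm (2 * m + 1) S} (hβ : β.IsSmooth) (x : S) {y : Model (2 * m + 1)}
    (hy : y ∈ (extChartAt (𝓡 (2 * m + 1)) x).target) (X Y V : Model (2 * m + 1)) :
    fderiv ℝ (formLoc β.dAt x) y V ![X, Y] =
      fderiv ℝ (formLoc β.dAt x) y X ![V, Y] - fderiv ℝ (formLoc β.dAt x) y Y ![V, X] := by
  have hmem := (isOpen_target x).mem_nhds hy
  have h : formLoc β.dAt x =ᶠ[nhds y] fun z => alt₂ (fderiv ℝ (β.loc x) z) :=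
    Filter.eventually_of_mem hmem fun z hz => hβ.formLoc_dAt x hz
  rw [h.fderiv_eq]
  exact closed_of_exact (((hβ x).contDiffAt hmem).of_le (WithTop.coe_le_coe.2 le_top)) X Y V

/-- The divergence of `h Z`, where `h` is the coefficient of `(dη_φ)^m ∧ η`, for the field `Z`
with `dη_φ(Z, ·) = β` and `η(Z)` constant. -/
theorem divergence_loc {φ : S → ℝ} (hφ : σ.IsBasic φ) {β : Model (2 * m + 1) →
    Model (2 * m + 1) →L[ℝ] ℝ} {Z : Model (2 * m + 1) → Model (2 * m + 1)} {c : ℝ} (x : S)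
    {y : Model (2 * m + 1)}
    (hy : y ∈ (extChartAt (𝓡 (2 * m + 1)) x).target) (hZ : DifferentiableAt ℝ Z y)
    (hβ : ∀ z ∈ (extChartAt (𝓡 (2 * m + 1)) x).target, ∀ X,
      formLoc (σ.omega φ) x z ![Z z, X] = β z X)
    (hc : ∀ z ∈ (extChartAt (𝓡 (2 * m + 1)) x).target, σ.η.loc x z (Z z) = c) :
    fderiv ℝ (fun z => topVal (stdBasis (2 * m + 1)) (formLoc (σ.omega φ) x z) (σ.η.loc x z)) y
        (Z y) + LinearMap.trace ℝ (Model (2 * m + 1)) (fderiv ℝ Z y : _ →ₗ[ℝ] _) *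
        topVal (stdBasis (2 * m + 1)) (formLoc (σ.omega φ) x y) (σ.η.loc x y) =
      topDeriv (stdBasis (2 * m + 1)) (formLoc (σ.omega φ) x y) (σ.η.loc x y)
        (alt₂ (fderiv ℝ β y)) := by
  have hmem := (isOpen_target x).mem_nhds hy
  exact divergence_eq_topDeriv (stdBasis (2 * m + 1))
    (differentiableAt_formLoc (σ.isSmoothForm_omega hφ.1) x hy)
    (differentiableAt_loc σ.isSmooth_η x hy) hZ (closed_loc (σ.isSmooth_etaOf hφ.1) x hy)
    (Filter.eventually_of_mem hmem hβ) (Filter.eventually_of_mem hmem hc)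
    (σ.fieldLoc_ξ_ne_zero x hy) (σ.two_form_horizontal_loc hφ x hy) (σ.deta_horizontal_loc x hy)

/-- The ratio of a density of weight one and `(dη_φ)^m ∧ η` is basic. -/
theorem isBasic_densDeriv_div {φ ψ : S → ℝ} (hφ : φ ∈ σ.potentials) (hψ : σ.IsBasic ψ) :
    σ.IsBasic fun p => σ.densDeriv φ (σ.ddc ψ) p / σ.dens φ p := by
  have hs : ContMDiff (𝓡 (2 * m + 1)) 𝓘(ℝ, ℝ) ∞
      fun p => σ.densDeriv φ (σ.ddc ψ) p / σ.dens φ p := by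
    refine ContMDiff.mul (σ.contMDiff_densDeriv hφ.1.1 (σ.isSmoothForm_ddc hψ.1)) ?_
    exact (σ.contMDiff_dens hφ.1.1).inv₀ fun p => (σ.dens_pos hφ p).ne'
  refine ⟨hs, fun p => ?_⟩
  have hy := mem_extChartAt_target (I := 𝓡 (2 * m + 1)) p
  have hmem := (isOpen_target p).mem_nhds hy
  set y := extChartAt (𝓡 (2 * m + 1)) p p with hydef
  have hξ : DifferentiableAt ℝ (fieldLoc σ.ξ p) y :=
    ((σ.contDiffOn_ξ p).contDiffAt hmem).differentiableAt (by simp)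
  have hη := differentiableAt_loc σ.isSmooth_η p hy
  have hω := differentiableAt_formLoc (σ.isSmoothForm_omega hφ.1.1) p hy
  have hα := differentiableAt_formLoc (σ.isSmoothForm_ddc hψ.1) p hy
  have hη1 : ∀ᶠ z in nhds y, σ.η.loc p z (fieldLoc σ.ξ p z) = 1 :=
    Filter.eventually_of_mem hmem fun z hz => (σ.isAlmostContact_loc p hz).η_ξ
  have hψ0 : ∀ z ∈ (extChartAt (𝓡 (2 * m + 1)) p).target, ∀ X,
      formLoc (σ.ddc ψ) p z ![fieldLoc σ.ξ p z, X] =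
        (0 : Model (2 * m + 1) →L[ℝ] ℝ) X := by
    intro z hz X
    rw [formLoc, two_form_comp_apply, σ.chartInv_fieldLoc_ξ p hz]
    exact (σ.isTransverse_ddc hψ _).left _
  have hzero : alt₂ (fderiv ℝ (fun _ : Model (2 * m + 1) =>
      (0 : Model (2 * m + 1) →L[ℝ] ℝ)) y) = 0 := by
    rw [fderiv_fun_const]
    exact map_zero _
  -- The Lie derivatives along ξ of ω_φ, of dd^cψ and of η all vanish: the 2-forms are closed and
  -- horizontal, and η(ξ) = 1 with ι_ξ dη = 0.
  have hL1 := lie_two_form hω hξ (closed_loc (σ.isSmooth_etaOf hφ.1.1) p hy)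
    (Filter.eventually_of_mem hmem (fun z hz X => σ.two_form_horizontal_loc hφ.1 p hz X) :
      ∀ᶠ z in nhds y, ∀ X, formLoc (σ.omega φ) p z ![fieldLoc σ.ξ p z, X] =
        (fun _ => (0 : Model (2 * m + 1) →L[ℝ] ℝ)) z X)
  have hL2 := lie_two_form hα hξ (closed_loc (σ.isSmooth_dc hψ.1) p hy)
    (β := fun _ => (0 : Model (2 * m + 1) →L[ℝ] ℝ)) (Filter.eventually_of_mem hmem hψ0)
  have hL3 : fderiv ℝ (σ.η.loc p) y (fieldLoc σ.ξ p y) +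
      (σ.η.loc p y).comp (fderiv ℝ (fieldLoc σ.ξ p) y) = 0 := by
    ext1 X
    rw [lie_one_form hη hξ hη1, σ.deta_horizontal_loc p hy]
    rfl
  rw [hzero] at hL1 hL2
  -- Numerator and denominator satisfy the same equation ξh + tr(Dξ) h = 0. In the Leibniz rule for
  -- numerator = quotient · denominator only the ξ-derivative of the quotient survives.
  have hN := topDeriv_reeb (stdBasis (2 * m + 1)) hω hη hα hL1 hL2 hL3
  have hD := σ.divergence_loc hφ.1 (β := fun _ => 0) p hy hξ
    (fun z hz X => σ.two_form_horizontal_loc hφ.1 p hz X)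
    (fun z hz => (σ.isAlmostContact_loc p hz).η_ξ)
  rw [hzero, map_zero] at hD
  have hN' := (((contDiffOn_topDeriv_loc (σ := σ) (σ.isSmoothForm_omega hφ.1.1)
    (σ.isSmoothForm_ddc hψ.1) p).contDiffAt hmem).differentiableAt (by simp)).hasFDerivAt
  have hD' := (((contDiffOn_topVal_loc (σ := σ) (σ.isSmoothForm_omega hφ.1.1)
    p).contDiffAt hmem).differentiableAt (by simp)).hasFDerivAt
  have hne : topVal (stdBasis (2 * m + 1)) (formLoc (σ.omega φ) p y) (σ.η.loc p y) ≠ 0 :=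
    (σ.isAlmostContact_loc p hy).topVal_ne_zero (σ.isPositive_loc hφ p hy) _
  have heq : (fun z => topDeriv (stdBasis (2 * m + 1)) (formLoc (σ.omega φ) p z) (σ.η.loc p z)
      (formLoc (σ.ddc ψ) p z)) =ᶠ[nhds y] fun z =>
      (σ.densDeriv φ (σ.ddc ψ) ((extChartAt (𝓡 (2 * m + 1)) p).symm z) /
        σ.dens φ ((extChartAt (𝓡 (2 * m + 1)) p).symm z)) *
      topVal (stdBasis (2 * m + 1)) (formLoc (σ.omega φ) p z) (σ.η.loc p z) := by
    filter_upwards [hmem] with z hz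
    have hz0 := (σ.isAlmostContact_loc p hz).topVal_ne_zero (σ.isPositive_loc hφ p hz)
      (stdBasis (2 * m + 1))
    rw [σ.densDeriv_loc φ _ p hz, σ.dens_loc φ p hz,
      div_div_div_cancel_right₀ (σ.baseLoc_ne_zero p hz), div_mul_cancel₀ _ hz0]
  have hQ := (((contDiffOn_comp_chart_symm hs p).contDiffAt hmem).differentiableAt
    (by simp)).hasFDerivAt
  have hprod := DFunLike.congr_fun (heq.fderiv_eq.trans (hQ.mul hD').fderiv) (fieldLoc σ.ξ p y)
  have hyy := heq.eq_of_nhds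
  rw [eq_neg_of_add_eq_zero_left hN, hyy] at hprod
  simp only [add_apply, smul_apply, smul_eq_mul] at hprod
  rw [eq_neg_of_add_eq_zero_left hD] at hprod
  have hfin : dif (n := 2 * m + 1) (fun p => σ.densDeriv φ (σ.ddc ψ) p / σ.dens φ p) p
      (fieldLoc σ.ξ p y) = 0 := by
    rw [dif_eq_fderiv hs, ← hydef]
    refine (mul_eq_zero.1 ?_).resolve_left hne
    linear_combination -hprod
  rw [hydef, fieldLoc_self] at hfin
  exact hfin

variable [CompactSpace S] [T2Space S] [MeasurableSpace S] [BorelSpace S]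

/-- The measure of integration against `(dη)^m ∧ η`. -/
def measure : Measure S := volMeasure σ.vol

instance : IsFiniteMeasure σ.measure := σ.isVolumeForm_vol.isFiniteMeasure

instance : σ.measure.IsOpenPosMeasure := σ.isVolumeForm_vol.isOpenPosMeasure

/-- The integrand times the reference volume is the divergence of fZ with respect to |ω_φ^m ∧ η|,
where Z is dual to β; for f supported in a chart the divergence theorem there applies. -/
theorem stokes_chart {φ : S → ℝ} (hφ : φ ∈ σ.potentials) {β : OneForm (2 * m + 1) S}
    (hβ : ∀ p, β p (σ.ξ p) = 0) (hβs : β.IsSmooth) {f : S → ℝ}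
    (hf : ContMDiff (𝓡 (2 * m + 1)) 𝓘(ℝ, ℝ) ∞ f) (x : S)
    (hs : tsupport f ⊆ (extChartAt (𝓡 (2 * m + 1)) x).source) :
    ∫ p, (f p * σ.densDeriv φ β.dAt p + σ.pairing φ f β p * σ.dens φ p) ∂σ.measure = 0 := by
  have hk : Continuous fun p => f p * σ.densDeriv φ β.dAt p + σ.pairing φ f β p * σ.dens φ p :=
    (hf.continuous.mul (σ.contMDiff_densDeriv hφ.1.1 hβs.isSmoothForm).continuous).add
      ((σ.contMDiff_pairing hφ hf hβ hβs).continuous.mul (σ.contMDiff_dens hφ.1.1).continuous)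
  have hdif : ∀ p, dif (n := 2 * m + 1) f p ≠ 0 → p ∈ tsupport f := by
    intro p hp
    by_contra hp'
    have h0 : f =ᶠ[nhds p] fun _ => 0 := by
      filter_upwards [(isClosed_tsupport f).isOpen_compl.mem_nhds hp'] with z hz
      exact image_eq_zero_of_notMem_tsupport hz
    exact hp (h0.mfderiv_eq.trans mfderiv_const)
  have hks : tsupport (fun p => f p * σ.densDeriv φ β.dAt p + σ.pairing φ f β p * σ.dens φ p) ⊆
      (extChartAt (𝓡 (2 * m + 1)) x).source := by
    refine (closure_minimal (fun p hp => ?_) (isClosed_tsupport f)).trans hs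
    by_contra hp'
    refine hp ?_
    have h1 : dif (n := 2 * m + 1) f p = 0 := by_contra fun h => hp' (hdif p h)
    simp only [image_eq_zero_of_notMem_tsupport hp', pairing, h1, zero_apply, zero_mul, add_zero]
  rw [measure, σ.isVolumeForm_vol.integral_eq_chart hk x hks]
  obtain ⟨g, hg, hgc, hgs, hgf⟩ := exists_chart_extension hf x hs
  let T := fun y => topVal (stdBasis (2 * m + 1)) (formLoc (σ.omega φ) x y) (σ.η.loc x y)
  let Z := fun y => sharp (formLoc (σ.omega φ) x y) (σ.η.loc x y) (β.loc x y)
  have hT : ContDiffOn ℝ ∞ T (extChartAt (𝓡 (2 * m + 1)) x).target :=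
    contDiffOn_topVal_loc (σ.isSmoothForm_omega hφ.1.1) x
  have hT0 : ∀ y ∈ (extChartAt (𝓡 (2 * m + 1)) x).target, T y ≠ 0 := fun y hy =>
    (σ.isAlmostContact_loc x hy).topVal_ne_zero (σ.isPositive_loc hφ x hy) _
  -- The coefficient T does not vanish, so its absolute value is smooth and differs from T by a
  -- locally constant sign.
  have hTabs : ContDiffOn ℝ ∞ (fun y => |T y|) (extChartAt (𝓡 (2 * m + 1)) x).target :=
    fun y hy => ((hT.contDiffAt ((isOpen_target x).mem_nhds hy)).abs (hT0 y hy)).contDiffWithinAt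
  have hZ : ContDiffOn ℝ ∞ Z (extChartAt (𝓡 (2 * m + 1)) x).target :=
    σ.contDiffOn_sharp_loc hφ hβs x
  rw [← integral_divergence_eq_zero volume (isOpen_target x) hg hgc hgs hTabs hZ]
  refine setIntegral_congr_fun (isOpen_target x).measurableSet fun y hy => ?_
  have hmem := (isOpen_target x).mem_nhds hy
  have hgf' : g =ᶠ[nhds y] fun y => f ((extChartAt (𝓡 (2 * m + 1)) x).symm y) :=
    Filter.eventually_of_mem hmem hgf
  have hβl : ∀ z ∈ (extChartAt (𝓡 (2 * m + 1)) x).target, β.loc x z (fieldLoc σ.ξ x z) = 0 := by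
    intro z hz
    exact (congrArg (β _) (chartInv_chartDiff x hz _)).trans (hβ _)
  have hdiv := σ.divergence_loc hφ.1 (β := β.loc x) (Z := Z) (c := 0) x hy
    ((hZ.contDiffAt hmem).differentiableAt (by simp))
    (fun z hz X => (σ.isAlmostContact_loc x hz).two_form_sharp (σ.isPositive_loc hφ x hz)
      (hβl z hz) X)
    (fun z hz => (σ.isAlmostContact_loc x hz).η_sharp (σ.isPositive_loc hφ x hz) (hβl z hz))
  have hsign : (fun z => |T z|) =ᶠ[nhds y] fun z => (SignType.sign (T y) : ℝ) * T z := by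
    have hTc := hT.continuousOn.continuousAt hmem
    rcases lt_or_gt_of_ne (hT0 y hy) with h | h
    · filter_upwards [hTc.eventually (gt_mem_nhds h)] with z hz
      rw [sign_neg h, abs_of_neg hz]; simp
    · filter_upwards [hTc.eventually (lt_mem_nhds h)] with z hz
      rw [sign_pos h, abs_of_pos hz]; simp
  have hTd : fderiv ℝ (fun z => |T z|) y = (SignType.sign (T y) : ℝ) • fderiv ℝ T y := by
    rw [hsign.fderiv_eq]
    exact (((hT.contDiffAt hmem).differentiableAt (by simp)).hasFDerivAt.const_mul _).fderiv
  have hTb : 0 < T y / σ.baseLoc x y := by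
    have := σ.dens_pos hφ ((extChartAt (𝓡 (2 * m + 1)) x).symm y)
    rwa [σ.dens_loc φ x hy] at this
  have hb : σ.baseLoc x y ≠ 0 := σ.baseLoc_ne_zero x hy
  -- The density T / `baseLoc` is positive, so both coefficients have the same sign and the absolute
  -- values are removed together.
  have hsb : |σ.baseLoc x y| = (SignType.sign (T y) : ℝ) * σ.baseLoc x y := by
    have : SignType.sign (T y) = SignType.sign (σ.baseLoc x y) := by
      rcases div_pos_iff.1 hTb with ⟨h1, h2⟩ | ⟨h1, h2⟩
      · rw [sign_pos h1, sign_pos h2]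
      · rw [sign_neg h1, sign_neg h2]
    rw [this, sign_mul_self]
  change |σ.vol.coeff x y| * (f ((extChartAt (𝓡 (2 * m + 1)) x).symm y) *
    σ.densDeriv φ β.dAt ((extChartAt (𝓡 (2 * m + 1)) x).symm y) +
    σ.pairing φ f β ((extChartAt (𝓡 (2 * m + 1)) x).symm y) *
    σ.dens φ ((extChartAt (𝓡 (2 * m + 1)) x).symm y)) = fderiv ℝ g y (Z y) * |T y| + g y *
      (fderiv ℝ (fun z => |T z|) y (Z y) + LinearMap.trace ℝ (Model (2 * m + 1)) (fderiv ℝ Z y : _ →ₗ[ℝ] _) * |T y|)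
  rw [σ.coeff_vol, σ.densDeriv_loc φ _ x hy, σ.dens_loc φ x hy, hβs.formLoc_dAt x hy, ← hdiv,
    σ.pairing_loc hφ hf hβ x hy, hTd, hsign.eq_of_nhds, hgf hy, hgf'.fderiv_eq, hsb, smul_apply,
    smul_eq_mul]
  change _ * (_ * ((fderiv ℝ T y (Z y) + _ * T y) / _) + _ * (T y / _)) = _
  field_simp
  ring

/-- Integration by parts on the Sasakian manifold. -/
theorem stokes {φ : S → ℝ} (hφ : φ ∈ σ.potentials) {β : OneForm (2 * m + 1) S}
    (hβ : ∀ p, β p (σ.ξ p) = 0) (hβs : β.IsSmooth) {f : S → ℝ}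
    (hf : ContMDiff (𝓡 (2 * m + 1)) 𝓘(ℝ, ℝ) ∞ f) :
    ∫ p, f p * σ.densDeriv φ β.dAt p ∂σ.measure =
      -∫ p, σ.pairing φ f β p * σ.dens φ p ∂σ.measure := by
  have hc : ∀ f : S → ℝ, ContMDiff (𝓡 (2 * m + 1)) 𝓘(ℝ, ℝ) ∞ f →
      Continuous fun p => f p * σ.densDeriv φ β.dAt p + σ.pairing φ f β p * σ.dens φ p := fun f hf =>
    (hf.continuous.mul (σ.contMDiff_densDeriv hφ.1.1 hβs.isSmoothForm).continuous).add
      ((σ.contMDiff_pairing hφ hf hβ hβs).continuous.mul (σ.contMDiff_dens hφ.1.1).continuous)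
  rw [← add_eq_zero_iff_eq_neg, ← integral_add]
  -- Both sides are linear in f, so f may be cut up by the partition of unity. The terms with
  -- derivatives of the partition are accounted for by linearity of the differential.
  · have hρf : ∀ x : S, ContMDiff (𝓡 (2 * m + 1)) 𝓘(ℝ, ℝ) ∞
        fun p => chartPartition (2 * m + 1) S x p * f p := fun x =>
      (chartPartition (2 * m + 1) S x).2.mul hf
    have hsumf : ∀ p, f p = ∑ x ∈ chartIndices (2 * m + 1) S,
        chartPartition (2 * m + 1) S x p * f p := fun p => by
      rw [← Finset.sum_mul, sum_chartPartition, one_mul]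
    have hsum : ∀ p, f p * σ.densDeriv φ β.dAt p + σ.pairing φ f β p * σ.dens φ p =
        ∑ x ∈ chartIndices (2 * m + 1) S,
          ((chartPartition (2 * m + 1) S x p * f p) * σ.densDeriv φ β.dAt p +
            σ.pairing φ (fun p => chartPartition (2 * m + 1) S x p * f p) β p * σ.dens φ p) := by
      intro p
      have h1 : dif (n := 2 * m + 1) f p = ∑ x ∈ chartIndices (2 * m + 1) S,
          dif (fun p => chartPartition (2 * m + 1) S x p * f p) p := by
        rw [← dif_sum _ hρf]
        exact congrArg (fun h => dif h p) (funext hsumf)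
      have h2 := congrArg (· * σ.densDeriv φ β.dAt p) (hsumf p)
      simp only [Finset.sum_mul] at h2
      rw [Finset.sum_add_distrib, ← h2, ← Finset.sum_mul]
      congr 2
      rw [pairing, h1, sum_apply]
      rfl
    rw [integral_congr_ae (Filter.Eventually.of_forall hsum), integral_finsetSum]
    · refine Finset.sum_eq_zero fun x _ => σ.stokes_chart hφ hβ hβs (hρf x) x ?_
      exact (closure_mono fun p hp => left_ne_zero_of_mul hp).trans (tsupport_chartPartition x)
    · exact fun x _ => integrable_of_continuous (hc _ (hρf x))
  · exact integrable_of_continuous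
      (hf.continuous.mul (σ.contMDiff_densDeriv hφ.1.1 hβs.isSmoothForm).continuous)
  · exact integrable_of_continuous
      ((σ.contMDiff_pairing hφ hf hβ hβs).continuous.mul (σ.contMDiff_dens hφ.1.1).continuous)

end SasakianStructure

/-! ### Inner products of differentials and the basic Dolbeault Laplacian. -/

namespace SasakianStructure

variable {m : ℕ} {S : Type*} [TopologicalSpace S]
  [ChartedSpace (EuclideanSpace ℝ (Fin (2 * m + 1))) S] [IsManifold (𝓡 (2 * m + 1)) ∞ S]
  (σ : SasakianStructure m S)

theorem finrank_model : Module.finrank ℝ (Model (2 * m + 1)) = 2 * m + 1 := finrank_euclideanSpace_fin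

variable {σ}

theorem sum_frame_dif {φ f g : S → ℝ} (hφ : φ ∈ σ.potentials) (hg : σ.IsBasic g) (p : S)
    {e : Fin (2 * m) → Model (2 * m + 1)}
    (he : IsOrthonormalFrame (σ.eta p) (σ.phi p) (σ.omega φ p) e) :
    ∑ a, dif f p (e a) * dif g p (e a) = 2 * σ.pairing φ f (σ.dc g) p := by
  rw [(σ.isAlmostContact p).sum_frame ((σ.mem_potentials_iff.1 hφ).2 p) finrank_model he _ _
    (σ.dif_ξ hg p), ← σ.dc_eq hg.1]
  rfl

/-- For basic g one has dg ∘ Φ² = -dg, so replacing dg by dg ∘ Φ in the trace turns d^c g into a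
multiple of dg. The result is a Poisson bracket, which later integrates to zero. -/
theorem sum_frame_dif_Φ {φ f g : S → ℝ} (hφ : φ ∈ σ.potentials) (hg : σ.IsBasic g) (p : S)
    {e : Fin (2 * m) → Model (2 * m + 1)}
    (he : IsOrthonormalFrame (σ.eta p) (σ.phi p) (σ.omega φ p) e) :
    ∑ a, dif f p (e a) * dif g p (σ.phi p (e a)) = σ.pairing φ f (grad g) p := by
  have hc := σ.isAlmostContact p
  have h := hc.sum_frame ((σ.mem_potentials_iff.1 hφ).2 p) finrank_model he (dif f p)
    ((dif g p).comp (σ.phi p)) (by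
      rw [ContinuousLinearMap.comp_apply, hc.Φ_ξ, map_zero])
  have h2 : -(1 / 2 : ℝ) • ((dif g p).comp (σ.phi p)).comp (σ.phi p) = (1 / 2 : ℝ) • dif g p := by
    ext X
    simp only [smul_apply, ContinuousLinearMap.comp_apply, hc.Φ_Φ, map_add, map_neg, map_smul,
      σ.dif_ξ hg p, smul_eq_mul]
    ring
  refine h.trans ?_
  have h3 : sharp (σ.omega φ p) (σ.eta p) ((1 / 2 : ℝ) • dif g p) =
      (1 / 2 : ℝ) • sharp (σ.omega φ p) (σ.eta p) (dif g p) := map_smul _ _ _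
  rw [h2, h3, map_smul, smul_eq_mul, ← mul_assoc]
  norm_num
  rfl

theorem exists_frame {φ : S → ℝ} (hφ : φ ∈ σ.potentials) (p : S) :
    ∃ e : Fin (2 * m) → Model (2 * m + 1),
      IsOrthonormalFrame (σ.eta p) (σ.phi p) (σ.omega φ p) e :=
  (σ.isAlmostContact p).exists_orthonormalFrame ((σ.mem_potentials_iff.1 hφ).2 p) finrank_model

theorem frame_Φ {φ : S → ℝ} (hφ : φ ∈ σ.potentials) (p : S)
    {e : Fin (2 * m) → Model (2 * m + 1)}
    (he : IsOrthonormalFrame (σ.eta p) (σ.phi p) (σ.omega φ p) e) :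
    IsOrthonormalFrame (σ.eta p) (σ.phi p) (σ.omega φ p) fun a => σ.phi p (e a) :=
  ⟨fun a => (σ.isAlmostContact p).η_Φ _, fun a b => by
    rw [((σ.mem_potentials_iff.1 hφ).2 p).invariant, he.2]⟩

theorem pairing_dc_comm {φ f g : S → ℝ} (hφ : φ ∈ σ.potentials) (hf : σ.IsBasic f)
    (hg : σ.IsBasic g) (p : S) : σ.pairing φ f (σ.dc g) p = σ.pairing φ g (σ.dc f) p := by
  obtain ⟨e, he⟩ := exists_frame hφ p
  have h1 := sum_frame_dif (f := f) hφ hg p he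
  have h2 := sum_frame_dif (f := g) hφ hf p he
  simp only [mul_comm (dif g p _)] at h2
  linarith

theorem pairing_dc_self_nonneg {φ f : S → ℝ} (hφ : φ ∈ σ.potentials) (hf : σ.IsBasic f)
    (p : S) : 0 ≤ σ.pairing φ f (σ.dc f) p := by
  obtain ⟨e, he⟩ := exists_frame hφ p
  have h1 := sum_frame_dif (f := f) hφ hf p he
  have h2 : 0 ≤ ∑ a, dif f p (e a) * dif f p (e a) := Finset.sum_nonneg fun a _ =>
    mul_self_nonneg _
  linarith

/-- A vanishing sum of squares makes df vanish on a frame of ker η. Then the vector dual to d^c f is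
annihilated by every covector, so df ∘ Φ = 0, and hence df = 0 since f is basic. -/
theorem dif_eq_zero_of_pairing {φ f : S → ℝ} (hφ : φ ∈ σ.potentials) (hf : σ.IsBasic f)
    {p : S} (h0 : σ.pairing φ f (σ.dc f) p = 0) : dif (n := 2 * m + 1) f p = 0 := by
  obtain ⟨e, he⟩ := exists_frame hφ p
  have hc := σ.isAlmostContact p
  have hp := (σ.mem_potentials_iff.1 hφ).2 p
  have h1 := sum_frame_dif (f := f) hφ hf p he
  rw [h0, mul_zero, Finset.sum_eq_zero_iff_of_nonneg fun a _ => mul_self_nonneg _] at h1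
  have h2 : ∀ α : Model (2 * m + 1) →L[ℝ] ℝ, α (sharp (σ.omega φ p) (σ.eta p)
      (-(1 / 2 : ℝ) • (dif f p).comp (σ.phi p))) = 0 := by
    intro α
    have h3 := hc.sum_frame hp finrank_model he α (dif f p) (σ.dif_ξ hf p)
    rw [Finset.sum_eq_zero fun a _ => by rw [mul_self_eq_zero.1 (h1 a (Finset.mem_univ a)),
      mul_zero]] at h3
    linarith
  have h4 : -(1 / 2 : ℝ) • (dif f p).comp (σ.phi p) = 0 := by
    rw [← hc.flat_sharp hp (-(1 / 2 : ℝ) • (dif f p).comp (σ.phi p))]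
    have h5 : sharp (σ.omega φ p) (σ.eta p) (-(1 / 2 : ℝ) • (dif f p).comp (σ.phi p)) = 0 :=
      SeparatingDual.eq_zero_of_forall_dual_eq_zero (R := ℝ) h2
    rw [h5, map_zero]
  ext X
  have h6 := congrArg (fun β => β (σ.phi p X)) h4
  simp only [smul_apply, ContinuousLinearMap.comp_apply, hc.Φ_Φ, map_add, map_neg, map_smul,
    σ.dif_ξ hf p, smul_eq_mul, zero_apply] at h6
  rw [zero_apply]
  linarith

theorem isBasic_const (C : ℝ) : σ.IsBasic fun _ : S => C :=
  ⟨contMDiff_const, fun p => by rw [mfderiv_const]; rfl⟩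

theorem IsBasic.comp_clm {F G : Type*} [NormedAddCommGroup F] [NormedSpace ℝ F]
    [NormedAddCommGroup G] [NormedSpace ℝ G] (L : F →L[ℝ] G) {f : S → F} (hf : σ.IsBasic f) :
    σ.IsBasic fun p => L (f p) := by
  refine ⟨L.contMDiff.comp hf.1, fun p => ?_⟩
  have h : HasMFDerivAt 𝓘(ℝ, F) 𝓘(ℝ, G) (fun r : F => L r) (f p) L := L.hasFDerivAt.hasMFDerivAt
  have h1 : HasMFDerivAt (𝓡 (2 * m + 1)) 𝓘(ℝ, F) f p (grad f p) :=
    ((hf.1 p).mdifferentiableAt (by simp)).hasMFDerivAt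
  have h2 := (h.comp p h1).mfderiv
  exact (congrArg (fun L : TangentSpace (𝓡 (2 * m + 1)) p →L[ℝ] G => L (σ.ξ p)) h2).trans
    ((congrArg L (hf.2 p)).trans (map_zero L))

theorem IsBasic.add {F : Type*} [NormedAddCommGroup F] [NormedSpace ℝ F] {φ ψ : S → F}
    (hφ : σ.IsBasic φ) (hψ : σ.IsBasic ψ) : σ.IsBasic fun p => φ p + ψ p := by
  refine ⟨hφ.1.add hψ.1, fun p => ?_⟩
  have h1 : HasMFDerivAt (𝓡 (2 * m + 1)) 𝓘(ℝ, F) φ p (grad φ p) :=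
    ((hφ.1 p).mdifferentiableAt (by simp)).hasMFDerivAt
  have h2 : HasMFDerivAt (𝓡 (2 * m + 1)) 𝓘(ℝ, F) ψ p (grad ψ p) :=
    ((hψ.1 p).mdifferentiableAt (by simp)).hasMFDerivAt
  have h3 : grad φ p (σ.ξ p) + grad ψ p (σ.ξ p) = 0 :=
    (congrArg₂ (fun x y : F => x + y) (hφ.2 p) (hψ.2 p)).trans (add_zero _)
  exact (congrArg (fun L : TangentSpace (𝓡 (2 * m + 1)) p →L[ℝ] F => L (σ.ξ p))
    (h1.add h2).mfderiv).trans h3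

theorem IsBasic.linear {φ ψ : S → ℝ} (hφ : σ.IsBasic φ) (hψ : σ.IsBasic ψ) (a c : ℝ) :
    σ.IsBasic fun p => a * φ p + c * ψ p :=
  (hφ.comp_clm (a • ContinuousLinearMap.id ℝ ℝ)).add (hψ.comp_clm (c • ContinuousLinearMap.id ℝ ℝ))

theorem dC_eq {ψ : S → ℂ} (hψ : ContMDiff (𝓡 (2 * m + 1)) 𝓘(ℝ, ℂ) ∞ ψ) (p : S)
    (X : Model (2 * m + 1)) : dC ψ p X = (dif (n := 2 * m + 1) (fun q => (ψ q).re) p X : ℂ) +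
      Complex.I * (dif (n := 2 * m + 1) (fun q => (ψ q).im) p X : ℂ) := by
  have h1 : HasMFDerivAt (𝓡 (2 * m + 1)) 𝓘(ℝ, ℂ) ψ p (grad ψ p) :=
    ((hψ p).mdifferentiableAt (by simp)).hasMFDerivAt
  have hr : HasMFDerivAt 𝓘(ℝ, ℂ) 𝓘(ℝ, ℝ) (fun z : ℂ => z.re) (ψ p) Complex.reCLM :=
    Complex.reCLM.hasFDerivAt.hasMFDerivAt
  have hi : HasMFDerivAt 𝓘(ℝ, ℂ) 𝓘(ℝ, ℝ) (fun z : ℂ => z.im) (ψ p) Complex.imCLM :=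
    Complex.imCLM.hasFDerivAt.hasMFDerivAt
  have e1 : dif (n := 2 * m + 1) (fun q => (ψ q).re) p X = (dC ψ p X).re :=
    congrArg (fun L : TangentSpace (𝓡 (2 * m + 1)) p →L[ℝ] ℝ => L X) (hr.comp p h1).mfderiv
  have e2 : dif (n := 2 * m + 1) (fun q => (ψ q).im) p X = (dC ψ p X).im :=
    congrArg (fun L : TangentSpace (𝓡 (2 * m + 1)) p →L[ℝ] ℝ => L X) (hi.comp p h1).mfderiv
  rw [e1, e2, mul_comm Complex.I]
  exact (Complex.re_add_im _).symm

/-- The Hermitian product of the `(0,1)`-parts of differentials of basic functions. -/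
theorem covectorInner_delbar {φ f : S → ℝ} {ψ : S → ℂ} (hφ : φ ∈ σ.potentials)
    (hf : σ.IsBasic f) (hψ : σ.IsBasic ψ) (p : S) :
    σ.covectorInner φ p (σ.delbar (fun q => (f q : ℂ)) p) (σ.delbar ψ p) =
      (σ.pairing φ f (σ.dc fun q => (ψ q).re) p - Complex.I *
        σ.pairing φ f (σ.dc fun q => (ψ q).im) p) - Complex.I / 2 *
      (σ.pairing φ f (grad fun q => (ψ q).re) p - Complex.I *
        σ.pairing φ f (grad fun q => (ψ q).im) p) := by
  have hc := σ.isAlmostContact p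
  have hr : σ.IsBasic fun q => (ψ q).re := hψ.comp_clm Complex.reCLM
  have hi : σ.IsBasic fun q => (ψ q).im := hψ.comp_clm Complex.imCLM
  have h : ∃ e : Fin (2 * m) → TangentSpace (𝓡 (2 * m + 1)) p,
      (∀ a, σ.η p (e a) = 0) ∧
      ∀ a b, σ.omegaOf φ p ![e a, σ.Φ p (e b)] = if a = b then 1 else 0 := exists_frame hφ p
  obtain ⟨e, he, heq⟩ : ∃ e : Fin (2 * m) → Model (2 * m + 1),
      IsOrthonormalFrame (σ.eta p) (σ.phi p) (σ.omega φ p) e ∧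
      σ.covectorInner φ p (σ.delbar (fun q => (f q : ℂ)) p) (σ.delbar ψ p) =
        ∑ a, ((1 / 2 : ℂ) * (dC (fun q => (f q : ℂ)) p (e a) + Complex.I *
            dC (fun q => (f q : ℂ)) p (σ.phi p (e a)))) *
          conj ((1 / 2 : ℂ) * (dC ψ p (e a) + Complex.I * dC ψ p (σ.phi p (e a)))) := by
    refine ⟨h.choose, h.choose_spec, ?_⟩
    rw [covectorInner, dif_pos h]
    rfl
  -- Φe is again an orthonormal frame, and the trace does not depend on the frame.
  have hsum : ∀ g : S → ℝ, σ.IsBasic g →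
      ∑ a, dif f p (σ.phi p (e a)) * dif g p (σ.phi p (e a)) =
        2 * σ.pairing φ f (σ.dc g) p := fun g hg =>
    sum_frame_dif hφ hg p (frame_Φ hφ p he)
  have hsum' : ∀ g : S → ℝ, σ.IsBasic g →
      ∑ a, dif f p (σ.phi p (e a)) * dif g p (e a) = -σ.pairing φ f (grad g) p := by
    intro g hg
    rw [← sum_frame_dif_Φ hφ hg p (frame_Φ hφ p he), ← Finset.sum_neg_distrib]
    refine Finset.sum_congr rfl fun a _ => ?_
    rw [hc.Φ_Φ, map_add, map_neg, map_smul, σ.dif_ξ hg, smul_zero, add_zero, mul_neg, neg_neg]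
  have hterm : ∀ a, ((1 / 2 : ℂ) * (dC (fun q => (f q : ℂ)) p (e a) + Complex.I *
            dC (fun q => (f q : ℂ)) p (σ.phi p (e a)))) *
          conj ((1 / 2 : ℂ) * (dC ψ p (e a) + Complex.I * dC ψ p (σ.phi p (e a)))) =
      1 / 4 * (((dif f p (e a) * dif (fun q => (ψ q).re) p (e a) : ℝ) +
          (dif f p (σ.phi p (e a)) * dif (fun q => (ψ q).re) p (σ.phi p (e a)) : ℝ)) -
        Complex.I * ((dif f p (e a) * dif (fun q => (ψ q).im) p (e a) : ℝ) +
          (dif f p (σ.phi p (e a)) * dif (fun q => (ψ q).im) p (σ.phi p (e a)) : ℝ)) +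
        Complex.I * ((dif f p (σ.phi p (e a)) * dif (fun q => (ψ q).re) p (e a) : ℝ) -
          (dif f p (e a) * dif (fun q => (ψ q).re) p (σ.phi p (e a)) : ℝ)) +
        ((dif f p (σ.phi p (e a)) * dif (fun q => (ψ q).im) p (e a) : ℝ) -
          (dif f p (e a) * dif (fun q => (ψ q).im) p (σ.phi p (e a)) : ℝ))) := by
    intro a
    rw [dC_ofReal hf.1, dC_ofReal hf.1, dC_eq hψ.1, dC_eq hψ.1]
    simp only [map_mul, map_add, Complex.conj_I, Complex.conj_ofReal, map_div₀, map_one,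
      map_ofNat, Complex.ofReal_mul]
    linear_combination (-(1 / 4 : ℂ) * (dif f p (σ.phi p (e a)) *
      dif (fun q => (ψ q).re) p (σ.phi p (e a)) + dif f p (σ.phi p (e a)) *
      dif (fun q => (ψ q).im) p (e a) - dif f p (e a) *
      dif (fun q => (ψ q).im) p (σ.phi p (e a)) - Complex.I * dif f p (σ.phi p (e a)) *
      dif (fun q => (ψ q).im) p (σ.phi p (e a)))) * Complex.I_sq
  rw [heq, Finset.sum_congr rfl fun a _ => hterm a, ← Finset.mul_sum]
  simp only [Finset.sum_add_distrib, Finset.sum_sub_distrib, ← Finset.mul_sum,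
    ← Complex.ofReal_sum]
  rw [sum_frame_dif hφ hr p he, sum_frame_dif hφ hi p he, hsum _ hr, hsum _ hi, hsum' _ hr,
    hsum' _ hi, sum_frame_dif_Φ hφ hr p he, sum_frame_dif_Φ hφ hi p he]
  push_cast
  linear_combination (-(1 / 2 : ℂ)) * (σ.pairing φ f (grad fun q => (ψ q).im) p) * Complex.I_sq

variable [CompactSpace S] [T2Space S] [MeasurableSpace S] [BorelSpace S]

theorem integral_mul_densDeriv {φ f g : S → ℝ} (hφ : φ ∈ σ.potentials)
    (hf : σ.IsBasic f) (hg : σ.IsBasic g) :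
    ∫ p, f p * σ.densDeriv φ (σ.ddc g) p ∂σ.measure =
      -∫ p, σ.pairing φ f (σ.dc g) p * σ.dens φ p ∂σ.measure :=
  σ.stokes hφ (σ.dc_ξ hg) (σ.isSmooth_dc hg.1) hf.1

/-- Stokes with the closed form β = dg. This disposes of the Poisson bracket terms in the Hermitian
product, which are not part of the real gradient product. -/
theorem integral_pairing_grad {φ f g : S → ℝ} (hφ : φ ∈ σ.potentials)
    (hf : σ.IsBasic f) (hg : σ.IsBasic g) :
    ∫ p, σ.pairing φ f (grad g) p * σ.dens φ p ∂σ.measure = 0 := by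
  have h := σ.stokes hφ (β := grad g) (σ.dif_ξ hg) (isSmooth_grad hg.1) hf.1
  have h0 : ∀ p, f p * σ.densDeriv φ (OneForm.dAt (n := 2 * m + 1) (grad g)) p = 0 := by
    intro p
    rw [densDeriv, dAt_grad hg.1, map_zero, zero_div, mul_zero]
  rw [integral_congr_ae (Filter.Eventually.of_forall h0), integral_zero] at h
  exact neg_eq_zero.1 h.symm

theorem integral_eq {F : Type*} [NormedAddCommGroup F] [NormedSpace ℝ F]
    [SecondCountableTopology F] {f : S → F} (hf : Continuous f)
    {α : DForm (2 * m + 1) S (2 * m + 1)} {r : S → ℝ} (hr : Continuous r)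
    (h : ∀ p, topCoeff α p = r p * topCoeff σ.vol p) :
    σ.integral f α = ∫ p, r p • f p ∂σ.measure :=
  σ.isVolumeForm_vol.formIntegral_eq hf hr h

theorem integral_sub_I_mul {a b : S → ℝ} (ha : Continuous a) (hb : Continuous b) :
    ∫ p, ((a p : ℂ) - Complex.I * (b p : ℂ)) ∂σ.measure =
      ((∫ p, a p ∂σ.measure : ℝ) : ℂ) - Complex.I * ((∫ p, b p ∂σ.measure : ℝ) : ℂ) := by
  rw [integral_sub, integral_const_mul, integral_complex_ofReal, integral_complex_ofReal]
  · exact integrable_of_continuous (Complex.continuous_ofReal.comp ha)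
  · exact (integrable_of_continuous (Complex.continuous_ofReal.comp hb)).const_mul _

variable (σ) in
/-- The basic Dolbeault Laplacian of a real function. -/
def lap (φ f : S → ℝ) (p : S) : ℝ := -(σ.densDeriv φ (σ.ddc f) p / σ.dens φ p)

theorem isBasic_lap {φ f : S → ℝ} (hφ : φ ∈ σ.potentials) (hf : σ.IsBasic f) :
    σ.IsBasic (σ.lap φ f) :=
  (σ.isBasic_densDeriv_div hφ hf).comp_clm (-ContinuousLinearMap.id ℝ ℝ)

theorem integral_lap {φ f g : S → ℝ} (hφ : φ ∈ σ.potentials)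
    (hf : σ.IsBasic f) (hg : σ.IsBasic g) :
    ∫ p, σ.dens φ p * (σ.lap φ f p * g p) ∂σ.measure =
      ∫ p, σ.pairing φ f (σ.dc g) p * σ.dens φ p ∂σ.measure := by
  have h : ∀ p, σ.dens φ p * (σ.lap φ f p * g p) = -(g p * σ.densDeriv φ (σ.ddc f) p) := by
    intro p
    have := (σ.dens_pos hφ p).ne'
    rw [lap]
    field_simp
  rw [integral_congr_ae (Filter.Eventually.of_forall h), integral_neg,
    integral_mul_densDeriv hφ hg hf, neg_neg]
  refine integral_congr_ae (Filter.Eventually.of_forall fun p => ?_)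
  simp only [pairing_dc_comm hφ hf hg]

/-- Split ψ into real and imaginary parts: the d^c terms give the Laplacian through `integral_lap`,
and the terms with dψ integrate to zero. -/
theorem integral_delbar {φ f : S → ℝ} {ψ : S → ℂ} (hφ : φ ∈ σ.potentials)
    (hf : σ.IsBasic f) (hψ : σ.IsBasic ψ) :
    σ.integral (fun p => σ.covectorInner φ p (σ.delbar (fun q => (f q : ℂ)) p) (σ.delbar ψ p))
      (σ.volOf φ) = σ.integral (fun p => (σ.lap φ f p : ℂ) * conj (ψ p)) (σ.volOf φ) := by
  have hr : σ.IsBasic fun q => (ψ q).re := hψ.comp_clm Complex.reCLM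
  have hi : σ.IsBasic fun q => (ψ q).im := hψ.comp_clm Complex.imCLM
  have hD := (σ.contMDiff_dens hφ.1.1).continuous
  have hP : ∀ g : S → ℝ, σ.IsBasic g → Continuous (σ.pairing φ f (σ.dc g)) := fun g hg =>
    (σ.contMDiff_pairing hφ hf.1 (σ.dc_ξ hg) (σ.isSmooth_dc hg.1)).continuous
  have hG : ∀ g : S → ℝ, σ.IsBasic g → Continuous (σ.pairing φ f (grad g)) := fun g hg =>
    (σ.contMDiff_pairing hφ hf.1 (σ.dif_ξ hg) (isSmooth_grad hg.1)).continuous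
  have hL := (isBasic_lap hφ hf).1.continuous
  have h1 : ∀ p, σ.dens φ p • σ.covectorInner φ p (σ.delbar (fun q => (f q : ℂ)) p)
      (σ.delbar ψ p) =
      ((σ.pairing φ f (σ.dc fun q => (ψ q).re) p * σ.dens φ p -
        1 / 2 * (σ.pairing φ f (grad fun q => (ψ q).im) p * σ.dens φ p) : ℝ) : ℂ) -
      Complex.I * ((σ.pairing φ f (σ.dc fun q => (ψ q).im) p * σ.dens φ p +
        1 / 2 * (σ.pairing φ f (grad fun q => (ψ q).re) p * σ.dens φ p) : ℝ) : ℂ) := by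
    intro p
    rw [covectorInner_delbar hφ hf hψ, Complex.real_smul]
    push_cast
    linear_combination (1 / 2 : ℂ) * (σ.dens φ p *
      σ.pairing φ f (grad fun q => (ψ q).im) p) * Complex.I_sq
  have h2 : ∀ p, σ.dens φ p • ((σ.lap φ f p : ℂ) * conj (ψ p)) =
      ((σ.dens φ p * (σ.lap φ f p * (ψ p).re) : ℝ) : ℂ) -
      Complex.I * ((σ.dens φ p * (σ.lap φ f p * (ψ p).im) : ℝ) : ℂ) := by
    intro p
    rw [Complex.real_smul]
    apply Complex.ext <;> simp
  have hc1 : Continuous fun p => σ.covectorInner φ p (σ.delbar (fun q => (f q : ℂ)) p)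
      (σ.delbar ψ p) := by
    rw [funext fun p => covectorInner_delbar hφ hf hψ p]
    have := hP _ hr
    have := hP _ hi
    have := hG _ hr
    have := hG _ hi
    fun_prop
  have hc2 : Continuous fun p => (σ.lap φ f p : ℂ) * conj (ψ p) :=
    (Complex.continuous_ofReal.comp hL).mul (Complex.continuous_conj.comp hψ.1.continuous)
  rw [integral_eq hc1 hD (σ.topCoeff_volOf φ),
    integral_eq hc2 hD (σ.topCoeff_volOf φ),
    integral_congr_ae (Filter.Eventually.of_forall h1),
    integral_congr_ae (Filter.Eventually.of_forall h2), integral_sub_I_mul, integral_sub_I_mul,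
    integral_lap hφ hf hr, integral_lap hφ hf hi, integral_sub, integral_add,
    integral_const_mul, integral_const_mul, integral_pairing_grad hφ hf hr,
    integral_pairing_grad hφ hf hi, mul_zero, sub_zero, add_zero]
  · exact integrable_of_continuous ((hP _ hi).mul hD)
  · exact integrable_of_continuous (((hG _ hr).mul hD).const_mul _)
  · exact integrable_of_continuous ((hP _ hr).mul hD)
  · exact integrable_of_continuous (((hG _ hi).mul hD).const_mul _)
  · exact hD.mul (hL.mul hr.1.continuous)
  · exact hD.mul (hL.mul hi.1.continuous)
  · exact ((hP _ hr).mul hD).sub (((hG _ hi).mul hD).const_mul _)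
  · exact ((hP _ hi).mul hD).add (((hG _ hr).mul hD).const_mul _)

theorem eq_zero_of_integral_eq_zero {k : S → ℝ} (hk : Continuous k) (h0 : ∀ p, 0 ≤ k p)
    (h : ∫ p, k p ∂σ.measure = 0) : ∀ p, k p = 0 := fun p =>
  congrFun (Measure.eq_of_ae_eq ((integral_eq_zero_iff_of_nonneg h0
    (integrable_of_continuous hk)).1 h) hk continuous_const) p

/-- Existence is `integral_delbar`. For uniqueness the difference of two solutions is itself basic;
used as test function it shows that its weighted L²-norm is zero, and the density is positive. -/
theorem isDolbeaultLaplacian_iff {φ f : S → ℝ} (hφ : φ ∈ σ.potentials) (hf : σ.IsBasic f)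
    (w : S → ℂ) : σ.IsDolbeaultLaplacian φ (fun p => (f p : ℂ)) w ↔
      w = fun p => (σ.lap φ f p : ℂ) := by
  have hu : σ.IsBasic fun p => (σ.lap φ f p : ℂ) := (isBasic_lap hφ hf).comp_clm Complex.ofRealCLM
  have hD := (σ.contMDiff_dens hφ.1.1).continuous
  constructor
  · rintro ⟨hw, h⟩
    have hv : σ.IsBasic fun p => w p + (-ContinuousLinearMap.id ℝ ℂ) (σ.lap φ f p : ℂ) :=
      hw.add (hu.comp_clm _)
    have hv' : (fun p => w p + (-ContinuousLinearMap.id ℝ ℂ) (σ.lap φ f p : ℂ)) =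
        fun p => w p - (σ.lap φ f p : ℂ) := funext fun p => (sub_eq_add_neg _ _).symm
    rw [hv'] at hv
    have hvc := hv.1.continuous
    have hcc : Continuous fun p => conj (w p - (σ.lap φ f p : ℂ)) :=
      Complex.continuous_conj.comp hvc
    have hc1 : Continuous fun p => w p * conj (w p - (σ.lap φ f p : ℂ)) :=
      hw.1.continuous.mul hcc
    have hc2 : Continuous fun p => (σ.lap φ f p : ℂ) * conj (w p - (σ.lap φ f p : ℂ)) :=
      hu.1.continuous.mul hcc
    have hi1 : Integrable (fun p => σ.dens φ p • (w p * conj (w p - (σ.lap φ f p : ℂ))))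
        σ.measure := integrable_of_continuous (hD.smul hc1)
    have hi2 : Integrable (fun p => σ.dens φ p • ((σ.lap φ f p : ℂ) *
        conj (w p - (σ.lap φ f p : ℂ)))) σ.measure := integrable_of_continuous (hD.smul hc2)
    have h1 := h _ hv
    rw [integral_delbar hφ hf hv,
      integral_eq hc1 hD (σ.topCoeff_volOf φ),
      integral_eq hc2 hD (σ.topCoeff_volOf φ), ← sub_eq_zero,
      ← integral_sub hi1 hi2] at h1
    have h2 : ∀ p, σ.dens φ p • (w p * conj (w p - (σ.lap φ f p : ℂ))) -
        σ.dens φ p • ((σ.lap φ f p : ℂ) * conj (w p - (σ.lap φ f p : ℂ))) =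
        ((σ.dens φ p * Complex.normSq (w p - σ.lap φ f p) : ℝ) : ℂ) := by
      intro p
      rw [← smul_sub, ← sub_mul, Complex.mul_conj, Complex.real_smul, Complex.ofReal_mul]
    have h3 := (integral_congr_ae (Filter.Eventually.of_forall h2)).symm.trans h1
    rw [integral_complex_ofReal, Complex.ofReal_eq_zero] at h3
    have h4 := eq_zero_of_integral_eq_zero (hD.mul (Complex.continuous_normSq.comp hvc))
      (fun p => mul_nonneg (σ.dens_pos hφ p).le (Complex.normSq_nonneg _)) h3
    funext p
    have h5 := (mul_eq_zero.1 (h4 p)).resolve_left (σ.dens_pos hφ p).ne'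
    exact sub_eq_zero.1 (Complex.normSq_eq_zero.1 h5)
  · rintro rfl
    exact ⟨hu, fun ψ hψ => (integral_delbar hφ hf hψ).symm⟩

end SasakianStructure

/-! ### Integrals over compact sets depending on a parameter. -/

section ParametricIntegrals

variable {X : Type*} [TopologicalSpace X] [MeasurableSpace X] [BorelSpace X] {μ : Measure X}
  {K : Set X}

theorem continuousOn_setIntegral {T : Type*} [TopologicalSpace T] [FirstCountableTopology T]
    {A : Set T} (hA : IsCompact A) (hK : IsCompact K) (hKm : MeasurableSet K) (hμ : μ K ≠ ⊤)
    {k : T → X → ℝ} (hk : ContinuousOn (fun q : T × X => k q.1 q.2) (A ×ˢ K)) :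
    ContinuousOn (fun t => ∫ p in K, k t p ∂μ) A := by
  obtain ⟨C, hC⟩ := (hA.prod hK).exists_bound_of_continuousOn hk
  refine continuousOn_of_dominated (bound := fun _ => C) (fun t ht => ?_) (fun t ht => ?_) ?_ ?_
  · exact (hk.comp (by fun_prop : ContinuousOn (fun p => (t, p)) K)
      fun p hp => ⟨ht, hp⟩).aestronglyMeasurable hKm
  · exact (ae_restrict_iff' hKm).2 (Filter.Eventually.of_forall fun p hp => hC (t, p) ⟨ht, hp⟩)
  · exact integrableOn_const hμ
  · exact (ae_restrict_iff' hKm).2 (Filter.Eventually.of_forall fun p hp =>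
      hk.comp (by fun_prop : ContinuousOn (fun t => (t, p)) A) fun t ht => ⟨ht, hp⟩)

/-- Differentiation under the integral sign on a compact interval. -/
theorem hasDerivWithinAt_setIntegral {a b : ℝ} (hK : IsCompact K) (hKm : MeasurableSet K)
    (hμ : μ K ≠ ⊤) {k k' : ℝ → X → ℝ}
    (hk : ContinuousOn (fun q : ℝ × X => k q.1 q.2) (Icc a b ×ˢ K))
    (hk' : ContinuousOn (fun q : ℝ × X => k' q.1 q.2) (Icc a b ×ˢ K))
    (h : ∀ t ∈ Icc a b, ∀ p ∈ K, HasDerivWithinAt (fun s => k s p) (k' t p) (Icc a b) t)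
    {t : ℝ} (ht : t ∈ Icc a b) :
    HasDerivWithinAt (fun s => ∫ p in K, k s p ∂μ) (∫ p in K, k' t p ∂μ) (Icc a b) t := by
  obtain ⟨C, hC⟩ := (isCompact_Icc.prod hK).exists_bound_of_continuousOn hk'
  have hm : ∀ s ∈ Icc a b, ContinuousOn (k s) K := fun s hs =>
    hk.comp (by fun_prop : ContinuousOn (fun p => (s, p)) K) fun p hp => ⟨hs, hp⟩
  have hint : ∀ s ∈ Icc a b, IntegrableOn (k s) K μ := by
    intro s hs
    obtain ⟨D, hD⟩ := hK.exists_bound_of_continuousOn (hm s hs)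
    exact IntegrableOn.of_bound hμ.lt_top ((hm s hs).aestronglyMeasurable hKm) D
      ((ae_restrict_iff' hKm).2 (Filter.Eventually.of_forall hD))
  have hev : ∀ᶠ s in nhdsWithin t (Icc a b \ {t}), s ∈ Icc a b :=
    Filter.mem_of_superset self_mem_nhdsWithin sdiff_subset
  rw [hasDerivWithinAt_iff_tendsto_slope]
  have hlim := tendsto_integral_filter_of_dominated_convergence
    (l := nhdsWithin t (Icc a b \ {t})) (μ := μ.restrict K)
    (F := fun s p => slope (fun s => k s p) t s) (f := k' t) (fun _ => C)
    (by
      filter_upwards [hev] with s hs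
      simp only [slope_def_field]
      exact (((hm s hs).sub (hm t ht)).div_const _).aestronglyMeasurable hKm)
    (by
      filter_upwards [hev] with s hs
      refine (ae_restrict_iff' hKm).2 (Filter.Eventually.of_forall fun p hp => ?_)
      -- The mean value inequality bounds the difference quotients by the bound C of the derivative,
      -- which is the dominating constant.
      have hb := (convex_Icc a b).norm_image_sub_le_of_norm_hasDerivWithin_le
        (fun r hr => h r hr p hp) (fun r hr => hC (r, p) ⟨hr, hp⟩) ht hs
      rw [slope_def_field, norm_div]
      refine div_le_of_le_mul₀ (norm_nonneg _) ?_ hb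
      exact (norm_nonneg _).trans (hC (t, p) ⟨ht, hp⟩))
    (integrableOn_const hμ)
    ((ae_restrict_iff' hKm).2 (Filter.Eventually.of_forall fun p hp =>
      hasDerivWithinAt_iff_tendsto_slope.1 (h t ht p hp)))
  refine hlim.congr' ?_
  filter_upwards [hev] with s hs
  rw [slope_def_field, ← integral_sub (hint s hs) (hint t ht), ← integral_div]
  simp only [slope_def_field]

end ParametricIntegrals

/-! ### Antisymmetrization of families of bilinear maps. -/

section Antisymmetrization

variable {E : Type*} [NormedAddCommGroup E] [NormedSpace ℝ E]

theorem contDiffOn_alt₂ {F : Type*} [NormedAddCommGroup F] [NormedSpace ℝ F] {U : Set F}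
    {γ : F → E →L[ℝ] E →L[ℝ] ℝ} (h : ContDiffOn ℝ ∞ γ U) :
    ContDiffOn ℝ ∞ (fun q => alt₂ (γ q)) U :=
  (ContinuousLinearMap.contDiff (alt₂ (E := E))).comp_contDiffOn h

theorem hasDerivWithinAt_alt₂ {γ : ℝ → E →L[ℝ] E →L[ℝ] ℝ} {γ' : E →L[ℝ] E →L[ℝ] ℝ} {s : Set ℝ}
    {t : ℝ} (h : HasDerivWithinAt γ γ' s t) :
    HasDerivWithinAt (fun t => alt₂ (γ t)) (alt₂ γ') s t :=
  (ContinuousLinearMap.hasFDerivAt (alt₂ (E := E))).comp_hasDerivWithinAt t h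

end Antisymmetrization

/-! ### Smooth families of functions and their velocities. -/

section Families

variable {n : ℕ} {S : Type*} [TopologicalSpace S] [ChartedSpace (EuclideanSpace ℝ (Fin n)) S]

theorem continuousOn_of_charts {T G : Type*} [TopologicalSpace T] [TopologicalSpace G] {A : Set T}
    {k : T → S → G} (hk : ∀ x : S, ContinuousOn
      (fun q : T × Model n => k q.1 ((extChartAt (𝓡 n) x).symm q.2))
      (A ×ˢ (extChartAt (𝓡 n) x).target)) :
    ContinuousOn (fun q : T × S => k q.1 q.2) (A ×ˢ univ) := by
  rintro ⟨t, p⟩ ⟨ht, -⟩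
  have hU : (univ : Set T) ×ˢ (extChartAt (𝓡 n) p).source ∈ nhds (t, p) :=
    prod_mem_nhds Filter.univ_mem (extChartAt_source_mem_nhds p)
  have h1 : ContinuousWithinAt (fun q : T × S => (q.1, extChartAt (𝓡 n) p q.2))
      (A ×ˢ (extChartAt (𝓡 n) p).source) (t, p) :=
    continuousWithinAt_fst.prodMk ((continuousAt_extChartAt p).comp_continuousWithinAt
      (f := fun q : T × S => q.2) continuousWithinAt_snd)
  have h2 := (hk p (t, extChartAt (𝓡 n) p p) ⟨ht, mem_extChartAt_target p⟩).comp
    (t := A ×ˢ (extChartAt (𝓡 n) p).target)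
    (f := fun q : T × S => (q.1, extChartAt (𝓡 n) p q.2)) (x := (t, p)) h1
    fun q hq => ⟨hq.1, (extChartAt (𝓡 n) p).map_source hq.2⟩
  have h3 : ContinuousWithinAt (fun q : T × S => k q.1 q.2)
      (A ×ˢ (extChartAt (𝓡 n) p).source) (t, p) := by
    refine h2.congr (fun q hq => ?_) ?_
    · exact congrArg (k q.1) ((extChartAt (𝓡 n) p).left_inv hq.2).symm
    · exact congrArg (k t) (extChartAt_to_inv p).symm
  refine (continuousWithinAt_inter hU).1 (h3.mono ?_)
  exact fun q hq => ⟨hq.1.1, hq.2.2⟩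

/-- Families of functions that are smooth in the parameter and the point, in charts. -/
def IsFamily (a b : ℝ) (v : ℝ → S → ℝ) : Prop :=
  ∀ x : S, ContDiffOn ℝ ∞ (fun q : ℝ × Model n => v q.1 ((extChartAt (𝓡 n) x).symm q.2))
    (Icc a b ×ˢ (extChartAt (𝓡 n) x).target)

/-- The velocity of a family. -/
def vel (a b : ℝ) (v : ℝ → S → ℝ) (t : ℝ) (p : S) : ℝ :=
  derivWithin (fun s => v s p) (Icc a b) t

variable {a b : ℝ} {v : ℝ → S → ℝ}

theorem IsFamily.slice (hv : IsFamily (n := n) a b v) {t : ℝ} (ht : t ∈ Icc a b) (x : S) :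
    ContDiffOn ℝ ∞ (fun y => v t ((extChartAt (𝓡 n) x).symm y)) (extChartAt (𝓡 n) x).target :=
  (hv x).comp (g := fun q : ℝ × Model n => v q.1 ((extChartAt (𝓡 n) x).symm q.2))
    (f := fun y => (t, y)) (contDiff_prodMk_right t).contDiffOn fun _ hy => ⟨ht, hy⟩

theorem IsFamily.vel (hv : IsFamily (n := n) a b v) (hab : a < b) :
    IsFamily (n := n) a b (vel a b v) := fun x =>
  contDiffOn_derivWithin_slice hab (hv x) (isOpen_target x)

theorem IsFamily.hasDerivWithinAt (hv : IsFamily (n := n) a b v) {t : ℝ} (ht : t ∈ Icc a b)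
    (p : S) : HasDerivWithinAt (fun s => v s p) (Sasaki.vel a b v t p) (Icc a b) t := by
  have h := hasDerivWithinAt_slice_left (hv p) (q := (t, extChartAt (𝓡 n) p p))
    ⟨ht, mem_extChartAt_target p⟩
  simp only [extChartAt_to_inv] at h
  exact h.differentiableWithinAt.hasDerivWithinAt

theorem IsFamily.continuousOn (hv : IsFamily (n := n) a b v) :
    ContinuousOn (fun q : ℝ × S => v q.1 q.2) (Icc a b ×ˢ univ) :=
  continuousOn_of_charts fun x => (hv x).continuousOn

theorem isFamily_const_mul (hv : IsFamily (n := n) a b v) (C : ℝ) :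
    IsFamily (n := n) a b fun t p => C * v t p := fun x => contDiffOn_const.mul (hv x)

variable [IsManifold (𝓡 n) ∞ S]

theorem IsFamily.contMDiff (hv : IsFamily (n := n) a b v) {t : ℝ} (ht : t ∈ Icc a b) :
    ContMDiff (𝓡 n) 𝓘(ℝ, ℝ) ∞ (v t) := contMDiff_of_chart fun x => hv.slice ht x

theorem isFamily_const {f : S → ℝ} (hf : ContMDiff (𝓡 n) 𝓘(ℝ, ℝ) ∞ f) :
    IsFamily (n := n) a b fun _ => f := fun x =>
  (contDiffOn_comp_chart_symm hf x).comp (g := fun y => f ((extChartAt (𝓡 n) x).symm y))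
    (f := fun q : ℝ × Model n => q.2) contDiff_snd.contDiffOn fun _ hq => hq.2

theorem isFamily_mul {f : S → ℝ} (hf : ContMDiff (𝓡 n) 𝓘(ℝ, ℝ) ∞ f) :
    IsFamily (n := n) a b fun t p => t * f p := fun x =>
  contDiff_fst.contDiffOn.mul (isFamily_const hf x)

theorem isFamily_of_contMDiffOn (hv : ContMDiffOn (𝓘(ℝ, ℝ).prod (𝓡 n)) 𝓘(ℝ, ℝ) ∞
    (fun q : ℝ × S => v q.1 q.2) (Icc a b ×ˢ univ)) : IsFamily (n := n) a b v := by
  intro x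
  rw [← contMDiffOn_iff_contDiffOn]
  have h1 : ContMDiffOn 𝓘(ℝ, ℝ × Model n) (𝓘(ℝ, ℝ).prod (𝓡 n)) ∞
      (fun q : ℝ × Model n => (q.1, (extChartAt (𝓡 n) x).symm q.2))
      (Icc a b ×ˢ (extChartAt (𝓡 n) x).target) :=
    contDiff_fst.contMDiff.contMDiffOn.prodMk ((contMDiffOn_extChartAt_symm x).comp
      (contDiff_snd.contMDiff.contMDiffOn) fun q hq => hq.2)
  exact hv.comp h1 fun q hq => ⟨hq.1, mem_univ _⟩

theorem contMDiffOn_of_segment {f g : S → ℝ} (hf : ContMDiff (𝓡 n) 𝓘(ℝ, ℝ) ∞ f)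
    (hg : ContMDiff (𝓡 n) 𝓘(ℝ, ℝ) ∞ g) : ContMDiff (𝓘(ℝ, ℝ).prod (𝓡 n)) 𝓘(ℝ, ℝ) ∞
      (fun q : ℝ × S => f q.2 + q.1 * g q.2) :=
  (hf.comp contMDiff_snd).add (contMDiff_fst.mul (hg.comp contMDiff_snd))

end Families

/-! ### Families of potentials: derivatives and joint continuity of the densities. -/

namespace SasakianStructure

variable {m : ℕ} {S : Type*} [TopologicalSpace S]
  [ChartedSpace (EuclideanSpace ℝ (Fin (2 * m + 1))) S] [IsManifold (𝓡 (2 * m + 1)) ∞ S]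
  {σ : SasakianStructure m S} {a b : ℝ} {v c : ℝ → S → ℝ}

variable (σ) in
theorem contDiffOn_dc_family (hab : a < b) (hv : IsFamily (n := 2 * m + 1) a b v) (x : S) :
    ContDiffOn ℝ ∞ (fun q : ℝ × Model (2 * m + 1) => (σ.dc (v q.1)).loc x q.2)
      (Icc a b ×ˢ (extChartAt (𝓡 (2 * m + 1)) x).target) :=
  (((contDiffOn_fderiv_slice hab (hv x) (isOpen_target x)).clm_comp
    ((σ.contDiffOn_Φ x).comp (f := fun q : ℝ × Model (2 * m + 1) => q.2)
      contDiff_snd.contDiffOn fun _ hq => hq.2)).const_smul (-(1 / 2 : ℝ))).congr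
    fun q hq => σ.loc_dc (hv.contMDiff hq.1) x hq.2

variable (σ) in
theorem contDiffOn_ddc_family (hab : a < b) (hv : IsFamily (n := 2 * m + 1) a b v) (x : S) :
    ContDiffOn ℝ ∞ (fun q : ℝ × Model (2 * m + 1) => formLoc (σ.ddc (v q.1)) x q.2)
      (Icc a b ×ˢ (extChartAt (𝓡 (2 * m + 1)) x).target) :=
  (contDiffOn_alt₂ (contDiffOn_fderiv_slice hab (σ.contDiffOn_dc_family hab hv x) (isOpen_target x))).congr
    fun q hq => (σ.isSmooth_dc (hv.contMDiff hq.1)).formLoc_dAt x hq.2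

theorem derivWithin_dc_loc (hab : a < b) (hv : IsFamily (n := 2 * m + 1) a b v) {t : ℝ}
    (ht : t ∈ Icc a b) (x : S) {y : Model (2 * m + 1)}
    (hy : y ∈ (extChartAt (𝓡 (2 * m + 1)) x).target) :
    derivWithin (fun s => (σ.dc (v s)).loc x y) (Icc a b) t =
      (σ.dc (vel a b v t)).loc x y := by
  have h1 := hasDerivWithinAt_fderiv_slice hab (hv x) (isOpen_target x) ht hy
  have h2 := ((h1.clm_comp (hasDerivWithinAt_const t (Icc a b)
    (endLoc σ.Φ x y))).const_smul (-(1 / 2 : ℝ)))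
  have h3 : HasDerivWithinAt (fun s => (σ.dc (v s)).loc x y) _ (Icc a b) t :=
    h2.congr_of_mem (fun s hs => σ.loc_dc (hv.contMDiff hs) x hy) ht
  rw [h3.derivWithin (uniqueDiffOn_Icc hab t ht), σ.loc_dc ((hv.vel hab).contMDiff ht) x hy,
    ContinuousLinearMap.comp_zero, add_zero]
  rfl

/-- The operator dd^c is linear with time-independent coefficients and commutes with the time
derivative by symmetry of mixed partials, applied twice because it is of second order. -/
theorem hasDerivWithinAt_ddc (hab : a < b) (hv : IsFamily (n := 2 * m + 1) a b v) {t : ℝ}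
    (ht : t ∈ Icc a b) (p : S) :
    HasDerivWithinAt (fun s => σ.ddc (v s) p) (σ.ddc (vel a b v t) p) (Icc a b) t := by
  have hy := mem_extChartAt_target (I := 𝓡 (2 * m + 1)) p
  have h1 := hasDerivWithinAt_fderiv_slice hab (σ.contDiffOn_dc_family hab hv p)
    (isOpen_target p) ht hy
  have h2 := hasDerivWithinAt_alt₂ h1
  have h3 : ∀ s ∈ Icc a b, σ.ddc (v s) p =
      alt₂ (fderiv ℝ ((σ.dc (v s)).loc p) (extChartAt (𝓡 (2 * m + 1)) p p)) := fun s hs =>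
    d_eq _ (σ.isSmooth_dc (hv.contMDiff hs)) p
  have h4 : σ.ddc (vel a b v t) p = alt₂ (fderiv ℝ ((σ.dc (vel a b v t)).loc p)
      (extChartAt (𝓡 (2 * m + 1)) p p)) :=
    d_eq _ (σ.isSmooth_dc ((hv.vel hab).contMDiff ht)) p
  have h5 : (fun y => derivWithin (fun s => (σ.dc (v s)).loc p y) (Icc a b) t) =ᶠ[nhds
      (extChartAt (𝓡 (2 * m + 1)) p p)] (σ.dc (vel a b v t)).loc p :=
    Filter.eventually_of_mem ((isOpen_target p).mem_nhds hy) fun z hz =>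
      derivWithin_dc_loc hab hv ht p hz
  rw [h4, ← h5.fderiv_eq]
  exact h2.congr_of_mem h3 ht

theorem isBasic_vel (hab : a < b) (hv : IsFamily (n := 2 * m + 1) a b v)
    (hb : ∀ t ∈ Icc a b, σ.IsBasic (v t)) {t : ℝ} (ht : t ∈ Icc a b) :
    σ.IsBasic (vel a b v t) := by
  have hs := (hv.vel hab).contMDiff ht
  refine ⟨hs, fun p => ?_⟩
  have hy := mem_extChartAt_target (I := 𝓡 (2 * m + 1)) p
  have h1 := hasDerivWithinAt_fderiv_slice hab (hv p) (isOpen_target p) ht hy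
  have h2 := h1.clm_apply (hasDerivWithinAt_const t (Icc a b) (σ.xi p))
  have h3 : ∀ s ∈ Icc a b, fderiv ℝ (fun y => v s ((extChartAt (𝓡 (2 * m + 1)) p).symm y))
      (extChartAt (𝓡 (2 * m + 1)) p p) (σ.xi p) = 0 := by
    intro s hs
    rw [← dif_eq_fderiv (hv.contMDiff hs)]
    exact σ.dif_ξ (hb s hs) p
  have h4 : HasDerivWithinAt (fun _ : ℝ => (0 : ℝ)) _ (Icc a b) t :=
    h2.congr_of_mem (fun s hs => (h3 s hs).symm) ht
  have h5 := (uniqueDiffOn_Icc hab t ht).eq_deriv _ h4 (hasDerivWithinAt_const t (Icc a b) 0)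
  rw [map_zero, add_zero] at h5
  have h6 : dif (n := 2 * m + 1) (vel a b v t) p (σ.xi p) = 0 := by
    rw [dif_eq_fderiv hs]
    exact h5
  exact h6

theorem hasDerivWithinAt_dens (hab : a < b) (hc : IsFamily (n := 2 * m + 1) a b c) {t : ℝ}
    (ht : t ∈ Icc a b) (p : S) : HasDerivWithinAt (fun s => σ.dens (c s) p)
      (σ.densDeriv (c t) (σ.ddc (vel a b c t)) p) (Icc a b) t := by
  have h1 := (hasDerivWithinAt_ddc (σ := σ) hab hc ht p).const_add (σ.deta p)
  have h2 : HasDerivWithinAt (fun s => σ.omega (c s) p) (σ.ddc (vel a b c t) p) (Icc a b) t :=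
    h1.congr_of_mem (fun s hs => σ.omega_eq (hc.contMDiff hs) p) ht
  exact (hasDerivWithinAt_topVal (stdBasis (2 * m + 1)) (σ.eta p) h2).div_const _

theorem formLoc_omega {φ : S → ℝ} (hφ : ContMDiff (𝓡 (2 * m + 1)) 𝓘(ℝ, ℝ) ∞ φ) (x : S)
    (y : Model (2 * m + 1)) :
    formLoc (σ.omega φ) x y = formLoc σ.deta x y + formLoc (σ.ddc φ) x y := by
  rw [formLoc, σ.omega_eq hφ]
  rfl

theorem formLoc_ddc_mul {φ : S → ℝ} (hφ : ContMDiff (𝓡 (2 * m + 1)) 𝓘(ℝ, ℝ) ∞ φ) (s : ℝ) (x : S)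
    (y : Model (2 * m + 1)) :
    formLoc (σ.ddc fun p => s * φ p) x y = s • formLoc (σ.ddc φ) x y := by
  rw [formLoc, σ.ddc_linear hφ hφ s 0 (fun p => by ring), zero_smul, add_zero]
  rfl

/-- Continuity of densities along multiples of families. -/
theorem continuousOn_dens (hab : a < b) (hc : IsFamily (n := 2 * m + 1) a b c) :
    ContinuousOn (fun q : (ℝ × ℝ) × S => σ.dens (fun p => q.1.2 * c q.1.1 p) q.2)
      ((Icc a b ×ˢ univ) ×ˢ univ) := by
  refine continuousOn_of_charts (n := 2 * m + 1)
    (k := fun (τ : ℝ × ℝ) p => σ.dens (fun p => τ.2 * c τ.1 p) p) fun x => ?_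
  have hd : ContinuousOn (fun q : (ℝ × ℝ) × Model (2 * m + 1) => formLoc σ.deta x q.2)
      ((Icc a b ×ˢ univ) ×ˢ (extChartAt (𝓡 (2 * m + 1)) x).target) :=
    (σ.isSmoothForm_deta x).continuousOn.comp continuousOn_snd fun q hq => hq.2
  have hη : ContinuousOn (fun q : (ℝ × ℝ) × Model (2 * m + 1) => σ.η.loc x q.2)
      ((Icc a b ×ˢ univ) ×ˢ (extChartAt (𝓡 (2 * m + 1)) x).target) :=
    (σ.isSmooth_η x).continuousOn.comp continuousOn_snd fun q hq => hq.2
  have hdd : ContinuousOn (fun q : (ℝ × ℝ) × Model (2 * m + 1) =>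
      formLoc (σ.ddc (c q.1.1)) x q.2)
      ((Icc a b ×ˢ univ) ×ˢ (extChartAt (𝓡 (2 * m + 1)) x).target) :=
    (σ.contDiffOn_ddc_family hab hc x).continuousOn.comp
      (f := fun q : (ℝ × ℝ) × Model (2 * m + 1) => (q.1.1, q.2)) (by fun_prop)
      fun q hq => ⟨hq.1.1, hq.2⟩
  have hs : ContinuousOn (fun q : (ℝ × ℝ) × Model (2 * m + 1) => q.1.2)
      ((Icc a b ×ˢ univ) ×ˢ (extChartAt (𝓡 (2 * m + 1)) x).target) := by fun_prop
  have h1 := (contDiff_topVal (stdBasis (2 * m + 1))).continuous.comp_continuousOn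
    ((hd.add (hs.smul hdd)).prodMk hη)
  have h2 := (contDiff_topVal (stdBasis (2 * m + 1))).continuous.comp_continuousOn (hd.prodMk hη)
  refine (h1.div h2 fun q hq => σ.baseLoc_ne_zero x hq.2).congr fun q hq => ?_
  have hcs := hc.contMDiff hq.1.1
  have hcm : ContMDiff (𝓡 (2 * m + 1)) 𝓘(ℝ, ℝ) ∞ fun p => q.1.2 * c q.1.1 p :=
    contMDiff_const.mul hcs
  refine (σ.dens_loc _ x hq.2).trans ?_
  rw [formLoc_omega hcm, formLoc_ddc_mul hcs]
  rfl

theorem continuousOn_densDeriv (hab : a < b) (hc : IsFamily (n := 2 * m + 1) a b c)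
    (hv : IsFamily (n := 2 * m + 1) a b v) :
    ContinuousOn (fun q : (ℝ × ℝ) × S =>
      σ.densDeriv (fun p => q.1.2 * c q.1.1 p) (σ.ddc (v q.1.1)) q.2)
      ((Icc a b ×ˢ univ) ×ˢ univ) := by
  refine continuousOn_of_charts (n := 2 * m + 1)
    (k := fun (τ : ℝ × ℝ) p => σ.densDeriv (fun p => τ.2 * c τ.1 p) (σ.ddc (v τ.1)) p) fun x => ?_
  have hd : ContinuousOn (fun q : (ℝ × ℝ) × Model (2 * m + 1) => formLoc σ.deta x q.2)
      ((Icc a b ×ˢ univ) ×ˢ (extChartAt (𝓡 (2 * m + 1)) x).target) :=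
    (σ.isSmoothForm_deta x).continuousOn.comp continuousOn_snd fun q hq => hq.2
  have hη : ContinuousOn (fun q : (ℝ × ℝ) × Model (2 * m + 1) => σ.η.loc x q.2)
      ((Icc a b ×ˢ univ) ×ˢ (extChartAt (𝓡 (2 * m + 1)) x).target) :=
    (σ.isSmooth_η x).continuousOn.comp continuousOn_snd fun q hq => hq.2
  have hdd : ∀ {v : ℝ → S → ℝ}, IsFamily (n := 2 * m + 1) a b v →
      ContinuousOn (fun q : (ℝ × ℝ) × Model (2 * m + 1) => formLoc (σ.ddc (v q.1.1)) x q.2)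
      ((Icc a b ×ˢ univ) ×ˢ (extChartAt (𝓡 (2 * m + 1)) x).target) := fun hv =>
    (σ.contDiffOn_ddc_family hab hv x).continuousOn.comp
      (f := fun q : (ℝ × ℝ) × Model (2 * m + 1) => (q.1.1, q.2)) (by fun_prop)
      fun q hq => ⟨hq.1.1, hq.2⟩
  have hs : ContinuousOn (fun q : (ℝ × ℝ) × Model (2 * m + 1) => q.1.2)
      ((Icc a b ×ˢ univ) ×ˢ (extChartAt (𝓡 (2 * m + 1)) x).target) := by fun_prop
  have h1 := (contDiff_topDeriv (stdBasis (2 * m + 1))).continuous.comp_continuousOn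
    ((hd.add (hs.smul (hdd hc))).prodMk (hη.prodMk (hdd hv)))
  have h2 := (contDiff_topVal (stdBasis (2 * m + 1))).continuous.comp_continuousOn (hd.prodMk hη)
  refine (h1.div h2 fun q hq => σ.baseLoc_ne_zero x hq.2).congr fun q hq => ?_
  have hcs := hc.contMDiff hq.1.1
  have hcm : ContMDiff (𝓡 (2 * m + 1)) 𝓘(ℝ, ℝ) ∞ fun p => q.1.2 * c q.1.1 p :=
    contMDiff_const.mul hcs
  refine (σ.densDeriv_loc _ _ x hq.2).trans ?_
  rw [formLoc_omega hcm, formLoc_ddc_mul hcs]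
  rfl

end SasakianStructure

theorem integral_eq_sub_of_hasDerivWithinAt {a b : ℝ} {f f' : ℝ → ℝ} (hab : a ≤ b)
    (h : ∀ t ∈ Icc a b, HasDerivWithinAt f (f' t) (Icc a b) t) (hc : ContinuousOn f' (Icc a b)) :
    ∫ t in a..b, f' t = f b - f a :=
  intervalIntegral.integral_eq_sub_of_hasDerivAt_of_le hab (fun t ht => (h t ht).continuousWithinAt)
    (fun t ht => (h t (Ioo_subset_Icc_self ht)).hasDerivAt (Icc_mem_nhds ht.1 ht.2))
    (hc.intervalIntegrable_of_Icc hab)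

/-! ### Velocities of special families. -/

section Velocities

variable {S : Type*} {a b t : ℝ}

theorem vel_eq (hab : a < b) (ht : t ∈ Icc a b) {v : ℝ → S → ℝ} {v' : S → ℝ}
    (h : ∀ p, HasDerivWithinAt (fun s => v s p) (v' p) (Icc a b) t) : vel a b v t = v' :=
  funext fun p => (h p).derivWithin (uniqueDiffOn_Icc hab t ht)

theorem vel_affine (hab : a < b) (ht : t ∈ Icc a b) (f g : S → ℝ) :
    vel a b (fun s p => f p + s * g p) t = g :=
  vel_eq hab ht fun p => by
    simpa using ((hasDerivWithinAt_id t (Icc a b)).mul_const (g p)).const_add (f p)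

theorem vel_mul (hab : a < b) (ht : t ∈ Icc a b) (g : S → ℝ) :
    vel a b (fun s p => s * g p) t = g :=
  vel_eq hab ht fun p => by
    simpa using (hasDerivWithinAt_id t (Icc a b)).mul_const (g p)

theorem vel_const (hab : a < b) (ht : t ∈ Icc a b) (f : S → ℝ) :
    vel a b (fun _ => f) t = fun _ => 0 :=
  vel_eq hab ht fun _ => hasDerivWithinAt_const _ _ _

variable {n : ℕ} [TopologicalSpace S] [ChartedSpace (EuclideanSpace ℝ (Fin n)) S]

theorem vel_const_mul (hab : a < b) (ht : t ∈ Icc a b) {v : ℝ → S → ℝ}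
    (hv : IsFamily (n := n) a b v) (C : ℝ) :
    vel a b (fun s p => C * v s p) t = fun p => C * vel a b v t p :=
  vel_eq hab ht fun p => (hv.hasDerivWithinAt ht p).const_mul C

theorem vel_sub_const (hab : a < b) (ht : t ∈ Icc a b) {v : ℝ → S → ℝ}
    (hv : IsFamily (n := n) a b v) (f : S → ℝ) :
    vel a b (fun s p => v s p - f p) t = vel a b v t :=
  vel_eq hab ht fun p => (hv.hasDerivWithinAt ht p).sub_const (f p)

theorem IsFamily.sub {v w : ℝ → S → ℝ} (hv : IsFamily (n := n) a b v)
    (hw : IsFamily (n := n) a b w) : IsFamily (n := n) a b fun t p => v t p - w t p := fun x =>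
  (hv x).sub (hw x)

theorem IsFamily.add {v w : ℝ → S → ℝ} (hv : IsFamily (n := n) a b v)
    (hw : IsFamily (n := n) a b w) : IsFamily (n := n) a b fun t p => v t p + w t p := fun x =>
  (hv x).add (hw x)

end Velocities

/-! ### Convexity of Ω and the primitive of the closed 1-form. -/

namespace SasakianStructure

variable {m : ℕ} {S : Type*} [TopologicalSpace S]
  [ChartedSpace (EuclideanSpace ℝ (Fin (2 * m + 1))) S] [IsManifold (𝓡 (2 * m + 1)) ∞ S]
  {σ : SasakianStructure m S} {a b : ℝ} {f c : ℝ → S → ℝ}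

theorem omega_convex {φ φ' : S → ℝ} (hφ : ContMDiff (𝓡 (2 * m + 1)) 𝓘(ℝ, ℝ) ∞ φ)
    (hφ' : ContMDiff (𝓡 (2 * m + 1)) 𝓘(ℝ, ℝ) ∞ φ') (s : ℝ) {χ : S → ℝ}
    (h : ∀ p, χ p = (1 - s) * φ p + s * φ' p) (p : S) :
    σ.omega χ p = (1 - s) • σ.omega φ p + s • σ.omega φ' p := by
  have hχ : ContMDiff (𝓡 (2 * m + 1)) 𝓘(ℝ, ℝ) ∞ χ := by
    rw [funext h]
    exact (contMDiff_const.mul hφ).add (contMDiff_const.mul hφ')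
  rw [σ.omega_eq hχ, σ.omega_eq hφ, σ.omega_eq hφ', σ.ddc_linear hφ hφ' (1 - s) s h]
  module

/-- dη_φ is affine in φ, and positivity of the transverse form is preserved by convex combinations.
-/
theorem convex_mem {φ φ' χ : S → ℝ} (hφ : φ ∈ σ.potentials) (hφ' : φ' ∈ σ.potentials) {s : ℝ}
    (hs : s ∈ Icc (0 : ℝ) 1) (h : ∀ p, χ p = (1 - s) * φ p + s * φ' p) : χ ∈ σ.potentials := by
  rw [mem_potentials_iff] at hφ hφ' ⊢
  refine ⟨funext h ▸ hφ.1.linear hφ'.1 (1 - s) s, fun p => ?_⟩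
  rw [omega_convex hφ.1.1 hφ'.1.1 s h]
  exact (hφ.2 p).convex (hφ'.2 p) hs

theorem ddc_const (C : ℝ) (p : S) : σ.ddc (fun _ => C) p = 0 := by
  have hC : ContMDiff (𝓡 (2 * m + 1)) 𝓘(ℝ, ℝ) ∞ fun _ : S => C := contMDiff_const
  have h0 : σ.dc (fun _ => C) = fun _ => 0 := by
    funext p
    rw [σ.dc_eq hC]
    have : dif (n := 2 * m + 1) (fun _ : S => C) p = 0 := mfderiv_const
    rw [this, ContinuousLinearMap.zero_comp, smul_zero]
    rfl
  have h1 := d_linear (σ.isSmooth_dc hC) (σ.isSmooth_dc hC) 0 0 (γ := σ.dc fun _ => C)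
    (fun p => by rw [h0]; simp) p
  have h2 : (σ.dc fun _ => C).dAt p = 0 := by simpa only [zero_smul, add_zero] using h1
  exact h2

theorem zero_mem : (fun _ => 0) ∈ σ.potentials := by
  rw [mem_potentials_iff]
  refine ⟨isBasic_const 0, fun p => ?_⟩
  rw [σ.omega_eq contMDiff_const, ddc_const, add_zero]
  exact σ.isPositive_deta p

theorem mul_mem {φ : S → ℝ} (hφ : φ ∈ σ.potentials) {s : ℝ} (hs : s ∈ Icc (0 : ℝ) 1) :
    (fun p => s * φ p) ∈ σ.potentials :=
  convex_mem zero_mem hφ hs fun p => by ring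

theorem segment_mem {φ φ' : S → ℝ} (hφ : φ ∈ σ.potentials) (hφ' : φ' ∈ σ.potentials) {s : ℝ}
    (hs : s ∈ Icc (0 : ℝ) 1) : (fun p => φ p + s * (φ' p - φ p)) ∈ σ.potentials :=
  convex_mem hφ hφ' hs fun p => by ring

theorem omega_add_const {φ : S → ℝ} (hφ : ContMDiff (𝓡 (2 * m + 1)) 𝓘(ℝ, ℝ) ∞ φ) (C : ℝ) (p : S) :
    σ.omega (fun q => φ q + C) p = σ.omega φ p := by
  have hφC : ContMDiff (𝓡 (2 * m + 1)) 𝓘(ℝ, ℝ) ∞ fun q => φ q + C := hφ.add contMDiff_const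
  rw [σ.omega_eq hφC, σ.omega_eq hφ, σ.ddc_linear hφ
    (ψ := fun _ => C) contMDiff_const 1 1 (fun p => by ring), ddc_const, one_smul, smul_zero,
    add_zero]

theorem add_const_mem {φ : S → ℝ} (hφ : φ ∈ σ.potentials) (C : ℝ) :
    (fun p => φ p + C) ∈ σ.potentials := by
  rw [mem_potentials_iff] at hφ ⊢
  refine ⟨hφ.1.add (isBasic_const C), fun p => ?_⟩
  rw [omega_add_const hφ.1.1]
  exact hφ.2 p

theorem dens_add_const {φ : S → ℝ} (hφ : ContMDiff (𝓡 (2 * m + 1)) 𝓘(ℝ, ℝ) ∞ φ) (C : ℝ) (p : S) :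
    σ.dens (fun q => φ q + C) p = σ.dens φ p := by
  rw [dens, omega_add_const hφ]
  rfl

theorem densDeriv_mul {φ ψ : S → ℝ} (hψ : ContMDiff (𝓡 (2 * m + 1)) 𝓘(ℝ, ℝ) ∞ ψ) (s : ℝ) (p : S) :
    σ.densDeriv φ (σ.ddc fun q => s * ψ q) p = s * σ.densDeriv φ (σ.ddc ψ) p := by
  rw [densDeriv, σ.ddc_linear hψ hψ s 0 (fun p => by ring), zero_smul, add_zero, map_smul,
    smul_eq_mul, mul_div_assoc]
  rfl

theorem continuousOn_dens_family (hab : a < b) (hc : IsFamily (n := 2 * m + 1) a b c) :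
    ContinuousOn (fun q : ℝ × S => σ.dens (c q.1) q.2) (Icc a b ×ˢ univ) := by
  refine ((continuousOn_dens (σ := σ) hab hc).comp (f := fun q : ℝ × S => ((q.1, (1 : ℝ)), q.2))
    (by fun_prop) fun q hq => ⟨⟨hq.1, mem_univ _⟩, mem_univ _⟩).congr fun q _ => ?_
  simp

theorem continuousOn_densDeriv_family (hab : a < b) (hc : IsFamily (n := 2 * m + 1) a b c)
    (hv : IsFamily (n := 2 * m + 1) a b f) :
    ContinuousOn (fun q : ℝ × S => σ.densDeriv (c q.1) (σ.ddc (f q.1)) q.2)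
      (Icc a b ×ˢ univ) := by
  refine ((continuousOn_densDeriv (σ := σ) hab hc hv).comp
    (f := fun q : ℝ × S => ((q.1, (1 : ℝ)), q.2))
    (by fun_prop) fun q hq => ⟨⟨hq.1, mem_univ _⟩, mem_univ _⟩).congr fun q _ => ?_
  simp

variable [CompactSpace S] [T2Space S] [MeasurableSpace S] [BorelSpace S]

theorem continuousOn_integral {T : Type*} [TopologicalSpace T] [FirstCountableTopology T]
    {A : Set T} (hA : IsCompact A) {k : T → S → ℝ}
    (hk : ContinuousOn (fun q : T × S => k q.1 q.2) (A ×ˢ univ)) :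
    ContinuousOn (fun t => ∫ p, k t p ∂σ.measure) A := by
  have h := continuousOn_setIntegral (μ := σ.measure) hA isCompact_univ MeasurableSet.univ
    (measure_ne_top _ _) hk
  simpa only [setIntegral_univ] using h

theorem hasDerivWithinAt_integral {k k' : ℝ → S → ℝ}
    (hk : ContinuousOn (fun q : ℝ × S => k q.1 q.2) (Icc a b ×ˢ univ))
    (hk' : ContinuousOn (fun q : ℝ × S => k' q.1 q.2) (Icc a b ×ˢ univ))
    (h : ∀ t ∈ Icc a b, ∀ p, HasDerivWithinAt (fun s => k s p) (k' t p) (Icc a b) t)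
    {t : ℝ} (ht : t ∈ Icc a b) :
    HasDerivWithinAt (fun s => ∫ p, k s p ∂σ.measure) (∫ p, k' t p ∂σ.measure) (Icc a b) t := by
  have h := hasDerivWithinAt_setIntegral (μ := σ.measure) isCompact_univ MeasurableSet.univ
    (measure_ne_top _ _) hk hk' (fun t ht p _ => h t ht p) ht
  simpa only [setIntegral_univ] using h

theorem hasDerivWithinAt_integral_dens (hab : a < b) (hf : IsFamily (n := 2 * m + 1) a b f)
    (hc : IsFamily (n := 2 * m + 1) a b c) {t : ℝ} (ht : t ∈ Icc a b) :
    HasDerivWithinAt (fun t => ∫ p, f t p * σ.dens (c t) p ∂σ.measure)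
      (∫ p, (vel a b f t p * σ.dens (c t) p +
        f t p * σ.densDeriv (c t) (σ.ddc (vel a b c t)) p) ∂σ.measure) (Icc a b) t :=
  hasDerivWithinAt_integral (k := fun t p => f t p * σ.dens (c t) p)
    (k' := fun t p => vel a b f t p * σ.dens (c t) p +
        f t p * σ.densDeriv (c t) (σ.ddc (vel a b c t)) p)
    (hf.continuousOn.mul (continuousOn_dens_family hab hc))
    (((hf.vel hab).continuousOn.mul (continuousOn_dens_family hab hc)).add
      (hf.continuousOn.mul (continuousOn_densDeriv_family hab hc (hc.vel hab))))
    (fun _ ht p => (hf.hasDerivWithinAt ht p).mul (hasDerivWithinAt_dens hab hc ht p)) ht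

/-- Both sides equal minus the Dirichlet product of f and g. This symmetry is the closedness of the
1-form ψ ↦ ∫ ψ (dη_φ)^m ∧ η on Ω. -/
theorem integral_mul_densDeriv_comm {φ f g : S → ℝ} (hφ : φ ∈ σ.potentials)
    (hf : σ.IsBasic f) (hg : σ.IsBasic g) :
    ∫ p, f p * σ.densDeriv φ (σ.ddc g) p ∂σ.measure =
      ∫ p, g p * σ.densDeriv φ (σ.ddc f) p ∂σ.measure := by
  rw [integral_mul_densDeriv hφ hf hg, integral_mul_densDeriv hφ hg hf]
  simp only [pairing_dc_comm hφ hf hg]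

variable (σ) in
/-- A primitive of the closed one-form `ψ ↦ ∫ ψ (dη_φ)^m ∧ η` on the space of potentials. -/
def energy (φ : S → ℝ) : ℝ :=
  ∫ s in (0 : ℝ)..1, ∫ p, φ p * σ.dens (fun q => s * φ q) p ∂σ.measure

/-- The Poincaré lemma for rays from 0. Differentiating under both integrals gives ∫ k'(t, s) ds,
and closedness identifies k'(t, ·) with the s-derivative of ∫ s ċ_t times the density of s c_t. The
value of the latter at s = 1 is the claim; at s = 0 it vanishes. -/
theorem hasDerivWithinAt_energy (hab : a < b) (hc : IsFamily (n := 2 * m + 1) a b c)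
    (hΩ : ∀ t ∈ Icc a b, c t ∈ σ.potentials) {t : ℝ} (ht : t ∈ Icc a b) :
    HasDerivWithinAt (fun t => σ.energy (c t)) (∫ p, vel a b c t p * σ.dens (c t) p ∂σ.measure)
      (Icc a b) t := by
  have h01 : (0 : ℝ) ≤ 1 := zero_le_one
  have hsub : (Icc a b ×ˢ Icc (0 : ℝ) 1) ×ˢ (univ : Set S) ⊆ (Icc a b ×ˢ univ) ×ˢ univ :=
    prod_mono (prod_mono le_rfl (subset_univ _)) le_rfl
  have hc2 : ∀ {v : ℝ → S → ℝ}, IsFamily (n := 2 * m + 1) a b v →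
      ContinuousOn (fun q : (ℝ × ℝ) × S => v q.1.1 q.2) ((Icc a b ×ˢ Icc (0 : ℝ) 1) ×ˢ univ) :=
    fun hv => hv.continuousOn.comp (f := fun q : (ℝ × ℝ) × S => (q.1.1, q.2)) (by fun_prop)
      fun q hq => ⟨hq.1.1, hq.2⟩
  have hD := (continuousOn_dens (σ := σ) hab hc).mono hsub
  have hD' := (continuousOn_densDeriv (σ := σ) hab hc (hc.vel hab)).mono hsub
  have hs : ContinuousOn (fun q : (ℝ × ℝ) × S => q.1.2)
    ((Icc a b ×ˢ Icc (0 : ℝ) 1) ×ˢ univ) := by fun_prop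
  have hA : IsCompact (Icc a b ×ˢ Icc (0 : ℝ) 1) := isCompact_Icc.prod isCompact_Icc
  let k' := fun t s => ∫ p, (vel a b c t p * σ.dens (fun q => s * c t q) p +
    c t p * (s * σ.densDeriv (fun q => s * c t q) (σ.ddc (vel a b c t)) p)) ∂σ.measure
  have hk := continuousOn_integral (σ := σ) hA
    (k := fun (τ : ℝ × ℝ) p => c τ.1 p * σ.dens (fun q => τ.2 * c τ.1 q) p) ((hc2 hc).mul hD)
  have hk' : ContinuousOn (fun τ : ℝ × ℝ => k' τ.1 τ.2) (Icc a b ×ˢ Icc (0 : ℝ) 1) :=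
    continuousOn_integral (σ := σ) hA
    (k := fun (τ : ℝ × ℝ) p => vel a b c τ.1 p * σ.dens (fun q => τ.2 * c τ.1 q) p +
      c τ.1 p * (τ.2 * σ.densDeriv (fun q => τ.2 * c τ.1 q) (σ.ddc (vel a b c τ.1)) p))
    (((hc2 (hc.vel hab)).mul hD).add ((hc2 hc).mul (hs.mul hD')))
  have hder : ∀ t ∈ Icc a b, ∀ s ∈ Icc (0 : ℝ) 1, HasDerivWithinAt
      (fun t => ∫ p, c t p * σ.dens (fun q => s * c t q) p ∂σ.measure) (k' t s) (Icc a b) t := by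
    intro t ht s _
    have h := hasDerivWithinAt_integral_dens (σ := σ) hab hc (isFamily_const_mul hc s) ht
    simpa only [vel_const_mul hab ht hc, densDeriv_mul ((hc.vel hab).contMDiff ht)] using h
  have hE := hasDerivWithinAt_setIntegral (μ := volume) isCompact_Icc measurableSet_Icc
    (by simp) hk hk' hder ht
  have hE' : ∀ t, σ.energy (c t) = ∫ s in Icc (0 : ℝ) 1,
      ∫ p, c t p * σ.dens (fun q => s * c t q) p ∂σ.measure := fun t => by
    rw [energy, intervalIntegral.integral_of_le h01, integral_Icc_eq_integral_Ioc]
  simp only [hE']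
  refine hE.congr_deriv ?_
  rw [integral_Icc_eq_integral_Ioc, ← intervalIntegral.integral_of_le h01]
  have hct := hc.contMDiff ht
  have hvt := (hc.vel hab).contMDiff ht
  have hb := isBasic_vel hab hc (fun t ht => (hΩ t ht).1) ht
  -- The s-derivative here has the variation of the density in direction c_t tested on ċ_t, while k'
  -- has the variation in direction ċ_t tested on c_t; the two agree by symmetry.
  have h1 : ∀ s ∈ Icc (0 : ℝ) 1, HasDerivWithinAt
      (fun s => ∫ p, (s * vel a b c t p) * σ.dens (fun q => s * c t q) p ∂σ.measure) (k' t s)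
      (Icc 0 1) s := by
    intro s hs
    have h := hasDerivWithinAt_integral_dens (σ := σ) zero_lt_one
      (isFamily_mul hvt) (isFamily_mul hct) hs
    simp only [vel_mul zero_lt_one hs] at h
    refine h.congr_deriv ?_
    have hmem := mul_mem (hΩ t ht) hs
    have hd := (σ.contMDiff_dens hmem.1.1).continuous
    have hd1 := (σ.contMDiff_densDeriv hmem.1.1 (σ.isSmoothForm_ddc hct)).continuous
    have hd2 := (σ.contMDiff_densDeriv hmem.1.1 (σ.isSmoothForm_ddc hvt)).continuous
    change _ = ∫ p, _ ∂_
    have i0 : Integrable (fun p => vel a b c t p * σ.dens (fun q => s * c t q) p) σ.measure :=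
      integrable_of_continuous (hvt.continuous.mul hd)
    have i1 : Integrable (fun p => s * vel a b c t p * σ.densDeriv (fun q => s * c t q)
        (σ.ddc (c t)) p) σ.measure :=
      integrable_of_continuous ((continuous_const.mul hvt.continuous).mul hd1)
    have i2 : Integrable (fun p => c t p * (s * σ.densDeriv (fun q => s * c t q)
        (σ.ddc (vel a b c t)) p)) σ.measure :=
      integrable_of_continuous (hct.continuous.mul (continuous_const.mul hd2))
    rw [integral_add i0 i1, integral_add i0 i2]
    have e1 : ∀ p, s * vel a b c t p * σ.densDeriv (fun q => s * c t q) (σ.ddc (c t)) p =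
      s * (vel a b c t p * σ.densDeriv (fun q => s * c t q) (σ.ddc (c t)) p) := fun p => by ring
    have e2 : ∀ p, c t p * (s * σ.densDeriv (fun q => s * c t q) (σ.ddc (vel a b c t)) p) =
      s * (c t p * σ.densDeriv (fun q => s * c t q) (σ.ddc (vel a b c t)) p) := fun p => by ring
    simp only [e1, e2, integral_const_mul]
    rw [integral_mul_densDeriv_comm hmem hb (hΩ t ht).1]
  have h2 : ContinuousOn (k' t) (Icc 0 1) := hk'.comp (f := fun s => (t, s)) (by fun_prop)
    fun s hs => ⟨ht, hs⟩
  rw [integral_eq_sub_of_hasDerivWithinAt h01 h1 h2]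
  simp

end SasakianStructure

/-- The integrand is only controlled inside the interval, since the two-sided derivative in the
functionals need not be the velocity at a break point. This does not affect the integral. -/
theorem intervalIntegrable_and_integral_eq {a b : ℝ} {F G g : ℝ → ℝ} (hab : a ≤ b)
    (hF : ∀ t ∈ Icc a b, HasDerivWithinAt F (G t) (Icc a b) t) (hG : ContinuousOn G (Icc a b))
    (hg : ∀ t ∈ Ioo a b, g t = G t) :
    IntervalIntegrable g volume a b ∧ ∫ t in a..b, g t = F b - F a := by
  refine ⟨(hG.intervalIntegrable_of_Icc hab).congr_uIoo ?_, ?_⟩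
  · rw [uIoo_of_le hab]
    exact fun t ht => (hg t ht).symm
  · rw [intervalIntegral.integral_congr_Ioo_of_le hab hg,
      integral_eq_sub_of_hasDerivWithinAt hab hF hG]

/-! ### Paths, and closed formulas for I, J, L and V. -/

namespace SasakianStructure

variable {m : ℕ} {S : Type*} [TopologicalSpace S]
  [ChartedSpace (EuclideanSpace ℝ (Fin (2 * m + 1))) S] [IsManifold (𝓡 (2 * m + 1)) ∞ S]
  {σ : SasakianStructure m S} {a b : ℝ} {c : ℝ → S → ℝ}

/-- Telescoping over the smooth pieces. -/
theorem IsPath.integral_eq {φ φ' : S → ℝ} (hp : σ.IsPath φ φ' a b c) {F : (S → ℝ) → ℝ}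
    {g : ℝ → ℝ} (h : ∀ a b, a < b → σ.IsSmoothFamily a b c →
      IntervalIntegrable g volume a b ∧ ∫ t in a..b, g t = F (c b) - F (c a)) :
    IntervalIntegrable g volume a b ∧ ∫ t in a..b, g t = F φ' - F φ := by
  obtain ⟨ha, hb, -, N, τ, hτ, h0, hN, hs⟩ := hp
  have key : ∀ i : Fin (N + 1), IntervalIntegrable g volume (τ 0) (τ i) ∧
      ∫ t in (τ 0)..(τ i), g t = F (c (τ i)) - F (c (τ 0)) := by
    intro i
    induction i using Fin.induction with
    | zero => simp
    | succ i ih =>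
      have h1 := h _ _ (hτ i.castSucc_lt_succ) (hs i)
      refine ⟨ih.1.trans h1.1, ?_⟩
      rw [← intervalIntegral.integral_add_adjacent_intervals ih.1 h1.1, ih.2, h1.2]
      ring
  have := key (Fin.last N)
  rwa [h0, hN, ha, hb] at this

theorem isPath_segment {φ φ' : S → ℝ} (hφ : φ ∈ σ.potentials) (hφ' : φ' ∈ σ.potentials) :
    σ.IsPath φ φ' 0 1 fun s p => φ p + s * (φ' p - φ p) := by
  have hmem : ∀ s ∈ Icc (0 : ℝ) 1, (fun p => φ p + s * (φ' p - φ p)) ∈ σ.potentials :=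
    fun s hs => segment_mem hφ hφ' hs
  refine ⟨by simp, by simp, hmem, 1, fun i => (i : ℕ), ?_, by simp, by simp, fun i => ?_⟩
  · exact fun i j hij => Nat.cast_lt.2 hij
  · obtain rfl : i = 0 := Subsingleton.elim _ _
    have e0 : (((0 : Fin 1).castSucc : ℕ) : ℝ) = 0 := by simp
    have e1 : (((0 : Fin 1).succ : ℕ) : ℝ) = 1 := by simp
    change σ.IsSmoothFamily (((0 : Fin 1).castSucc : ℕ) : ℝ) (((0 : Fin 1).succ : ℕ) : ℝ) _
    rw [e0, e1]
    exact ⟨hmem, (contMDiffOn_of_segment hφ.1.1 (hφ'.1.1.sub hφ.1.1)).contMDiffOn⟩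

theorem IsSmoothFamily.isFamily (hc : σ.IsSmoothFamily a b c) :
    IsFamily (n := 2 * m + 1) a b c := isFamily_of_contMDiffOn hc.2

theorem deriv_eq_vel (hc : σ.IsSmoothFamily a b c) {t : ℝ} (ht : t ∈ Ioo a b) :
    (fun p => deriv (fun s => c s p) t) = vel a b c t :=
  funext fun p => ((hc.isFamily.hasDerivWithinAt (Ioo_subset_Icc_self ht) p).hasDerivAt
    (Icc_mem_nhds ht.1 ht.2)).deriv

variable [CompactSpace S] [T2Space S] [MeasurableSpace S] [BorelSpace S]

variable (σ) in
/-- The integral of a function against `(dη_φ)^m ∧ η`. -/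
def mean (φ f : S → ℝ) : ℝ := ∫ p, f p * σ.dens φ p ∂σ.measure

theorem integrable_mul_dens {φ f : S → ℝ} (hφ : φ ∈ σ.potentials) (hf : Continuous f) :
    Integrable (fun p => f p * σ.dens φ p) σ.measure :=
  integrable_of_continuous (hf.mul (σ.contMDiff_dens hφ.1.1).continuous)

theorem mean_add {φ f g : S → ℝ} (hφ : φ ∈ σ.potentials) (hf : Continuous f) (hg : Continuous g) :
    σ.mean φ (fun p => f p + g p) = σ.mean φ f + σ.mean φ g := by
  simp only [mean, add_mul]
  exact integral_add (integrable_mul_dens hφ hf) (integrable_mul_dens hφ hg)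

theorem mean_sub {φ f g : S → ℝ} (hφ : φ ∈ σ.potentials) (hf : Continuous f) (hg : Continuous g) :
    σ.mean φ (fun p => f p - g p) = σ.mean φ f - σ.mean φ g := by
  simp only [mean, sub_mul]
  exact integral_sub (integrable_mul_dens hφ hf) (integrable_mul_dens hφ hg)

theorem dens_zero (p : S) : σ.dens (fun _ => 0) p = 1 := by
  rw [dens, σ.omega_eq contMDiff_const, ddc_const, add_zero]
  exact div_self (σ.base_ne_zero p)

theorem V_eq : σ.V = σ.mean (fun _ => 0) fun _ => 1 := by
  rw [V, integral_eq (r := fun _ => 1) continuous_const continuous_const fun p => (one_mul _).symm]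
  simp only [mean, dens_zero, smul_eq_mul]

theorem V_pos [Nonempty S] : 0 < σ.V := by
  rw [V_eq]
  simp only [mean, dens_zero, mul_one, MeasureTheory.integral_const, smul_eq_mul]
  exact ENNReal.toReal_pos (isOpen_univ.measure_pos _ univ_nonempty).ne' (measure_ne_top _ _)

theorem integral_volOf {φ f : S → ℝ} (hφ : φ ∈ σ.potentials) (hf : Continuous f) :
    σ.integral f (σ.volOf φ) = σ.mean φ f := by
  rw [integral_eq hf (σ.contMDiff_dens hφ.1.1).continuous (σ.topCoeff_volOf φ), mean]
  simp only [smul_eq_mul, mul_comm]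

theorem integral_volOf' {φ f : S → ℝ} (hφ : φ ∈ σ.potentials) (hf : Continuous f) :
    σ.integral f (σ.volOf' φ) = σ.mean φ f := by
  rw [integral_eq hf (σ.contMDiff_dens hφ.1.1).continuous (σ.topCoeff_volOf' hφ.1), mean]
  simp only [smul_eq_mul, mul_comm]

theorem integral_volDiff {φ φ' f : S → ℝ} (hφ : φ ∈ σ.potentials) (hφ' : φ' ∈ σ.potentials)
    (hf : Continuous f) : σ.integral f (σ.volDiff φ φ') = σ.mean φ f - σ.mean φ' f := by
  have h : Continuous fun p => σ.dens φ p - σ.dens φ' p :=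
    (σ.contMDiff_dens hφ.1.1).continuous.sub (σ.contMDiff_dens hφ'.1.1).continuous
  rw [integral_eq hf h (σ.topCoeff_volDiff φ φ'), mean, mean,
    ← integral_sub (integrable_mul_dens hφ hf) (integrable_mul_dens hφ' hf)]
  refine integral_congr_ae (Filter.Eventually.of_forall fun p => ?_)
  simp only [smul_eq_mul]
  ring

theorem continuousOn_mean_vel (hab : a < b) (hc : IsFamily (n := 2 * m + 1) a b c) :
    ContinuousOn (fun t => σ.mean (c t) (vel a b c t)) (Icc a b) :=
  continuousOn_integral isCompact_Icc (k := fun t p => vel a b c t p * σ.dens (c t) p)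
    ((hc.vel hab).continuousOn.mul (continuousOn_dens_family hab hc))

theorem hasDerivWithinAt_mean {φ : S → ℝ} (hφ : φ ∈ σ.potentials) (hab : a < b)
    (hc : IsFamily (n := 2 * m + 1) a b c) {t : ℝ} (ht : t ∈ Icc a b) :
    HasDerivWithinAt (fun t => σ.mean φ (c t)) (σ.mean φ (vel a b c t)) (Icc a b) t := by
  have hD : ContinuousOn (fun q : ℝ × S => σ.dens φ q.2) (Icc a b ×ˢ univ) :=
    ((σ.contMDiff_dens hφ.1.1).continuous.comp continuous_snd).continuousOn
  exact hasDerivWithinAt_integral (k := fun t p => c t p * σ.dens φ p)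
    (k' := fun t p => vel a b c t p * σ.dens φ p) (hc.continuousOn.mul hD)
    ((hc.vel hab).continuousOn.mul hD)
    (fun t ht p => (hc.hasDerivWithinAt ht p).mul_const _) ht

theorem continuousOn_mean {φ : S → ℝ} (hφ : φ ∈ σ.potentials)
    (hc : IsFamily (n := 2 * m + 1) a b c) :
    ContinuousOn (fun t => σ.mean φ (c t)) (Icc a b) :=
  continuousOn_integral isCompact_Icc (k := fun t p => c t p * σ.dens φ p)
    (hc.continuousOn.mul ((σ.contMDiff_dens hφ.1.1).continuous.comp continuous_snd).continuousOn)

theorem IsPath.integrandL {φ φ' : S → ℝ} (hp : σ.IsPath φ φ' a b c) :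
    IntervalIntegrable (σ.integrandL c) volume a b ∧
      ∫ t in a..b, σ.integrandL c t = σ.energy φ' - σ.energy φ := by
  refine hp.integral_eq fun a b hab hc => ?_
  refine intervalIntegrable_and_integral_eq (F := fun t => σ.energy (c t)) hab.le
    (fun t ht => hasDerivWithinAt_energy hab hc.isFamily hc.1 ht)
    (continuousOn_mean_vel hab hc.isFamily) fun t ht => ?_
  have ht' := Ioo_subset_Icc_self ht
  rw [SasakianStructure.integrandL, deriv_eq_vel hc ht, integral_volOf' (hc.1 t ht')]
  · rfl
  exact ((hc.isFamily.vel hab).contMDiff ht').continuous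

theorem IsPath.integrandJ {φ φ' : S → ℝ} (hφ : φ ∈ σ.potentials) (hp : σ.IsPath φ φ' a b c) :
    IntervalIntegrable (σ.integrandJ φ c) volume a b ∧ ∫ t in a..b, σ.integrandJ φ c t =
      (σ.mean φ φ' - σ.energy φ') - (σ.mean φ φ - σ.energy φ) := by
  refine hp.integral_eq (F := fun χ => σ.mean φ χ - σ.energy χ) fun a b hab hc => ?_
  refine intervalIntegrable_and_integral_eq (F := fun t => σ.mean φ (c t) - σ.energy (c t)) hab.le
    (fun t ht => (hasDerivWithinAt_mean hφ hab hc.isFamily ht).sub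
      (hasDerivWithinAt_energy hab hc.isFamily hc.1 ht))
    ((continuousOn_mean hφ (hc.isFamily.vel hab)).sub
      (continuousOn_mean_vel hab hc.isFamily)) fun t ht => ?_
  have ht' := Ioo_subset_Icc_self ht
  rw [SasakianStructure.integrandJ, deriv_eq_vel hc ht, integral_volDiff hφ (hc.1 t ht')]
  · rfl
  · exact ((hc.isFamily.vel hab).contMDiff ht').continuous

theorem IsPath.pathL_eq {φ φ' : S → ℝ} (hp : σ.IsPath φ φ' a b c) :
    σ.pathL a b c = 1 / σ.V * (σ.energy φ' - σ.energy φ) := by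
  rw [pathL, hp.integrandL.2]

theorem IsPath.pathJ_eq {φ φ' : S → ℝ} (hφ : φ ∈ σ.potentials) (hp : σ.IsPath φ φ' a b c) :
    σ.pathJ φ a b c =
      1 / σ.V * ((σ.mean φ φ' - σ.energy φ') - (σ.mean φ φ - σ.energy φ)) := by
  rw [pathJ, (hp.integrandJ hφ).2]

/-- The choice in the definition is meaningful because the segment is a path; every path yields the
same value, so the chosen one does too. -/
theorem L_eq {φ φ' : S → ℝ} (hφ : φ ∈ σ.potentials) (hφ' : φ' ∈ σ.potentials) :
    σ.L φ φ' = 1 / σ.V * (σ.energy φ' - σ.energy φ) := by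
  have h : ∃ x a b c, σ.IsPath φ φ' a b c ∧ x = σ.pathL a b c :=
    ⟨_, 0, 1, _, isPath_segment hφ hφ', rfl⟩
  obtain ⟨a, b, c, hp, hx⟩ := Classical.epsilon_spec h
  exact hx.trans hp.pathL_eq

theorem J_eq {φ φ' : S → ℝ} (hφ : φ ∈ σ.potentials) (hφ' : φ' ∈ σ.potentials) :
    σ.J φ φ' = 1 / σ.V * ((σ.mean φ φ' - σ.energy φ') - (σ.mean φ φ - σ.energy φ)) := by
  have h : ∃ x a b c, σ.IsPath φ φ' a b c ∧ x = σ.pathJ φ a b c :=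
    ⟨_, 0, 1, _, isPath_segment hφ hφ', rfl⟩
  obtain ⟨a, b, c, hp, hx⟩ := Classical.epsilon_spec h
  exact hx.trans (hp.pathJ_eq hφ)

theorem I_eq {φ φ' : S → ℝ} (hφ : φ ∈ σ.potentials) (hφ' : φ' ∈ σ.potentials) :
    σ.I φ φ' = 1 / σ.V * (σ.mean φ φ' - σ.mean φ φ - (σ.mean φ' φ' - σ.mean φ' φ)) := by
  have h1 := hφ.1.1.continuous
  have h2 := hφ'.1.1.continuous
  have h3 : Continuous fun p => φ' p - φ p := h2.sub h1
  rw [I, integral_volDiff hφ hφ' h3, mean_sub hφ h2 h1, mean_sub hφ' h2 h1]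

end SasakianStructure

/-- A weighted integral inequality for functions that are monotone up to a power of `1 - s`. -/
theorem integral_weight_nonneg (k : ℕ) {A : ℝ → ℝ} (hA : ContinuousOn A (Icc 0 1))
    (h : ∀ s ∈ Ico (0 : ℝ) 1, ∀ s' ∈ Ico (0 : ℝ) 1, s ≤ s' →
      A s * (1 - s') ^ k ≤ A s' * (1 - s) ^ k) :
    0 ≤ ∫ s in (0 : ℝ)..1, (((k : ℝ) + 2) * s - 1) * A s := by
  have hk : (0 : ℝ) < (k : ℝ) + 2 := by positivity
  -- The zero of the weight, at which the comparison function A(r)(1 - s)^k/(1 - r)^k touches A.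
  set r : ℝ := 1 / ((k : ℝ) + 2) with hr
  have hkr : ((k : ℝ) + 2) * r = 1 := by rw [hr]; field_simp
  have hr0 : 0 ≤ r := by positivity
  have hr1 : r < 1 := by rw [hr, div_lt_one hk]; have : (0 : ℝ) ≤ k := k.cast_nonneg; linarith
  have hrk : 0 < (1 - r) ^ k := pow_pos (by linarith) k
  -- The primitive -s(1 - s)^(k+1) vanishes at both ends, so the weight is orthogonal to (1 - s)^k.
  have hd : ∀ s ∈ Icc (0 : ℝ) 1, HasDerivWithinAt (fun s : ℝ => -(s * (1 - s) ^ (k + 1)))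
      ((((k : ℝ) + 2) * s - 1) * (1 - s) ^ k) (Icc 0 1) s := by
    intro s _
    have h1 := ((hasDerivAt_id s).mul ((((hasDerivAt_id s).const_sub 1).pow (k + 1)))).neg
    refine (h1.congr_deriv ?_).hasDerivWithinAt
    simp only [id, Nat.add_sub_cancel, Nat.cast_add, Nat.cast_one, pow_succ, Pi.pow_apply]
    ring
  have hc : Continuous fun s : ℝ => (((k : ℝ) + 2) * s - 1) * (1 - s) ^ k := by fun_prop
  have hw : ContinuousOn (fun s : ℝ => ((k : ℝ) + 2) * s - 1) (Icc 0 1) := by fun_prop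
  have h0 := integral_eq_sub_of_hasDerivWithinAt zero_le_one hd hc.continuousOn
  have h1 : ∫ s in (0 : ℝ)..1, A r / (1 - r) ^ k * ((((k : ℝ) + 2) * s - 1) * (1 - s) ^ k) = 0 := by
    rw [intervalIntegral.integral_const_mul, h0]
    simp
  refine h1.symm.trans_le ?_
  have hi1 : IntervalIntegrable (fun s => A r / (1 - r) ^ k *
      ((((k : ℝ) + 2) * s - 1) * (1 - s) ^ k)) volume 0 1 :=
    (continuous_const.mul hc).intervalIntegrable _ _
  have hi2 : IntervalIntegrable (fun s => (((k : ℝ) + 2) * s - 1) * A s) volume 0 1 :=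
    (hw.mul hA).intervalIntegrable_of_Icc zero_le_one
  -- To the right of r the weight is non-negative and A lies above the comparison function; to the
  -- left both signs are reversed.
  refine intervalIntegral.integral_mono_on_of_le_Ioo zero_le_one hi1 hi2 fun s hs => ?_
  have hs' : s ∈ Ico (0 : ℝ) 1 := ⟨hs.1.le, hs.2⟩
  rcases le_total r s with hrs | hrs
  · have h2 := h r ⟨hr0, hr1⟩ s hs' hrs
    have h3 : A r / (1 - r) ^ k * (1 - s) ^ k ≤ A s := by
      rw [div_mul_eq_mul_div, div_le_iff₀ hrk]
      exact h2
    have h4 : 0 ≤ ((k : ℝ) + 2) * s - 1 := by nlinarith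
    nlinarith
  · have h2 := h s hs' r ⟨hr0, hr1⟩ hrs
    have h3 : A s ≤ A r / (1 - r) ^ k * (1 - s) ^ k := by
      rw [div_mul_eq_mul_div, le_div_iff₀ hrk]
      exact h2
    have h4 : ((k : ℝ) + 2) * s - 1 ≤ 0 := by nlinarith
    nlinarith

/-! ### The Dirichlet energy along a segment. -/

namespace SasakianStructure

variable {m : ℕ} {S : Type*} [TopologicalSpace S]
  [ChartedSpace (EuclideanSpace ℝ (Fin (2 * m + 1))) S] [IsManifold (𝓡 (2 * m + 1)) ∞ S]
  {σ : SasakianStructure m S} {a b : ℝ} {c : ℝ → S → ℝ}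

theorem isLocallyConstant_of_dif {f : S → ℝ} (hf : ContMDiff (𝓡 (2 * m + 1)) 𝓘(ℝ, ℝ) ∞ f)
    (h : ∀ p, dif (n := 2 * m + 1) f p = 0) : IsLocallyConstant f := by
  rw [IsLocallyConstant.iff_eventually_eq]
  intro p
  have hs := contDiffOn_comp_chart_symm hf p
  have hO := (isOpen_target p).isOpen_inter_preimage_of_fderiv_eq_zero
    (hs.differentiableOn (by simp)) (fun y hy => by
      ext X
      rw [fderiv_comp_chart_symm hf p hy]
      exact congrArg (fun L : Model (2 * m + 1) →L[ℝ] ℝ => L (chartInv p y X)) (h _)) {f p}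
  have hmem := hO.mem_nhds (x := extChartAt (𝓡 (2 * m + 1)) p p)
    ⟨mem_extChartAt_target p, congrArg f (extChartAt_to_inv p)⟩
  filter_upwards [(continuousAt_extChartAt p).preimage_mem_nhds hmem,
    extChartAt_source_mem_nhds (I := 𝓡 (2 * m + 1)) p] with q hq hqs
  have h1 : f ((extChartAt (𝓡 (2 * m + 1)) p).symm (extChartAt (𝓡 (2 * m + 1)) p q)) = f p := hq.2
  rwa [(extChartAt (𝓡 (2 * m + 1)) p).left_inv hqs] at h1

/-- The pointwise form of the monotonicity. The gradient term contributes 1/(1 - s) to the volume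
factor (1 - s)^m, so the exponent is m - 1 = k. The powers are multiplied crosswise to avoid a
division. -/
theorem monotone_pairing {φ φ' ψ : S → ℝ} {k : ℕ} (hm : m = k + 1) (hφ : φ ∈ σ.potentials)
    (hφ' : φ' ∈ σ.potentials) (hψ : σ.IsBasic ψ) (p : S) {s s' : ℝ} (hs : s ∈ Ico (0 : ℝ) 1)
    (hs' : s' ∈ Ico (0 : ℝ) 1) (hss : s ≤ s') :
    (σ.pairing (fun q => φ q + s * (φ' q - φ q)) ψ (σ.dc ψ) p *
      σ.dens (fun q => φ q + s * (φ' q - φ q)) p) * (1 - s') ^ k ≤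
    (σ.pairing (fun q => φ q + s' * (φ' q - φ q)) ψ (σ.dc ψ) p *
      σ.dens (fun q => φ q + s' * (φ' q - φ q)) p) * (1 - s) ^ k := by
  obtain ⟨Q, hQ, hQs⟩ := (σ.isAlmostContact p).exists_monotone_density
    ((σ.mem_potentials_iff.1 hφ).2 p) ((σ.mem_potentials_iff.1 hφ').2 p) (stdBasis (2 * m + 1))
    (σ.dif_ξ hψ p)
  have key : ∀ r ∈ Ico (0 : ℝ) 1, σ.pairing (fun q => φ q + r * (φ' q - φ q)) ψ (σ.dc ψ) p *
      σ.dens (fun q => φ q + r * (φ' q - φ q)) p = (1 - r) ^ k * (Q r * σ.dens φ p) := by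
    intro r hr
    have h1 := hQs r hr
    have hpow : (1 - r) ^ m = (1 - r) ^ k * (1 - r) := by rw [hm, pow_succ]
    have hr0 : 1 - r ≠ 0 := by linarith [hr.2]
    rw [← omega_convex (χ := fun q => φ q + r * (φ' q - φ q)) hφ.1.1 hφ'.1.1 r
      (fun p => by ring), ← σ.dc_eq hψ.1, hpow] at h1
    have h2 : σ.pairing (fun q => φ q + r * (φ' q - φ q)) ψ (σ.dc ψ) p *
      topVal (stdBasis (2 * m + 1)) (σ.omega (fun q => φ q + r * (φ' q - φ q)) p) (σ.eta p) =
      (1 - r) ^ k * Q r * topVal (stdBasis (2 * m + 1)) (σ.omega φ p) (σ.eta p) :=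
      mul_left_cancel₀ hr0 (h1.trans (by ring))
    rw [dens, dens, ← mul_div_assoc, h2]
    ring
  rw [key s hs, key s' hs']
  have h1 := mul_le_mul_of_nonneg_right (hQ hs hs' hss) (σ.dens_pos hφ p).le
  have h2 : 0 ≤ (1 - s) ^ k * (1 - s') ^ k :=
    mul_nonneg (pow_nonneg (by linarith [hs.2]) _) (pow_nonneg (by linarith [hs'.2]) _)
  nlinarith [mul_le_mul_of_nonneg_left h1 h2]

/-- On a 1-dimensional manifold ker η is zero, so the frame is empty. -/
theorem pairing_eq_zero_of_dim {φ f g : S → ℝ} (hm : m = 0) (hφ : φ ∈ σ.potentials)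
    (hg : σ.IsBasic g) (p : S) : σ.pairing φ f (σ.dc g) p = 0 := by
  obtain ⟨e, he⟩ := exists_frame hφ p
  have h := sum_frame_dif (f := f) hφ hg p he
  subst hm
  rw [Finset.sum_eq_zero fun a _ => a.elim0] at h
  linarith

theorem isBasic_sub {φ φ' : S → ℝ} (hφ : σ.IsBasic φ) (hφ' : σ.IsBasic φ') :
    σ.IsBasic fun p => φ' p - φ p := by
  have h := hφ'.linear hφ 1 (-1)
  simpa only [one_mul, neg_mul, ← sub_eq_add_neg] using h

theorem isFamily_segment {φ φ' : S → ℝ} (hφ : φ ∈ σ.potentials) (hφ' : φ' ∈ σ.potentials) :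
    IsFamily (n := 2 * m + 1) 0 1 fun s p => φ p + s * (φ' p - φ p) :=
  (isFamily_const hφ.1.1).add (isFamily_mul (isBasic_sub hφ.1 hφ'.1).1)

variable [CompactSpace S] [T2Space S] [MeasurableSpace S] [BorelSpace S]

variable (σ) in
/-- The Dirichlet energy of `φ' - φ` along the segment from `φ` to `φ'`. -/
def dirichlet (φ φ' : S → ℝ) (s : ℝ) : ℝ :=
  ∫ p, σ.pairing (fun q => φ q + s * (φ' q - φ q)) (fun q => φ' q - φ q)
    (σ.dc fun q => φ' q - φ q) p * σ.dens (fun q => φ q + s * (φ' q - φ q)) p ∂σ.measure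

theorem dirichlet_eq {φ φ' : S → ℝ} (hφ : φ ∈ σ.potentials) (hφ' : φ' ∈ σ.potentials) {s : ℝ}
    (hs : s ∈ Icc (0 : ℝ) 1) : σ.dirichlet φ φ' s = -∫ p, (φ' p - φ p) * σ.densDeriv
      (fun q => φ q + s * (φ' q - φ q)) (σ.ddc fun q => φ' q - φ q) p ∂σ.measure := by
  have hb := isBasic_sub hφ.1 hφ'.1
  rw [integral_mul_densDeriv (segment_mem hφ hφ' hs) hb hb, neg_neg]
  rfl

theorem continuousOn_dirichlet {φ φ' : S → ℝ} (hφ : φ ∈ σ.potentials) (hφ' : φ' ∈ σ.potentials) :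
    ContinuousOn (σ.dirichlet φ φ') (Icc 0 1) := by
  have hψ : IsFamily (n := 2 * m + 1) 0 1 fun _ p => φ' p - φ p :=
    isFamily_const (isBasic_sub hφ.1 hφ'.1).1
  have h1 := hψ.continuousOn.mul (continuousOn_densDeriv_family (σ := σ) zero_lt_one
    (isFamily_segment hφ hφ') hψ)
  have h2 := continuousOn_integral (σ := σ) isCompact_Icc
    (k := fun s p => (φ' p - φ p) * σ.densDeriv
      (fun q => φ q + s * (φ' q - φ q)) (σ.ddc fun q => φ' q - φ q) p) h1
  exact h2.neg.congr fun s hs => dirichlet_eq hφ hφ' hs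

theorem dirichlet_nonneg {φ φ' : S → ℝ} (hφ : φ ∈ σ.potentials) (hφ' : φ' ∈ σ.potentials) {s : ℝ}
    (hs : s ∈ Icc (0 : ℝ) 1) : 0 ≤ σ.dirichlet φ φ' s :=
  integral_nonneg fun p => mul_nonneg (pairing_dc_self_nonneg (segment_mem hφ hφ' hs)
    (isBasic_sub hφ.1 hφ'.1) p) (σ.dens_pos (segment_mem hφ hφ' hs) p).le

theorem hasDerivWithinAt_mean_segment {φ φ' : S → ℝ} (hφ : φ ∈ σ.potentials)
    (hφ' : φ' ∈ σ.potentials) {s : ℝ} (hs : s ∈ Icc (0 : ℝ) 1) :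
    HasDerivWithinAt (fun s => σ.mean (fun p => φ p + s * (φ' p - φ p)) fun p => φ' p - φ p)
      (-σ.dirichlet φ φ' s) (Icc 0 1) s := by
  have h := hasDerivWithinAt_integral_dens (σ := σ) zero_lt_one
    (isFamily_const (isBasic_sub hφ.1 hφ'.1).1) (isFamily_segment hφ hφ') hs
  rw [vel_const zero_lt_one hs, vel_affine zero_lt_one hs] at h
  rw [dirichlet_eq hφ hφ' hs, neg_neg]
  simp only [zero_mul, zero_add] at h
  exact h

/-- The Dirichlet energy is minus the s-derivative of the mean of φ' - φ along the segment. -/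
theorem integral_dirichlet {φ φ' : S → ℝ} (hφ : φ ∈ σ.potentials) (hφ' : φ' ∈ σ.potentials) :
    ∫ s in (0 : ℝ)..1, σ.dirichlet φ φ' s =
      σ.mean φ (fun p => φ' p - φ p) - σ.mean φ' (fun p => φ' p - φ p) := by
  have h := integral_eq_sub_of_hasDerivWithinAt zero_le_one
    (fun s hs => hasDerivWithinAt_mean_segment hφ hφ' hs) (continuousOn_dirichlet hφ hφ').neg
  rw [intervalIntegral.integral_neg] at h
  simp only [one_mul, zero_mul, add_zero, add_sub_cancel] at h
  linarith

/-- A primitive of s A(s) is E(φ_s) - s ∫ ψ (dη_{φ_s})^m ∧ η: the derivative of the energy cancels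
against the first term of the product rule. -/
theorem integral_mul_dirichlet {φ φ' : S → ℝ} (hφ : φ ∈ σ.potentials)
    (hφ' : φ' ∈ σ.potentials) : ∫ s in (0 : ℝ)..1, s * σ.dirichlet φ φ' s =
      σ.energy φ' - σ.energy φ - σ.mean φ' (fun p => φ' p - φ p) := by
  have hc : ContinuousOn (fun s => s * σ.dirichlet φ φ' s) (Icc 0 1) :=
    continuousOn_id.mul (continuousOn_dirichlet hφ hφ')
  have h := integral_eq_sub_of_hasDerivWithinAt (f' := fun s => s * σ.dirichlet φ φ' s)
    (f := fun s => σ.energy (fun p => φ p + s * (φ' p - φ p)) -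
      s * σ.mean (fun p => φ p + s * (φ' p - φ p)) fun p => φ' p - φ p) zero_le_one
    (fun s hs => by
      have h1 := hasDerivWithinAt_energy (σ := σ) zero_lt_one (isFamily_segment hφ hφ')
        (fun s hs => segment_mem hφ hφ' hs) hs
      rw [vel_affine zero_lt_one hs] at h1
      refine (h1.sub ((hasDerivWithinAt_id s _).mul
        (hasDerivWithinAt_mean_segment hφ hφ' hs))).congr_deriv ?_
      simp only [id, mean]
      ring) hc
  rw [h]
  simp only [one_mul, zero_mul, add_zero, add_sub_cancel, sub_zero]
  ring

end SasakianStructure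

/-! ### Properties (1)-(5) of the functionals. -/

namespace SasakianStructure

variable {m : ℕ} {S : Type*} [TopologicalSpace S]
  [ChartedSpace (EuclideanSpace ℝ (Fin (2 * m + 1))) S] [IsManifold (𝓡 (2 * m + 1)) ∞ S]
  {σ : SasakianStructure m S} [CompactSpace S] [T2Space S] [MeasurableSpace S] [BorelSpace S]
  {φ φ' φ'' : S → ℝ}

theorem I_eq_mean (hφ : φ ∈ σ.potentials) (hφ' : φ' ∈ σ.potentials) :
    σ.I φ φ' = 1 / σ.V *
      (σ.mean φ (fun p => φ' p - φ p) - σ.mean φ' (fun p => φ' p - φ p)) := by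
  have h3 : Continuous fun p => φ' p - φ p := hφ'.1.1.continuous.sub hφ.1.1.continuous
  rw [I, integral_volDiff hφ hφ' h3]

theorem I_sub_J_eq (hφ : φ ∈ σ.potentials) (hφ' : φ' ∈ σ.potentials) :
    σ.I φ φ' - σ.J φ φ' = 1 / σ.V *
      (σ.energy φ' - σ.energy φ - σ.mean φ' (fun p => φ' p - φ p)) := by
  rw [I_eq hφ hφ', J_eq hφ hφ', mean_sub hφ' hφ'.1.1.continuous hφ.1.1.continuous]
  ring

theorem I_comm (hφ : φ ∈ σ.potentials) (hφ' : φ' ∈ σ.potentials) : σ.I φ φ' = σ.I φ' φ := by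
  rw [I_eq hφ hφ', I_eq hφ' hφ]
  ring

theorem J_add_J (hφ : φ ∈ σ.potentials) (hφ' : φ' ∈ σ.potentials) :
    σ.J φ φ' + σ.J φ' φ = σ.I φ φ' := by
  rw [I_eq hφ hφ', J_eq hφ hφ', J_eq hφ' hφ]
  ring

theorem J_self (hφ : φ ∈ σ.potentials) : σ.J φ φ = 0 := by
  rw [J_eq hφ hφ, sub_self, mul_zero]

theorem J_cocycle (hφ : φ ∈ σ.potentials) (hφ' : φ' ∈ σ.potentials) (hφ'' : φ'' ∈ σ.potentials) :
    σ.J φ φ' + σ.J φ' φ'' =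
      σ.J φ φ'' - 1 / σ.V * σ.integral (fun p => φ'' p - φ' p) (σ.volDiff φ φ') := by
  have h1 := hφ'.1.1.continuous
  have h2 := hφ''.1.1.continuous
  have h3 : Continuous fun p => φ'' p - φ' p := h2.sub h1
  rw [integral_volDiff hφ hφ' h3, mean_sub hφ h2 h1, mean_sub hφ' h2 h1, J_eq hφ hφ',
    J_eq hφ' hφ'', J_eq hφ hφ'']
  ring

theorem J_eq_neg_L (hφ : φ ∈ σ.potentials) (hφ' : φ' ∈ σ.potentials) :
    σ.J φ φ' = -σ.L φ φ' + 1 / σ.V * σ.integral (fun p => φ' p - φ p) (σ.volOf φ) := by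
  have h1 := hφ.1.1.continuous
  have h2 := hφ'.1.1.continuous
  have h3 : Continuous fun p => φ' p - φ p := h2.sub h1
  rw [integral_volOf hφ h3, mean_sub hφ h2 h1, J_eq hφ hφ', L_eq hφ hφ']
  ring

/-- The total volume does not depend on the potential. -/
theorem mean_one (hφ : φ ∈ σ.potentials) : σ.mean φ (fun _ => 1) = σ.V := by
  have h0 : ∀ s ∈ Icc (0 : ℝ) 1, HasDerivWithinAt
      (fun s => ∫ p, 1 * σ.dens (fun q => s * φ q) p ∂σ.measure) 0 (Icc 0 1) s := by
    intro s hs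
    have h := hasDerivWithinAt_integral_dens (σ := σ) zero_lt_one
      (isFamily_const (f := fun _ => 1) contMDiff_const) (isFamily_mul hφ.1.1) hs
    rw [vel_const zero_lt_one hs, vel_mul zero_lt_one hs] at h
    simp only [zero_mul, zero_add] at h
    refine h.congr_deriv ?_
    -- By symmetry the variation of the total volume is the integral of φ against the variation in
    -- direction dd^c 1 = 0.
    have h1 := integral_mul_densDeriv_comm (f := fun _ => 1) (mul_mem hφ hs) (isBasic_const 1) hφ.1
    rw [h1]
    simp only [densDeriv, ddc_const, map_zero, zero_div, mul_zero, integral_zero]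
  have h2 := integral_eq_sub_of_hasDerivWithinAt zero_le_one h0 continuousOn_const
  simp only [intervalIntegral.integral_zero, one_mul, zero_mul] at h2
  rw [V_eq]
  simp only [mean, one_mul]
  linarith

theorem mean_const (hφ : φ ∈ σ.potentials) (C : ℝ) : σ.mean φ (fun _ => C) = C * σ.V := by
  rw [← mean_one hφ]
  simp only [mean, one_mul, integral_const_mul]

theorem mean_add_const (hφ : φ ∈ σ.potentials) (C : ℝ) (f : S → ℝ) :
    σ.mean (fun p => φ p + C) f = σ.mean φ f := by
  simp only [mean, dens_add_const hφ.1.1]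

/-- Along s ↦ φ + sC the energy has constant derivative C·V, because the total volume is V for every
potential. -/
theorem energy_add_const (hφ : φ ∈ σ.potentials) (C : ℝ) :
    σ.energy (fun p => φ p + C) = σ.energy φ + C * σ.V := by
  have hC : ContMDiff (𝓡 (2 * m + 1)) 𝓘(ℝ, ℝ) ∞ fun _ : S => C := contMDiff_const
  have hfam : IsFamily (n := 2 * m + 1) 0 1 fun s p => φ p + s * C :=
    (isFamily_const hφ.1.1).add (isFamily_mul hC)
  have h := integral_eq_sub_of_hasDerivWithinAt (f' := fun _ => C * σ.V)
    (f := fun s => σ.energy (fun p => φ p + s * C)) zero_le_one (fun s hs => by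
      refine (hasDerivWithinAt_energy (σ := σ) zero_lt_one hfam
        (fun s _ => add_const_mem hφ (s * C)) hs).congr_deriv ?_
      rw [vel_affine zero_lt_one hs φ fun _ => C, ← mean_const (add_const_mem hφ (s * C)) C]
      rfl) continuousOn_const
  simp only [intervalIntegral.integral_const, one_mul, zero_mul, add_zero, sub_zero,
    smul_eq_mul] at h
  linarith

theorem I_add_const (hφ : φ ∈ σ.potentials) (hφ' : φ' ∈ σ.potentials) (C : ℝ) :
    σ.I φ (fun p => φ' p + C) = σ.I φ φ' := by
  have h2 := hφ'.1.1.continuous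
  rw [I_eq hφ (add_const_mem hφ' C), I_eq hφ hφ', mean_add_const hφ', mean_add_const hφ',
    mean_add hφ h2 continuous_const, mean_add hφ' h2 continuous_const, mean_const hφ,
    mean_const hφ']
  ring

theorem J_add_const (hφ : φ ∈ σ.potentials) (hφ' : φ' ∈ σ.potentials) (C : ℝ) :
    σ.J φ (fun p => φ' p + C) = σ.J φ φ' := by
  rw [J_eq hφ (add_const_mem hφ' C), J_eq hφ hφ', mean_add hφ hφ'.1.1.continuous continuous_const,
    mean_const hφ, energy_add_const hφ']
  ring

section Inequalities

theorem I_eq_integral (hφ : φ ∈ σ.potentials) (hφ' : φ' ∈ σ.potentials) :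
    σ.I φ φ' = 1 / σ.V * ∫ s in (0 : ℝ)..1, σ.dirichlet φ φ' s := by
  rw [integral_dirichlet hφ hφ', I_eq_mean hφ hφ']

theorem I_sub_J_eq_integral (hφ : φ ∈ σ.potentials) (hφ' : φ' ∈ σ.potentials) :
    σ.I φ φ' - σ.J φ φ' = 1 / σ.V * ∫ s in (0 : ℝ)..1, s * σ.dirichlet φ φ' s := by
  rw [integral_mul_dirichlet hφ hφ', I_sub_J_eq hφ hφ']

variable [Nonempty S]

theorem I_nonneg (hφ : φ ∈ σ.potentials) (hφ' : φ' ∈ σ.potentials) : 0 ≤ σ.I φ φ' := by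
  rw [I_eq_integral hφ hφ']
  exact mul_nonneg (one_div_pos.2 V_pos).le (intervalIntegral.integral_nonneg zero_le_one
    fun s hs => dirichlet_nonneg hφ hφ' hs)

theorem I_sub_J_nonneg (hφ : φ ∈ σ.potentials) (hφ' : φ' ∈ σ.potentials) :
    0 ≤ σ.I φ φ' - σ.J φ φ' := by
  rw [I_sub_J_eq_integral hφ hφ']
  exact mul_nonneg (one_div_pos.2 V_pos).le (intervalIntegral.integral_nonneg zero_le_one
    fun s hs => mul_nonneg hs.1 (dirichlet_nonneg hφ hφ' hs))

/-- J(φ, φ') = I(φ', φ) - J(φ', φ), since the two values of J add up to I. -/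
theorem J_nonneg (hφ : φ ∈ σ.potentials) (hφ' : φ' ∈ σ.potentials) : 0 ≤ σ.J φ φ' := by
  have h1 := I_sub_J_nonneg hφ' hφ
  rw [← J_add_J hφ' hφ] at h1
  linarith

/-- Integration of the pointwise monotonicity: the power of 1 - s there is the same at every point
of S. -/
theorem dirichlet_monotone {k : ℕ} (hm : m = k + 1) (hφ : φ ∈ σ.potentials)
    (hφ' : φ' ∈ σ.potentials) {s s' : ℝ} (hs : s ∈ Ico (0 : ℝ) 1) (hs' : s' ∈ Ico (0 : ℝ) 1)
    (hss : s ≤ s') :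
    σ.dirichlet φ φ' s * (1 - s') ^ k ≤ σ.dirichlet φ φ' s' * (1 - s) ^ k := by
  have hψ := isBasic_sub hφ.1 hφ'.1
  have hc : ∀ s ∈ Ico (0 : ℝ) 1, Continuous fun p =>
      σ.pairing (fun q => φ q + s * (φ' q - φ q)) (fun q => φ' q - φ q)
      (σ.dc fun q => φ' q - φ q) p * σ.dens (fun q => φ q + s * (φ' q - φ q)) p := by
    intro s hs
    have hmem := segment_mem hφ hφ' (Ico_subset_Icc_self hs)
    exact (σ.contMDiff_pairing hmem hψ.1 (σ.dc_ξ hψ) (σ.isSmooth_dc hψ.1)).continuous.mul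
      (σ.contMDiff_dens hmem.1.1).continuous
  rw [dirichlet, dirichlet, ← integral_mul_const, ← integral_mul_const]
  exact integral_mono ((integrable_of_continuous (hc s hs)).mul_const _)
    ((integrable_of_continuous (hc s' hs')).mul_const _)
    fun p => monotone_pairing hm hφ hφ' hψ p hs hs' hss

/-- The inequality is ∫ ((m+1)s - 1) A(s) ds ≥ 0 for the Dirichlet energy A, an instance of
`integral_weight_nonneg` with k = m - 1. -/
theorem I_le (hφ : φ ∈ σ.potentials) (hφ' : φ' ∈ σ.potentials) :
    σ.I φ φ' ≤ ((m : ℝ) + 1) * (σ.I φ φ' - σ.J φ φ') := by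
  have hA := continuousOn_dirichlet hφ hφ'
  have hi1 : IntervalIntegrable (σ.dirichlet φ φ') volume 0 1 :=
    hA.intervalIntegrable_of_Icc zero_le_one
  have hi2 : IntervalIntegrable (fun s => s * σ.dirichlet φ φ' s) volume 0 1 :=
    (continuousOn_id.mul hA).intervalIntegrable_of_Icc zero_le_one
  have key : 0 ≤ ∫ s in (0 : ℝ)..1, (((m : ℝ) + 1) * s - 1) * σ.dirichlet φ φ' s := by
    -- For m = 0 there is no exponent m - 1, but then the Dirichlet energy vanishes identically.
    rcases Nat.eq_zero_or_pos m with h0 | hpos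
    · have hz : ∀ s ∈ uIcc (0 : ℝ) 1, (((m : ℝ) + 1) * s - 1) * σ.dirichlet φ φ' s = 0 := by
        intro s hs
        rw [uIcc_of_le zero_le_one] at hs
        have hmem := segment_mem hφ hφ' hs
        simp only [dirichlet, pairing_eq_zero_of_dim h0 hmem (isBasic_sub hφ.1 hφ'.1), zero_mul,
          integral_zero, mul_zero]
      rw [intervalIntegral.integral_congr (g := fun _ => 0) hz, intervalIntegral.integral_zero]
    · obtain ⟨k, hk⟩ : ∃ k, m = k + 1 := ⟨m - 1, by omega⟩
      have h := integral_weight_nonneg k hA fun s hs s' hs' hss =>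
        dirichlet_monotone hk hφ hφ' hs hs' hss
      have hmk : (m : ℝ) + 1 = (k : ℝ) + 2 := by rw [hk]; push_cast; ring
      rwa [hmk]
  have h1 : ∫ s in (0 : ℝ)..1, (((m : ℝ) + 1) * s - 1) * σ.dirichlet φ φ' s =
      ((m : ℝ) + 1) * (∫ s in (0 : ℝ)..1, s * σ.dirichlet φ φ' s) -
        ∫ s in (0 : ℝ)..1, σ.dirichlet φ φ' s := by
    rw [← intervalIntegral.integral_const_mul, ← intervalIntegral.integral_sub
      (hi2.const_mul _) hi1]
    refine intervalIntegral.integral_congr fun s _ => ?_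
    ring
  rw [h1] at key
  rw [I_sub_J_eq_integral hφ hφ', I_eq_integral hφ hφ']
  have hV := (one_div_pos.2 (V_pos (σ := σ))).le
  have := mul_nonneg hV key
  linarith

/-- `I_le` for the pair (φ', φ): there I is the same and I - J becomes J(φ, φ'). -/
theorem le_I (hφ : φ ∈ σ.potentials) (hφ' : φ' ∈ σ.potentials) :
    ((m : ℝ) + 1) * (σ.I φ φ' - σ.J φ φ') ≤ (m : ℝ) * σ.I φ φ' := by
  have h1 := I_le hφ' hφ
  rw [← I_comm hφ hφ'] at h1
  have h2 := J_add_J hφ hφ'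
  have h3 : σ.I φ φ' - σ.J φ' φ = σ.J φ φ' := by linarith
  rw [h3] at h1
  linarith

/-- The integral of the continuous non-negative Dirichlet energy vanishes, hence so does its value
at s = 0. This is the integral of a non-negative continuous function against a measure that charges
every open set, so d(φ' - φ) = 0 everywhere. -/
theorem isLocallyConstant_of_I_eq_zero (hφ : φ ∈ σ.potentials) (hφ' : φ' ∈ σ.potentials)
    (h : σ.I φ φ' = 0) : IsLocallyConstant fun p => φ' p - φ p := by
  have hψ := isBasic_sub hφ.1 hφ'.1
  have hA := continuousOn_dirichlet hφ hφ'
  rw [I_eq_integral hφ hφ', mul_eq_zero_iff_left (one_div_pos.2 V_pos).ne'] at h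
  have h0 : σ.dirichlet φ φ' 0 = 0 := by
    by_contra hne
    have hpos := lt_of_le_of_ne (dirichlet_nonneg hφ hφ' (left_mem_Icc.2 zero_le_one))
      (Ne.symm hne)
    have := intervalIntegral.integral_pos zero_lt_one hA
      (fun s hs => dirichlet_nonneg hφ hφ' (Ioc_subset_Icc_self hs))
      ⟨0, left_mem_Icc.2 zero_le_one, hpos⟩
    exact this.ne' h
  have h1 : ∀ p, σ.pairing φ (fun q => φ' q - φ q) (σ.dc fun q => φ' q - φ q) p * σ.dens φ p = 0 := by
    refine eq_zero_of_integral_eq_zero (σ := σ) ?_ (fun p => mul_nonneg (pairing_dc_self_nonneg hφ hψ p)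
      (σ.dens_pos hφ p).le) ?_
    · exact (σ.contMDiff_pairing hφ hψ.1 (σ.dc_ξ hψ) (σ.isSmooth_dc hψ.1)).continuous.mul
        (σ.contMDiff_dens hφ.1.1).continuous
    · simpa only [dirichlet, zero_mul, add_zero] using h0
  exact isLocallyConstant_of_dif hψ.1 fun p => dif_eq_zero_of_pairing hφ hψ
    ((mul_eq_zero.1 (h1 p)).resolve_right (σ.dens_pos hφ p).ne')

end Inequalities

/-- I - J is E(c_t) - E(φ) minus the mean of c_t - φ for c_t, divided by V. The term with the
velocity cancels, and what remains is minus the variation of the density tested on c_t - φ, that is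
the Laplacian of the velocity. -/
theorem hasDerivWithinAt_I_sub_J (hφ : φ ∈ σ.potentials) {a b : ℝ} {c : ℝ → S → ℝ} (hab : a < b)
    (hc : σ.IsSmoothFamily a b c) {t : ℝ} (ht : t ∈ Icc a b) :
    HasDerivWithinAt (fun s => σ.I φ (c s) - σ.J φ (c s))
      (1 / σ.V * σ.integral (fun p => (c t p - φ p) * σ.lap (c t) (vel a b c t) p)
        (σ.volOf (c t))) (Icc a b) t := by
  have hf := hc.isFamily
  have hft := hf.contMDiff ht
  have hv := isBasic_vel hab hf (fun s hs => (hc.1 s hs).1) ht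
  have hE := hasDerivWithinAt_energy (σ := σ) hab hf hc.1 ht
  have hM := hasDerivWithinAt_integral_dens (σ := σ) hab (hf.sub (isFamily_const hφ.1.1)) hf ht
  rw [vel_sub_const hab ht hf] at hM
  have h := ((hE.sub_const (σ.energy φ)).sub hM).const_mul (1 / σ.V)
  refine (h.congr_of_mem (fun s hs => I_sub_J_eq hφ (hc.1 s hs)) ht).congr_deriv ?_
  have hD := (σ.contMDiff_dens (hc.1 t ht).1.1).continuous
  have hl := (isBasic_lap (hc.1 t ht) hv).1.continuous
  have hcφ : Continuous fun p => c t p - φ p := hft.continuous.sub hφ.1.1.continuous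
  have hcl : Continuous fun p => (c t p - φ p) * σ.lap (c t) (vel a b c t) p := hcφ.mul hl
  rw [integral_volOf (hc.1 t ht) hcl, mean]
  have i1 : Integrable (fun p => vel a b c t p * σ.dens (c t) p) σ.measure :=
    integrable_of_continuous (hv.1.continuous.mul hD)
  have i2 : Integrable (fun p => (c t p - φ p) * σ.densDeriv (c t) (σ.ddc (vel a b c t)) p)
      σ.measure := integrable_of_continuous (hcφ.mul
    (σ.contMDiff_densDeriv hft (σ.isSmoothForm_ddc hv.1)).continuous)
  rw [integral_add i1 i2, sub_add_cancel_left, ← integral_neg]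
  congr 1
  refine integral_congr_ae (Filter.Eventually.of_forall fun p => ?_)
  have hne := (σ.dens_pos (hc.1 t ht) p).ne'
  simp only [lap]
  field_simp

end SasakianStructure

end Sasaki

end

theorem mainTheorem8 {m : ℕ} {S : Type*} [TopologicalSpace S]
    [ChartedSpace (EuclideanSpace ℝ (Fin (2 * m + 1))) S] [IsManifold (𝓡 (2 * m + 1)) ∞ S]
    [CompactSpace S] [T2Space S] [Nonempty S] (σ : Sasaki.SasakianStructure m S) :
    -- the normalizing volume is positive, any two potentials are joined by a path
    0 < σ.V ∧
    (∀ φ ∈ σ.potentials, ∀ φ' ∈ σ.potentials, ∃ a b c, σ.IsPath φ φ' a b c) ∧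
    -- `J` and `L` may be computed along any path
    (∀ φ ∈ σ.potentials, ∀ φ' ∈ σ.potentials, ∀ a b c, σ.IsPath φ φ' a b c →
      IntervalIntegrable (σ.integrandJ φ c) volume a b ∧ σ.J φ φ' = σ.pathJ φ a b c ∧
      IntervalIntegrable (σ.integrandL c) volume a b ∧ σ.L φ φ' = σ.pathL a b c) ∧
    -- (1)
    (∀ φ ∈ σ.potentials, ∀ φ' ∈ σ.potentials,
      σ.J φ φ' = -σ.L φ φ' + 1 / σ.V * σ.integral (fun p => φ' p - φ p) (σ.volOf φ)) ∧
    -- (2)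
    (∀ φ ∈ σ.potentials, ∀ φ' ∈ σ.potentials, ∀ φ'' ∈ σ.potentials,
      σ.J φ φ' + σ.J φ' φ'' =
        σ.J φ φ'' - 1 / σ.V * σ.integral (fun p => φ'' p - φ' p) (σ.volDiff φ φ')) ∧
    (∀ φ ∈ σ.potentials, ∀ φ' ∈ σ.potentials, ¬ IsLocallyConstant (fun p => φ' p - φ p) →
      σ.J φ φ' + σ.J φ' φ ≠ σ.J φ φ) ∧
    -- (3)
    (∀ φ ∈ σ.potentials, ∀ φ' ∈ σ.potentials, ∀ C : ℝ,
      (fun p => φ' p + C) ∈ σ.potentials ∧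
      σ.I φ (fun p => φ' p + C) = σ.I φ φ' ∧ σ.J φ (fun p => φ' p + C) = σ.J φ φ') ∧
    -- (4)
    (∀ φ ∈ σ.potentials, ∀ (a b : ℝ) (c : ℝ → S → ℝ), a < b → σ.IsSmoothFamily a b c →
      ∀ t ∈ Set.Icc a b, ∃ u : S → ℝ,
        (∀ w : S → ℂ, σ.IsDolbeaultLaplacian (c t)
            (fun p => ((derivWithin (fun s => c s p) (Set.Icc a b) t : ℝ) : ℂ)) w ↔
          w = fun p => (u p : ℂ)) ∧
        HasDerivWithinAt (fun s => σ.I φ (c s) - σ.J φ (c s))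
          (1 / σ.V * σ.integral (fun p => (c t p - φ p) * u p) (σ.volOf (c t)))
          (Set.Icc a b) t) ∧
    -- (5)
    (∀ φ ∈ σ.potentials, ∀ φ' ∈ σ.potentials,
      0 ≤ σ.I φ φ' ∧ 0 ≤ σ.I φ φ' - σ.J φ φ' ∧ 0 ≤ σ.J φ φ' ∧
      σ.I φ φ' ≤ ((m : ℝ) + 1) * (σ.I φ φ' - σ.J φ φ') ∧
      ((m : ℝ) + 1) * (σ.I φ φ' - σ.J φ φ') ≤ (m : ℝ) * σ.I φ φ') := by
  -- Integration of forms needs no σ-algebra on S; the Borel one serves to express it through a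
  -- measure on S.
  borelize S
  refine ⟨Sasaki.SasakianStructure.V_pos, fun φ hφ φ' hφ' =>
    ⟨0, 1, _, Sasaki.SasakianStructure.isPath_segment hφ hφ'⟩, fun φ hφ φ' hφ' a b c hc => ?_,
    fun φ hφ φ' hφ' => Sasaki.SasakianStructure.J_eq_neg_L hφ hφ',
    fun φ hφ φ' hφ' φ'' hφ'' => Sasaki.SasakianStructure.J_cocycle hφ hφ' hφ'',
    fun φ hφ φ' hφ' hne h => ?_, fun φ hφ φ' hφ' C =>
    ⟨Sasaki.SasakianStructure.add_const_mem hφ' C, Sasaki.SasakianStructure.I_add_const hφ hφ' C,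
      Sasaki.SasakianStructure.J_add_const hφ hφ' C⟩, fun φ hφ a b c hab hc t ht => ?_,
    fun φ hφ φ' hφ' => ⟨Sasaki.SasakianStructure.I_nonneg hφ hφ',
      Sasaki.SasakianStructure.I_sub_J_nonneg hφ hφ', Sasaki.SasakianStructure.J_nonneg hφ hφ',
      Sasaki.SasakianStructure.I_le hφ hφ', Sasaki.SasakianStructure.le_I hφ hφ'⟩⟩
  · exact ⟨(hc.integrandJ hφ).1, (Sasaki.SasakianStructure.J_eq hφ hφ').trans (hc.pathJ_eq hφ).symm,
      hc.integrandL.1, (Sasaki.SasakianStructure.L_eq hφ hφ').trans hc.pathL_eq.symm⟩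
  · rw [Sasaki.SasakianStructure.J_add_J hφ hφ', Sasaki.SasakianStructure.J_self hφ] at h
    exact hne (Sasaki.SasakianStructure.isLocallyConstant_of_I_eq_zero hφ hφ' h)
  · have hv := Sasaki.SasakianStructure.isBasic_vel hab hc.isFamily (fun s hs => (hc.1 s hs).1) ht
    exact ⟨σ.lap (c t) (Sasaki.vel a b c t),
      Sasaki.SasakianStructure.isDolbeaultLaplacian_iff (hc.1 t ht) hv,
      Sasaki.SasakianStructure.hasDerivWithinAt_I_sub_J hφ hab hc ht⟩
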